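/- Let $M$ be a smooth $n$-dimensional manifold with a smooth torsion-free connection $\nabla$. For a smooth function $f$ put $\nabla^2 f(X,Y)=YXf-(\nabla_YX)f$. Let $p\in M$, and let $\Omega_0$ be a normal neighborhood of $p$: an open set containing $p$ such that for every $q\in\Omega_0$ there is exactly one geodesic $\gamma_q:[0,1]\to\Omega_0$ with $\gamma_q(0)=p$, $\gamma_q(1)=q$, and such that $\gamma_q(s)$ depends smoothly on $(s,q)$. Let $\Phi$ be a smooth real-valued function on $\Omega_0$ with a nondegenerate critical point at $p$. For $q\in\Omega_0$ and $\sigma>0$ let \[ \nabla^2_{\sigma}\Phi|_q(X,Y)=\sigma\int_0^1(1-s)^{\sigma-1}\,\nabla^2\Phi|_{\gamma_q(s)}(X_s,Y_s)\,ds, \] where $X_s,Y_s$ are the parallel vector fields along $\gamma_q$ with $X_1=X$, $Y_1=Y$, and assume that $\nabla^2_1\Phi$ is nondegenerate at every point of $\Omega_0$. Define on $\Omega_0$ \[ \square_0f=\mathrm{tr}\big((\nabla_1^2\Phi)^{-1}\nabla_2^2\Phi(\nabla_1^2\Phi)^{-1}\nabla^2f\big),\quad \eta(q)=\int_0^1\big[n-\square_0\Phi(\gamma_q(s))\big]\frac{ds}{s},\quad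 \square f=\square_0f+(\nabla_1^2\Phi)^{-1}(d\eta,df). \] Let $\Omega\subseteq\Omega_0$ be an open neighborhood of $p$, let $d\mu$ be the measure generated by a smooth positive density $\mu$ on $M$, and let $\square^*$ be the adjoint of $\square$ with respect to $d\mu$, i.e. $\int_\Omega(\square f)g\,d\mu=\int_\Omega f\,\square^*g\,d\mu$ for $f,g\in C_c^\infty(\Omega)$. Let $\omega$ be the number of positive eigenvalues of $\nabla^2\Phi(p)$ minus the number of negative ones. For $\psi\in C_c^\infty(\Omega)$ and $t>0$ let \[ I_\psi(t)=\int_\Omega t^{-\frac n2}e^{it^{-1}\Phi}\psi\,d\mu \] and, for an integer $N\ge 0$, let $E^N_\psi(t)$ be the magnitude of \[ I_\psi(t)-(2\pi)^{\frac n2}e^{i\frac\pi4\omega}e^{it^{-1}\Phi(p)}\Big(\frac{\sqrt{|\det\nabla^2\Phi|}}{\mu}(p)\Big)^{-1}\sum_{\ell=0}^N\frac{(i\square^*)^\ell\psi(p)}{2^\ell\,\ell!}t^\ell, \] where $\det\nabla^2\Phi(p)$ and $\mu(p)$ are evaluated on the same basis of $T_pM$. Then $E^N_\psi(t)=O(t^{N+1})$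 as $t\to0^+$ for each $N$. Moreover, for every integer $k>\frac n2$ there is a constant $C$ depending only on $N$, $n$ and $k$ such that for all $t>0$ \[ E^N_\psi(t)\le C\,t^{N+1}\Big(\int_\Omega|(\square^*)^{N+1}\psi|\,d\mu\Big)^{1-\frac n{2k}}\Big(\int_\Omega|(\square^*)^{N+k+1}\psi|\,d\mu\Big)^{\frac n{2k}}. \] -/

import Mathlib

open scoped Manifold ContDiff Topology
open MeasureTheory

noncomputable section

namespace GeomOsc

universe u v

/-- An affine connection on the `n`-dimensional manifold `M`, that is, a covariant derivative on
its tangent bundle. `cov X x Y` is the vector `(∇_Y X)(x)`. -/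
abbrev Connection (n : ℕ) (M : Type u) [TopologicalSpace M]
    [ChartedSpace (EuclideanSpace ℝ (Fin n)) M] [IsManifold (𝓡 n) ∞ M] :=
  CovariantDerivative (𝓡 n) (EuclideanSpace ℝ (Fin n)) (TangentSpace (𝓡 n) : M → Type)

section Basic

variable {n : ℕ} {M : Type u} [TopologicalSpace M] [ChartedSpace (EuclideanSpace ℝ (Fin n)) M]

/-- The standard basis of `T_x M`, which is the space `ℝⁿ` through the preferred chart at `x`.
All traces and contractions below are independent of the choice of a basis. -/
def stdFrame (x : M) (i : Fin n) : TangentSpace (𝓡 n) x :=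
  (EuclideanSpace.single i (1 : ℝ) : EuclideanSpace ℝ (Fin n))

end Basic

section Hessian

variable {n : ℕ} {M : Type u} [TopologicalSpace M] [ChartedSpace (EuclideanSpace ℝ (Fin n)) M]
  [IsManifold (𝓡 n) ∞ M]
variable {F : Type v} [NormedAddCommGroup F] [NormedSpace ℝ F]

/-- The Hessian `∇²f (X, Y) = Y X f - (∇_Y X) f` at `x`, where the vector `X` is extended to a
vector field that is smooth near `x`. The value does not depend on the extension. -/
def hess (cov : Connection n M) (f : M → F) (x : M) (X Y : TangentSpace (𝓡 n) x) : F :=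
  mvfderiv (𝓡 n)
      (fun y => mvfderiv (𝓡 n) f y (FiberBundle.extend (EuclideanSpace ℝ (Fin n)) X y)) x Y
    - mvfderiv (𝓡 n) f x (cov (FiberBundle.extend (EuclideanSpace ℝ (Fin n)) X) x Y)

/-- The matrix of `∇²f` at `x` in the standard basis of `T_x M`. -/
def hessMatrix (cov : Connection n M) (f : M → ℝ) (x : M) : Matrix (Fin n) (Fin n) ℝ :=
  Matrix.of fun i j => hess cov f x (stdFrame x i) (stdFrame x j)

end Hessian

section Curves

variable {n : ℕ} {M : Type u} [TopologicalSpace M] [ChartedSpace (EuclideanSpace ℝ (Fin n)) M]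

/-- The velocity of a curve that is parametrized by `[0, 1]` (one-sided at the end points). -/
def velocity (c : ℝ → M) (s : ℝ) : TangentSpace (𝓡 n) (c s) :=
  mfderivWithin 𝓘(ℝ, ℝ) (𝓡 n) c (Set.Icc 0 1) s (1 : ℝ)

variable [IsManifold (𝓡 n) ∞ M]

/-- The vector field `V` along the curve `c` is smooth on `[0, 1]`. -/
def SmoothAlong (c : ℝ → M) (V : ∀ s, TangentSpace (𝓡 n) (c s)) : Prop :=
  ContMDiffOn 𝓘(ℝ, ℝ) (𝓡 n).tangent ∞
    (fun s => (⟨c s, V s⟩ : TangentBundle (𝓡 n) M)) (Set.Icc 0 1)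

/-- The covariant derivative `∇_{ċ} V` at the time `s` of a vector field `V` along `c`: the
derivative of the components of `V` in the coordinate frame of the preferred chart at `c s`, plus
the derivative `∇_{ċ(s)}` of the field that has in this frame the constant components of `V s`. -/
def covDerivAlong (cov : Connection n M) (c : ℝ → M) (V : ∀ s, TangentSpace (𝓡 n) (c s))
    (s : ℝ) : TangentSpace (𝓡 n) (c s) :=
  (trivializationAt (EuclideanSpace ℝ (Fin n)) (TangentSpace (𝓡 n) : M → Type) (c s)).symm (c s)
      (derivWithin
        (fun r => (trivializationAt (EuclideanSpace ℝ (Fin n)) (TangentSpace (𝓡 n) : M → Type)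
          (c s) (⟨c r, V r⟩ : TangentBundle (𝓡 n) M)).2) (Set.Icc 0 1) s)
    + cov (FiberBundle.extend (EuclideanSpace ℝ (Fin n)) (V s)) (c s) (velocity c s)

/-- `c` is a geodesic on `[0, 1]`. -/
structure IsGeodesic (cov : Connection n M) (c : ℝ → M) : Prop where
  smooth : ContMDiffOn 𝓘(ℝ, ℝ) (𝓡 n) ∞ c (Set.Icc 0 1)
  eq_zero : ∀ s ∈ Set.Icc (0 : ℝ) 1, covDerivAlong cov c (velocity c) s = 0

/-- `V` is a parallel vector field along `c` on `[0, 1]`. -/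
structure IsParallel (cov : Connection n M) (c : ℝ → M) (V : ∀ s, TangentSpace (𝓡 n) (c s)) :
    Prop where
  smooth : SmoothAlong c V
  eq_zero : ∀ s ∈ Set.Icc (0 : ℝ) 1, covDerivAlong cov c V s = 0

open Classical in
/-- Reverse parallel transport of `X ∈ T_{c(1)} M` along `c`: the parallel field along `c` whose
value at the time `1` is `X`. -/
def transport (cov : Connection n M) (c : ℝ → M) (X : TangentSpace (𝓡 n) (c 1)) :
    ∀ s, TangentSpace (𝓡 n) (c s) :=
  if h : ∃ V : ∀ s, TangentSpace (𝓡 n) (c s), IsParallel cov c V ∧ V 1 = X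
  then h.choose else fun _ => 0

/-- The weighted Hessian `∇²_σ f (X, Y) = σ ∫₀¹ (1 - s)^(σ-1) ∇²f (X_s, Y_s) ds` at the end point
`c 1` of the geodesic `c`, where `X_s`, `Y_s` are the parallel fields along `c` that end in
`X`, `Y`. -/
def weightedHess (cov : Connection n M) (σ : ℝ) (f : M → ℝ) (c : ℝ → M)
    (X Y : TangentSpace (𝓡 n) (c 1)) : ℝ :=
  σ * ∫ s in (0 : ℝ)..1,
    (1 - s) ^ (σ - 1) * hess cov f (c s) (transport cov c X s) (transport cov c Y s)

/-- The matrix of the weighted Hessian in the standard basis of the tangent space at `c 1`. -/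
def weightedHessMatrix (cov : Connection n M) (σ : ℝ) (f : M → ℝ) (c : ℝ → M) :
    Matrix (Fin n) (Fin n) ℝ :=
  Matrix.of fun i j => weightedHess cov σ f c (stdFrame (c 1) i) (stdFrame (c 1) j)

/-- `Ω₀` is an open neighborhood of `p`, each point `q` of which is joined to `p` by exactly one
geodesic in `Ω₀`, namely `γ q`, and `γ q` depends smoothly on `q`: a (geodesically star-shaped)
normal neighborhood of `p`. -/
structure IsNormalNhd (cov : Connection n M) (p : M) (Ω₀ : Set M) (γ : M → ℝ → M) : Prop where
  isOpen : IsOpen Ω₀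
  mem : p ∈ Ω₀
  geodesic : ∀ q ∈ Ω₀, IsGeodesic cov (γ q)
  source : ∀ q ∈ Ω₀, γ q 0 = p
  target : ∀ q ∈ Ω₀, γ q 1 = q
  mapsTo : ∀ q ∈ Ω₀, Set.MapsTo (γ q) (Set.Icc 0 1) Ω₀
  unique : ∀ q ∈ Ω₀, ∀ c : ℝ → M, IsGeodesic cov c → c 0 = p → c 1 = q →
    Set.MapsTo c (Set.Icc 0 1) Ω₀ → Set.EqOn c (γ q) (Set.Icc 0 1)
  smooth : ContMDiffOn (𝓘(ℝ, ℝ).prod (𝓡 n)) (𝓡 n) ∞ (fun z : ℝ × M => γ z.2 z.1)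
    (Set.Icc (0 : ℝ) 1 ×ˢ Ω₀)

end Curves

section Operator

variable {n : ℕ} {M : Type u} [TopologicalSpace M] [ChartedSpace (EuclideanSpace ℝ (Fin n)) M]
  [IsManifold (𝓡 n) ∞ M]
variable {F : Type v} [NormedAddCommGroup F] [NormedSpace ℝ F]

/-- The operator `□₀ f = tr ((∇²₁Φ)⁻¹ ∇²₂Φ (∇²₁Φ)⁻¹ ∇²f)`. -/
def box₀ (cov : Connection n M) (Φ : M → ℝ) (γ : M → ℝ → M) (f : M → F) (q : M) : F :=
  ∑ i, ∑ j,
    ((weightedHessMatrix cov 1 Φ (γ q))⁻¹ * weightedHessMatrix cov 2 Φ (γ q)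
        * (weightedHessMatrix cov 1 Φ (γ q))⁻¹) i j
      • hess cov f q (stdFrame q j) (stdFrame q i)

/-- The function `η(q) = ∫₀¹ (n - □₀Φ(γ(s))) ds / s`, where `γ` is the geodesic from `p` to `q`. -/
def eta (cov : Connection n M) (Φ : M → ℝ) (γ : M → ℝ → M) (q : M) : ℝ :=
  ∫ s in (0 : ℝ)..1, ((n : ℝ) - box₀ cov Φ γ Φ (γ q s)) / s

/-- The derivative `Z_g f = (∇²₁Φ)⁻¹ (dg, df)`. -/
def zField (cov : Connection n M) (Φ : M → ℝ) (γ : M → ℝ → M) (g : M → ℝ) (f : M → F) (q : M) :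
    F :=
  ∑ i, ∑ j,
    ((weightedHessMatrix cov 1 Φ (γ q))⁻¹ i j * mvfderiv (𝓡 n) g q (stdFrame q i))
      • mvfderiv (𝓡 n) f q (stdFrame q j)

/-- The operator `□ f = □₀ f + Z_η f`. -/
def box (cov : Connection n M) (Φ : M → ℝ) (γ : M → ℝ → M) (f : M → F) (q : M) : F :=
  box₀ cov Φ γ f q + zField cov Φ γ (eta cov Φ γ) f q

end Operator

section Density

/-- A positive smooth density on `M`: it assigns to every frame of every tangent space a number,
`ρ (A v₁, …, A vₙ) = |det A| ρ (v₁, …, vₙ)` for every linear map `A`, and its values on the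
coordinate frames of the charts are smooth. -/
structure SmoothDensity (n : ℕ) (M : Type u) [TopologicalSpace M]
    [ChartedSpace (EuclideanSpace ℝ (Fin n)) M] [IsManifold (𝓡 n) ∞ M] where
  toFun : ∀ x : M, (Fin n → TangentSpace (𝓡 n) x) → ℝ
  map_linear : ∀ (x : M) (A : TangentSpace (𝓡 n) x →ₗ[ℝ] TangentSpace (𝓡 n) x)
    (v : Fin n → TangentSpace (𝓡 n) x),
    toFun x (fun i => A (v i)) = |LinearMap.det A| * toFun x v
  pos : ∀ (x : M) (v : Fin n → TangentSpace (𝓡 n) x), LinearIndependent ℝ v → 0 < toFun x v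
  smooth : ∀ x₀ : M, ContDiffOn ℝ ∞
    (fun y : EuclideanSpace ℝ (Fin n) => toFun ((extChartAt (𝓡 n) x₀).symm y)
      (fun i => mfderiv 𝓘(ℝ, EuclideanSpace ℝ (Fin n)) (𝓡 n) (extChartAt (𝓡 n) x₀).symm y
        (EuclideanSpace.single i (1 : ℝ) : EuclideanSpace ℝ (Fin n))))
    (extChartAt (𝓡 n) x₀).target

variable {n : ℕ} {M : Type u} [TopologicalSpace M] [ChartedSpace (EuclideanSpace ℝ (Fin n)) M]
  [IsManifold (𝓡 n) ∞ M]

/-- The density with respect to the coordinates of the preferred chart at `x₀`. -/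
def SmoothDensity.inChart (ρ : SmoothDensity n M) (x₀ : M) (y : EuclideanSpace ℝ (Fin n)) : ℝ :=
  ρ.toFun ((extChartAt (𝓡 n) x₀).symm y)
    (fun i => mfderiv 𝓘(ℝ, EuclideanSpace ℝ (Fin n)) (𝓡 n) (extChartAt (𝓡 n) x₀).symm y
      (EuclideanSpace.single i (1 : ℝ) : EuclideanSpace ℝ (Fin n)))

/-- `μ` is the measure generated by the density `ρ`: in the coordinates `(y₁, …, yₙ)` of every
chart, `dμ = ρ(∂₁, …, ∂ₙ) dy`. -/
def SmoothDensity.Generates [MeasurableSpace M] (ρ : SmoothDensity n M) (μ : Measure M) : Prop :=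
  ∀ x₀ : M, ∀ s : Set M, MeasurableSet s → s ⊆ (extChartAt (𝓡 n) x₀).source →
    μ s = ∫⁻ y in extChartAt (𝓡 n) x₀ '' s, ENNReal.ofReal (ρ.inChart x₀ y)

end Density

section Integral

variable {n : ℕ} {M : Type u} [TopologicalSpace M] [ChartedSpace (EuclideanSpace ℝ (Fin n)) M]

variable (n) in
/-- The smooth complex-valued functions with compact support in `Ω`. -/
def testFunctions (Ω : Set M) : Set (M → ℂ) :=
  {f | ContMDiff (𝓡 n) 𝓘(ℝ, ℂ) ∞ f ∧ HasCompactSupport f ∧ tsupport f ⊆ Ω}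

variable [MeasurableSpace M]

variable (n) in
open Classical in
/-- The adjoint `L*` of the operator `L` on `Ω` with respect to `μ`: `L* g` is the test function
with `∫ (L f) g dμ = ∫ f (L* g) dμ` for all test functions `f`. -/
def adjoint (μ : Measure M) (Ω : Set M) (L : (M → ℂ) → (M → ℂ)) (g : M → ℂ) : M → ℂ :=
  if h : ∃ h ∈ testFunctions n Ω, ∀ f ∈ testFunctions n Ω,
      ∫ x in Ω, L f x * g x ∂μ = ∫ x in Ω, f x * h x ∂μ
  then h.choose else 0

variable (n) in
/-- `I_ψ(t) = ∫_Ω t^(-n/2) e^{iΦ/t} ψ dμ`. -/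
def oscIntegral (μ : Measure M) (Ω : Set M) (Φ : M → ℝ) (ψ : M → ℂ) (t : ℝ) : ℂ :=
  ∫ x in Ω, ((t ^ (-(n : ℝ) / 2) : ℝ) : ℂ) * Complex.exp (Complex.I * (t⁻¹ * Φ x : ℝ)) * ψ x ∂μ

/-- The number of positive eigenvalues minus the number of negative eigenvalues, counted with
multiplicity, of a real symmetric matrix. -/
def signature (A : Matrix (Fin n) (Fin n) ℝ) : ℤ :=
  (Multiset.countP (fun x => 0 < x) A.charpoly.roots : ℤ)
    - (Multiset.countP (fun x => x < 0) A.charpoly.roots : ℤ)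

variable [IsManifold (𝓡 n) ∞ M]

/-- The difference between `I_ψ(t)` and the `N`-th partial sum of its expansion. -/
def expansionError (cov : Connection n M) (Φ : M → ℝ) (γ : M → ℝ → M) (ρ : SmoothDensity n M)
    (μ : Measure M) (Ω : Set M) (p : M) (ψ : M → ℂ) (N : ℕ) (t : ℝ) : ℂ :=
  oscIntegral n μ Ω Φ ψ t
    - (((2 * Real.pi) ^ ((n : ℝ) / 2) : ℝ) : ℂ)
      * Complex.exp (Complex.I * (Real.pi / 4 * signature (hessMatrix cov Φ p) : ℝ))
      * Complex.exp (Complex.I * (t⁻¹ * Φ p : ℝ))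
      * ((Real.sqrt |(hessMatrix cov Φ p).det| / ρ.toFun p (stdFrame p) : ℝ) : ℂ)⁻¹
      * ∑ l ∈ Finset.range (N + 1),
          Complex.I ^ l * ((adjoint n μ Ω (box cov Φ γ))^[l] ψ p) / (2 ^ l * (l.factorial : ℂ))
            * (t : ℂ) ^ l

end Integral

end GeomOsc

end

/-! Write φ = Φ - Φ(p). The operator □ is built so that it acts on functions of the phase like an
ordinary differential operator: □(g ∘ φ) = 2φ g''(φ) + n g'(φ) (`IsNormalNhd.box_comp`). In
particular □ e^{iφ/t} = (-2φ/t² + in/t) e^{iφ/t}, which says exactly that u = t^{-n/2} e^{iφ/t}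
solves ∂u/∂t = (i/2) □u. After transposition, the normalized integral J_ψ(t) = e^{-iΦ(p)/t} I_ψ(t)
has the derivative (i/2) J_{□*ψ}(t) (`IsPhase.hasDerivAt_oscN`). The asymptotic expansion is
therefore the Taylor formula for J_ψ at t = 0 (`taylor_error_bound`). What is needed besides is the
limit of J_ψ at 0 and a bound for J_g that is uniform in t, with g = (□*)^{N+1} ψ.

The action of □ on functions of φ comes from two identities along the geodesics γ issuing from p.
Let R be the radial field, R = γ'(1). For X_s parallel, dΦ(X_s) vanishes at s = 0 and has the
derivative ∇²Φ(X_s, γ'), so dΦ = ∇²_1Φ(·, R) (`IsNormalNhd.frameDeriv_eq`). The second order Taylor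
formula along γ gives ∇²_2Φ(R, R) = 2φ (`IsNormalNhd.secondMatrix_radial`). Thus R is the gradient
of Φ with respect to ∇²_1Φ, the second order part of □ takes the value 2φ on dΦ ⊗ dΦ, and η is
defined so that Rη = n - □₀Φ, hence □Φ = n (`IsNormalNhd.box_phase`).

The uniform bound is an interpolation (`interpolation_bound`). Trivially |J_g| ≤ ‖g‖₁ t^{-n/2}, and
the k-th derivative of J_g is bounded by ‖(□*)^k g‖₁ t^{-n/2}. Forward differences of order k > n/2
remove the singularity at t = 0, and the best step size produces the product of powers in the
theorem.

The limit at 0 (`IsPhase.tendsto_oscN`) is found by rescaling. Replacing φ(y) by φ(εz)/ε² only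
rescales t, and the transposed operators of the rescaled problems depend smoothly on ε up to ε = 0.
The rate of convergence as t → 0 is therefore uniform in ε, and ε → 0 replaces the phase by its
quadratic Taylor polynomial, for which the limit is a product of one-dimensional Fresnel integrals.
Cutoffs do not matter, since φ has no other critical point.

All this takes place in one chart: the normal coordinates of Ω₀ (`IsNormalNhd.isChart`). Their
smoothness and invertibility are derived from the smooth dependence of γ_q(s) on (s, q). Integrals
over geodesics and parallel transport depend smoothly on q because they are treated as smooth maps
into the Banach space C([0,1]). The adjoint becomes the formal transpose in this chart
(`IsChart.adjoint_eq`). -/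

namespace GeomOsc

/-! ### Interpolation and Taylor remainders for functions of one variable -/

section OneVariable

open Set Filter

/-- The increment is dominated by the integral of B s^{-(κ+θ)} over [t, t + τ]. The factor s^{-κ} is
at most t^{-κ}, and the rest integrates to a difference of powers of exponent 1 - θ, which is
controlled by subadditivity of this power. One difference thus removes θ from the order of the
singularity. -/
lemma norm_fwdDiff_le {f g : ℝ → ℂ} {B θ κ τ t : ℝ} (hτ : 0 ≤ τ) (ht : 0 < t) (hκ : 0 ≤ κ)
    (hθ0 : 0 ≤ θ) (hθ1 : θ < 1) (hB : 0 ≤ B) (hf : ∀ s, 0 < s → HasDerivAt f (g s) s)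
    (hg : ∀ s, 0 < s → ‖g s‖ ≤ B * s ^ (-(κ + θ))) :
    ‖fwdDiff τ f t‖ ≤ τ ^ (1 - θ) / (1 - θ) * B * t ^ (-κ) := by
  have h1 : 0 < 1 - θ := by linarith
  have hder : ∀ u, 0 < t + u → HasDerivAt
      (fun u => B * t ^ (-κ) * (((t + u) ^ (1 - θ) - t ^ (1 - θ)) / (1 - θ)))
      (B * t ^ (-κ) * (t + u) ^ (-θ)) u := by
    intro u hu
    have h2 : HasDerivAt (fun u => (t + u) ^ (1 - θ)) ((1 - θ) * (t + u) ^ (1 - θ - 1)) u := by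
      have := (Real.hasDerivAt_rpow_const (x := t + u) (p := 1 - θ)
        (Or.inl hu.ne')).comp_const_add t u
      simpa using this
    have h3 := ((h2.sub_const (t ^ (1 - θ))).div_const (1 - θ)).const_mul (B * t ^ (-κ))
    refine h3.congr_deriv ?_
    rw [show 1 - θ - 1 = -θ by ring]
    field_simp
  have key : ∀ u ∈ Icc (0 : ℝ) τ, ‖f (t + u) - f t‖ ≤
      B * t ^ (-κ) * (((t + u) ^ (1 - θ) - t ^ (1 - θ)) / (1 - θ)) := by
    intro u hu
    refine image_norm_le_of_norm_deriv_right_le_deriv_boundary'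
      (f := fun u => f (t + u) - f t) (f' := fun u => g (t + u)) (a := 0) (b := τ)
      (B := fun u => B * t ^ (-κ) * (((t + u) ^ (1 - θ) - t ^ (1 - θ)) / (1 - θ)))
      (B' := fun u => B * t ^ (-κ) * (t + u) ^ (-θ)) ?_ ?_ ?_ ?_ ?_ ?_ hu
    · intro u hu
      have : HasDerivAt (fun u => f (t + u) - f t) (g (t + u)) u := by
        have := (hf (t + u) (by linarith [hu.1])).comp_const_add t u
        exact this.sub_const _
      exact this.continuousAt.continuousWithinAt
    · intro u hu
      have := (hf (t + u) (by linarith [hu.1])).comp_const_add t u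
      exact (this.sub_const _).hasDerivWithinAt
    · simp
    · exact fun u hu => (hder u (by linarith [hu.1])).continuousAt.continuousWithinAt
    · exact fun u hu => (hder u (by linarith [hu.1])).hasDerivWithinAt
    · intro u hu
      have hu' : 0 < t + u := by linarith [hu.1]
      refine (hg _ hu').trans ?_
      rw [neg_add, Real.rpow_add hu', mul_assoc]
      gcongr ?_ * (?_ * ?_)
      exact Real.rpow_le_rpow_of_nonpos ht (by linarith [hu.1]) (by linarith)
  have h4 := key τ ⟨hτ, le_rfl⟩
  have h5 : (t + τ) ^ (1 - θ) ≤ t ^ (1 - θ) + τ ^ (1 - θ) :=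
    Real.rpow_add_le_add_rpow ht.le hτ h1.le (by linarith)
  refine h4.trans ?_
  rw [mul_comm (τ ^ (1 - θ) / (1 - θ)), mul_assoc, mul_assoc]
  rw [mul_comm (t ^ (-κ))]
  have h6 : 0 ≤ t ^ (-κ) := (Real.rpow_pos_of_pos ht _).le
  gcongr
  linarith

/-- Each of the k differences uses up one derivative and θ of the exponent, so that nothing is left
of the singularity of order kθ. In the induction the whole tower of derivatives is replaced by its
first difference. -/
lemma norm_fwdDiff_iterate_le {θ τ : ℝ} (hτ : 0 ≤ τ) (hθ0 : 0 ≤ θ) (hθ1 : θ < 1) (k : ℕ) :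
    ∀ (B : ℝ) (_ : 0 ≤ B) (G : ℕ → ℝ → ℂ)
      (_ : ∀ j < k, ∀ s, 0 < s → HasDerivAt (G j) (G (j + 1) s) s)
      (_ : ∀ s, 0 < s → ‖G k s‖ ≤ B * s ^ (-(k * θ))) (t : ℝ) (_ : 0 < t),
      ‖(fwdDiff τ)^[k] (G 0) t‖ ≤ (τ ^ (1 - θ) / (1 - θ)) ^ k * B := by
  induction k with
  | zero =>
    intro B hB G _ h t ht
    simpa using h t ht
  | succ k ih =>
    intro B hB G hG h t ht
    have h1 : 0 < 1 - θ := by linarith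
    rw [Function.iterate_succ_apply, pow_succ, mul_assoc]
    refine ih (τ ^ (1 - θ) / (1 - θ) * B) (by positivity) (fun j => fwdDiff τ (G j)) ?_ ?_ t ht
    · intro j hj s hs
      have a := (hG j (by omega) (s + τ) (by linarith)).comp_add_const s τ
      exact a.sub (hG j (by omega) s hs)
    · intro s hs
      refine norm_fwdDiff_le hτ hs (by positivity) hθ0 hθ1 hB (hG k (by omega)) ?_
      intro r hr
      refine (h r hr).trans (le_of_eq ?_)
      push_cast
      ring_nf

/-- In the binomial expansion of the k-th difference, f(t) itself has the coefficient ±1; the other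
binomial coefficients add up to less than 2^k. -/
lemma norm_le_of_fwdDiff (k : ℕ) (τ : ℝ) (f : ℝ → ℂ) (t D : ℝ) (hD0 : 0 ≤ D)
    (hD : ∀ i ∈ Finset.range k, ‖f (t + ((i + 1 : ℕ) : ℝ) * τ)‖ ≤ D) :
    ‖f t‖ ≤ ‖(fwdDiff τ)^[k] f t‖ + 2 ^ k * D := by
  have h := fwdDiff_iter_eq_sum_shift τ f k t
  rw [Finset.sum_range_succ'] at h
  simp only [tsub_zero, Nat.choose_zero_right, Nat.cast_one, mul_one, zero_smul, add_zero] at h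
  have h2 : ‖((-1 : ℤ) ^ k) • f t‖ = ‖f t‖ := by
    rcases neg_one_pow_eq_or ℤ k with h | h <;> simp [h]
  rw [← h2, ← sub_eq_iff_eq_add'.mpr h]
  refine (norm_sub_le _ _).trans ?_
  gcongr
  calc _ ≤ ∑ i ∈ Finset.range k, (k.choose (i + 1) : ℝ) * D := by
        refine (norm_sum_le _ _).trans (Finset.sum_le_sum fun i hi => ?_)
        rw [← Int.cast_smul_eq_zsmul ℝ, norm_smul]
        have := hD i hi
        rw [nsmul_eq_mul]
        gcongr
        simp
    _ ≤ 2 ^ k * D := by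
        rw [← Finset.sum_mul]
        gcongr
        have := Nat.sum_range_choose k
        rw [Finset.sum_range_succ'] at this
        have h3 : (∑ i ∈ Finset.range k, k.choose (i + 1)) ≤ 2 ^ k := by omega
        exact_mod_cast h3

/-- A Landau–Kolmogorov inequality for functions that are singular at 0. The shifted values in the
k-th difference with step τ are taken at points ≥ τ and are at most A τ^{-a}. The difference itself
is of size B τ^{k-a}, by the previous bounds with θ = a/k < 1. The estimate does not depend on t. -/
lemma interpolation_bound {a : ℝ} {k : ℕ} (ha : 0 ≤ a) (hk : a < k) {A B : ℝ} (hA : 0 ≤ A)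
    (hB : 0 ≤ B) (G : ℕ → ℝ → ℂ)
    (hG : ∀ j < k, ∀ s, 0 < s → HasDerivAt (G j) (G (j + 1) s) s)
    (h0 : ∀ s, 0 < s → ‖G 0 s‖ ≤ A * s ^ (-a))
    (h1 : ∀ s, 0 < s → ‖G k s‖ ≤ B * s ^ (-a)) {t : ℝ} (ht : 0 < t) :
    ‖G 0 t‖ ≤ ((1 / (1 - a / k)) ^ k + 2 ^ k) * A ^ (1 - a / k) * B ^ (a / k) := by
  have hk0 : (0 : ℝ) < k := lt_of_le_of_lt ha hk
  have hθ0 : 0 ≤ a / k := by positivity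
  have hθ1 : a / k < 1 := (div_lt_one hk0).2 hk
  have hθ : 0 < 1 - a / k := by linarith
  -- A and B may vanish, and then the optimal τ is undefined. They are first replaced by larger
  -- positive numbers; the general case follows by continuity.
  have main : ∀ A' B' : ℝ, A < A' → B < B' →
      ‖G 0 t‖ ≤ ((1 / (1 - a / k)) ^ k + 2 ^ k) * A' ^ (1 - a / k) * B' ^ (a / k) := by
    intro A' B' hA' hB'
    have hA0 : 0 < A' := by linarith
    have hB0 : 0 < B' := by linarith
    -- With this step both contributions A' τ^{-a} and B' τ^{k-a} equal A'^{1-a/k} B'^{a/k}.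
    set τ : ℝ := (A' / B') ^ (1 / (k : ℝ)) with hτd
    have hτ : 0 < τ := by positivity
    have e1 := norm_le_of_fwdDiff k τ (G 0) t (A' * τ ^ (-a)) (by positivity) (by
      intro i _
      have hs : τ ≤ t + ((i + 1 : ℕ) : ℝ) * τ := by
        push_cast
        have : (0 : ℝ) ≤ i * τ := by positivity
        linarith
      refine (h0 _ (hτ.trans_le hs)).trans ?_
      gcongr ?_ * ?_
      exact Real.rpow_le_rpow_of_nonpos hτ hs (by linarith))
    have e2 := norm_fwdDiff_iterate_le hτ.le hθ0 hθ1 k B' hB0.le G hG (by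
      intro s hs
      rw [mul_div_cancel₀ _ hk0.ne']
      refine (h1 s hs).trans ?_
      gcongr) t ht
    have e3 : A' * τ ^ (-a) = A' ^ (1 - a / k) * B' ^ (a / k) := by
      rw [hτd, ← Real.rpow_mul (by positivity), Real.div_rpow hA0.le hB0.le,
        Real.rpow_sub hA0, Real.rpow_one, show 1 / (k : ℝ) * -a = -(a / k) by ring,
        Real.rpow_neg hA0.le, Real.rpow_neg hB0.le]
      field_simp
    have e4 : (τ ^ (1 - a / k)) ^ k * B' = A' ^ (1 - a / k) * B' ^ (a / k) := by
      rw [← Real.rpow_natCast, ← Real.rpow_mul hτ.le, hτd, ← Real.rpow_mul (by positivity),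
        show 1 / (k : ℝ) * ((1 - a / k) * k) = 1 - a / k by field_simp,
        Real.div_rpow hA0.le hB0.le, Real.rpow_sub hB0, Real.rpow_one]
      field_simp
    calc ‖G 0 t‖ ≤ _ := e1
      _ ≤ (τ ^ (1 - a / k) / (1 - a / k)) ^ k * B' + 2 ^ k * (A' * τ ^ (-a)) := by gcongr
      _ = (1 / (1 - a / k)) ^ k * ((τ ^ (1 - a / k)) ^ k * B') + 2 ^ k * (A' * τ ^ (-a)) := by
        rw [div_pow, div_pow]; ring
      _ = _ := by rw [e3, e4]; ring
  have lim : Tendsto (fun ε : ℝ => ((1 / (1 - a / k)) ^ k + 2 ^ k) * (A + ε) ^ (1 - a / k)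
      * (B + ε) ^ (a / k)) (𝓝[>] 0)
      (𝓝 (((1 / (1 - a / k)) ^ k + 2 ^ k) * (A + 0) ^ (1 - a / k) * (B + 0) ^ (a / k))) := by
    have c1 := Real.continuous_rpow_const hθ.le
    have c2 := Real.continuous_rpow_const hθ0
    have : Continuous (fun ε : ℝ => ((1 / (1 - a / k)) ^ k + 2 ^ k) * (A + ε) ^ (1 - a / k)
      * (B + ε) ^ (a / k)) := by fun_prop
    exact (this.tendsto 0).mono_left nhdsWithin_le_nhds
  rw [add_zero, add_zero] at lim
  refine ge_of_tendsto lim ?_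
  filter_upwards [self_mem_nhdsWithin] with ε hε
  exact main _ _ (by linarith [mem_Ioi.1 hε]) (by linarith [mem_Ioi.1 hε])

/-- The mean value inequality on [ε, t], followed by ε → 0, since f is only known to have a limit at
0. The factor 1/(m+1) is given up. -/
lemma norm_sub_le_of_deriv_bound {f : ℝ → ℂ} {g : ℝ → ℂ} {L : ℂ} {K : ℝ} {m : ℕ}
    (hf : ∀ s, 0 < s → HasDerivAt f (g s) s) (hL : Tendsto f (𝓝[>] 0) (𝓝 L))
    (hg : ∀ s, 0 < s → ‖g s‖ ≤ K * s ^ m) (hK : 0 ≤ K) {t : ℝ} (ht : 0 < t) :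
    ‖f t - L‖ ≤ K * t ^ (m + 1) := by
  have h : ∀ ε ∈ Ioo 0 t, ‖f t - f ε‖ ≤ K * t ^ m * (t - ε) := by
    intro ε hε
    refine norm_image_sub_le_of_norm_deriv_le_segment' (f := f) (f' := g) (a := ε) (b := t) ?_ ?_ t
      ⟨hε.2.le, le_rfl⟩
    · intro s hs
      exact (hf s (hε.1.trans_le hs.1)).hasDerivWithinAt
    · intro s hs
      have : 0 < s := hε.1.trans_le hs.1
      refine (hg s this).trans ?_
      gcongr
      exact hs.2.le
  have l1 : Tendsto (fun ε => ‖f t - f ε‖) (𝓝[>] 0) (𝓝 ‖f t - L‖) :=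
    (tendsto_const_nhds.sub hL).norm
  have l2 : Tendsto (fun ε => K * t ^ m * (t - ε)) (𝓝[>] 0) (𝓝 (K * t ^ m * (t - 0))) :=
    ((continuous_const.mul (continuous_const.sub continuous_id)).tendsto 0).mono_left
      nhdsWithin_le_nhds
  have := le_of_tendsto_of_tendsto l1 l2 (by
    filter_upwards [Ioo_mem_nhdsGT ht] with ε hε using h ε hε)
  rw [sub_zero, mul_assoc] at this
  rwa [pow_succ]

/-- By induction on N: the remainder of the tower shifted by one is the derivative of the remainder
of G 0. -/
lemma taylor_error_bound (N : ℕ) : ∀ (G : ℕ → ℝ → ℂ) (L : ℕ → ℂ)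
    (_ : ∀ j ≤ N, ∀ s, 0 < s → HasDerivAt (G j) (G (j + 1) s) s)
    (_ : ∀ j ≤ N, Tendsto (G j) (𝓝[>] 0) (𝓝 (L j))) (K : ℝ)
    (_ : 0 ≤ K) (_ : ∀ s, 0 < s → ‖G (N + 1) s‖ ≤ K) (t : ℝ) (_ : 0 < t),
    ‖G 0 t - ∑ l ∈ Finset.range (N + 1), L l * (t : ℂ) ^ l / (l.factorial : ℂ)‖
      ≤ K * t ^ (N + 1) := by
  induction N with
  | zero =>
    intro G L hG hL K hK h t ht
    simpa using norm_sub_le_of_deriv_bound (m := 0) (hG 0 le_rfl) (hL 0 le_rfl)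
      (by simpa using h) hK ht
  | succ N ih =>
    intro G L hG hL K hK h t ht
    have h1 := ih (fun j => G (j + 1)) (fun j => L (j + 1)) (fun j hj => hG (j + 1) (by omega))
      (fun j hj => hL (j + 1) (by omega)) K hK h
    -- The primitive, vanishing at 0, of the Taylor polynomial of G 1.
    set P : ℝ → ℂ := fun s => ∑ l ∈ Finset.range (N + 1),
      L (l + 1) * (s : ℂ) ^ (l + 1) / ((l + 1).factorial : ℂ) with hP
    have dP : ∀ s : ℝ, HasDerivAt P
        (∑ l ∈ Finset.range (N + 1), L (l + 1) * (s : ℂ) ^ l / (l.factorial : ℂ)) s := by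
      intro s
      refine HasDerivAt.fun_sum fun l _ => ?_
      have h2 : HasDerivAt (fun s : ℝ => (s : ℂ) ^ (l + 1)) (((l + 1 : ℕ) : ℂ) * (s : ℂ) ^ l) s := by
        simpa using (hasDerivAt_pow (l + 1) (s : ℂ)).comp_ofReal
      have h3 := (h2.const_mul (L (l + 1))).div_const ((l + 1).factorial : ℂ)
      refine h3.congr_deriv ?_
      rw [Nat.factorial_succ]
      have : ((l + 1 : ℕ) : ℂ) ≠ 0 := by exact_mod_cast Nat.succ_ne_zero l
      have h4 : (l.factorial : ℂ) ≠ 0 := by exact_mod_cast l.factorial_ne_zero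
      push_cast at this ⊢
      field_simp
    have P0 : P 0 = 0 := by simp [hP]
    have tP : Tendsto P (𝓝[>] 0) (𝓝 0) := by
      have := (dP 0).continuousAt.tendsto
      rw [P0] at this
      exact this.mono_left nhdsWithin_le_nhds
    have h5 := norm_sub_le_of_deriv_bound (f := fun s => G 0 s - P s) (L := L 0) (K := K)
      (m := N + 1) (fun s hs => (hG 0 (by omega) s hs).sub (dP s))
      (by simpa using (hL 0 (by omega)).sub tP) (fun s hs => h1 s hs) hK ht
    rw [Finset.sum_range_succ']
    convert h5 using 2
    simp [hP]
    ring

end OneVariable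

end GeomOsc

noncomputable section

set_option linter.unusedSectionVars false

namespace GeomOsc

/-! ### Smooth dependence on parameters for maps into C([0,1], F) -/

section CurriedMaps

open Set Filter

abbrev UI : Type := Set.Icc (0 : ℝ) 1

variable {E : Type*} [NormedAddCommGroup E] [NormedSpace ℝ E]
variable {F : Type*} [NormedAddCommGroup F] [NormedSpace ℝ F]

open Classical in
/-- The map `s ↦ g s` on the unit interval as a bundled continuous map (zero if it is not
continuous). -/
def toUI (g : ℝ → F) : C(UI, F) :=
  if h : Continuous (fun s : UI => g s) then ⟨fun s => g s, h⟩ else 0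

lemma toUI_apply {g : ℝ → F} (h : ContinuousOn g (Icc 0 1)) (s : UI) : toUI g s = g s := by
  have : Continuous (fun s : UI => g s) := continuousOn_iff_continuous_domRestrict.1 h
  simp [toUI, this]

/-- Evaluation of a family of linear maps. -/
def applyFamily : C(UI, E →L[ℝ] F) →L[ℝ] (E →L[ℝ] C(UI, F)) :=
  LinearMap.mkContinuous₂
    (LinearMap.mk₂ ℝ (fun (φ : C(UI, E →L[ℝ] F)) (v : E) =>
        (⟨fun s => φ s v, by fun_prop⟩ : C(UI, F)))
      (by intros; ext; simp) (by intros; ext; simp) (by intros; ext; simp) (by intros; ext; simp))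
    1 (by
      intro φ v
      rw [ContinuousMap.norm_le _ (by positivity)]
      intro s
      simp only [LinearMap.mk₂_apply, ContinuousMap.coe_mk, one_mul]
      exact (ContinuousLinearMap.le_opNorm _ _).trans (by gcongr; exact φ.norm_coe_le_norm s))

lemma applyFamily_apply (φ : C(UI, E →L[ℝ] F)) (v : E) (s : UI) :
    applyFamily φ v s = φ s v := rfl

lemma contDiff_applyFamily :
    ContDiff ℝ ∞ (fun φ : C(UI, E →L[ℝ] F) => applyFamily φ) :=
  ContinuousLinearMap.contDiff (𝕜 := ℝ) (E := C(UI, E →L[ℝ] F)) (F := E →L[ℝ] C(UI, F)) applyFamily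

lemma continuousOn_toUI {G : ℝ → E → F} {U : Set E}
    (hG : ContinuousOn (fun z : ℝ × E => G z.1 z.2) (Icc (0 : ℝ) 1 ×ˢ U)) :
    ContinuousOn (fun y => toUI fun s => G s y) U := by
  rw [continuousOn_iff_continuous_domRestrict]
  have h : Continuous (fun z : U × UI => G z.2 z.1) := by
    refine hG.comp_continuous (f := fun z : U × UI => ((z.2 : ℝ), (z.1 : E))) (by fun_prop) ?_
    intro z
    exact ⟨z.2.2, z.1.2⟩
  have := (ContinuousMap.curry ⟨_, h⟩).continuous
  convert this using 1
  ext y s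
  have hy : ContinuousOn (fun s => G s y) (Icc 0 1) :=
    hG.comp (f := fun s => (s, (y : E))) (by fun_prop) (fun s hs => ⟨hs, y.2⟩)
  simp [toUI_apply hy, ContinuousMap.curry]

lemma slice_continuousOn {G : ℝ → E → F} {U : Set E} {y : E} (hy : y ∈ U)
    (hG : ContinuousOn (fun z : ℝ × E => G z.1 z.2) (Icc (0 : ℝ) 1 ×ˢ U)) :
    ContinuousOn (fun s => G s y) (Icc 0 1) :=
  hG.comp (f := fun s => (s, y)) (by fun_prop) (fun _ hs => ⟨hs, hy⟩)

/-- Pointwise differentiability becomes differentiability in the sup norm because the derivative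
D(·, y) depends on y continuously in the sup norm: one δ serves in the mean value inequality for all
s. -/
lemma hasFDerivAt_toUI {G : ℝ → E → F} {D : ℝ → E → E →L[ℝ] F} {U : Set E} (hU : IsOpen U)
    (hG : ContinuousOn (fun z : ℝ × E => G z.1 z.2) (Icc (0 : ℝ) 1 ×ˢ U))
    (hD : ContinuousOn (fun z : ℝ × E => D z.1 z.2) (Icc (0 : ℝ) 1 ×ˢ U))
    (h : ∀ s ∈ Icc (0 : ℝ) 1, ∀ y ∈ U, HasFDerivAt (G s) (D s y) y) {y : E} (hy : y ∈ U) :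
    HasFDerivAt (fun y => toUI fun s => G s y) (applyFamily (toUI fun s => D s y)) y := by
  rw [hasFDerivAt_iff_isLittleO, Asymptotics.isLittleO_iff]
  intro ε hε
  have c := (continuousOn_toUI hD).continuousAt (hU.mem_nhds hy)
  rw [Metric.continuousAt_iff] at c
  obtain ⟨δ, hδ, hc⟩ := c ε hε
  obtain ⟨δ', hδ', hball⟩ := Metric.isOpen_iff.1 hU y hy
  filter_upwards [Metric.ball_mem_nhds y (lt_min hδ hδ')] with z hz
  rw [ContinuousMap.norm_le _ (by positivity)]
  intro s
  have hzU : ∀ w ∈ Metric.ball y (min δ δ'), w ∈ U := fun w hw =>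
    hball (Metric.ball_subset_ball (min_le_right _ _) hw)
  simp only [ContinuousMap.sub_apply, applyFamily_apply]
  rw [toUI_apply (slice_continuousOn (hzU z hz) hG), toUI_apply (slice_continuousOn hy hG),
    toUI_apply (slice_continuousOn hy hD)]
  refine (convex_ball y (min δ δ')).norm_image_sub_le_of_norm_hasFDerivWithin_le'
    (f := G s) (f' := D s) (fun w hw => (h s s.2 w (hzU w hw)).hasFDerivWithinAt) ?_
    (Metric.mem_ball_self (lt_min hδ hδ')) hz
  intro w hw
  have h1 := hc (Metric.ball_subset_ball (min_le_left _ _) hw)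
  rw [dist_eq_norm] at h1
  have h2 := (ContinuousMap.norm_coe_le_norm _ s).trans h1.le
  simpa [toUI_apply (slice_continuousOn (hzU w hw) hD), toUI_apply (slice_continuousOn hy hD)]
    using h2

/-- The derivative of the curried map is a map of the same kind with values in E →L[ℝ] F. For this
reason F is quantified inside the induction, and E and F are kept in one universe that is stable
under E →L[ℝ] F. -/
lemma contDiffOn_toUI_nat {E : Type} [NormedAddCommGroup E] [NormedSpace ℝ E] {U : Set E}
    (hU : IsOpen U) (m : ℕ) :
    ∀ {F : Type} [NormedAddCommGroup F] [NormedSpace ℝ F] {G : ℝ → E → F}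
    (_ : ContDiffOn ℝ m (fun z : ℝ × E => G z.1 z.2) (Icc (0 : ℝ) 1 ×ˢ U)),
    ContDiffOn ℝ m (fun y => toUI fun s => G s y) U := by
  have hud : UniqueDiffOn ℝ (Icc (0 : ℝ) 1 ×ˢ U) := (uniqueDiffOn_Icc zero_lt_one).prod hU.uniqueDiffOn
  induction m with
  | zero =>
    intro F _ _ G hG
    exact contDiffOn_zero.2 (continuousOn_toUI hG.continuousOn)
  | succ m ih =>
    intro F _ _ G hG
    set D : ℝ → E → E →L[ℝ] F := fun s y =>
      (fderivWithin ℝ (fun z : ℝ × E => G z.1 z.2) (Icc (0 : ℝ) 1 ×ˢ U) (s, y)).comp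
        (ContinuousLinearMap.inr ℝ ℝ E) with hDdef
    have hDs : ContDiffOn ℝ m (fun z : ℝ × E => D z.1 z.2) (Icc (0 : ℝ) 1 ×ˢ U) :=
      (hG.fderivWithin hud (by push_cast; exact le_rfl)).clm_comp contDiffOn_const
    have hd : ∀ s ∈ Icc (0 : ℝ) 1, ∀ y ∈ U, HasFDerivAt (G s) (D s y) y := by
      intro s hs y hy
      have h1 := ((hG.differentiableOn (by simp)) (s, y) ⟨hs, hy⟩).hasFDerivWithinAt
      have h2 : HasFDerivWithinAt (fun y : E => (s, y)) (ContinuousLinearMap.inr ℝ ℝ E) U y := by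
        have := (hasFDerivWithinAt_const s y U).prodMk (hasFDerivWithinAt_id (𝕜 := ℝ) y U)
        exact this
      have h3 := h1.comp y h2 (fun w hw => ⟨hs, hw⟩)
      exact h3.hasFDerivAt (hU.mem_nhds hy)
    have hder : ∀ y ∈ U, HasFDerivAt (fun y => toUI fun s => G s y)
        (applyFamily (toUI fun s => D s y)) y := fun y hy =>
      hasFDerivAt_toUI hU hG.continuousOn hDs.continuousOn hd hy
    push_cast
    rw [contDiffOn_succ_iff_fderiv_of_isOpen hU]
    refine ⟨fun y hy => (hder y hy).differentiableAt.differentiableWithinAt, by simp, ?_⟩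
    have h4 := (contDiff_infty.1 contDiff_applyFamily m).comp_contDiffOn (ih hDs)
    exact h4.congr fun y hy => (hder y hy).fderiv

lemma contDiffOn_toUI {E : Type} [NormedAddCommGroup E] [NormedSpace ℝ E] {U : Set E}
    (hU : IsOpen U) {F : Type} [NormedAddCommGroup F] [NormedSpace ℝ F] {G : ℝ → E → F}
    (hG : ContDiffOn ℝ ∞ (fun z : ℝ × E => G z.1 z.2) (Icc (0 : ℝ) 1 ×ˢ U)) :
    ContDiffOn ℝ ∞ (fun y => toUI fun s => G s y) U :=
  contDiffOn_infty.2 fun m => contDiffOn_toUI_nat hU m (contDiffOn_infty.1 hG m)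

end CurriedMaps
-- Linear differential equations as Volterra equations
section Volterra

open Set Filter

variable {E : Type*} [NormedAddCommGroup E] [NormedSpace ℝ E] [CompleteSpace E]

/-- The continuous extension of a map on the unit interval. -/
def extUI (f : C(UI, E)) (s : ℝ) : E := f (projIcc 0 1 zero_le_one s)

lemma extUI_continuous (f : C(UI, E)) : Continuous (extUI f) :=
  f.continuous.comp continuous_projIcc

lemma extUI_of_mem (f : C(UI, E)) {s : ℝ} (hs : s ∈ Icc (0 : ℝ) 1) : extUI f s = f ⟨s, hs⟩ := by
  rw [extUI, projIcc_of_mem _ hs]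

lemma norm_extUI_le (f : C(UI, E)) (s : ℝ) : ‖extUI f s‖ ≤ ‖f‖ := f.norm_coe_le_norm _

lemma extUI_toUI {g : ℝ → E} (h : ContinuousOn g (Icc 0 1)) {s : ℝ} (hs : s ∈ Icc (0 : ℝ) 1) :
    extUI (toUI g) s = g s := by
  rw [extUI_of_mem _ hs, toUI_apply h]

/-- The linear map `f ↦ ∫ₛ¹ f`. -/
def primitiveUI : C(UI, E) →L[ℝ] C(UI, E) :=
  LinearMap.mkContinuous
    { toFun := fun f => ⟨fun s => ∫ r in (s : ℝ)..1, extUI f r, by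
        have h : Continuous (fun s : ℝ => ∫ r in s..1, extUI f r) := by
          simp_rw [intervalIntegral.integral_symm 1]
          exact (intervalIntegral.continuous_primitive
            (fun a b => (extUI_continuous f).intervalIntegrable a b) 1).neg
        exact h.comp continuous_subtype_val⟩
      map_add' := by
        intro f g
        ext s
        exact intervalIntegral.integral_add ((extUI_continuous f).intervalIntegrable _ _)
          ((extUI_continuous g).intervalIntegrable _ _)
      map_smul' := by
        intro c f
        ext s
        exact intervalIntegral.integral_smul _ _ } 1 (by
      intro f
      rw [ContinuousMap.norm_le _ (by positivity)]
      intro s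
      refine (intervalIntegral.norm_integral_le_of_norm_le_const
        (fun r _ => norm_extUI_le f r)).trans ?_
      rw [one_mul]
      refine mul_le_of_le_one_right (norm_nonneg _) ?_
      rw [abs_of_nonneg (by linarith [s.2.2])]
      linarith [s.2.1])

/-- Pointwise application of a family of endomorphisms. -/
def mulUI : C(UI, E →L[ℝ] E) →L[ℝ] (C(UI, E) →L[ℝ] C(UI, E)) :=
  LinearMap.mkContinuous₂
    (LinearMap.mk₂ ℝ (fun (φ : C(UI, E →L[ℝ] E)) (v : C(UI, E)) =>
        (⟨fun s => φ s (v s), by fun_prop⟩ : C(UI, E)))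
      (by intros; ext; simp) (by intros; ext; simp) (by intros; ext; simp) (by intros; ext; simp))
    1 (by
      intro φ v
      rw [ContinuousMap.norm_le _ (by positivity)]
      intro s
      simp only [LinearMap.mk₂_apply, ContinuousMap.coe_mk, one_mul]
      exact (ContinuousLinearMap.le_opNorm _ _).trans (by
        gcongr
        exacts [φ.norm_coe_le_norm s, v.norm_coe_le_norm s]))

/-- The Volterra operator `v ↦ ∫ₛ¹ A v`. -/
def volterra : C(UI, E →L[ℝ] E) →L[ℝ] (C(UI, E) →L[ℝ] C(UI, E)) :=
  (ContinuousLinearMap.compL ℝ _ _ _ primitiveUI).comp mulUI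

lemma contDiff_volterra : ContDiff ℝ ∞ (fun A : C(UI, E →L[ℝ] E) => volterra A) :=
  ContinuousLinearMap.contDiff (𝕜 := ℝ) (E := C(UI, E →L[ℝ] E)) (F := C(UI, E) →L[ℝ] C(UI, E))
    volterra

lemma volterra_apply (A : C(UI, E →L[ℝ] E)) (v : C(UI, E)) (s : UI) :
    volterra A v s = ∫ r in (s : ℝ)..1, extUI A r (extUI v r) := rfl

lemma norm_volterra_pow_le (A : C(UI, E →L[ℝ] E)) (m : ℕ) (v : C(UI, E)) (s : UI) :
    ‖((volterra A) ^ m) v s‖ ≤ ‖A‖ ^ m * (1 - s) ^ m / m.factorial * ‖v‖ := by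
  induction m generalizing s with
  | zero => simpa using v.norm_coe_le_norm s
  | succ m ih =>
    rw [pow_succ']
    change ‖volterra A (((volterra A) ^ m) v) s‖ ≤ _
    rw [volterra_apply]
    have h1 : ∀ r ∈ Ioc (s : ℝ) 1, ‖extUI A r (extUI (((volterra A) ^ m) v) r)‖ ≤
        ‖A‖ * (‖A‖ ^ m * (1 - r) ^ m / m.factorial * ‖v‖) := by
      intro r hr
      have hr' : r ∈ Icc (0 : ℝ) 1 := ⟨by linarith [s.2.1, hr.1], hr.2⟩
      refine (ContinuousLinearMap.le_opNorm _ _).trans ?_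
      gcongr
      · exact norm_extUI_le A r
      · rw [extUI_of_mem _ hr']
        exact ih ⟨r, hr'⟩
    refine (intervalIntegral.norm_integral_le_of_norm_le s.2.2 (ae_of_all _ h1) ?_).trans ?_
    · apply Continuous.intervalIntegrable; fun_prop
    · apply le_of_eq
      have : ∫ r in (s : ℝ)..1, (1 - r) ^ m = (1 - s) ^ (m + 1) / (m + 1) := by
        rw [intervalIntegral.integral_comp_sub_left (fun x => x ^ m) 1]
        simp
      rw [intervalIntegral.integral_const_mul, intervalIntegral.integral_mul_const,
        intervalIntegral.integral_div, intervalIntegral.integral_const_mul, this,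
        Nat.factorial_succ]
      push_cast
      field_simp
      ring

/-- By the factorial bound a power V^m has norm below 1, so 1 - V^m is invertible. It is the product
of 1 - V and a commuting geometric sum, so 1 - V is invertible too. -/
lemma isUnit_one_sub_volterra (A : C(UI, E →L[ℝ] E)) : IsUnit (1 - volterra A) := by
  have h : Tendsto (fun m : ℕ => ‖A‖ ^ m / (m.factorial : ℝ)) atTop (𝓝 0) :=
    FloorSemiring.tendsto_pow_div_factorial_atTop _
  obtain ⟨m, hm⟩ := ((h.eventually (gt_mem_nhds (zero_lt_one' ℝ)))).exists
  have h1 : ‖(volterra A) ^ m‖ < 1 := by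
    refine lt_of_le_of_lt (ContinuousLinearMap.opNorm_le_bound _ (by positivity) fun v => ?_) hm
    rw [ContinuousMap.norm_le _ (by positivity)]
    intro s
    refine (norm_volterra_pow_le A m v s).trans ?_
    gcongr
    refine mul_le_of_le_one_right (by positivity) (pow_le_one₀ ?_ ?_)
    · linarith [s.2.2]
    · linarith [s.2.1]
  have h2 : IsUnit (1 - (volterra A) ^ m) :=
    isUnit_one_sub_of_norm_lt_one (R := C(UI, E) →L[ℝ] C(UI, E)) h1
  rw [← mul_neg_geom_sum] at h2
  exact ((Commute.isUnit_mul_iff (by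
    rw [commute_iff_eq, mul_neg_geom_sum, geom_sum_mul_neg])).1 h2).1

/-- The solution of `v' = - A v`, `v 1 = X` on the unit interval. -/
def linSol (A : C(UI, E →L[ℝ] E)) (X : E) : C(UI, E) :=
  Ring.inverse (1 - volterra A) (ContinuousMap.const _ X)

lemma linSol_eq (A : C(UI, E →L[ℝ] E)) (X : E) (s : UI) :
    linSol A X s = X + ∫ r in (s : ℝ)..1, extUI A r (extUI (linSol A X) r) := by
  have h := Ring.mul_inverse_cancel _ (isUnit_one_sub_volterra A)
  have h2 := congrArg (fun T : C(UI, E) →L[ℝ] C(UI, E) => T (ContinuousMap.const _ X) s) h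
  change linSol A X s - volterra A (linSol A X) s = X at h2
  rw [← volterra_apply]
  exact sub_eq_iff_eq_add.1 h2

lemma linSol_one (A : C(UI, E →L[ℝ] E)) (X : E) : extUI (linSol A X) 1 = X := by
  rw [extUI_of_mem _ ⟨zero_le_one, le_rfl⟩, linSol_eq]
  simp

lemma eq_linSol {A : C(UI, E →L[ℝ] E)} {X : E} {v : C(UI, E)}
    (h : ∀ s : UI, v s = X + ∫ r in (s : ℝ)..1, extUI A r (extUI v r)) : v = linSol A X := by
  have h1 : (1 - volterra A) v = ContinuousMap.const _ X := by
    ext s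
    simp [volterra_apply, ← h s, sub_eq_iff_eq_add]
  have h2 := congrArg (fun T : C(UI, E) →L[ℝ] C(UI, E) => T v)
    (Ring.inverse_mul_cancel _ (isUnit_one_sub_volterra A))
  rw [linSol, ← h1]
  exact h2.symm

lemma hasDerivWithinAt_linSol (A : C(UI, E →L[ℝ] E)) (X : E) {s : ℝ} (hs : s ∈ Icc (0 : ℝ) 1) :
    HasDerivWithinAt (extUI (linSol A X)) (-(extUI A s (extUI (linSol A X) s))) (Icc 0 1) s := by
  have hc : Continuous fun r => extUI A r (extUI (linSol A X) r) :=
    (extUI_continuous A).clm_apply (extUI_continuous _)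
  have h1 : HasDerivAt (fun s => X + ∫ r in s..1, extUI A r (extUI (linSol A X) r))
      (-(extUI A s (extUI (linSol A X) s))) s := by
    refine HasDerivAt.const_add X ?_
    exact intervalIntegral.integral_hasDerivAt_left (hc.intervalIntegrable _ _)
      hc.aestronglyMeasurable.stronglyMeasurableAtFilter hc.continuousAt
  refine h1.hasDerivWithinAt.congr_of_mem (fun r hr => ?_) hs
  rw [extUI_of_mem (linSol A X) hr, linSol_eq]

/-- Uniqueness: the fundamental theorem of calculus turns the differential equation into the
Volterra equation, whose solution is unique. -/
lemma eq_linSol_of_hasDerivWithinAt {A : C(UI, E →L[ℝ] E)} {w : ℝ → E}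
    (hw : ∀ s ∈ Icc (0 : ℝ) 1, HasDerivWithinAt w (-(extUI A s (w s))) (Icc 0 1) s) {s : ℝ}
    (hs : s ∈ Icc (0 : ℝ) 1) : w s = extUI (linSol A (w 1)) s := by
  have hc : ContinuousOn w (Icc 0 1) := fun s hs => (hw s hs).continuousWithinAt
  have key : toUI w = linSol A (w 1) := by
    refine eq_linSol fun r => ?_
    rw [toUI_apply hc]
    have h1 : ∫ x in (r : ℝ)..1, -(extUI A x (extUI (toUI w) x)) = w 1 - w r := by
      refine intervalIntegral.integral_eq_sub_of_hasDeriv_right_of_le r.2.2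
        (hc.mono (Icc_subset_Icc_left r.2.1)) ?_ ?_
      · intro x hx
        have hx' : x ∈ Icc (0 : ℝ) 1 := ⟨by linarith [r.2.1, hx.1], hx.2.le⟩
        rw [extUI_toUI hc hx']
        have := (hw x hx').mono (Icc_subset_Icc_left hx'.1)
        exact this.mono_of_mem_nhdsWithin (Icc_mem_nhdsGT hx.2)
      · exact ((extUI_continuous A).clm_apply (extUI_continuous _)).neg.intervalIntegrable _ _
    rw [intervalIntegral.integral_neg] at h1
    have h2 : ∫ x in (r : ℝ)..1, extUI A x (extUI (toUI w) x) = w r - w 1 := by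
      rw [← neg_inj, h1]; abel
    rw [h2]; abel
  rw [← key, extUI_toUI hc hs]

/-- Bootstrapping: the equation expresses w' through w, so each degree of smoothness of w yields the
next one. -/
lemma contDiffOn_of_hasDerivWithinAt {A : ℝ → E →L[ℝ] E} {w : ℝ → E}
    (hA : ContDiffOn ℝ ∞ A (Icc 0 1))
    (hw : ∀ s ∈ Icc (0 : ℝ) 1, HasDerivWithinAt w (-(A s (w s))) (Icc 0 1) s) :
    ContDiffOn ℝ ∞ w (Icc 0 1) := by
  rw [contDiffOn_infty]
  intro m
  induction m with
  | zero => exact contDiffOn_zero.2 fun s hs => (hw s hs).continuousWithinAt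
  | succ m ih =>
    push_cast
    rw [contDiffOn_succ_iff_derivWithin (uniqueDiffOn_Icc zero_lt_one)]
    refine ⟨fun s hs => (hw s hs).differentiableWithinAt, by simp, ?_⟩
    have : ContDiffOn ℝ m (fun s => -(A s (w s))) (Icc 0 1) :=
      ((hA.of_le (by exact_mod_cast le_top)).clm_apply ih).neg
    exact this.congr fun s hs => (hw s hs).derivWithin (uniqueDiffOn_Icc zero_lt_one s hs)

/-- Smooth dependence on the coefficients is the smoothness of inversion in the Banach algebra of
operators, composed with the linear map `volterra`. -/
lemma contDiff_linSol (X : E) : ContDiff ℝ ∞ (fun A : C(UI, E →L[ℝ] E) => linSol A X) := by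
  rw [contDiff_iff_contDiffAt]
  intro A
  obtain ⟨u, hu⟩ := isUnit_one_sub_volterra A
  have h1 : ContDiffAt ℝ ∞ (Ring.inverse : (C(UI, E) →L[ℝ] C(UI, E)) → _) (1 - volterra A) := by
    rw [← hu]; exact contDiffAt_ringInverse (R := C(UI, E) →L[ℝ] C(UI, E)) ℝ u
  have h2 : ContDiffAt ℝ ∞ (fun A : C(UI, E →L[ℝ] E) => 1 - volterra A) A :=
    contDiffAt_const.sub contDiff_volterra.contDiffAt
  exact (h1.comp A h2).clm_apply contDiffAt_const

end Volterra

end GeomOsc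
end

noncomputable section

set_option linter.unusedSectionVars false

namespace GeomOsc

/-! ### Fresnel integrals -/

section Fresnel

open Set Filter

lemma exists_fourier_representation {χ : ℝ → ℂ} (hχ : ContDiff ℝ ∞ χ) (hc : HasCompactSupport χ) :
    ∃ h : ℝ → ℂ, Integrable h ∧ ∀ y : ℝ, χ y = ∫ v : ℝ, Complex.exp (Complex.I * (2 * Real.pi * y * v : ℝ)) * h v := by
  set S : SchwartzMap ℝ ℂ := hc.toSchwartzMap hχ with hS
  refine ⟨FourierTransform.fourier S, (FourierTransform.fourier S).integrable, fun y => ?_⟩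
  have h1 : FourierTransformInv.fourierInv (FourierTransform.fourier S) = S :=
    FourierTransform.fourierInv_fourier_eq S
  have h2 : χ y = S y := rfl
  rw [h2, ← h1, SchwartzMap.fourierInv_coe, Real.fourierInv_eq', h1]
  refine integral_congr_ae (ae_of_all _ fun v => ?_)
  simp only [RCLike.inner_apply, conj_trivial, smul_eq_mul]
  congr 2
  push_cast
  ring

/-- Insert the Fourier representation of χ, exchange the integrals (absolutely convergent since Re b
> 0), and use the Fourier transform of the Gaussian. -/
lemma integral_gaussian_mul {χ h : ℝ → ℂ} (hh : Integrable h)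
    (hrep : ∀ y : ℝ, χ y = ∫ v : ℝ, Complex.exp (Complex.I * (2 * Real.pi * y * v : ℝ)) * h v)
    {b : ℂ} (hb : 0 < b.re) (ε : ℝ) :
    ∫ x : ℝ, Complex.exp (-b * x ^ 2) * χ (ε * x) =
      (Real.pi / b) ^ (1 / 2 : ℂ) *
        ∫ v : ℝ, Complex.exp (-(2 * Real.pi * ε * v : ℝ) ^ 2 / (4 * b)) * h v := by
  have hg : Integrable (fun x : ℝ => Complex.exp (-b * x ^ 2)) := integrable_cexp_neg_mul_sq hb
  calc ∫ x : ℝ, Complex.exp (-b * x ^ 2) * χ (ε * x)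
      = ∫ x : ℝ, ∫ v : ℝ, Complex.exp (Complex.I * (2 * Real.pi * ε * v : ℝ) * x)
          * Complex.exp (-b * x ^ 2) * h v := by
        refine integral_congr_ae (ae_of_all _ fun x => ?_)
        simp only
        rw [hrep, ← integral_const_mul]
        refine integral_congr_ae (ae_of_all _ fun v => ?_)
        simp only
        rw [← mul_assoc, mul_comm (Complex.exp (-b * x ^ 2))]
        congr 3
        push_cast
        ring
    _ = ∫ v : ℝ, ∫ x : ℝ, Complex.exp (Complex.I * (2 * Real.pi * ε * v : ℝ) * x)
          * Complex.exp (-b * x ^ 2) * h v := by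
        refine integral_integral_swap ?_
        have hm : AEStronglyMeasurable (Function.uncurry fun x v : ℝ =>
            Complex.exp (Complex.I * (2 * Real.pi * ε * v : ℝ) * x)
              * Complex.exp (-b * x ^ 2) * h v) (volume.prod volume) := by
          refine AEStronglyMeasurable.mul ?_ (hh.aestronglyMeasurable.comp_snd)
          exact (by fun_prop : Continuous fun z : ℝ × ℝ =>
            Complex.exp (Complex.I * (2 * Real.pi * ε * z.2 : ℝ) * z.1)
              * Complex.exp (-b * z.1 ^ 2)).aestronglyMeasurable
        refine Integrable.mono (hg.mul_prod hh) hm (ae_of_all _ fun z => le_of_eq ?_)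
        simp only [Function.uncurry, norm_mul]
        have : Complex.I * (2 * Real.pi * ε * z.2 : ℝ) * z.1 =
            ((2 * Real.pi * ε * z.2 * z.1 : ℝ) : ℂ) * Complex.I := by push_cast; ring
        rw [this, Complex.norm_exp_ofReal_mul_I, one_mul]
    _ = _ := by
        rw [← integral_const_mul]
        refine integral_congr_ae (ae_of_all _ fun v => ?_)
        simp only
        rw [integral_mul_const, fourierIntegral_gaussian hb, mul_assoc]

lemma re_inv_nonneg {b : ℂ} (hb : 0 ≤ b.re) (x : ℝ) : (-(x : ℂ) ^ 2 / (4 * b)).re ≤ 0 := by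
  have : (-(x : ℂ) ^ 2 / (4 * b)) = ((-(x ^ 2) / 4 : ℝ) : ℂ) * b⁻¹ := by
    push_cast
    rw [div_mul_eq_div_div]
    rfl
  rw [this, Complex.re_ofReal_mul, Complex.inv_re]
  have h2 : 0 ≤ b.re / Complex.normSq b := div_nonneg hb (Complex.normSq_nonneg b)
  nlinarith [sq_nonneg x]

lemma norm_cexp_le_one {z : ℂ} (h : z.re ≤ 0) : ‖Complex.exp z‖ ≤ 1 := by
  rw [Complex.norm_exp]; exact Real.exp_le_one_iff.2 h

/-- The value of the one-dimensional Fresnel integral. -/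
def fresnelConst (l : ℝ) : ℂ := (Real.pi / (-(Complex.I * (l / 2)))) ^ (1 / 2 : ℂ)

/-- The number is 2πi/l, on the imaginary axis and nonzero, so the principal square root is
continuous there. -/
lemma slit {l : ℝ} (hl : l ≠ 0) : (Real.pi / (-(Complex.I * (l / 2))) : ℂ) ∈ Complex.slitPlane := by
  right
  have : (Real.pi / (-(Complex.I * (l / 2))) : ℂ) = ((2 * Real.pi / l : ℝ) : ℂ) * Complex.I := by
    have h : (l : ℂ) ≠ 0 := by exact_mod_cast hl
    push_cast
    field_simp
    simp
  rw [this]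
  simp [hl, Real.pi_ne_zero]

/-- The Gaussian formula is continued to the boundary Re b = 0 along b = δ - il/2, δ → 0+. The left
side is dominated by |χ(ε·)|, the right side by |h|. -/
lemma fresnel_identity {χ h : ℝ → ℂ} (hχ : Continuous χ) (hc : HasCompactSupport χ)
    (hh : Integrable h)
    (hrep : ∀ y : ℝ, χ y = ∫ v : ℝ, Complex.exp (Complex.I * (2 * Real.pi * y * v : ℝ)) * h v)
    {l : ℝ} (hl : l ≠ 0) {ε : ℝ} (hε : ε ≠ 0) :
    ∫ x : ℝ, Complex.exp (Complex.I * (l / 2 * x ^ 2 : ℝ)) * χ (ε * x) =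
      fresnelConst l *
        ∫ v : ℝ, Complex.exp (-(2 * Real.pi * ε * v : ℝ) ^ 2 / (4 * (-(Complex.I * (l / 2))))) * h v := by
  set b : ℝ → ℂ := fun δ => δ - Complex.I * (l / 2) with hbdef
  have hbre : ∀ δ : ℝ, (b δ).re = δ := by intro δ; simp [hbdef]
  have b0 : b 0 = -(Complex.I * (l / 2)) := by simp [hbdef]
  have hb0 : b 0 ≠ 0 := by rw [b0]; simp [hl]
  have hbc : Continuous b := by fun_prop
  have lim1 : Tendsto (fun δ : ℝ => ∫ x : ℝ, Complex.exp (-b δ * x ^ 2) * χ (ε * x)) (𝓝[>] 0)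
      (𝓝 (∫ x : ℝ, Complex.exp (-b 0 * x ^ 2) * χ (ε * x))) := by
    have hχi : Integrable fun x => ‖χ (ε * x)‖ := by
      have : Integrable χ := hχ.integrable_of_hasCompactSupport hc
      exact (this.comp_mul_left' hε).norm
    refine tendsto_integral_filter_of_dominated_convergence (fun x => ‖χ (ε * x)‖) ?_ ?_ hχi ?_
    · exact Eventually.of_forall fun δ => (by fun_prop : Continuous fun x : ℝ =>
        Complex.exp (-b δ * x ^ 2) * χ (ε * x)).aestronglyMeasurable
    · filter_upwards [self_mem_nhdsWithin] with δ hδ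
      refine ae_of_all _ fun x => ?_
      rw [norm_mul]
      refine mul_le_of_le_one_left (norm_nonneg _) (norm_cexp_le_one ?_)
      have : (-b δ * (x : ℂ) ^ 2).re = -δ * x ^ 2 := by
        rw [← Complex.ofReal_pow, Complex.re_mul_ofReal, Complex.neg_re, hbre]
      rw [this]
      nlinarith [sq_nonneg x, mem_Ioi.1 hδ]
    · refine ae_of_all _ fun x => ?_
      have : Continuous fun δ => Complex.exp (-b δ * x ^ 2) * χ (ε * x) := by fun_prop
      exact (this.tendsto 0).mono_left nhdsWithin_le_nhds
  have lim2 : Tendsto (fun δ : ℝ => (Real.pi / b δ) ^ (1 / 2 : ℂ) *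
        ∫ v : ℝ, Complex.exp (-(2 * Real.pi * ε * v : ℝ) ^ 2 / (4 * b δ)) * h v) (𝓝[>] 0)
      (𝓝 ((Real.pi / b 0) ^ (1 / 2 : ℂ) *
        ∫ v : ℝ, Complex.exp (-(2 * Real.pi * ε * v : ℝ) ^ 2 / (4 * b 0)) * h v)) := by
    refine Tendsto.mul ?_ ?_
    · have hs : (Real.pi / b 0 : ℂ) ∈ Complex.slitPlane := by rw [b0]; exact slit hl
      have h1 : ContinuousAt (fun δ : ℝ => (Real.pi / b δ : ℂ)) 0 :=
        continuousAt_const.div hbc.continuousAt hb0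
      exact ((h1.cpow continuousAt_const hs).tendsto).mono_left nhdsWithin_le_nhds
    · refine tendsto_integral_filter_of_dominated_convergence (fun x => ‖h x‖) ?_ ?_ hh.norm ?_
      · exact Eventually.of_forall fun δ => ((by fun_prop : Continuous fun v : ℝ =>
          Complex.exp (-(2 * Real.pi * ε * v : ℝ) ^ 2 / (4 * b δ))).aestronglyMeasurable).mul
            hh.aestronglyMeasurable
      · filter_upwards [self_mem_nhdsWithin] with δ hδ
        refine ae_of_all _ fun x => ?_
        rw [norm_mul]
        refine mul_le_of_le_one_left (norm_nonneg _) (norm_cexp_le_one (re_inv_nonneg ?_ _))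
        rw [hbre]; exact (mem_Ioi.1 hδ).le
      · refine ae_of_all _ fun x => ?_
        have : ContinuousAt (fun δ => Complex.exp (-(2 * Real.pi * ε * x : ℝ) ^ 2 / (4 * b δ)) * h x) 0 := by
          refine ContinuousAt.mul (Complex.continuous_exp.continuousAt.comp ?_) continuousAt_const
          exact continuousAt_const.div (continuousAt_const.mul hbc.continuousAt)
            (mul_ne_zero (by norm_num) hb0)
        exact this.tendsto.mono_left nhdsWithin_le_nhds
  have heq : ∀ᶠ δ : ℝ in 𝓝[>] 0, (Real.pi / b δ) ^ (1 / 2 : ℂ) *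
        ∫ v : ℝ, Complex.exp (-(2 * Real.pi * ε * v : ℝ) ^ 2 / (4 * b δ)) * h v
        = ∫ x : ℝ, Complex.exp (-b δ * x ^ 2) * χ (ε * x) := by
    filter_upwards [self_mem_nhdsWithin] with δ hδ
    exact (integral_gaussian_mul hh hrep (by rw [hbre]; exact hδ) ε).symm
  have := tendsto_nhds_unique (lim2.congr' heq) lim1
  rw [b0] at this
  rw [fresnelConst, this]
  refine integral_congr_ae (ae_of_all _ fun x => ?_)
  simp only
  congr 2
  push_cast
  ring

/-- On the Fourier side the integrand is dominated by |h| uniformly in ε, and at ε = 0 it integrates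
to χ(0). -/
lemma tendsto_fresnel_one {χ : ℝ → ℂ} (hχ : ContDiff ℝ ∞ χ) (hc : HasCompactSupport χ)
    {l : ℝ} (hl : l ≠ 0) :
    Tendsto (fun ε : ℝ => ∫ x : ℝ, Complex.exp (Complex.I * (l / 2 * x ^ 2 : ℝ)) * χ (ε * x))
      (𝓝[>] 0) (𝓝 (fresnelConst l * χ 0)) := by
  obtain ⟨h, hh, hrep⟩ := exists_fourier_representation hχ hc
  have heq : ∀ᶠ ε : ℝ in 𝓝[>] 0, fresnelConst l *
        ∫ v : ℝ, Complex.exp (-(2 * Real.pi * ε * v : ℝ) ^ 2 / (4 * (-(Complex.I * (l / 2))))) * h v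
      = ∫ x : ℝ, Complex.exp (Complex.I * (l / 2 * x ^ 2 : ℝ)) * χ (ε * x) := by
    filter_upwards [self_mem_nhdsWithin] with ε hε
    exact (fresnel_identity hχ.continuous hc hh hrep hl (mem_Ioi.1 hε).ne').symm
  refine Tendsto.congr' heq (Tendsto.const_mul _ ?_)
  have h0 : χ 0 = ∫ v : ℝ, Complex.exp (-(2 * Real.pi * 0 * v : ℝ) ^ 2 / (4 * (-(Complex.I * (l / 2))))) * h v := by
    rw [hrep 0]; simp
  rw [h0]
  refine tendsto_integral_filter_of_dominated_convergence (fun x => ‖h x‖) ?_ ?_ hh.norm ?_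
  · exact Eventually.of_forall fun δ => ((by fun_prop : Continuous fun v : ℝ =>
      Complex.exp (-(2 * Real.pi * δ * v : ℝ) ^ 2 / (4 * (-(Complex.I * (l / 2)))))).aestronglyMeasurable).mul
            hh.aestronglyMeasurable
  · refine Eventually.of_forall fun δ => ae_of_all _ fun x => ?_
    rw [norm_mul]
    refine mul_le_of_le_one_left (norm_nonneg _) (norm_cexp_le_one (re_inv_nonneg ?_ _))
    simp
  · refine ae_of_all _ fun x => ?_
    have : Continuous fun δ : ℝ => Complex.exp (-(2 * Real.pi * δ * x : ℝ) ^ 2 / (4 * (-(Complex.I * (l / 2))))) * h x := by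
      fun_prop
    exact (this.tendsto 0).mono_left nhdsWithin_le_nhds

/-- The base of the power has the argument ±π/2 according to the sign of l; the principal square
root halves it. -/
lemma fresnelConst_eq {l : ℝ} (hl : l ≠ 0) :
    fresnelConst l = ((2 * Real.pi) ^ (1 / 2 : ℝ) : ℝ) * ((Real.sqrt |l| : ℝ) : ℂ)⁻¹ *
      Complex.exp (Complex.I * (Real.pi / 4 * (SignType.sign l : ℝ) : ℝ)) := by
  have h2 : (Real.pi / (-(Complex.I * (l / 2))) : ℂ) = ((2 * Real.pi / |l| : ℝ) : ℂ) *
      Complex.exp (Complex.I * (Real.pi / 2 * (SignType.sign l : ℝ) : ℝ)) := by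
    have h : (l : ℂ) ≠ 0 := by exact_mod_cast hl
    rcases lt_or_gt_of_ne hl with h' | h'
    · rw [abs_of_neg h', sign_neg h']
      simp only [SignType.coe_neg_one]
      rw [show (Complex.I * ((Real.pi / 2 * (-1) : ℝ) : ℂ)) = -(Real.pi / 2) * Complex.I by push_cast; ring]
      rw [show (-(Real.pi / 2) * Complex.I : ℂ) = -(Real.pi / 2 * Complex.I) by ring, Complex.exp_neg,
        Complex.exp_pi_div_two_mul_I]
      push_cast
      field_simp
    · rw [abs_of_pos h', sign_pos h']
      simp only [SignType.coe_one, mul_one]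
      rw [show (Complex.I * ((Real.pi / 2 : ℝ) : ℂ)) = (Real.pi / 2) * Complex.I by push_cast; ring,
        Complex.exp_pi_div_two_mul_I]
      push_cast
      field_simp
      simp
  have hpos : 0 < 2 * Real.pi / |l| := by positivity
  have hsl : |((SignType.sign l : ℝ))| ≤ 1 := by
    rcases lt_or_gt_of_ne hl with h' | h'
    · simp [sign_neg h']
    · simp [sign_pos h']
  have hs2 := abs_le.1 hsl
  have him : (Complex.I * (Real.pi / 2 * (SignType.sign l : ℝ) : ℝ) : ℂ).im =
      Real.pi / 2 * (SignType.sign l : ℝ) := by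
    rw [Complex.I_mul_im, Complex.ofReal_re]
  rw [fresnelConst, h2, Complex.cpow_def_of_ne_zero (mul_ne_zero (by exact_mod_cast hpos.ne')
    (Complex.exp_ne_zero _)), Complex.log_ofReal_mul hpos (Complex.exp_ne_zero _),
    Complex.log_exp (by rw [him]; nlinarith [Real.pi_pos]) (by rw [him]; nlinarith [Real.pi_pos]),
    add_mul, Complex.exp_add]
  congr 1
  · rw [← Complex.ofReal_inv, ← Complex.ofReal_mul, ← Complex.ofReal_one, ← Complex.ofReal_ofNat,
      ← Complex.ofReal_div, ← Complex.ofReal_mul, ← Complex.ofReal_exp]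
    congr 1
    rw [← Real.rpow_def_of_pos hpos, Real.div_rpow (by positivity) (abs_nonneg _),
      Real.sqrt_eq_rpow, div_eq_mul_inv]
  · congr 1
    push_cast
    ring

/-- The signature as a sum of signs of eigenvalues. -/
lemma signature_eq {n : ℕ} {H : Matrix (Fin n) (Fin n) ℝ} (hH : H.IsHermitian) :
    (signature H : ℝ) = ∑ i, (SignType.sign (hH.eigenvalues i) : ℝ) := by
  classical
  have h1 : ∀ i, (SignType.sign (hH.eigenvalues i) : ℝ) =
      (if 0 < hH.eigenvalues i then (1 : ℝ) else 0) - (if hH.eigenvalues i < 0 then 1 else 0) := by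
    intro i
    rcases lt_trichotomy (hH.eigenvalues i) 0 with h | h | h
    · simp [h, h.le.not_gt]
    · simp [h]
    · simp [h, h.le.not_gt]
  simp_rw [h1]
  rw [Finset.sum_sub_distrib]
  simp only [signature, hH.roots_charpoly_eq_eigenvalues, Multiset.countP_map]
  push_cast
  congr 1 <;> rw [← Finset.sum_filter, Finset.sum_const, nsmul_eq_mul, mul_one] <;> rfl

lemma quadratic_eq_sum_eigenvalues {n : ℕ} {H : Matrix (Fin n) (Fin n) ℝ} (hH : H.IsHermitian)
    (z : EuclideanSpace ℝ (Fin n)) :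
    ∑ i, ∑ j, H i j * z i * z j =
      ∑ i, hH.eigenvalues i * (hH.eigenvectorBasis.repr z i) ^ 2 := by
  have h1 : ∑ i, ∑ j, H i j * z i * z j = inner ℝ z (WithLp.toLp 2 (H.mulVec z.ofLp)) := by
    simp only [PiLp.inner_apply, RCLike.inner_apply, conj_trivial, Matrix.mulVec, dotProduct,
      Finset.sum_mul]
    exact Finset.sum_congr rfl fun i _ => Finset.sum_congr rfl fun j _ => by ring
  have h2 : ∀ i, inner ℝ (hH.eigenvectorBasis i) (WithLp.toLp 2 (H.mulVec z.ofLp)) =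
      hH.eigenvalues i * inner ℝ (hH.eigenvectorBasis i) z := by
    intro i
    have h3 := hH.mulVec_eigenvectorBasis i
    have h4 : ∀ a b : EuclideanSpace ℝ (Fin n), inner ℝ a b = dotProduct b.ofLp a.ofLp := by
      intro a b
      simp [PiLp.inner_apply, dotProduct]
    rw [h4, h4, dotProduct_comm, Matrix.dotProduct_mulVec, ← Matrix.mulVec_transpose]
    have h5 : H.transpose = H := by simpa [Matrix.IsHermitian] using hH
    rw [h5, h3, smul_dotProduct, dotProduct_comm, smul_eq_mul]
  rw [h1, ← hH.eigenvectorBasis.sum_inner_mul_inner]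
  refine Finset.sum_congr rfl fun i _ => ?_
  rw [h2, OrthonormalBasis.repr_apply_apply, real_inner_comm]
  ring

/-- A smooth cutoff on the line. -/
lemma exists_line_cutoff : ∃ χ : ℝ → ℂ, ContDiff ℝ ∞ χ ∧ HasCompactSupport χ ∧
    (∀ x, |x| ≤ 1 → χ x = 1) := by
  let f : ContDiffBump (0 : ℝ) := ⟨1, 2, by norm_num, by norm_num⟩
  refine ⟨fun x => ((f x : ℝ) : ℂ), Complex.ofRealCLM.contDiff.comp f.contDiff,
    f.hasCompactSupport.comp_left (g := ((↑) : ℝ → ℂ)) (by simp), fun x hx => ?_⟩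
  have : f x = 1 := f.one_of_mem_closedBall (by simpa [f, Real.dist_eq] using hx)
  simp [this]

/-- The cutoff is a product in the coordinates of an eigenbasis of H. The integral then factors into
one-dimensional Fresnel integrals, the eigenvalues giving the determinant and their signs the
signature. -/
lemma exists_fresnel_cutoff {n : ℕ} {H : Matrix (Fin n) (Fin n) ℝ} (hH : H.IsHermitian)
    (hdet : H.det ≠ 0) :
    ∃ g : EuclideanSpace ℝ (Fin n) → ℂ, ContDiff ℝ ∞ g ∧ HasCompactSupport g ∧
      (∀ᶠ x in 𝓝 0, g x = 1) ∧
      Tendsto (fun ε : ℝ => ∫ z : EuclideanSpace ℝ (Fin n),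
          Complex.exp (Complex.I * (1 / 2 * ∑ i, ∑ j, H i j * z i * z j : ℝ)) * g (ε • z))
        (𝓝[>] 0)
        (𝓝 ((((2 * Real.pi) ^ ((n : ℝ) / 2) : ℝ) : ℂ)
          * Complex.exp (Complex.I * (Real.pi / 4 * signature H : ℝ))
          * ((Real.sqrt |H.det| : ℝ) : ℂ)⁻¹)) := by
  obtain ⟨χ, hχ, hc, h1⟩ := exists_line_cutoff
  set T := hH.eigenvectorBasis.repr with hT
  set ev := hH.eigenvalues with hev
  have hdet' : H.det = ∏ i, ev i := by simpa using hH.det_eq_prod_eigenvalues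
  have hne : ∀ i, ev i ≠ 0 := by
    intro i h
    exact hdet (by rw [hdet']; exact Finset.prod_eq_zero (Finset.mem_univ i) h)
  have hcoord : ∀ i, Continuous fun z => T z i := fun i =>
    (EuclideanSpace.proj (𝕜 := ℝ) i).continuous.comp T.continuous
  refine ⟨fun z => ∏ i, χ (T z i), ?_, ?_, ?_, ?_⟩
  · refine contDiff_prod fun i _ => hχ.comp ?_
    exact (EuclideanSpace.proj (𝕜 := ℝ) i).contDiff.comp T.toContinuousLinearEquiv.contDiff
  · obtain ⟨r, hr⟩ := hc.isBounded.subset_closedBall 0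
    refine HasCompactSupport.of_support_subset_isCompact
      (K := T.symm '' ((fun w : EuclideanSpace ℝ (Fin n) => w.ofLp) ⁻¹'
        (Set.univ.pi fun _ => Metric.closedBall 0 r))) ?_ ?_
    · refine IsCompact.image ?_ T.symm.continuous
      have := (isCompact_univ_pi (fun _ : Fin n => isCompact_closedBall (0 : ℝ) r))
      exact ((PiLp.homeomorph 2 (fun _ : Fin n => ℝ)).isCompact_preimage).2 this
    · intro z hz
      refine ⟨T z, ?_, by simp⟩
      intro i _
      have : χ (T z i) ≠ 0 := fun h => hz (Finset.prod_eq_zero (Finset.mem_univ i) h)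
      exact hr (subset_tsupport _ this)
  · have : ∀ i, ∀ᶠ z in 𝓝 (0 : EuclideanSpace ℝ (Fin n)), |T z i| ≤ 1 := by
      intro i
      have h2 := ((hcoord i).abs.tendsto 0).eventually_le_const (u := 1) (by simp)
      exact h2
    filter_upwards [eventually_all.2 this] with z hz
    exact Finset.prod_eq_one fun i _ => h1 _ (hz i)
  · have key : ∀ ε : ℝ, ∫ z : EuclideanSpace ℝ (Fin n),
          Complex.exp (Complex.I * (1 / 2 * ∑ i, ∑ j, H i j * z i * z j : ℝ)) *
            ∏ i, χ (T (ε • z) i) =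
        ∏ i, ∫ x : ℝ, Complex.exp (Complex.I * (ev i / 2 * x ^ 2 : ℝ)) * χ (ε * x) := by
      intro ε
      set F : EuclideanSpace ℝ (Fin n) → ℂ := fun w =>
        ∏ i, Complex.exp (Complex.I * (ev i / 2 * w i ^ 2 : ℝ)) * χ (ε * w i) with hF
      have e1 : ∫ z, F (T z) = ∫ w, F w :=
        T.measurePreserving.integral_comp T.toHomeomorph.measurableEmbedding F
      have e2 : ∫ w, F w = ∫ x : Fin n → ℝ, F (WithLp.toLp 2 x) :=
        ((EuclideanSpace.volume_preserving_symm_measurableEquiv_toLp (Fin n)).symm).integral_comp'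
          F |>.symm
      rw [← integral_fintype_prod_volume_eq_prod]
      refine Eq.trans ?_ (e1.trans e2)
      refine integral_congr_ae (ae_of_all _ fun z => ?_)
      simp only [hF, Finset.prod_mul_distrib]
      rw [← Complex.exp_sum, quadratic_eq_sum_eigenvalues hH]
      congr 2
      · rw [← Finset.mul_sum, ← Complex.ofReal_sum]
        congr 2
        rw [Finset.mul_sum]
        exact Finset.sum_congr rfl fun i _ => by simp only [hT, hev]; ring
      · ext i
        simp [T.map_smul]
    simp_rw [key]
    have lim := tendsto_finsetProd Finset.univ fun i (_ : i ∈ Finset.univ) =>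
      tendsto_fresnel_one hχ hc (hne i)
    convert lim using 2
    simp_rw [h1 0 (by simp), mul_one, fun i => fresnelConst_eq (hne i)]
    rw [Finset.prod_mul_distrib, Finset.prod_mul_distrib, ← Complex.exp_sum, Finset.prod_const,
      Finset.card_univ, Fintype.card_fin, Finset.prod_inv_distrib, ← Complex.ofReal_prod,
      mul_right_comm]
    have a1 : (((2 * Real.pi) ^ ((n : ℝ) / 2) : ℝ) : ℂ) =
        (((2 * Real.pi) ^ (1 / 2 : ℝ) : ℝ) : ℂ) ^ n := by
      rw [← Complex.ofReal_pow, ← Real.rpow_natCast, ← Real.rpow_mul (by positivity)]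
      congr 2
      ring
    have a2 : Real.sqrt |H.det| = ∏ i, Real.sqrt |ev i| := by
      rw [hdet', Finset.abs_prod]
      exact Real.sqrt_prod _ (fun i _ => abs_nonneg _)
    have a3 : Complex.I * (Real.pi / 4 * signature H : ℝ) =
        ∑ i, Complex.I * (Real.pi / 4 * (SignType.sign (ev i) : ℝ) : ℝ) := by
      rw [← Finset.mul_sum, ← Complex.ofReal_sum, ← Finset.mul_sum, signature_eq hH]
    rw [a1, a2, a3]

end Fresnel

end GeomOsc
end

noncomputable section

set_option linter.unusedSectionVars false

namespace GeomOsc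

universe u v

/-! ### Functions and vector fields in the preferred charts -/

section Charts

open Set Filter Bundle

variable {n : ℕ} {M : Type u} [TopologicalSpace M] [ChartedSpace (EuclideanSpace ℝ (Fin n)) M]
  [IsManifold (𝓡 n) ∞ M]
variable {F : Type v} [NormedAddCommGroup F] [NormedSpace ℝ F]

local notation "𝔼" => EuclideanSpace ℝ (Fin n)
local notation "φ" => extChartAt (𝓡 n)

/-- Differentiability of a vector field at a point. -/
abbrev VFDiffAt (σ : ∀ x : M, TangentSpace (𝓡 n) x) (x : M) : Prop :=
  MDifferentiableAt (𝓡 n) (𝓡 n).tangent (fun y => (⟨y, σ y⟩ : TangentBundle (𝓡 n) M)) x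

/-- Smoothness of a vector field at a point. -/
abbrev VFSmoothAt (σ : ∀ x : M, TangentSpace (𝓡 n) x) (x : M) : Prop :=
  ContMDiffAt (𝓡 n) (𝓡 n).tangent ∞ (fun y => (⟨y, σ y⟩ : TangentBundle (𝓡 n) M)) x

lemma VFSmoothAt.diffAt {σ : ∀ x : M, TangentSpace (𝓡 n) x} {x : M} (h : VFSmoothAt σ x) :
    VFDiffAt σ x := h.mdifferentiableAt (by simp)

lemma contMDiffAt_chart {x₀ x : M} (hx : x ∈ (φ x₀).source) :
    ContMDiffAt (𝓡 n) 𝓘(ℝ, 𝔼) ∞ (φ x₀) x :=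
  contMDiffAt_extChartAt' (by simpa using hx)

lemma triv_snd {x₀ x : M} (hx : x ∈ (φ x₀).source) (v : TangentSpace (𝓡 n) x) :
    (trivializationAt 𝔼 (TangentSpace (𝓡 n) : M → Type) x₀ (⟨x, v⟩ : TangentBundle (𝓡 n) M)).2 =
      mvfderiv (𝓡 n) (φ x₀) x v := by
  have hx' : x ∈ (chartAt 𝔼 x₀).source := by simpa using hx
  have h := TangentBundle.continuousLinearMapAt_trivializationAt (I := 𝓡 n) hx'
  have h2 := Trivialization.coe_linearMapAt_of_mem (R := ℝ)
    (trivializationAt 𝔼 (TangentSpace (𝓡 n) : M → Type) x₀) (b := x) (by simpa using hx')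
  have h3 := congrFun h2 v
  rw [← h3]
  have h4 := congrArg (fun L => L v) h
  exact h4

lemma triv_symm_chart {x₀ x : M} (hx : x ∈ (φ x₀).source) (v : TangentSpace (𝓡 n) x) :
    (trivializationAt 𝔼 (TangentSpace (𝓡 n) : M → Type) x₀).symm x
      (mvfderiv (𝓡 n) (φ x₀) x v) = v := by
  have hx' : x ∈ (chartAt 𝔼 x₀).source := by simpa using hx
  rw [← triv_snd hx]
  exact Trivialization.symm_apply_apply_mk _ (by simpa using hx') v

lemma chart_triv_symm {x₀ x : M} (hx : x ∈ (φ x₀).source) (w : 𝔼) :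
    mvfderiv (𝓡 n) (φ x₀) x
      ((trivializationAt 𝔼 (TangentSpace (𝓡 n) : M → Type) x₀).symm x w) = w := by
  have hx' : x ∈ (chartAt 𝔼 x₀).source := by simpa using hx
  rw [← triv_snd hx, Trivialization.apply_mk_symm _ (by simpa using hx')]

/-- The tangent space at x is by construction ℝⁿ through the preferred chart at x, so the
differential of this chart at x is the identity. -/
lemma mvfderiv_chart_self (x : M) (v : TangentSpace (𝓡 n) x) :
    mvfderiv (𝓡 n) (φ x) x v = v := by
  have h := triv_snd (mem_extChartAt_source x) v
  rw [← h]
  exact congrArg Prod.snd (TangentBundle.trivializationAt_apply x (⟨x, v⟩ : TangentBundle (𝓡 n) M)) |>.trans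
    (tangentCoordChange_self (I := 𝓡 n) (x := x) (z := x) (v := v) (mem_extChartAt_source x))

/-- The expression of a function in a chart. -/
def inCoord (x₀ : M) (f : M → F) (y : 𝔼) : F := f ((φ x₀).symm y)

lemma inCoord_chart {x₀ x : M} (hx : x ∈ (φ x₀).source) (f : M → F) :
    inCoord x₀ f (φ x₀ x) = f x := by rw [inCoord, (φ x₀).left_inv hx]

lemma source_mem_nhds {x₀ x : M} (hx : x ∈ (φ x₀).source) : (φ x₀).source ∈ 𝓝 x :=
  (isOpen_extChartAt_source x₀).mem_nhds hx

lemma target_mem_nhds {x₀ x : M} (hx : x ∈ (φ x₀).source) : (φ x₀).target ∈ 𝓝 (φ x₀ x) :=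
  (isOpen_extChartAt_target x₀).mem_nhds ((φ x₀).map_source hx)

lemma contMDiffAt_chart_symm {x₀ : M} {y : 𝔼} (hy : y ∈ (φ x₀).target) :
    ContMDiffAt 𝓘(ℝ, 𝔼) (𝓡 n) ∞ (φ x₀).symm y :=
  (contMDiffOn_extChartAt_symm x₀).contMDiffAt ((isOpen_extChartAt_target x₀).mem_nhds hy)

lemma contDiffAt_inCoord {x₀ x : M} (hx : x ∈ (φ x₀).source) {f : M → F}
    (hf : ContMDiffAt (𝓡 n) 𝓘(ℝ, F) ∞ f x) : ContDiffAt ℝ ∞ (inCoord x₀ f) (φ x₀ x) := by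
  rw [← contMDiffAt_iff_contDiffAt]
  refine ContMDiffAt.comp (φ x₀ x) (g := f) (f := (φ x₀).symm) ?_
    (contMDiffAt_chart_symm ((φ x₀).map_source hx))
  rwa [(φ x₀).left_inv hx]

lemma mdiffAt_inCoord {x₀ x : M} (hx : x ∈ (φ x₀).source) {f : M → F}
    (hf : MDifferentiableAt (𝓡 n) 𝓘(ℝ, F) f x) : DifferentiableAt ℝ (inCoord x₀ f) (φ x₀ x) := by
  rw [← mdifferentiableAt_iff_differentiableAt]
  refine MDifferentiableAt.comp (φ x₀ x) (g := f) (f := (φ x₀).symm) ?_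
    ((contMDiffAt_chart_symm ((φ x₀).map_source hx)).mdifferentiableAt (by simp))
  rwa [(φ x₀).left_inv hx]

lemma mvfderiv_comp_fderiv {G : Type*} [NormedAddCommGroup G] [NormedSpace ℝ G] {g : F → G}
    {f : M → F} {x : M} (hg : DifferentiableAt ℝ g (f x))
    (hf : MDifferentiableAt (𝓡 n) 𝓘(ℝ, F) f x) (v : TangentSpace (𝓡 n) x) :
    mvfderiv (𝓡 n) (fun y => g (f y)) x v = fderiv ℝ g (f x) (mvfderiv (𝓡 n) f x v) := by
  have h := mfderiv_comp_apply (I := 𝓡 n) (I' := 𝓘(ℝ, F)) (I'' := 𝓘(ℝ, G)) x (g := g) (f := f)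
    hg.mdifferentiableAt hf v
  rw [mfderiv_eq_fderiv] at h
  exact h

lemma mvfderiv_congr {f g : M → F} {x : M} (h : f =ᶠ[𝓝 x] g) (v : TangentSpace (𝓡 n) x) :
    mvfderiv (𝓡 n) f x v = mvfderiv (𝓡 n) g x v := by
  have h2 : mfderiv (𝓡 n) 𝓘(ℝ, F) f x = mfderiv (𝓡 n) 𝓘(ℝ, F) g x := h.mfderiv_eq
  change mfderiv (𝓡 n) 𝓘(ℝ, F) f x v = mfderiv (𝓡 n) 𝓘(ℝ, F) g x v
  rw [h2]
  rfl

lemma mvfderiv_eq_fderiv_inCoord {x₀ x : M} (hx : x ∈ (φ x₀).source) {f : M → F}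
    (hf : MDifferentiableAt (𝓡 n) 𝓘(ℝ, F) f x) (v : TangentSpace (𝓡 n) x) :
    mvfderiv (𝓡 n) f x v =
      fderiv ℝ (inCoord x₀ f) (φ x₀ x) (mvfderiv (𝓡 n) (φ x₀) x v) := by
  rw [← mvfderiv_comp_fderiv (mdiffAt_inCoord hx hf)
    ((contMDiffAt_chart hx).mdifferentiableAt (by simp))]
  refine mvfderiv_congr ?_ v
  filter_upwards [source_mem_nhds hx] with y hy
  exact (inCoord_chart hy f).symm

lemma contMDiffAt_of_inCoord {x₀ x : M} (hx : x ∈ (φ x₀).source) {f : M → F}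
    (hf : ContDiffAt ℝ ∞ (inCoord x₀ f) (φ x₀ x)) : ContMDiffAt (𝓡 n) 𝓘(ℝ, F) ∞ f x := by
  have h : ContMDiffAt (𝓡 n) 𝓘(ℝ, F) ∞ (fun y => inCoord x₀ f (φ x₀ y)) x :=
    ContMDiffAt.comp x (g := inCoord x₀ f) hf.contMDiffAt (contMDiffAt_chart hx)
  refine h.congr_of_eventuallyEq ?_
  filter_upwards [source_mem_nhds hx] with y hy
  exact (inCoord_chart hy f).symm

lemma vfSmoothAt_iff {σ : ∀ x : M, TangentSpace (𝓡 n) x} {x : M} :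
    VFSmoothAt σ x ↔
      ContMDiffAt (𝓡 n) 𝓘(ℝ, 𝔼) ∞ (fun y => mvfderiv (𝓡 n) (φ x) y (σ y)) x := by
  rw [VFSmoothAt, Bundle.contMDiffAt_section]
  refine Filter.EventuallyEq.contMDiffAt_iff ?_
  filter_upwards [source_mem_nhds (mem_extChartAt_source (I := 𝓡 n) x)] with y hy
  exact triv_snd hy _

lemma vfDiffAt_iff {σ : ∀ x : M, TangentSpace (𝓡 n) x} {x : M} :
    VFDiffAt σ x ↔
      MDifferentiableAt (𝓡 n) 𝓘(ℝ, 𝔼) (fun y => mvfderiv (𝓡 n) (φ x) y (σ y)) x := by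
  rw [VFDiffAt, mdifferentiableAt_section]
  refine Filter.EventuallyEq.mdifferentiableAt_iff ?_
  filter_upwards [source_mem_nhds (mem_extChartAt_source (I := 𝓡 n) x)] with y hy
  exact triv_snd hy _

lemma eventually_mdiff {f : M → F} {x : M} (hf : ContMDiffAt (𝓡 n) 𝓘(ℝ, F) ∞ f x) :
    ∀ᶠ y in 𝓝 x, MDifferentiableAt (𝓡 n) 𝓘(ℝ, F) f y := by
  have h1 : ContMDiffAt (𝓡 n) 𝓘(ℝ, F) 1 f x := hf.of_le (by simp)
  filter_upwards [contMDiffAt_iff_contMDiffAt_nhds (by simp) |>.1 h1] with y hy using hy.mdifferentiableAt (by simp)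

lemma eventually_mvfderiv_eq {f : M → F} {x : M} (hf : ContMDiffAt (𝓡 n) 𝓘(ℝ, F) ∞ f x)
    (σ : ∀ x : M, TangentSpace (𝓡 n) x) :
    (fun y => mvfderiv (𝓡 n) f y (σ y)) =ᶠ[𝓝 x]
      fun y => fderiv ℝ (inCoord x f) (φ x y) (mvfderiv (𝓡 n) (φ x) y (σ y)) := by
  filter_upwards [source_mem_nhds (mem_extChartAt_source (I := 𝓡 n) x), eventually_mdiff hf]
    with y hy hf'
  exact mvfderiv_eq_fderiv_inCoord hy hf' _

lemma contMDiffAt_fderiv_inCoord {f : M → F} {x : M} (hf : ContMDiffAt (𝓡 n) 𝓘(ℝ, F) ∞ f x) :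
    ContMDiffAt (𝓡 n) 𝓘(ℝ, 𝔼 →L[ℝ] F) ∞ (fun y => fderiv ℝ (inCoord x f) (φ x y)) x := by
  have h := (contDiffAt_inCoord (mem_extChartAt_source (I := 𝓡 n) x) hf).fderiv_right (m := ∞) (by simp)
  exact ContMDiffAt.comp x (g := fderiv ℝ (inCoord x f)) h.contMDiffAt
    (contMDiffAt_chart (mem_extChartAt_source x))

/-- The derivative of a smooth function along a smooth vector field is smooth. -/
lemma contMDiffAt_mvfderiv {f : M → F} {x : M} (hf : ContMDiffAt (𝓡 n) 𝓘(ℝ, F) ∞ f x)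
    {σ : ∀ x : M, TangentSpace (𝓡 n) x} (hσ : VFSmoothAt σ x) :
    ContMDiffAt (𝓡 n) 𝓘(ℝ, F) ∞ (fun y => mvfderiv (𝓡 n) f y (σ y)) x :=
  ((contMDiffAt_fderiv_inCoord hf).clm_apply (vfSmoothAt_iff.1 hσ)).congr_of_eventuallyEq
    (eventually_mvfderiv_eq hf σ)

lemma mdiffAt_mvfderiv {f : M → F} {x : M} (hf : ContMDiffAt (𝓡 n) 𝓘(ℝ, F) ∞ f x)
    {σ : ∀ x : M, TangentSpace (𝓡 n) x} (hσ : VFDiffAt σ x) :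
    MDifferentiableAt (𝓡 n) 𝓘(ℝ, F) (fun y => mvfderiv (𝓡 n) f y (σ y)) x :=
  (((contMDiffAt_fderiv_inCoord hf).mdifferentiableAt (by simp)).clm_apply
    (vfDiffAt_iff.1 hσ)).congr_of_eventuallyEq (eventually_mvfderiv_eq hf σ)

end Charts

/-! ### Coordinate systems and coordinate fields -/

section Coordinates

open Set Filter Bundle

variable {n : ℕ} {M : Type u} [TopologicalSpace M] [ChartedSpace (EuclideanSpace ℝ (Fin n)) M]
  [IsManifold (𝓡 n) ∞ M]
variable {F : Type v} [NormedAddCommGroup F] [NormedSpace ℝ F]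

local notation "𝔼" => EuclideanSpace ℝ (Fin n)
local notation "φ" => extChartAt (𝓡 n)

/-- `Θ` is a system of (possibly non-injective) smooth coordinates on the open set `U`. -/
structure IsCoord (Θ : M → EuclideanSpace ℝ (Fin n)) (U : Set M) : Prop where
  isOpen : IsOpen U
  smooth : ∀ q ∈ U, ContMDiffAt (𝓡 n) 𝓘(ℝ, EuclideanSpace ℝ (Fin n)) ∞ Θ q
  injective : ∀ q ∈ U, Function.Injective (mvfderiv (𝓡 n) Θ q)

/-- The coordinate vector fields of `Θ`. -/
def frame (Θ : M → EuclideanSpace ℝ (Fin n)) (v : EuclideanSpace ℝ (Fin n)) (q : M) :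
    TangentSpace (𝓡 n) q :=
  (mvfderiv (𝓡 n) Θ q).inverse v

variable {Θ : M → EuclideanSpace ℝ (Fin n)} {U : Set M}

lemma IsCoord.isInvertible (h : IsCoord Θ U) {q : M} (hq : q ∈ U) :
    (mvfderiv (𝓡 n) Θ q).IsInvertible := by
  let L : 𝔼 →L[ℝ] 𝔼 := mvfderiv (𝓡 n) Θ q
  have hi : Function.Injective L := h.injective q hq
  exact ⟨(LinearEquiv.ofInjectiveEndo L.toLinearMap hi).toContinuousLinearEquiv, by ext; rfl⟩

lemma IsCoord.apply_frame (h : IsCoord Θ U) {q : M} (hq : q ∈ U) (v : 𝔼) :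
    mvfderiv (𝓡 n) Θ q (frame Θ v q) = v :=
  congrArg (fun L => L v) (h.isInvertible hq).self_comp_inverse

lemma IsCoord.frame_apply (h : IsCoord Θ U) {q : M} (hq : q ∈ U) (w : TangentSpace (𝓡 n) q) :
    frame Θ (mvfderiv (𝓡 n) Θ q w) q = w :=
  congrArg (fun L => L w) (h.isInvertible hq).inverse_comp_self

lemma frame_add (v w : 𝔼) (q : M) : frame Θ (v + w) q = frame Θ v q + frame Θ w q :=
  map_add _ v w

lemma frame_smul (c : ℝ) (v : 𝔼) (q : M) : frame Θ (c • v) q = c • frame Θ v q :=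
  map_smul _ c v

lemma sum_single_smul (v : 𝔼) : v = ∑ i, v i • EuclideanSpace.single i (1 : ℝ) := by
  have := (EuclideanSpace.basisFun (Fin n) ℝ).sum_repr v
  simpa using this.symm

lemma frame_eq_sum (v : 𝔼) (q : M) :
    frame Θ v q = ∑ i, v i • frame Θ (EuclideanSpace.single i 1) q := by
  conv_lhs => rw [sum_single_smul v]
  simp [frame, map_sum]

/-- A vector field is smooth if its components in smooth coordinates are smooth. -/
lemma IsCoord.vfSmoothAt (h : IsCoord Θ U) {q : M} (hq : q ∈ U)
    {σ : ∀ x : M, TangentSpace (𝓡 n) x}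
    (hσ : ContMDiffAt (𝓡 n) 𝓘(ℝ, 𝔼) ∞ (fun y => mvfderiv (𝓡 n) Θ y (σ y)) q) :
    VFSmoothAt σ q := by
  rw [vfSmoothAt_iff]
  have hs := mem_extChartAt_source (I := 𝓡 n) q
  have hA := contMDiffAt_fderiv_inCoord (h.smooth q hq)
  have hinv : (fderiv ℝ (inCoord q Θ) (φ q q)).IsInvertible := by
    have hi : Function.Injective (fderiv ℝ (inCoord q Θ) (φ q q)) := by
      intro a b hab
      have := mvfderiv_eq_fderiv_inCoord hs ((h.smooth q hq).mdifferentiableAt (by simp))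
      rw [← chart_triv_symm hs a, ← chart_triv_symm hs b, ← this, ← this] at hab
      rw [← chart_triv_symm hs a, h.injective q hq hab, chart_triv_symm hs b]
    exact ⟨(LinearEquiv.ofInjectiveEndo _ hi).toContinuousLinearEquiv, by ext; rfl⟩
  obtain ⟨e, he⟩ := hinv
  have hI : ContMDiffAt (𝓡 n) 𝓘(ℝ, 𝔼 →L[ℝ] 𝔼) ∞
      (fun y => (fderiv ℝ (inCoord q Θ) (φ q y)).inverse) q := by
    refine ContMDiffAt.comp (I' := 𝓘(ℝ, 𝔼 →L[ℝ] 𝔼)) q (g := ContinuousLinearMap.inverse) (f := fun y => fderiv ℝ (inCoord q Θ) (φ q y)) ?_ hA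
    rw [← he]
    exact (contDiffAt_map_inverse e).contMDiffAt
  refine (hI.clm_apply hσ).congr_of_eventuallyEq ?_
  have hev : ∀ᶠ y in 𝓝 q, (fderiv ℝ (inCoord q Θ) (φ q y)).IsInvertible := by
    have hc := hA.continuousAt
    have : ∀ᶠ L in 𝓝 (fderiv ℝ (inCoord q Θ) (φ q q)), L.IsInvertible := by
      rw [← he]
      exact (ContinuousLinearEquiv.nhds e)
    exact hc.eventually this
  filter_upwards [source_mem_nhds hs, eventually_mdiff (h.smooth q hq), hev] with y hy hd hi
  rw [mvfderiv_eq_fderiv_inCoord hy hd (σ y)]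
  exact (congrArg (fun L => L (mvfderiv (𝓡 n) (φ q) y (σ y))) hi.inverse_comp_self).symm

lemma IsCoord.vfSmoothAt_frame (h : IsCoord Θ U) {q : M} (hq : q ∈ U) (v : 𝔼) :
    VFSmoothAt (frame Θ v) q := by
  refine h.vfSmoothAt hq (contMDiffAt_const.congr_of_eventuallyEq (f := fun _ => v) ?_)
  filter_upwards [h.isOpen.mem_nhds hq] with y hy
  exact h.apply_frame hy v

/-- The preferred charts are coordinates. -/
lemma isCoord_chart (x₀ : M) : IsCoord (φ x₀) (φ x₀).source where
  isOpen := isOpen_extChartAt_source x₀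
  smooth _ hq := contMDiffAt_chart hq
  injective q hq v w hvw := by
    rw [← triv_symm_chart hq v, ← triv_symm_chart hq w, hvw]

lemma frame_chart {x₀ x : M} (hx : x ∈ (φ x₀).source) (w : 𝔼) :
    frame (φ x₀) w x = (trivializationAt 𝔼 (TangentSpace (𝓡 n) : M → Type) x₀).symm x w :=
  (isCoord_chart x₀).injective x hx (by
    rw [(isCoord_chart x₀).apply_frame hx, chart_triv_symm hx])

lemma frame_chart_self (x : M) (w : 𝔼) : frame (φ x) w x = w := by
  have h := (isCoord_chart x).apply_frame (mem_extChartAt_source x) w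
  rwa [mvfderiv_chart_self] at h

/-- Near x the extension used in the definition of the Hessian is a coordinate field of the
preferred chart, so that it can be treated like the other frames. -/
lemma extend_eventuallyEq (x : M) (X : TangentSpace (𝓡 n) x) :
    ∀ᶠ y in 𝓝 x, FiberBundle.extend 𝔼 X y = frame (φ x) X y := by
  filter_upwards [source_mem_nhds (mem_extChartAt_source (I := 𝓡 n) x)] with y hy
  refine Eq.trans ?_ (frame_chart hy X).symm
  have h := triv_snd (mem_extChartAt_source x) X
  rw [mvfderiv_chart_self] at h
  exact congrArg (fun w : 𝔼 =>
    (trivializationAt 𝔼 (TangentSpace (𝓡 n) : M → Type) x).symm y w) h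

lemma vfSmoothAt_congr {σ τ : ∀ x : M, TangentSpace (𝓡 n) x} {x : M} (hσ : VFSmoothAt σ x)
    (h : ∀ᶠ y in 𝓝 x, τ y = σ y) : VFSmoothAt τ x := by
  refine hσ.congr_of_eventuallyEq ?_
  filter_upwards [h] with y hy
  rw [hy]

lemma vfSmoothAt_extend (x : M) (X : TangentSpace (𝓡 n) x) :
    VFSmoothAt (FiberBundle.extend 𝔼 X) x :=
  vfSmoothAt_congr ((isCoord_chart x).vfSmoothAt_frame (mem_extChartAt_source x) X)
    (extend_eventuallyEq x X)

end Coordinates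

end GeomOsc
end

noncomputable section

set_option linter.unusedSectionVars false

namespace GeomOsc

universe u v

/-! ### The Hessian and the Christoffel symbols in coordinates -/

section Connections

open Set Filter Bundle

variable {n : ℕ} {M : Type u} [TopologicalSpace M] [ChartedSpace (EuclideanSpace ℝ (Fin n)) M]
  [IsManifold (𝓡 n) ∞ M]
variable {F : Type v} [NormedAddCommGroup F] [NormedSpace ℝ F]

local notation "𝔼" => EuclideanSpace ℝ (Fin n)
local notation "φ" => extChartAt (𝓡 n)

variable {cov : Connection n M} {Θ : M → EuclideanSpace ℝ (Fin n)} {U : Set M}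

lemma cov_add {σ τ : ∀ x : M, TangentSpace (𝓡 n) x} {x : M} (hσ : VFDiffAt σ x)
    (hτ : VFDiffAt τ x) : cov (σ + τ) x = cov σ x + cov τ x :=
  cov.isCovariantDerivativeOnUniv.add hσ hτ

lemma cov_leibniz {σ : ∀ x : M, TangentSpace (𝓡 n) x} {g : M → ℝ} {x : M} (hσ : VFDiffAt σ x)
    (hg : MDifferentiableAt (𝓡 n) 𝓘(ℝ, ℝ) g x) :
    cov (g • σ) x = g x • cov σ x + (mvfderiv (𝓡 n) g x).smulRight (σ x) :=
  cov.isCovariantDerivativeOnUniv.leibniz hσ hg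

lemma cov_congr {σ τ : ∀ x : M, TangentSpace (𝓡 n) x} {x : M} (hσ : VFDiffAt σ x)
    (hτ : VFDiffAt τ x) (h : ∀ᶠ y in 𝓝 x, σ y = τ y) : cov σ x = cov τ x :=
  cov.isCovariantDerivativeOnUniv.congr_of_eventuallyEq hσ hτ univ_mem h

/-- The two derivative terms that the Leibniz rules produce for gσ cancel. This is why the Hessian
may be computed with any differentiable extension of the vector. -/
lemma hess_tensorial {f : M → F} {x : M} (hf : ContMDiffAt (𝓡 n) 𝓘(ℝ, F) ∞ f x)
    (Y : TangentSpace (𝓡 n) x) :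
    TensorialAt (𝓡 n) 𝔼 (fun σ : ∀ x : M, TangentSpace (𝓡 n) x =>
      mvfderiv (𝓡 n) (fun y => mvfderiv (𝓡 n) f y (σ y)) x Y
        - mvfderiv (𝓡 n) f x (cov σ x Y)) x where
  smul {g σ} hg hσ := by
    have h1 : (fun y => mvfderiv (𝓡 n) f y ((g • σ) y)) =
        fun y => g y • mvfderiv (𝓡 n) f y (σ y) := by
      ext y
      exact (mvfderiv (𝓡 n) f y).map_smul (g y) (σ y)
    rw [h1, mvfderiv_fun_smul hg (mdiffAt_mvfderiv hf hσ), cov_leibniz hσ hg]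
    simp only [add_apply, smul_apply, ContinuousLinearMap.smulRight_apply, map_add, map_smul,
      smul_sub]
    abel
  add {σ τ} hσ hτ := by
    have h1 : (fun y => mvfderiv (𝓡 n) f y ((σ + τ) y)) =
        fun y => mvfderiv (𝓡 n) f y (σ y) + mvfderiv (𝓡 n) f y (τ y) := by
      ext y
      exact map_add _ _ _
    rw [h1, mvfderiv_fun_add (mdiffAt_mvfderiv hf hσ) (mdiffAt_mvfderiv hf hτ), cov_add hσ hτ]
    simp only [add_apply, map_add]
    abel

lemma hess_eq {f : M → F} {x : M} (hf : ContMDiffAt (𝓡 n) 𝓘(ℝ, F) ∞ f x)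
    {σ : ∀ x : M, TangentSpace (𝓡 n) x} (hσ : VFDiffAt σ x) (Y : TangentSpace (𝓡 n) x) :
    hess cov f x (σ x) Y = mvfderiv (𝓡 n) (fun y => mvfderiv (𝓡 n) f y (σ y)) x Y
        - mvfderiv (𝓡 n) f x (cov σ x Y) :=
  (hess_tensorial (cov := cov) hf Y).pointwise (vfSmoothAt_extend x (σ x)).diffAt hσ (by simp)

lemma hess_add_right {f : M → F} {x : M} (X Y Z : TangentSpace (𝓡 n) x) :
    hess cov f x X (Y + Z) = hess cov f x X Y + hess cov f x X Z := by
  simp only [hess, map_add]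
  abel

lemma hess_smul_right {f : M → F} {x : M} (c : ℝ) (X Y : TangentSpace (𝓡 n) x) :
    hess cov f x X (c • Y) = c • hess cov f x X Y := by
  simp only [hess, map_smul, smul_sub]

lemma hess_add_left {f : M → F} {x : M} (hf : ContMDiffAt (𝓡 n) 𝓘(ℝ, F) ∞ f x)
    (X Y Z : TangentSpace (𝓡 n) x) :
    hess cov f x (X + Y) Z = hess cov f x X Z + hess cov f x Y Z := by
  have hX := (vfSmoothAt_extend x X).diffAt
  have hY := (vfSmoothAt_extend x Y).diffAt
  have h := (hess_tensorial (cov := cov) hf Z).add hX hY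
  have hXY : VFDiffAt (FiberBundle.extend 𝔼 X + FiberBundle.extend 𝔼 Y) x :=
    mdifferentiableAt_add_section hX hY
  rw [← hess_eq hf hX, ← hess_eq hf hY, ← hess_eq hf hXY] at h
  simpa using h

lemma hess_smul_left {f : M → F} {x : M} (hf : ContMDiffAt (𝓡 n) 𝓘(ℝ, F) ∞ f x)
    (c : ℝ) (X Z : TangentSpace (𝓡 n) x) :
    hess cov f x (c • X) Z = c • hess cov f x X Z := by
  have hX := (vfSmoothAt_extend x X).diffAt
  have h := (hess_tensorial (cov := cov) hf Z).smul (f := fun _ => c) mdifferentiableAt_const hX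
  have hXY : VFDiffAt ((fun _ : M => c) • FiberBundle.extend 𝔼 X) x :=
    mdifferentiableAt_const.smul_section hX
  rw [← hess_eq hf hX, ← hess_eq hf hXY] at h
  simpa using h

/-- The covariant derivative in coordinates. -/
lemma IsCoord.cov_eq (h : IsCoord Θ U) {x : M} (hx : x ∈ U) {σ : ∀ x : M, TangentSpace (𝓡 n) x}
    (hσ : VFDiffAt σ x) (Y : TangentSpace (𝓡 n) x) :
    cov σ x Y = frame Θ (mvfderiv (𝓡 n) (fun y => mvfderiv (𝓡 n) Θ y (σ y)) x Y) x
      + cov (frame Θ (mvfderiv (𝓡 n) Θ x (σ x))) x Y := by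
  -- The covariant derivative minus the derivative of the components is tensorial in σ, hence may be
  -- evaluated on the field with constant components.
  have ht : TensorialAt (𝓡 n) 𝔼 (fun σ : ∀ x : M, TangentSpace (𝓡 n) x => cov σ x Y -
      frame Θ (mvfderiv (𝓡 n) (fun y => mvfderiv (𝓡 n) Θ y (σ y)) x Y) x) x :=
    { smul := by
        intro g σ hg hσ
        have h1 : (fun y => mvfderiv (𝓡 n) Θ y ((g • σ) y)) =
            fun y => g y • mvfderiv (𝓡 n) Θ y (σ y) := by
          ext1 y
          exact (mvfderiv (𝓡 n) Θ y).map_smul (g y) (σ y)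
        rw [h1, mvfderiv_fun_smul hg (mdiffAt_mvfderiv (h.smooth x hx) hσ), cov_leibniz hσ hg]
        simp only [add_apply, smul_apply, ContinuousLinearMap.smulRight_apply, frame_add,
          frame_smul, h.frame_apply hx, smul_sub]
        abel
      add := by
        intro σ τ hσ hτ
        have h1 : (fun y => mvfderiv (𝓡 n) Θ y ((σ + τ) y)) =
            fun y => mvfderiv (𝓡 n) Θ y (σ y) + mvfderiv (𝓡 n) Θ y (τ y) := by
          ext1 y
          exact map_add _ _ _
        rw [h1, mvfderiv_fun_add (mdiffAt_mvfderiv (h.smooth x hx) hσ)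
          (mdiffAt_mvfderiv (h.smooth x hx) hτ), cov_add hσ hτ]
        simp only [add_apply, frame_add]
        abel }
  have h2 := ht.pointwise hσ (h.vfSmoothAt_frame hx (mvfderiv (𝓡 n) Θ x (σ x))).diffAt
    (h.frame_apply hx (σ x)).symm
  have h3 : mvfderiv (𝓡 n) (fun y => mvfderiv (𝓡 n) Θ y
      (frame Θ (mvfderiv (𝓡 n) Θ x (σ x)) y)) x Y = 0 := by
    rw [mvfderiv_congr (g := fun _ => mvfderiv (𝓡 n) Θ x (σ x)), mvfderiv_const]
    · rfl
    · filter_upwards [h.isOpen.mem_nhds hx] with y hy using h.apply_frame hy _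
  simp only [h3] at h2
  have h4 : frame Θ 0 x = 0 := map_zero _
  rw [h4, sub_zero] at h2
  rw [← h2]
  abel

lemma hess_eq_frame (h : IsCoord Θ U) {f : M → F} {x : M} (hx : x ∈ U)
    (hf : ContMDiffAt (𝓡 n) 𝓘(ℝ, F) ∞ f x) (v : 𝔼) (Y : TangentSpace (𝓡 n) x) :
    hess cov f x (frame Θ v x) Y =
      mvfderiv (𝓡 n) (fun y => mvfderiv (𝓡 n) f y (frame Θ v y)) x Y
        - mvfderiv (𝓡 n) f x (cov (frame Θ v) x Y) :=
  hess_eq hf (h.vfSmoothAt_frame hx v).diffAt Y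

/-- The iterated derivative along constant fields in a preferred chart. -/
lemma mvfderiv_mvfderiv_frame_chart {f : M → F} {x : M}
    (hf : ContMDiffAt (𝓡 n) 𝓘(ℝ, F) ∞ f x) (v w : 𝔼) :
    mvfderiv (𝓡 n) (fun y => mvfderiv (𝓡 n) f y (frame (φ x) v y)) x (frame (φ x) w x) =
      fderiv ℝ (fderiv ℝ (inCoord x f)) (φ x x) w v := by
  have hs := mem_extChartAt_source (I := 𝓡 n) x
  have h1 : (fun y => mvfderiv (𝓡 n) f y (frame (φ x) v y)) =ᶠ[𝓝 x]
      fun y => (fun z => fderiv ℝ (inCoord x f) z v) (φ x y) := by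
    filter_upwards [eventually_mvfderiv_eq hf (frame (φ x) v), source_mem_nhds hs] with y hy hy'
    rw [hy, (isCoord_chart x).apply_frame hy']
  have hd : DifferentiableAt ℝ (fderiv ℝ (inCoord x f)) (φ x x) :=
    ((contDiffAt_inCoord hs hf).fderiv_right (m := ∞) (by simp)).differentiableAt (by simp)
  rw [mvfderiv_congr h1, mvfderiv_comp_fderiv (g := fun z => fderiv ℝ (inCoord x f) z v)
    (f := φ x) (hd.clm_apply (differentiableAt_const _))
    ((contMDiffAt_chart hs).mdifferentiableAt (by simp)),
    (isCoord_chart x).apply_frame hs, fderiv_clm_apply hd (differentiableAt_const _)]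
  simp

lemma two_le_infty : (2 : WithTop ℕ∞) ≤ ∞ := WithTop.coe_le_coe.2 (le_top (a := (2 : ℕ∞)))

/-- Coordinate fields are pullbacks of constant fields, and pullback commutes with the bracket. -/
lemma mlieBracket_frame (h : IsCoord Θ U) {x : M} (hx : x ∈ U) (v w : 𝔼) :
    VectorField.mlieBracket (𝓡 n) (frame Θ v) (frame Θ w) x = 0 := by
  have hm : IsManifold (𝓡 n) (minSmoothness ℝ 2) M :=
    IsManifold.of_le (n := ∞) (by rw [minSmoothness_of_isRCLikeNormedField]; exact two_le_infty)
  let V : 𝔼 → ∀ y : 𝔼, TangentSpace 𝓘(ℝ, 𝔼) y := fun v _ => v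
  have hV : ∀ v y, MDifferentiableAt 𝓘(ℝ, 𝔼) 𝓘(ℝ, 𝔼).tangent
      (fun y => (⟨y, V v y⟩ : TangentBundle 𝓘(ℝ, 𝔼) 𝔼)) y := by
    intro v y
    have : ContMDiffAt 𝓘(ℝ, 𝔼) 𝓘(ℝ, 𝔼).tangent ∞
      (fun y => (⟨y, V v y⟩ : TangentBundle 𝓘(ℝ, 𝔼) 𝔼)) y :=
      contMDiffAt_vectorSpace_iff_contDiffAt.2 contDiffAt_const
    exact this.mdifferentiableAt (by simp)
  have h1 := VectorField.mpullback_mlieBracket (hV v (Θ x)) (hV w (Θ x)) (h.smooth x hx)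
    (by rw [minSmoothness_of_isRCLikeNormedField]; exact two_le_infty)
  have h2 : VectorField.mlieBracket 𝓘(ℝ, 𝔼) (V v) (V w) (Θ x) = 0 := by
    have h3 := congrFun (VectorField.mlieBracketWithin_eq_lieBracketWithin (𝕜 := ℝ)
      (V := V v) (W := V w) (s := univ)) (Θ x)
    rw [VectorField.mlieBracketWithin_univ] at h3
    rw [h3]
    have e1 : (V v : 𝔼 → 𝔼) = fun _ => v := rfl
    have e2 : (V w : 𝔼 → 𝔼) = fun _ => w := rfl
    simp [VectorField.lieBracketWithin, e1, e2]
    rfl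
  rw [VectorField.mpullback_apply, h2] at h1
  refine Eq.trans h1.symm ?_
  exact map_zero _

/-- Coordinate fields commute, so vanishing torsion makes the connection term symmetric; the other
term is an ordinary second derivative in the chart. -/
lemma hess_symm {cov : Connection n M} (htor : cov.torsion = 0) {f : M → F} {x : M}
    (hf : ContMDiffAt (𝓡 n) 𝓘(ℝ, F) ∞ f x) (X Y : TangentSpace (𝓡 n) x) :
    hess cov f x X Y = hess cov f x Y X := by
  have hs := mem_extChartAt_source (I := 𝓡 n) x
  have hc := isCoord_chart (n := n) x
  have hX := (hc.vfSmoothAt_frame hs X).diffAt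
  have hY := (hc.vfSmoothAt_frame hs Y).diffAt
  have h1 : cov (frame (φ x) Y) x (frame (φ x) X x) = cov (frame (φ x) X) x (frame (φ x) Y x) :=
    sub_eq_zero.1 (((CovariantDerivative.torsion_eq_zero_iff cov).1 htor hX hY).trans
      (mlieBracket_frame hc hs X Y))
  have eX : frame (φ x) X x = X := frame_chart_self x X
  have eY : frame (φ x) Y x = Y := frame_chart_self x Y
  have h2 := hess_eq_frame (cov := cov) hc hs hf X Y
  have h3 := hess_eq_frame (cov := cov) hc hs hf Y X
  rw [eX] at h2
  rw [eY] at h3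
  rw [eX, eY] at h1
  rw [h2, h3, h1]
  congr 1
  have h4 := mvfderiv_mvfderiv_frame_chart hf X Y
  have h5 := mvfderiv_mvfderiv_frame_chart hf Y X
  rw [eX] at h5
  rw [eY] at h4
  rw [h4, h5]
  have : IsSymmSndFDerivAt ℝ (inCoord x f) (φ x x) :=
    (contDiffAt_inCoord hs hf).isSymmSndFDerivAt
      (by rw [minSmoothness_of_isRCLikeNormedField]; exact two_le_infty)
  exact this Y X

/-- The Hessian of a composition. -/
lemma hess_comp {G : Type*} [NormedAddCommGroup G] [NormedSpace ℝ G] {f : M → ℝ} {x : M}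
    (hf : ContMDiffAt (𝓡 n) 𝓘(ℝ, ℝ) ∞ f x) {g g' g'' : ℝ → G} (hg : ∀ s, HasDerivAt g (g' s) s)
    (hg' : ∀ s, HasDerivAt g' (g'' s) s) (X Y : TangentSpace (𝓡 n) x) :
    hess cov (fun y => g (f y)) x X Y =
      (mvfderiv (𝓡 n) f x X * mvfderiv (𝓡 n) f x Y) • g'' (f x) + hess cov f x X Y • g' (f x) := by
  have hd : ∀ y, MDifferentiableAt (𝓡 n) 𝓘(ℝ, ℝ) f y → ∀ Z : TangentSpace (𝓡 n) y,
      mvfderiv (𝓡 n) (fun y => g (f y)) y Z = mvfderiv (𝓡 n) f y Z • g' (f y) := by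
    intro y hy Z
    rw [mvfderiv_comp_fderiv (hg _).differentiableAt hy, ← (hg (f y)).hasFDerivAt.fderiv.symm]
    simp
  have hd' : ∀ Z : TangentSpace (𝓡 n) x,
      mvfderiv (𝓡 n) (fun y => g' (f y)) x Z = mvfderiv (𝓡 n) f x Z • g'' (f x) := by
    intro Z
    rw [mvfderiv_comp_fderiv (hg' _).differentiableAt (hf.mdifferentiableAt (by simp)),
      (hg' (f x)).hasFDerivAt.fderiv]
    simp
  have hfd := hf.mdifferentiableAt (n := ∞) (by simp)
  have hX := (vfSmoothAt_extend x X).diffAt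
  have h1 : (fun y => mvfderiv (𝓡 n) (fun y => g (f y)) y (FiberBundle.extend 𝔼 X y)) =ᶠ[𝓝 x]
      fun y => mvfderiv (𝓡 n) f y (FiberBundle.extend 𝔼 X y) • g' (f y) := by
    filter_upwards [eventually_mdiff hf] with y hy using hd y hy _
  have hg'd : MDifferentiableAt (𝓡 n) 𝓘(ℝ, G) (fun y => g' (f y)) x :=
    MDifferentiableAt.comp x (g := g') (f := f) (hg' _).differentiableAt.mdifferentiableAt hfd
  rw [hess, mvfderiv_congr h1, hd x hfd, mvfderiv_fun_smul (mdiffAt_mvfderiv hf hX) hg'd, hess]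
  simp only [add_apply, smul_apply, ContinuousLinearMap.smulRight_apply, hd',
    FiberBundle.extend_apply_self, sub_smul, smul_smul]
  abel

/-- The components of the covariant derivative of coordinate fields. -/
def christoffel (cov : Connection n M) (Θ : M → EuclideanSpace ℝ (Fin n))
    (v w : EuclideanSpace ℝ (Fin n)) (q : M) : EuclideanSpace ℝ (Fin n) :=
  mvfderiv (𝓡 n) Θ q (cov (frame Θ w) q (frame Θ v q))

/-- Smoothness of the connection is applied to a field that is smooth on all of M. The coordinate
field is therefore cut off by a bump function, which does not change its covariant derivative near
q. -/
lemma vfSmoothAt_cov [T2Space M] (hcov : cov.ContMDiffCovariantDerivative ∞) (h : IsCoord Θ U)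
    {q : M} (hq : q ∈ U) (v w : 𝔼) :
    VFSmoothAt (fun y => cov (frame Θ w) y (frame Θ v y)) q := by
  obtain ⟨f, -, hf⟩ := (SmoothBumpFunction.nhds_basis_tsupport (I := 𝓡 n) q).mem_iff.1
    (h.isOpen.mem_nhds hq)
  set σ : ∀ x : M, TangentSpace (𝓡 n) x := fun x => f x • frame Θ w x with hσ
  have hs : ContMDiff (𝓡 n) (𝓡 n).tangent ∞ (fun y => (⟨y, σ y⟩ : TangentBundle (𝓡 n) M)) := by
    intro x
    by_cases hx : x ∈ U
    · exact (f.contMDiff x).smul_section (h.vfSmoothAt_frame hx w)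
    · have hx' : x ∉ tsupport f := fun hx' => hx (hf hx')
      have hz : VFSmoothAt (fun y : M => (0 : TangentSpace (𝓡 n) y)) x :=
        (contMDiff_zeroSection ℝ (TangentSpace (𝓡 n) : M → Type)).contMDiffAt
      refine vfSmoothAt_congr hz ?_
      filter_upwards [(isClosed_tsupport f).isOpen_compl.mem_nhds hx'] with y hy
      simp [hσ, image_eq_zero_of_notMem_tsupport hy]
  have h1 := hcov.contMDiff.contMDiff (σ := σ) hs.contMDiffOn
  have h2 := (h1 q (mem_univ q)).contMDiffAt univ_mem
  have h3 : VFSmoothAt (fun y => cov σ y (frame Θ v y)) q :=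
    ContMDiffAt.clm_bundle_apply (E₁ := (TangentSpace (𝓡 n) : M → Type))
      (E₂ := (TangentSpace (𝓡 n) : M → Type)) (b := fun y => y) h2 (h.vfSmoothAt_frame hq v)
  refine vfSmoothAt_congr h3 ?_
  filter_upwards [h.isOpen.mem_nhds hq, eventually_eventually_nhds.2 f.eventuallyEq_one]
    with y hy hy1
  rw [cov_congr (h.vfSmoothAt_frame hy w).diffAt (VFSmoothAt.diffAt (σ := σ) (hs y))]
  filter_upwards [hy1] with z hz
  simp [hσ, hz]

lemma contMDiffAt_christoffel [T2Space M] (hcov : cov.ContMDiffCovariantDerivative ∞)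
    (h : IsCoord Θ U) {q : M} (hq : q ∈ U) (v w : 𝔼) :
    ContMDiffAt (𝓡 n) 𝓘(ℝ, 𝔼) ∞ (christoffel cov Θ v w) q :=
  contMDiffAt_mvfderiv (h.smooth q hq) (vfSmoothAt_cov hcov h hq v w)

lemma cov_frame_add (h : IsCoord Θ U) {q : M} (hq : q ∈ U) (v w : 𝔼) :
    cov (frame Θ (v + w)) q = cov (frame Θ v) q + cov (frame Θ w) q := by
  have : frame Θ (v + w) = frame (M := M) Θ v + frame Θ w := by
    ext1 y; exact frame_add v w y
  rw [this, cov_add (h.vfSmoothAt_frame hq v).diffAt (h.vfSmoothAt_frame hq w).diffAt]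

lemma cov_frame_smul (h : IsCoord Θ U) {q : M} (hq : q ∈ U) (c : ℝ) (v : 𝔼) :
    cov (frame Θ (c • v)) q = c • cov (frame Θ v) q := by
  have : frame Θ (c • v) = c • frame (M := M) Θ v := by
    ext1 y; exact frame_smul c v y
  rw [this]
  exact cov.isCovariantDerivativeOnUniv.smul_const c (h.vfSmoothAt_frame hq v).diffAt

/-- The Christoffel symbols as a continuous linear map in the second argument. -/
def christoffelMap (cov : Connection n M) (Θ : M → EuclideanSpace ℝ (Fin n))
    (v : EuclideanSpace ℝ (Fin n)) (q : M) :
    EuclideanSpace ℝ (Fin n) →L[ℝ] EuclideanSpace ℝ (Fin n) :=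
  ∑ i, ∑ j, v i • (EuclideanSpace.proj (𝕜 := ℝ) j).smulRight
    (christoffel cov Θ (EuclideanSpace.single i 1) (EuclideanSpace.single j 1) q)

lemma cov_frame_eq_sum (h : IsCoord Θ U) {q : M} (hq : q ∈ U) (w : 𝔼) :
    cov (frame Θ w) q = ∑ j, w j • cov (frame Θ (EuclideanSpace.single j 1)) q := by
  let L : 𝔼 →ₗ[ℝ] (TangentSpace (𝓡 n) q →L[ℝ] TangentSpace (𝓡 n) q) :=
    { toFun := fun w => cov (frame Θ w) q
      map_add' := cov_frame_add h hq
      map_smul' := cov_frame_smul h hq }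
  change L w = ∑ j, w j • L (EuclideanSpace.single j 1)
  conv_lhs => rw [sum_single_smul w]
  simp only [map_sum, map_smul]

lemma christoffelMap_apply (h : IsCoord Θ U) {q : M} (hq : q ∈ U) (v w : 𝔼) :
    christoffelMap cov Θ v q w = christoffel cov Θ v w q := by
  rw [christoffel, cov_frame_eq_sum h hq w, frame_eq_sum v]
  simp only [map_sum, map_smul, sum_apply, smul_apply, christoffelMap,
    ContinuousLinearMap.smulRight_apply, PiLp.proj_apply, Finset.smul_sum, christoffel]

lemma cov_frame_frame (h : IsCoord Θ U) {q : M} (hq : q ∈ U) (v w : 𝔼) :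
    cov (frame Θ w) q (frame Θ v q) = frame Θ (christoffelMap cov Θ v q w) q := by
  rw [christoffelMap_apply h hq, christoffel, h.frame_apply hq]

end Connections

end GeomOsc
end

noncomputable section

set_option linter.unusedSectionVars false

namespace GeomOsc

universe u v

/-! ### Covariant derivatives along curves in coordinates -/

section AlongCurves

open Set Filter Bundle

variable {n : ℕ} {M : Type u} [TopologicalSpace M] [ChartedSpace (EuclideanSpace ℝ (Fin n)) M]
  [IsManifold (𝓡 n) ∞ M]
variable {F : Type v} [NormedAddCommGroup F] [NormedSpace ℝ F]

local notation "𝔼" => EuclideanSpace ℝ (Fin n)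
local notation "φ" => extChartAt (𝓡 n)

variable {cov : Connection n M} {Θ : M → EuclideanSpace ℝ (Fin n)} {U : Set M}

lemma hasDerivWithinAt_comp_curve {f : M → F} {c : ℝ → M} {s : ℝ}
    (hf : MDifferentiableAt (𝓡 n) 𝓘(ℝ, F) f (c s))
    (hc : MDifferentiableWithinAt 𝓘(ℝ, ℝ) (𝓡 n) c (Icc 0 1) s) :
    HasDerivWithinAt (fun r => f (c r)) (mvfderiv (𝓡 n) f (c s) (velocity c s)) (Icc 0 1) s := by
  have h := hf.hasMFDerivAt.comp_hasMFDerivWithinAt s hc.hasMFDerivWithinAt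
  let L : ℝ →L[ℝ] F := (mfderiv (𝓡 n) 𝓘(ℝ, F) f (c s)).comp
    (mfderivWithin 𝓘(ℝ, ℝ) (𝓡 n) c (Icc 0 1) s)
  have h2 : HasFDerivWithinAt (fun r => f (c r)) L (Icc 0 1) s :=
    hasMFDerivWithinAt_iff_hasFDerivWithinAt.1 h
  have h3 := h2.hasDerivWithinAt
  exact h3

lemma derivWithin_comp_curve {f : M → F} {c : ℝ → M} {s : ℝ} (hs : s ∈ Icc (0 : ℝ) 1)
    (hf : MDifferentiableAt (𝓡 n) 𝓘(ℝ, F) f (c s))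
    (hc : MDifferentiableWithinAt 𝓘(ℝ, ℝ) (𝓡 n) c (Icc 0 1) s) :
    derivWithin (fun r => f (c r)) (Icc 0 1) s = mvfderiv (𝓡 n) f (c s) (velocity c s) :=
  (hasDerivWithinAt_comp_curve hf hc).derivWithin (uniqueDiffOn_Icc zero_lt_one s hs)

lemma cov_extend (x : M) (X Y : TangentSpace (𝓡 n) x) :
    cov (FiberBundle.extend 𝔼 X) x Y = cov (frame (φ x) X) x Y := by
  rw [cov_congr (vfSmoothAt_extend x X).diffAt
    ((isCoord_chart x).vfSmoothAt_frame (mem_extChartAt_source x) X).diffAt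
    (extend_eventuallyEq x X)]

/-- The covariant derivative along a curve in coordinates. -/
lemma covDerivAlong_eq (h : IsCoord Θ U) {c : ℝ → M} {s : ℝ} (hs : s ∈ Icc (0 : ℝ) 1)
    (hcs : c s ∈ U) (hc : MDifferentiableWithinAt 𝓘(ℝ, ℝ) (𝓡 n) c (Icc 0 1) s)
    {V : ∀ s, TangentSpace (𝓡 n) (c s)}
    (hv : DifferentiableWithinAt ℝ (fun r => mvfderiv (𝓡 n) Θ (c r) (V r)) (Icc 0 1) s) :
    covDerivAlong cov c V s =
      frame Θ (derivWithin (fun r => mvfderiv (𝓡 n) Θ (c r) (V r)) (Icc 0 1) s) (c s)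
        + cov (frame Θ (mvfderiv (𝓡 n) Θ (c s) (V s))) (c s) (velocity c s) := by
  set x := c s with hx
  set v : ℝ → 𝔼 := fun r => mvfderiv (𝓡 n) Θ (c r) (V r) with hvdef
  -- The components of the Θ-frame in the preferred chart at c s. The field has there the components
  -- ∑ v_i A_i, to which the product rule applies.
  let A : Fin n → M → 𝔼 := fun i y =>
    mvfderiv (𝓡 n) (φ x) y (frame Θ (EuclideanSpace.single i 1) y)
  have hxs := mem_extChartAt_source (I := 𝓡 n) x
  have hA : ∀ i, MDifferentiableAt (𝓡 n) 𝓘(ℝ, 𝔼) (A i) x := fun i =>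
    mdiffAt_mvfderiv (contMDiffAt_chart hxs) (h.vfSmoothAt_frame hcs _).diffAt
  have hAsum : ∀ (w : 𝔼) (y : M), mvfderiv (𝓡 n) (φ x) y (frame Θ w y) = ∑ i, w i • A i y := by
    intro w y
    rw [frame_eq_sum]
    simp only [map_sum, map_smul, A]
  have e1 : (fun r => (trivializationAt 𝔼 (TangentSpace (𝓡 n) : M → Type)
      x (⟨c r, V r⟩ : TangentBundle (𝓡 n) M)).2) =ᶠ[𝓝[Icc 0 1] s]
      fun r => ∑ i, v r i • A i (c r) := by
    filter_upwards [hc.continuousWithinAt (h.isOpen.mem_nhds hcs),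
      hc.continuousWithinAt (source_mem_nhds hxs)] with r hr1 hr2
    rw [triv_snd hr2, ← hAsum, h.frame_apply hr1]
  have hd : HasDerivWithinAt (fun r => ∑ i, v r i • A i (c r))
      (∑ i, (v s i • mvfderiv (𝓡 n) (A i) x (velocity c s)
        + (derivWithin v (Icc 0 1) s) i • A i x)) (Icc 0 1) s := by
    refine HasDerivWithinAt.fun_sum fun i _ => ?_
    have h1 : HasDerivWithinAt (fun r => v r i) ((derivWithin v (Icc 0 1) s) i) (Icc 0 1) s :=
      ((EuclideanSpace.proj (𝕜 := ℝ) i).hasFDerivAt.comp_hasDerivWithinAt s hv.hasDerivWithinAt)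
    exact h1.fun_smul (hasDerivWithinAt_comp_curve (hA i) hc)
  have e2 : derivWithin (fun r => (trivializationAt 𝔼 (TangentSpace (𝓡 n) : M → Type)
      x (⟨c r, V r⟩ : TangentBundle (𝓡 n) M)).2) (Icc 0 1) s =
      @HAdd.hAdd 𝔼 𝔼 𝔼 instHAdd (∑ i, v s i • mvfderiv (𝓡 n) (A i) x (velocity c s))
        (frame Θ (derivWithin v (Icc 0 1) s) x) := by
    rw [e1.derivWithin_eq (e1.self_of_nhdsWithin hs),
      hd.derivWithin (uniqueDiffOn_Icc zero_lt_one s hs), Finset.sum_add_distrib, ← hAsum,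
      mvfderiv_chart_self]
  have e3 : mvfderiv (𝓡 n) (fun y => mvfderiv (𝓡 n) (φ x) y (frame Θ (v s) y)) x (velocity c s)
      = ∑ i, v s i • mvfderiv (𝓡 n) (A i) x (velocity c s) := by
    have : (fun y => mvfderiv (𝓡 n) (φ x) y (frame Θ (v s) y)) = fun y => ∑ i, v s i • A i y := by
      ext1 y; exact hAsum _ _
    rw [this]
    have hsum := HasMFDerivAt.sum (I := 𝓡 n) (t := Finset.univ) (z := x)
      (f := fun i => v s i • A i) (f' := fun i => v s i • mfderiv (𝓡 n) 𝓘(ℝ, 𝔼) (A i) x)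
      (fun i _ => (hA i).hasMFDerivAt.const_smul _)
    have e : (fun y => ∑ i, v s i • A i y) = ∑ i, v s i • A i := by
      ext1 y; simp
    rw [e]
    have := congrArg (fun L => L (velocity c s)) hsum.mfderiv
    refine Eq.trans this ?_
    have key : ∀ (L : Fin n → 𝔼 →L[ℝ] 𝔼) (w : 𝔼), (∑ i, L i) w = ∑ i, L i w := by simp
    exact key _ _
  -- The derivatives of the A_i that the change of frame creates in the first term of
  -- `covDerivAlong` are absorbed when the covariant derivative of the Θ-frame is expressed in the
  -- chart frame.
  have e4 := (isCoord_chart x).cov_eq (cov := cov) hxs (h.vfSmoothAt_frame hcs (v s)).diffAt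
    (velocity c s)
  rw [e3] at e4
  rw [covDerivAlong, cov_extend, e2, ← frame_chart hxs, frame_chart_self, e4, frame_chart_self,
    mvfderiv_chart_self, h.frame_apply hcs]
  abel

lemma mdiffWithinAt_curve {c : ℝ → M} (hc : ContMDiffOn 𝓘(ℝ, ℝ) (𝓡 n) ∞ c (Icc 0 1)) {s : ℝ}
    (hs : s ∈ Icc (0 : ℝ) 1) : MDifferentiableWithinAt 𝓘(ℝ, ℝ) (𝓡 n) c (Icc 0 1) s :=
  (hc s hs).mdifferentiableWithinAt (by simp)

/-- The components of a smooth field along a curve. -/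
lemma SmoothAlong.contDiffWithinAt (h : IsCoord Θ U) {c : ℝ → M}
    {V : ∀ s, TangentSpace (𝓡 n) (c s)} (hV : SmoothAlong c V) {s : ℝ} (hs : s ∈ Icc (0 : ℝ) 1)
    (hcs : c s ∈ U) :
    ContDiffWithinAt ℝ ∞ (fun r => mvfderiv (𝓡 n) Θ (c r) (V r)) (Icc 0 1) s := by
  have h1 := Bundle.contMDiffWithinAt_totalSpace.1 (hV s hs)
  have hxs := mem_extChartAt_source (I := 𝓡 n) (c s)
  rw [← contMDiffWithinAt_iff_contDiffWithinAt]
  have h2 := (contMDiffAt_fderiv_inCoord (h.smooth (c s) hcs)).comp_contMDiffWithinAt s h1.1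
  refine (h2.clm_apply h1.2).congr_of_eventuallyEq_of_mem ?_ hs
  filter_upwards [h1.1.continuousWithinAt (source_mem_nhds hxs),
    h1.1.continuousWithinAt (eventually_mdiff (h.smooth (c s) hcs))] with r hr1 hr2
  refine (mvfderiv_eq_fderiv_inCoord hr1 hr2 (V r)).trans ?_
  rw [← triv_snd hr1]
  rfl

lemma contMDiffAt_frame_comp (h : IsCoord Θ U) {q : M} (hq : q ∈ U) (v : 𝔼) :
    ContMDiffAt (𝓡 n) 𝓘(ℝ, 𝔼) ∞ (fun y => mvfderiv (𝓡 n) (φ q) y (frame Θ v y)) q :=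
  vfSmoothAt_iff.1 (h.vfSmoothAt_frame hq v)

/-- A field along a curve is smooth if its components are smooth. -/
lemma smoothAlong_frame (h : IsCoord Θ U) {c : ℝ → M}
    (hc : ContMDiffOn 𝓘(ℝ, ℝ) (𝓡 n) ∞ c (Icc 0 1)) (hcU : MapsTo c (Icc 0 1) U) {v : ℝ → 𝔼}
    (hv : ContDiffOn ℝ ∞ v (Icc 0 1)) : SmoothAlong c (fun s => frame Θ (v s) (c s)) := by
  intro s hs
  rw [Bundle.contMDiffWithinAt_totalSpace]
  refine ⟨hc s hs, ?_⟩
  have hxs := mem_extChartAt_source (I := 𝓡 n) (c s)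
  have h1 : ContMDiffWithinAt 𝓘(ℝ, ℝ) 𝓘(ℝ, 𝔼) ∞ (fun r => ∑ i, v r i •
      mvfderiv (𝓡 n) (φ (c s)) (c r) (frame Θ (EuclideanSpace.single i 1) (c r))) (Icc 0 1) s := by
    refine ContMDiffWithinAt.sum fun i _ => ?_
    have hvi : ContMDiffWithinAt 𝓘(ℝ, ℝ) 𝓘(ℝ, ℝ) ∞ (fun r => v r i) (Icc 0 1) s :=
      ((EuclideanSpace.proj (𝕜 := ℝ) i).contDiff.comp_contDiffWithinAt (hv s hs)).contMDiffWithinAt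
    exact hvi.smul ((contMDiffAt_frame_comp h (hcU hs) _).comp_contMDiffWithinAt s (hc s hs))
  refine h1.congr_of_eventuallyEq_of_mem ?_ hs
  filter_upwards [(hc s hs).continuousWithinAt (source_mem_nhds hxs)] with r hr1
  refine (triv_snd hr1 _).trans ?_
  rw [frame_eq_sum (v r)]
  simp only [map_sum, map_smul]

/-- The geodesic equation in coordinates. -/
lemma covDerivAlong_velocity (h : IsCoord Θ U) {c : ℝ → M}
    (hc : ContMDiffOn 𝓘(ℝ, ℝ) (𝓡 n) ∞ c (Icc 0 1)) {s : ℝ} (hs : s ∈ Icc (0 : ℝ) 1)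
    (hcs : c s ∈ U) {x' : ℝ → 𝔼} {x'' : 𝔼}
    (hx' : ∀ᶠ r in 𝓝[Icc 0 1] s, HasDerivWithinAt (fun r => Θ (c r)) (x' r) (Icc 0 1) r)
    (hx'' : HasDerivWithinAt x' x'' (Icc 0 1) s) :
    covDerivAlong cov c (velocity c) s =
      frame Θ (x'' + christoffelMap cov Θ (x' s) (c s) (x' s)) (c s) := by
  have hcs' := mdiffWithinAt_curve hc hs
  have e : (fun r => mvfderiv (𝓡 n) Θ (c r) (velocity c r)) =ᶠ[𝓝[Icc 0 1] s] x' := by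
    filter_upwards [hx', self_mem_nhdsWithin, hcs'.continuousWithinAt (h.isOpen.mem_nhds hcs)]
      with r hr hr1 hr2
    rw [← derivWithin_comp_curve hr1 ((h.smooth _ hr2).mdifferentiableAt (by simp))
      (mdiffWithinAt_curve hc hr1), hr.derivWithin (uniqueDiffOn_Icc zero_lt_one r hr1)]
  have es := e.self_of_nhdsWithin hs
  have hd := hx''.congr_of_eventuallyEq e es
  rw [covDerivAlong_eq h hs hcs hcs' hd.differentiableWithinAt,
    hd.derivWithin (uniqueDiffOn_Icc zero_lt_one s hs), frame_add, ← cov_frame_frame h hcs]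
  congr 1
  rw [← es, h.frame_apply hcs]

end AlongCurves

end GeomOsc
end

noncomputable section

set_option linter.unusedSectionVars false

namespace GeomOsc

universe u v

/-! ### Radial geodesics -/

section NormalNeighborhoods

open Set Filter Bundle

variable {n : ℕ} {M : Type u} [TopologicalSpace M] [ChartedSpace (EuclideanSpace ℝ (Fin n)) M]
  [IsManifold (𝓡 n) ∞ M]
variable {F : Type} [NormedAddCommGroup F] [NormedSpace ℝ F]

local notation "𝔼" => EuclideanSpace ℝ (Fin n)
local notation "φ" => extChartAt (𝓡 n)

variable {cov : Connection n M} {Θ : M → EuclideanSpace ℝ (Fin n)} {U : Set M}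

/-- The part of the range of the chart at `q` that lies in `Ω`. -/
def chartRange (q : M) (Ω : Set M) : Set (EuclideanSpace ℝ (Fin n)) :=
  (φ q).target ∩ (φ q).symm ⁻¹' Ω

lemma isOpen_chartRange (q : M) {Ω : Set M} (hΩ : IsOpen Ω) :
    IsOpen (chartRange (n := n) q Ω) :=
  (continuousOn_extChartAt_symm q).isOpen_inter_preimage (isOpen_extChartAt_target q) hΩ

lemma mem_chartRange {q x : M} {Ω : Set M} (hx : x ∈ (φ q).source) (hxΩ : x ∈ Ω) :
    φ q x ∈ chartRange (n := n) q Ω :=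
  ⟨(φ q).map_source hx, by rwa [mem_preimage, (φ q).left_inv hx]⟩

lemma contDiffOn_family {G : ℝ → M → F} {S : Set ℝ} {Ω : Set M}
    (hG : ContMDiffOn (𝓘(ℝ, ℝ).prod (𝓡 n)) 𝓘(ℝ, F) ∞ (fun z : ℝ × M => G z.1 z.2) (S ×ˢ Ω))
    (q : M) :
    ContDiffOn ℝ ∞ (fun z : ℝ × 𝔼 => G z.1 ((φ q).symm z.2)) (S ×ˢ chartRange (n := n) q Ω) := by
  rw [← contMDiffOn_iff_contDiffOn, modelWithCornersSelf_prod, ← chartedSpaceSelf_prod]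
  have h1 : ContMDiffOn (𝓘(ℝ, ℝ).prod 𝓘(ℝ, 𝔼)) (𝓘(ℝ, ℝ).prod (𝓡 n)) ∞
      (fun z : ℝ × 𝔼 => (z.1, (φ q).symm z.2)) (S ×ˢ chartRange (n := n) q Ω) :=
    contMDiffOn_fst.prodMk ((contMDiffOn_extChartAt_symm q).comp contMDiffOn_snd
      fun z hz => hz.2.1)
  exact hG.comp h1 fun z hz => ⟨hz.1, hz.2.2⟩

lemma contMDiffAt_toUI {G : ℝ → M → F} {Ω : Set M} (hΩ : IsOpen Ω)
    (hG : ContMDiffOn (𝓘(ℝ, ℝ).prod (𝓡 n)) 𝓘(ℝ, F) ∞ (fun z : ℝ × M => G z.1 z.2)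
      (Icc 0 1 ×ˢ Ω)) {q : M} (hq : q ∈ Ω) :
    ContMDiffAt (𝓡 n) 𝓘(ℝ, C(UI, F)) ∞ (fun y => toUI fun s => G s y) q := by
  have hs := mem_extChartAt_source (I := 𝓡 n) q
  have hU := isOpen_chartRange (n := n) q hΩ
  exact contMDiffAt_of_inCoord hs ((contDiffOn_toUI (G := fun s y => G s ((φ q).symm y)) hU
    (contDiffOn_family hG q)).contDiffAt (hU.mem_nhds (mem_chartRange hs hq)))

lemma christoffelMap_smul (c : ℝ) (v : 𝔼) (q : M) :
    christoffelMap cov Θ (c • v) q = c • christoffelMap cov Θ v q := by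
  simp [christoffelMap, mul_smul, Finset.smul_sum]

/-- The coordinates of a smooth curve have two derivatives. -/
lemma hasDerivWithinAt_coord (h : IsCoord Θ U) {c : ℝ → M}
    (hc : ContMDiffOn 𝓘(ℝ, ℝ) (𝓡 n) ∞ c (Icc 0 1)) {s : ℝ} (hs : s ∈ Icc (0 : ℝ) 1)
    (hcs : c s ∈ U) :
    (∀ᶠ r in 𝓝[Icc 0 1] s, HasDerivWithinAt (fun r => Θ (c r))
      (derivWithin (fun r => Θ (c r)) (Icc 0 1) r) (Icc 0 1) r) ∧
    DifferentiableWithinAt ℝ (derivWithin (fun r => Θ (c r)) (Icc 0 1)) (Icc 0 1) s := by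
  constructor
  · filter_upwards [self_mem_nhdsWithin, (hc s hs).continuousWithinAt (h.isOpen.mem_nhds hcs)]
      with r hr hr'
    exact (hasDerivWithinAt_comp_curve ((h.smooth _ hr').mdifferentiableAt (by simp))
      (mdiffWithinAt_curve hc hr)).differentiableWithinAt.hasDerivWithinAt
  · have h1 : ContDiffWithinAt ℝ ∞ (fun r => Θ (c r)) (Icc 0 1) s := by
      rw [← contMDiffWithinAt_iff_contDiffWithinAt]
      exact (h.smooth _ hcs).comp_contMDiffWithinAt s (hc s hs)
    have h2 := h1.fderivWithin_right (m := 1) (uniqueDiffOn_Icc zero_lt_one)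
      (by rw [one_add_one_eq_two]; exact two_le_infty) hs
    exact (h2.differentiableWithinAt one_ne_zero).clm_apply (differentiableWithinAt_const (1 : ℝ))

lemma IsGeodesic.hasDerivWithinAt (h : IsCoord Θ U) {c : ℝ → M} (hc : IsGeodesic cov c) {s : ℝ}
    (hs : s ∈ Icc (0 : ℝ) 1) (hcs : c s ∈ U) :
    HasDerivWithinAt (derivWithin (fun r => Θ (c r)) (Icc 0 1))
      (-(christoffelMap cov Θ (derivWithin (fun r => Θ (c r)) (Icc 0 1) s) (c s)
        (derivWithin (fun r => Θ (c r)) (Icc 0 1) s))) (Icc 0 1) s := by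
  obtain ⟨h1, h2⟩ := hasDerivWithinAt_coord h hc.smooth hs hcs
  have h3 := covDerivAlong_velocity (cov := cov) h hc.smooth hs hcs h1 h2.hasDerivWithinAt
  rw [hc.eq_zero s hs] at h3
  have h4 := congrArg (mvfderiv (𝓡 n) Θ (c s)) h3
  rw [h.apply_frame hcs, map_zero] at h4
  rw [← eq_neg_of_add_eq_zero_left h4.symm]
  exact h2.hasDerivWithinAt

/-- Slowing down a geodesic by a constant factor gives a geodesic. -/
lemma IsGeodesic.comp_mul {c : ℝ → M} (hc : IsGeodesic cov c) {s : ℝ}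
    (hs : s ∈ Icc (0 : ℝ) 1) : IsGeodesic cov (fun r => c (s * r)) := by
  have hmaps : MapsTo (fun r : ℝ => s * r) (Icc 0 1) (Icc 0 1) := fun r hr =>
    ⟨mul_nonneg hs.1 hr.1, mul_le_one₀ hs.2 hr.1 hr.2⟩
  have hsm : ContMDiffOn 𝓘(ℝ, ℝ) (𝓡 n) ∞ (fun r => c (s * r)) (Icc 0 1) :=
    hc.smooth.comp (contDiff_const.mul contDiff_id).contMDiff.contMDiffOn hmaps
  refine ⟨hsm, fun r hr => ?_⟩
  have hU := isCoord_chart (n := n) (c (s * r))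
  have hx := mem_extChartAt_source (I := 𝓡 n) (c (s * r))
  obtain ⟨h1, -⟩ := hasDerivWithinAt_coord hU hc.smooth (hmaps hr) hx
  have h2 := hc.hasDerivWithinAt hU (hmaps hr) hx
  have hm : ∀ r, HasDerivWithinAt (fun r : ℝ => s * r) s (Icc 0 1) r := fun r => by
    simpa using (hasDerivWithinAt_id r (Icc (0 : ℝ) 1)).const_mul s
  have ht : Tendsto (fun r : ℝ => s * r) (𝓝[Icc 0 1] r) (𝓝[Icc 0 1] (s * r)) :=
    (hm r).continuousWithinAt.tendsto_nhdsWithin hmaps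
  have h3 : ∀ᶠ r' in 𝓝[Icc 0 1] r, HasDerivWithinAt (fun r' => φ (c (s * r)) (c (s * r')))
      (s • derivWithin (fun r' => φ (c (s * r)) (c r')) (Icc 0 1) (s * r')) (Icc 0 1) r' := by
    filter_upwards [ht.eventually h1] with r' hr'
    exact HasDerivWithinAt.scomp r' hr' (hm r') hmaps
  have h4 := (HasDerivWithinAt.scomp r h2 (hm r) hmaps).fun_const_smul s
  rw [covDerivAlong_velocity hU hsm hr hx h3 h4, christoffelMap_smul]
  simp only [map_smul, smul_apply, smul_neg, neg_add_cancel]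
  exact map_zero _

variable {p : M} {Ω₀ : Set M} {γ : M → ℝ → M}

/-- The slowed-down curve r ↦ γ_q(sr) is a geodesic in Ω₀ from p to γ_q(s), and there is only one.
-/
lemma IsNormalNhd.curve_curve (h : IsNormalNhd cov p Ω₀ γ) {q : M} (hq : q ∈ Ω₀) {s r : ℝ}
    (hs : s ∈ Icc (0 : ℝ) 1) (hr : r ∈ Icc (0 : ℝ) 1) : γ (γ q s) r = γ q (s * r) :=
  (h.unique (γ q s) (h.mapsTo q hq hs) _ ((h.geodesic q hq).comp_mul hs)
    (by simp [h.source q hq]) (by simp) (fun r hr => h.mapsTo q hq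
      ⟨mul_nonneg hs.1 hr.1, mul_le_one₀ hs.2 hr.1 hr.2⟩) hr).symm

lemma IsNormalNhd.curve_center (h : IsNormalNhd cov p Ω₀ γ) {r : ℝ} (hr : r ∈ Icc (0 : ℝ) 1) :
    γ p r = p := by
  have := h.curve_curve h.mem (s := 0) ⟨le_rfl, zero_le_one⟩ hr
  simpa [h.source p h.mem] using this

variable (n) in
/-- Normal coordinates at `p`. -/
def normalCoord (p : M) (γ : M → ℝ → M) (q : M) : EuclideanSpace ℝ (Fin n) :=
  derivWithin (fun s => φ p (γ q s)) (Icc 0 1) 0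

lemma IsNormalNhd.hasDerivWithinAt_zero (h : IsNormalNhd cov p Ω₀ γ) {q : M} (hq : q ∈ Ω₀) :
    HasDerivWithinAt (fun s => φ p (γ q s)) (normalCoord n p γ q) (Icc 0 1) 0 := by
  have h0 : (0 : ℝ) ∈ Icc (0 : ℝ) 1 := ⟨le_rfl, zero_le_one⟩
  have hx : γ q 0 ∈ (φ p).source := by
    rw [h.source q hq]; exact mem_extChartAt_source p
  exact (hasDerivWithinAt_coord (isCoord_chart p) (h.geodesic q hq).smooth h0
    hx).1.self_of_nhdsWithin h0

lemma IsNormalNhd.normalCoord_curve (h : IsNormalNhd cov p Ω₀ γ) {q : M} (hq : q ∈ Ω₀) {s : ℝ}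
    (hs : s ∈ Icc (0 : ℝ) 1) : normalCoord n p γ (γ q s) = s • normalCoord n p γ q := by
  have h0 : (0 : ℝ) ∈ Icc (0 : ℝ) 1 := ⟨le_rfl, zero_le_one⟩
  have hm : HasDerivWithinAt (fun r : ℝ => s * r) s (Icc 0 1) 0 := by
    simpa using (hasDerivWithinAt_id (0 : ℝ) (Icc (0 : ℝ) 1)).const_mul s
  have h1 : HasDerivWithinAt (fun s => φ p (γ q s)) (normalCoord n p γ q) (Icc 0 1) (s * 0) := by
    simpa using h.hasDerivWithinAt_zero hq
  have h2 := HasDerivWithinAt.scomp (h := fun r : ℝ => s * r) (0 : ℝ) h1 hm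
    (fun r hr => ⟨mul_nonneg hs.1 hr.1, mul_le_one₀ hs.2 hr.1 hr.2⟩)
  have h3 : HasDerivWithinAt (fun r => φ p (γ (γ q s) r)) (s • normalCoord n p γ q) (Icc 0 1) 0 :=
    h2.congr (fun r hr => by rw [h.curve_curve hq hs hr]; rfl)
      (by rw [h.curve_curve hq hs h0]; rfl)
  exact h3.derivWithin (uniqueDiffOn_Icc zero_lt_one 0 h0)

lemma IsNormalNhd.normalCoord_center (h : IsNormalNhd cov p Ω₀ γ) : normalCoord n p γ p = 0 := by
  have h0 : (0 : ℝ) ∈ Icc (0 : ℝ) 1 := ⟨le_rfl, zero_le_one⟩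
  have h1 := h.normalCoord_curve h.mem h0
  rwa [h.curve_center h0, zero_smul] at h1

lemma IsNormalNhd.contMDiffAt_curve (h : IsNormalNhd cov p Ω₀ γ) {q : M} (hq : q ∈ Ω₀) {s : ℝ}
    (hs : s ∈ Icc (0 : ℝ) 1) : ContMDiffAt (𝓡 n) (𝓡 n) ∞ (fun q => γ q s) q := by
  have h1 : ContMDiffOn (𝓡 n) (𝓡 n) ∞ (fun q => γ q s) Ω₀ :=
    h.smooth.comp (f := fun q => (s, q)) (contMDiff_const.prodMk contMDiff_id).contMDiffOn
      (fun q hq => ⟨hs, hq⟩)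
  exact h1.contMDiffAt (h.isOpen.mem_nhds hq)

/-- The geodesic to p is constant; joint continuity and compactness of [0,1] keep the nearby
geodesics close to p for all times at once. -/
lemma IsNormalNhd.eventually_curve_mem (h : IsNormalNhd cov p Ω₀ γ) {N : Set M} (hN : N ∈ 𝓝 p) :
    ∀ᶠ q in 𝓝 p, ∀ s ∈ Icc (0 : ℝ) 1, γ q s ∈ N := by
  have h1 : ∀ᶠ q in 𝓝 p, ∀ s ∈ (univ : Set UI), γ q s ∈ N := by
    refine isCompact_univ.eventually_forall_of_forall_eventually fun s _ => ?_
    have h2 := h.smooth.continuousOn (s, p) ⟨s.2, h.mem⟩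
    have h3 : Tendsto (fun z : M × UI => ((z.2 : ℝ), z.1)) (𝓝 (p, s))
        (𝓝[Icc 0 1 ×ˢ Ω₀] ((s : ℝ), p)) := by
      refine tendsto_nhdsWithin_iff.2 ⟨Continuous.tendsto' (by fun_prop) _ _ rfl, ?_⟩
      filter_upwards [continuous_fst.continuousAt.preimage_mem_nhds (h.isOpen.mem_nhds h.mem)]
        with z hz using ⟨z.2.2, hz⟩
    have h4 := h2.tendsto.comp h3
    refine h4 (by simpa [h.curve_center s.2] using hN)
  filter_upwards [h1] with q hq s hs using hq ⟨s, hs⟩ (mem_univ _)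

lemma contDiffOn_derivWithin_family {G : ℝ → 𝔼 → F} {W : Set 𝔼} (hW : IsOpen W)
    (hG : ContDiffOn ℝ ∞ (fun z : ℝ × 𝔼 => G z.1 z.2) (Icc (0 : ℝ) 1 ×ˢ W)) :
    ContDiffOn ℝ ∞ (fun z : ℝ × 𝔼 => derivWithin (fun r => G r z.2) (Icc 0 1) z.1)
      (Icc (0 : ℝ) 1 ×ˢ W) := by
  have hud : UniqueDiffOn ℝ (Icc (0 : ℝ) 1 ×ˢ W) :=
    (uniqueDiffOn_Icc zero_lt_one).prod hW.uniqueDiffOn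
  have h1 := (hG.fderivWithin hud (m := ∞) (by simp)).clm_apply
    (contDiffOn_const (c := ((1 : ℝ), (0 : 𝔼))))
  refine h1.congr fun z hz => ?_
  have h2 := ((hG.differentiableOn (by simp)) z hz).hasFDerivWithinAt
  have h3 : HasDerivWithinAt (fun r : ℝ => (r, z.2)) ((1 : ℝ), (0 : 𝔼)) (Icc 0 1) z.1 :=
    (hasDerivWithinAt_id _ _).prodMk (hasDerivWithinAt_const _ _ _)
  have h4 := HasFDerivWithinAt.comp_hasDerivWithinAt (f := fun r : ℝ => (r, z.2)) z.1 h2 h3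
    (fun r hr => ⟨hr, hz.2⟩)
  exact h4.derivWithin (uniqueDiffOn_Icc zero_lt_one _ hz.1)

lemma norm_christoffelMap_le (v : 𝔼) (q : M) :
    ‖christoffelMap cov Θ v q v‖ ≤ (∑ i, ∑ j, ‖christoffel cov Θ (EuclideanSpace.single i 1)
      (EuclideanSpace.single j 1) q‖) * ‖v‖ ^ 2 := by
  simp only [christoffelMap, sum_apply, smul_apply, ContinuousLinearMap.smulRight_apply,
    PiLp.proj_apply, Finset.sum_mul]
  refine norm_sum_le_of_le _ fun i _ => norm_sum_le_of_le _ fun j _ => ?_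
  rw [norm_smul, norm_smul, ← mul_assoc, mul_comm, sq]
  gcongr <;> exact PiLp.norm_apply_le v _

lemma eventually_norm_christoffelMap_le [T2Space M] (hcov : cov.ContMDiffCovariantDerivative ∞)
    (h : IsCoord Θ U) {q : M} (hq : q ∈ U) :
    ∃ K : ℝ, 0 ≤ K ∧ ∀ᶠ y in 𝓝 q, ∀ v, ‖christoffelMap cov Θ v y v‖ ≤ K * ‖v‖ ^ 2 := by
  have hc : ContinuousAt (fun y => ∑ i, ∑ j, ‖christoffel cov Θ (EuclideanSpace.single i 1)
      (EuclideanSpace.single j 1) y‖) q := by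
    refine tendsto_finsetSum _ fun i _ => tendsto_finsetSum _ fun j _ => ?_
    exact (contMDiffAt_christoffel hcov h hq _ _).continuousAt.norm
  refine ⟨(∑ i, ∑ j, ‖christoffel cov Θ (EuclideanSpace.single i 1)
    (EuclideanSpace.single j 1) q‖) + 1, by positivity, ?_⟩
  filter_upwards [hc.eventually (gt_mem_nhds (lt_add_one _))] with y hy v
  exact (norm_christoffelMap_le v y).trans (by gcongr)

end NormalNeighborhoods

end GeomOsc
end

noncomputable section

set_option linter.unusedSectionVars false

namespace GeomOsc

universe u v

/-! ### Normal coordinates are smooth coordinates -/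

section NormalCoordinates

open Set Filter Bundle

variable {n : ℕ} {M : Type u} [TopologicalSpace M] [ChartedSpace (EuclideanSpace ℝ (Fin n)) M]
  [IsManifold (𝓡 n) ∞ M]
variable {F : Type} [NormedAddCommGroup F] [NormedSpace ℝ F]

local notation "𝔼" => EuclideanSpace ℝ (Fin n)
local notation "φ" => extChartAt (𝓡 n)

variable {cov : Connection n M} {Θ : M → EuclideanSpace ℝ (Fin n)} {U : Set M}
variable {p : M} {Ω₀ : Set M} {γ : M → ℝ → M}

lemma slice_contDiffOn {G : ℝ → 𝔼 → F} {W : Set 𝔼} {y : 𝔼} (hy : y ∈ W)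
    (hG : ContDiffOn ℝ ∞ (fun z : ℝ × 𝔼 => G z.1 z.2) (Icc (0 : ℝ) 1 ×ˢ W)) :
    ContDiffOn ℝ ∞ (fun s => G s y) (Icc 0 1) :=
  hG.comp (f := fun s => (s, y)) (by fun_prop) (fun _ hs => ⟨hs, hy⟩)

/-- Near the center, normal coordinates are smooth; at the center, their differential is the
identity. -/
lemma IsNormalNhd.normalCoord_near_center [T2Space M] (h : IsNormalNhd cov p Ω₀ γ)
    (hcov : cov.ContMDiffCovariantDerivative ∞) :
    (∀ᶠ q in 𝓝 p, ContMDiffAt (𝓡 n) 𝓘(ℝ, 𝔼) ∞ (normalCoord n p γ) q) ∧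
      ∀ v : TangentSpace (𝓡 n) p, mvfderiv (𝓡 n) (normalCoord n p γ) p v = v := by
  have hp := mem_extChartAt_source (I := 𝓡 n) p
  have h0 : (0 : ℝ) ∈ Icc (0 : ℝ) 1 := ⟨le_rfl, zero_le_one⟩
  have h1 : (1 : ℝ) ∈ Icc (0 : ℝ) 1 := ⟨zero_le_one, le_rfl⟩
  obtain ⟨K, hK0, hK⟩ := eventually_norm_christoffelMap_le hcov (isCoord_chart p) hp
  have hN := h.eventually_curve_mem (Filter.inter_mem hK (source_mem_nhds hp))
  obtain ⟨Ω₁, hΩ₁, hΩ₁o, hpΩ₁⟩ := mem_nhds_iff.1 (Filter.inter_mem hN (h.isOpen.mem_nhds h.mem))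
  have hG : ContMDiffOn (𝓘(ℝ, ℝ).prod (𝓡 n)) 𝓘(ℝ, 𝔼) ∞ (fun z : ℝ × M => φ p (γ z.2 z.1))
      (Icc 0 1 ×ˢ Ω₁) :=
    (contMDiffOn_extChartAt (n := ∞) (I := 𝓡 n) (x := p)).comp
      (h.smooth.mono (prod_mono subset_rfl fun q hq => (hΩ₁ hq).2))
      fun z hz => by simpa using ((hΩ₁ hz.2).1 z.1 hz.1).2
  set W := chartRange (n := n) p Ω₁ with hWdef
  have hW : IsOpen W := isOpen_chartRange p hΩ₁o
  set G : ℝ → 𝔼 → 𝔼 := fun s y => φ p (γ ((φ p).symm y) s) with hGdef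
  have hG' : ContDiffOn ℝ ∞ (fun z : ℝ × 𝔼 => G z.1 z.2) (Icc (0 : ℝ) 1 ×ˢ W) :=
    contDiffOn_family (G := fun s q => φ p (γ q s)) hG p
  have hD := contDiffOn_derivWithin_family hW hG'
  set D : ℝ → 𝔼 → 𝔼 := fun s y => derivWithin (fun r => G r y) (Icc 0 1) s with hDdef
  have hΘ : ∀ y, inCoord p (normalCoord n p γ) y = D 0 y := fun y => rfl
  have hΘs : ContDiffOn ℝ ∞ (inCoord p (normalCoord n p γ)) W := by
    have : ContDiffOn ℝ ∞ (fun y => D 0 y) W :=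
      hD.comp (f := fun y => ((0 : ℝ), y)) (by fun_prop) (fun y hy => ⟨h0, hy⟩)
    exact this
  have hpW : φ p p ∈ W := mem_chartRange hp hpΩ₁
  refine ⟨?_, ?_⟩
  · filter_upwards [hΩ₁o.mem_nhds hpΩ₁, source_mem_nhds hp] with q hq hqs
    exact contMDiffAt_of_inCoord hqs (hΘs.contDiffAt (hW.mem_nhds (mem_chartRange hqs hq)))
  have hT := contDiffOn_toUI (G := D) hW hD
  have hDp : ∀ s ∈ Icc (0 : ℝ) 1, D s (φ p p) = 0 := by
    intro s hs
    have e : ∀ r ∈ Icc (0 : ℝ) 1, G r (φ p p) = φ p p := fun r hr => by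
      rw [hGdef]; simp only [(φ p).left_inv hp, h.curve_center hr]
    have : HasDerivWithinAt (fun r => G r (φ p p)) 0 (Icc 0 1) s :=
      (hasDerivWithinAt_const s _ (φ p p)).congr e (e s hs)
    exact this.derivWithin (uniqueDiffOn_Icc zero_lt_one s hs)
  have hTp : toUI (fun s => D s (φ p p)) = 0 := by
    ext1 s
    rw [toUI_apply (slice_continuousOn hpW hD.continuousOn), hDp s s.2]
    rfl
  -- The geodesic equation bounds the acceleration in the chart by K times the square of the maximal
  -- speed. Integrating it twice over [0,1] compares the end point y with its tangential
  -- approximation φ(p) + D(0, y).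
  have hbd : ∀ y ∈ W, ‖y - φ p p - D 0 y‖ ≤ K * ‖toUI (fun s => D s y)‖ ^ 2 := by
    intro y hy
    obtain ⟨hy1, hy2⟩ := hΩ₁ hy.2
    have hgeo := h.geodesic _ hy2
    have hb : ∀ s ∈ Icc (0 : ℝ) 1, ‖D s y‖ ≤ ‖toUI (fun s => D s y)‖ := fun s hs => by
      have := (toUI (fun s => D s y)).norm_coe_le_norm ⟨s, hs⟩
      rwa [toUI_apply (slice_continuousOn hy hD.continuousOn)] at this
    have hd : ∀ s ∈ Icc (0 : ℝ) 1, ∃ w : 𝔼, HasDerivWithinAt (fun s => D s y) w (Icc 0 1) s ∧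
        ‖w‖ ≤ K * ‖toUI (fun s => D s y)‖ ^ 2 := by
      intro s hs
      have h2 := hgeo.hasDerivWithinAt (isCoord_chart p) hs (hy1 s hs).2
      refine ⟨_, h2, ?_⟩
      rw [norm_neg]
      have h3 := (hy1 s hs).1 (D s y)
      exact h3.trans (by gcongr; exact hb s hs)
    choose! w hw using hd
    have hb1 : ∀ s ∈ Icc (0 : ℝ) 1, ‖D s y - D 0 y‖ ≤ K * ‖toUI (fun s => D s y)‖ ^ 2 := by
      intro s hs
      have := (convex_Icc (0 : ℝ) 1).norm_image_sub_le_of_norm_hasDerivWithin_le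
        (fun s hs => (hw s hs).1) (fun s hs => (hw s hs).2) h0 hs
      refine this.trans ?_
      rw [sub_zero, Real.norm_of_nonneg hs.1]
      exact mul_le_of_le_one_right (by positivity) hs.2
    have hG1 : ∀ s ∈ Icc (0 : ℝ) 1, HasDerivWithinAt (fun s => G s y - s • D 0 y)
        (D s y - D 0 y) (Icc 0 1) s := by
      intro s hs
      have h2 : HasDerivWithinAt (fun s => G s y) (D s y) (Icc 0 1) s :=
        (((slice_contDiffOn hy hG').differentiableOn (by simp)) s hs).hasDerivWithinAt
      have h3 := h2.fun_sub ((hasDerivWithinAt_id s (Icc (0 : ℝ) 1)).smul_const (D 0 y))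
      rw [one_smul] at h3
      exact h3
    have := (convex_Icc (0 : ℝ) 1).norm_image_sub_le_of_norm_hasDerivWithin_le hG1 hb1 h0 h1
    have e1 : G 1 y = y := by
      simp only [hGdef, h.target _ hy2, (φ p).right_inv hy.1]
    have e0 : G 0 y = φ p p := by simp only [hGdef, h.source _ hy2]
    rw [e1, e0] at this
    simp only [one_smul, zero_smul, sub_zero, norm_one, mul_one] at this
    rwa [show y - φ p p - D 0 y = y - D 0 y - φ p p by abel]
  -- The velocity vanishes for y = φ(p) and depends differentiably on y in the sup norm, so its
  -- square is o(|y - φ(p)|).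
  have hder : HasFDerivAt (inCoord p (normalCoord n p γ)) (ContinuousLinearMap.id ℝ 𝔼) (φ p p) := by
    rw [hasFDerivAt_iff_isLittleO]
    have hO : (fun y => toUI (fun s => D s y)) =O[𝓝 (φ p p)] fun y => y - φ p p := by
      have := ((hT.contDiffAt (hW.mem_nhds hpW)).differentiableAt (by simp)).isBigO_sub
      simpa only [hTp, sub_zero] using this
    have hO2 : (fun y => ‖toUI (fun s => D s y)‖ ^ 2) =o[𝓝 (φ p p)] fun y => y - φ p p := by
      have h2 := (hO.norm_norm.pow 2)
      refine h2.trans_isLittleO ?_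
      refine Asymptotics.IsLittleO.of_norm_right ?_
      have h3 : Tendsto (fun y => ‖y - φ p p‖) (𝓝 (φ p p)) (𝓝 0) :=
        tendsto_norm_sub_self (φ p p)
      have h4 := (Asymptotics.isLittleO_pow_id (𝕜 := ℝ) (one_lt_two)).comp_tendsto h3
      exact h4
    have hO3 : (fun y => y - φ p p - D 0 y) =O[𝓝 (φ p p)]
        fun y => ‖toUI (fun s => D s y)‖ ^ 2 := by
      refine Asymptotics.IsBigO.of_bound K ?_
      filter_upwards [hW.mem_nhds hpW] with y hy
      rw [norm_pow, norm_norm]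
      exact hbd y hy
    refine (hO3.trans_isLittleO hO2).neg_left.congr_left fun y => ?_
    rw [hΘ, hΘ, hDp 0 h0]
    simp
  have hsm := hΘs.contDiffAt (hW.mem_nhds hpW)
  have hmd := (contMDiffAt_of_inCoord hp hsm).mdifferentiableAt (by simp)
  intro v
  rw [mvfderiv_eq_fderiv_inCoord hp hmd, hder.fderiv, mvfderiv_chart_self]
  rfl

/-- Normal coordinates are smooth. -/
lemma IsNormalNhd.contMDiffAt_normalCoord [T2Space M] (h : IsNormalNhd cov p Ω₀ γ)
    (hcov : cov.ContMDiffCovariantDerivative ∞) {q : M} (hq : q ∈ Ω₀) :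
    ContMDiffAt (𝓡 n) 𝓘(ℝ, 𝔼) ∞ (normalCoord n p γ) q := by
  have h0 : (0 : ℝ) ∈ Icc (0 : ℝ) 1 := ⟨le_rfl, zero_le_one⟩
  have hc := ((h.geodesic q hq).smooth 0 h0).continuousWithinAt.tendsto
  rw [h.source q hq] at hc
  have h1 : ∀ᶠ s in 𝓝[Icc 0 1] (0 : ℝ),
      ContMDiffAt (𝓡 n) 𝓘(ℝ, 𝔼) ∞ (normalCoord n p γ) (γ q s) :=
    hc.eventually (h.normalCoord_near_center hcov).1
  rw [nhdsWithin_Icc_eq_nhdsGE zero_lt_one] at h1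
  have h2 : ∀ᶠ s in 𝓝[>] (0 : ℝ),
      ContMDiffAt (𝓡 n) 𝓘(ℝ, 𝔼) ∞ (normalCoord n p γ) (γ q s) :=
    h1.filter_mono (nhdsWithin_mono _ Ioi_subset_Ici_self)
  -- For small s > 0 the point γ_q(s) lies where normal coordinates are known to be smooth. The
  -- scaling relation Θ(q) = s⁻¹ Θ(γ_q(s)) carries the smoothness to q.
  obtain ⟨s, hs, hs'⟩ := (h2.and (Ioc_mem_nhdsGT zero_lt_one)).exists
  have hsI : s ∈ Icc (0 : ℝ) 1 := ⟨hs'.1.le, hs'.2⟩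
  have h3 := ContMDiffAt.comp q (g := normalCoord n p γ) hs (h.contMDiffAt_curve hq hsI)
  have h4 : ContMDiffAt (𝓡 n) 𝓘(ℝ, 𝔼) ∞ (fun y => s⁻¹ • normalCoord n p γ (γ y s)) q :=
    (contMDiffAt_const (c := s⁻¹) (I' := 𝓘(ℝ, ℝ))).smul (g := normalCoord n p γ ∘ fun q => γ q s) h3
  refine h4.congr_of_eventuallyEq ?_
  filter_upwards [h.isOpen.mem_nhds hq] with y hy
  rw [h.normalCoord_curve hy hsI, inv_smul_smul₀ hs'.1.ne']

lemma eventually_injective_mvfderiv {f : M → 𝔼} {q : M} (hf : ContMDiffAt (𝓡 n) 𝓘(ℝ, 𝔼) ∞ f q)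
    (hi : Function.Injective (mvfderiv (𝓡 n) f q)) :
    ∀ᶠ y in 𝓝 q, Function.Injective (mvfderiv (𝓡 n) f y) := by
  have hq := mem_extChartAt_source (I := 𝓡 n) q
  have hc := (contMDiffAt_fderiv_inCoord hf).continuousAt
  have hi' : Function.Injective (fderiv ℝ (inCoord q f) (φ q q)) := by
    intro v w hvw
    have e : ∀ v : TangentSpace (𝓡 n) q, mvfderiv (𝓡 n) f q v = fderiv ℝ (inCoord q f) (φ q q) v := fun v => by
      rw [mvfderiv_eq_fderiv_inCoord hq (hf.mdifferentiableAt (by simp)), mvfderiv_chart_self]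
    exact hi ((e v).trans (hvw.trans (e w).symm))
  let e : 𝔼 ≃L[ℝ] 𝔼 := (LinearEquiv.ofInjectiveEndo
    (fderiv ℝ (inCoord q f) (φ q q)).toLinearMap hi').toContinuousLinearEquiv
  have he : (e : 𝔼 →L[ℝ] 𝔼) = fderiv ℝ (inCoord q f) (φ q q) := by ext; rfl
  have hn := ContinuousLinearEquiv.nhds e
  rw [he] at hn
  filter_upwards [hc hn, source_mem_nhds hq, eventually_mdiff hf] with y hy hy1 hy2 v w hvw
  obtain ⟨e', he''⟩ := hy
  have he' : (e' : 𝔼 →L[ℝ] 𝔼) = fderiv ℝ (inCoord q f) (φ q y) := he''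
  rw [mvfderiv_eq_fderiv_inCoord hy1 hy2, mvfderiv_eq_fderiv_inCoord hy1 hy2, ← he'] at hvw
  exact (isCoord_chart q).injective y hy1 (e'.injective hvw)

/-- Differentiate Θ(γ_q(r)) = r Θ(q) in q: a vector killed by dΘ at q is killed by the composition
of two injective maps. -/
lemma IsNormalNhd.injective_of_curve [T2Space M] (h : IsNormalNhd cov p Ω₀ γ)
    (hcov : cov.ContMDiffCovariantDerivative ∞) {q : M} (hq : q ∈ Ω₀) {r : ℝ}
    (hr : r ∈ Icc (0 : ℝ) 1)
    (h1 : Function.Injective (mvfderiv (𝓡 n) (normalCoord n p γ) (γ q r)))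
    (h2 : Function.Injective (mfderiv (𝓡 n) (𝓡 n) (fun q => γ q r) q)) :
    Function.Injective (mvfderiv (𝓡 n) (normalCoord n p γ) q) := by
  rw [injective_iff_map_eq_zero]
  intro v hv
  have hd := h.contMDiffAt_normalCoord hcov (h.mapsTo q hq hr)
  have h3 := mfderiv_comp_apply (I := 𝓡 n) (I' := 𝓡 n) (I'' := 𝓘(ℝ, 𝔼)) q
    (g := normalCoord n p γ) (f := fun q => γ q r) (hd.mdifferentiableAt (by simp))
    ((h.contMDiffAt_curve hq hr).mdifferentiableAt (by simp)) v
  have h4 : (normalCoord n p γ ∘ fun q => γ q r) =ᶠ[𝓝 q] fun y => r • normalCoord n p γ y := by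
    filter_upwards [h.isOpen.mem_nhds hq] with y hy
    exact h.normalCoord_curve hy hr
  have h5 : mvfderiv (𝓡 n) (normalCoord n p γ ∘ fun q => γ q r) q v = 0 := by
    rw [mvfderiv_congr h4, mvfderiv_comp_fderiv (g := fun y : 𝔼 => r • y) (by fun_prop)
      ((h.contMDiffAt_normalCoord hcov hq).mdifferentiableAt (by simp)), hv, map_zero]
  have h6 : mvfderiv (𝓡 n) (normalCoord n p γ) (γ q r)
      (mfderiv (𝓡 n) (𝓡 n) (fun q => γ q r) q v) = 0 := h3.symm.trans h5
  have h7 := h1 (h6.trans (map_zero _).symm)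
  exact h2 (h7.trans (map_zero _).symm)

/-- The map q ↦ γ_q(r) is the identity for r = 1, and its differential depends continuously on r;
invertibility is an open condition. -/
lemma IsNormalNhd.eventually_injective_curve (h : IsNormalNhd cov p Ω₀ γ) {q : M} (hq : q ∈ Ω₀) :
    ∀ᶠ r in 𝓝[Icc 0 1] (1 : ℝ),
      Function.Injective (mfderiv (𝓡 n) (𝓡 n) (fun q => γ q r) q) := by
  have hqs := mem_extChartAt_source (I := 𝓡 n) q
  have h1 : (1 : ℝ) ∈ Icc (0 : ℝ) 1 := ⟨zero_le_one, le_rfl⟩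
  have hc := h.smooth.continuousOn (1, q) ⟨h1, hq⟩
  have h2 : (fun z : ℝ × M => γ z.2 z.1) ⁻¹' (φ q).source ∈ 𝓝[Icc (0 : ℝ) 1 ×ˢ Ω₀] (1, q) :=
    hc (by simpa only [h.target q hq] using source_mem_nhds hqs)
  obtain ⟨S, hS, Ω₁, hΩ₁, hsub⟩ := mem_nhdsWithin_prod_iff.1 h2
  rw [nhdsWithin_Icc_eq_nhdsLE zero_lt_one] at hS
  rw [h.isOpen.nhdsWithin_eq hq] at hΩ₁
  -- Only times in [l, 1] are used, for which the geodesics to points near q remain in the chart at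
  -- q.
  obtain ⟨l, hl, hlS⟩ := mem_nhdsLE_iff_exists_Icc_subset.1
    (Filter.inter_mem hS (Icc_mem_nhdsLE zero_lt_one))
  obtain ⟨Ω₂, hΩ₂, hΩ₂o, hqΩ₂⟩ := mem_nhds_iff.1 (Filter.inter_mem hΩ₁ (h.isOpen.mem_nhds hq))
  have hG : ContMDiffOn (𝓘(ℝ, ℝ).prod (𝓡 n)) 𝓘(ℝ, 𝔼) ∞ (fun z : ℝ × M => φ q (γ z.2 z.1))
      (Icc l 1 ×ˢ Ω₂) :=
    (contMDiffOn_extChartAt (n := ∞) (I := 𝓡 n) (x := q)).comp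
      (h.smooth.mono (prod_mono (fun r hr => (hlS hr).2) fun q hq => (hΩ₂ hq).2))
      fun z hz => by simpa using hsub (mk_mem_prod (hlS hz.1).1 (hΩ₂ hz.2).1)
  set W := chartRange (n := n) q Ω₂ with hWdef
  have hW : IsOpen W := isOpen_chartRange q hΩ₂o
  have hqW : φ q q ∈ W := mem_chartRange hqs hqΩ₂
  have hG' := contDiffOn_family (G := fun s y => φ q (γ y s)) hG q
  have hud : UniqueDiffOn ℝ (Icc l 1 ×ˢ W) := (uniqueDiffOn_Icc hl).prod hW.uniqueDiffOn
  have hA := hG'.continuousOn_fderivWithin hud (by simp)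
  set A : ℝ → 𝔼 →L[ℝ] 𝔼 := fun r => (fderivWithin ℝ (fun z : ℝ × 𝔼 =>
    φ q (γ ((φ q).symm z.2) z.1)) (Icc l 1 ×ˢ W) (r, φ q q)).comp (ContinuousLinearMap.inr ℝ ℝ 𝔼)
  have hAd : ∀ r ∈ Icc l 1, HasFDerivAt (inCoord q fun y => φ q (γ y r)) (A r) (φ q q) := by
    intro r hr
    have h3 := ((hG'.differentiableOn (by simp)) (r, φ q q) ⟨hr, hqW⟩).hasFDerivWithinAt
    have h4 : HasFDerivWithinAt (fun y : 𝔼 => (r, y)) (ContinuousLinearMap.inr ℝ ℝ 𝔼) W (φ q q) :=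
      (hasFDerivAt_prodMk_right r (φ q q)).hasFDerivWithinAt
    exact (HasFDerivWithinAt.comp (φ q q) h3 h4 (fun y hy => ⟨hr, hy⟩)).hasFDerivAt
      (hW.mem_nhds hqW)
  have hA1 : A 1 = ContinuousLinearMap.id ℝ 𝔼 := by
    refine (hAd 1 ⟨hl.le, le_rfl⟩).unique ((hasFDerivAt_id (φ q q)).congr_of_eventuallyEq ?_)
    filter_upwards [hW.mem_nhds hqW] with y hy
    have := h.target _ (hΩ₂ hy.2).2
    simp only [inCoord, this, (φ q).right_inv hy.1, id]
  have hAc : ContinuousWithinAt A (Icc l 1) 1 := by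
    refine ContinuousWithinAt.clm_comp ?_ continuousWithinAt_const
    exact (hA (1, φ q q) ⟨⟨hl.le, le_rfl⟩, hqW⟩).comp (f := fun r : ℝ => (r, φ q q))
      (by fun_prop) (fun r hr => ⟨hr, hqW⟩)
  have hn := ContinuousLinearEquiv.nhds (ContinuousLinearEquiv.refl ℝ 𝔼)
  have hn' : range ((↑) : (𝔼 ≃L[ℝ] 𝔼) → 𝔼 →L[ℝ] 𝔼) ∈ 𝓝 (A 1) := by rw [hA1]; exact hn
  have hev : ∀ᶠ r in 𝓝[Icc l 1] (1 : ℝ), A r ∈ range ((↑) : (𝔼 ≃L[ℝ] 𝔼) → 𝔼 →L[ℝ] 𝔼) := hAc hn'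
  rw [nhdsWithin_Icc_eq_nhdsLE zero_lt_one]
  rw [nhdsWithin_Icc_eq_nhdsLE hl] at hev
  filter_upwards [hev, Icc_mem_nhdsLE hl] with r ⟨e, he⟩ hr
  rw [injective_iff_map_eq_zero]
  intro v hv
  have hrI := (hlS hr).2
  have hsrc : γ q r ∈ (φ q).source := hsub (mk_mem_prod (hlS hr).1 (hΩ₂ hqΩ₂).1)
  have hd1 := (contMDiffAt_chart hsrc).mdifferentiableAt (n := ∞) (by simp)
  have hd2 := (h.contMDiffAt_curve hq hrI).mdifferentiableAt (by simp)
  have hd3 : MDifferentiableAt (𝓡 n) 𝓘(ℝ, 𝔼) (fun y => φ q (γ y r)) q := hd1.comp q hd2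
  have h3 : mvfderiv (𝓡 n) (fun y => φ q (γ y r)) q v =
      mvfderiv (𝓡 n) (φ q) (γ q r) (mfderiv (𝓡 n) (𝓡 n) (fun q => γ q r) q v) :=
    mfderiv_comp_apply (I := 𝓡 n) (I' := 𝓡 n) (I'' := 𝓘(ℝ, 𝔼)) q
      (g := φ q) (f := fun q => γ q r) hd1 hd2 v
  rw [hv, map_zero, mvfderiv_eq_fderiv_inCoord hqs hd3, (hAd r hr).fderiv,
    mvfderiv_chart_self, ← he] at h3
  exact e.injective (h3.trans (map_zero _).symm)

/-- Normal coordinates are coordinates. -/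
theorem IsNormalNhd.isCoord_normalCoord [T2Space M] (h : IsNormalNhd cov p Ω₀ γ)
    (hcov : cov.ContMDiffCovariantDerivative ∞) : IsCoord (normalCoord n p γ) Ω₀ where
  isOpen := h.isOpen
  smooth _ hq := h.contMDiffAt_normalCoord hcov hq
  injective q hq := by
    have h0 : (0 : ℝ) ∈ Icc (0 : ℝ) 1 := ⟨le_rfl, zero_le_one⟩
    have h1 : (1 : ℝ) ∈ Icc (0 : ℝ) 1 := ⟨zero_le_one, le_rfl⟩
    let P : ℝ → Prop := fun r => Function.Injective (mvfderiv (𝓡 n) (normalCoord n p γ) (γ q r))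
    have hopen : ∀ s ∈ Icc (0 : ℝ) 1, P s → ∀ᶠ r in 𝓝[Icc 0 1] s, P r := by
      intro s hs hP
      exact ((h.geodesic q hq).smooth s hs).continuousWithinAt.eventually
        (eventually_injective_mvfderiv (h.contMDiffAt_normalCoord hcov (h.mapsTo q hq hs)) hP)
    -- Injectivity of dΘ passes from the earlier points of the geodesic to γ_q(s): going back by a
    -- factor r < 1 close to 1 is an immersion at γ_q(s). At s = 0 the differential is the identity.
    have hleft : ∀ s ∈ Icc (0 : ℝ) 1, (∀ r ∈ Ico 0 s, P r) → P s := by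
      intro s hs hP
      rcases hs.1.eq_or_lt with rfl | hs0
      · change Function.Injective (mvfderiv (𝓡 n) (normalCoord n p γ) (γ q 0))
        rw [h.source q hq]
        intro v w hvw
        rwa [(h.normalCoord_near_center hcov).2, (h.normalCoord_near_center hcov).2] at hvw
      have h2 := h.eventually_injective_curve (h.mapsTo q hq hs)
      rw [nhdsWithin_Icc_eq_nhdsLE zero_lt_one] at h2
      have h3 := h2.filter_mono (nhdsWithin_mono _ Iio_subset_Iic_self)
      obtain ⟨r, hr, hr'⟩ := (h3.and (Ico_mem_nhdsLT zero_lt_one)).exists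
      have hrI : r ∈ Icc (0 : ℝ) 1 := ⟨hr'.1, hr'.2.le⟩
      refine h.injective_of_curve hcov (h.mapsTo q hq hs) hrI ?_ hr
      rw [h.curve_curve hq hs hrI]
      exact hP _ ⟨mul_nonneg hs.1 hr'.1, mul_lt_of_lt_one_right hs0 hr'.2⟩
    -- Continuous induction in the time along the geodesic from p to q, with `hopen` and `hleft` as
    -- the two steps.
    let S : Set ℝ := {s | ∀ r ∈ Icc 0 s, P r}
    have key : Icc (0 : ℝ) 1 ⊆ S := by
      refine IsClosed.Icc_subset_of_forall_exists_gt ?_ ?_ ?_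
      · refine isClosed_of_closure_subset fun s hs => ?_
        have hsI : s ∈ Icc (0 : ℝ) 1 := closure_minimal inter_subset_right isClosed_Icc hs
        refine ⟨?_, hsI⟩
        have hlt : ∀ r ∈ Ico 0 s, P r := by
          intro r hr
          obtain ⟨s', hs', hs''⟩ := mem_closure_iff_nhds.1 hs (Ioi r) (Ioi_mem_nhds hr.2)
          exact hs''.1 r ⟨hr.1, le_of_lt hs'⟩
        intro r hr
        rcases hr.2.eq_or_lt with rfl | hr'
        · exact hleft _ hsI hlt
        · exact hlt r ⟨hr.1, hr'⟩
      · intro r hr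
        obtain rfl : r = 0 := le_antisymm hr.2 hr.1
        exact hleft 0 h0 fun r hr => absurd hr.2 (not_lt.2 hr.1)
      · intro s ⟨hs, hsI⟩ y hy
        have h2 := hopen s ⟨hsI.1, hsI.2.le⟩ (hs s ⟨hsI.1, le_rfl⟩)
        have h3 : ∀ᶠ r in 𝓝[≥] s, P r := by
          have : 𝓝[Icc s 1] s ≤ 𝓝[Icc 0 1] s := nhdsWithin_mono _ (Icc_subset_Icc_left hsI.1)
          rw [nhdsWithin_Icc_eq_nhdsGE hsI.2] at this
          exact h2.filter_mono this
        obtain ⟨u, hu, hu'⟩ := mem_nhdsGE_iff_exists_Icc_subset.1 h3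
        refine ⟨min u y, fun r hr => ?_, lt_min hu hy, min_le_right _ _⟩
        rcases le_total r s with hrs | hrs
        · exact hs r ⟨hr.1, hrs⟩
        · exact hu' ⟨hrs, hr.2.trans (min_le_left _ _)⟩
    have h2 : Function.Injective (mvfderiv (𝓡 n) (normalCoord n p γ) (γ q 1)) := key h1 1 h1
    rwa [h.target q hq] at h2

/-- The components of the velocity of the radial geodesics in normal coordinates are constant. -/
lemma IsNormalNhd.mvfderiv_velocity [T2Space M] (h : IsNormalNhd cov p Ω₀ γ)
    (hcov : cov.ContMDiffCovariantDerivative ∞) {q : M} (hq : q ∈ Ω₀) {s : ℝ}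
    (hs : s ∈ Icc (0 : ℝ) 1) :
    mvfderiv (𝓡 n) (normalCoord n p γ) (γ q s) (velocity (γ q) s) = normalCoord n p γ q := by
  have h1 := hasDerivWithinAt_comp_curve (c := γ q) (s := s)
    ((h.contMDiffAt_normalCoord hcov (h.mapsTo q hq hs)).mdifferentiableAt (by simp))
    (mdiffWithinAt_curve (h.geodesic q hq).smooth hs)
  have h2 : HasDerivWithinAt (fun r => normalCoord n p γ (γ q r)) (normalCoord n p γ q)
      (Icc 0 1) s := by
    have h3 := (hasDerivWithinAt_id s (Icc (0 : ℝ) 1)).smul_const (normalCoord n p γ q)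
    rw [one_smul] at h3
    exact h3.congr (fun r hr => h.normalCoord_curve hq hr) (h.normalCoord_curve hq hs)
  exact (uniqueDiffOn_Icc zero_lt_one s hs).eq_deriv _ h1 h2

lemma IsNormalNhd.velocity_eq [T2Space M] (h : IsNormalNhd cov p Ω₀ γ)
    (hcov : cov.ContMDiffCovariantDerivative ∞) {q : M} (hq : q ∈ Ω₀) {s : ℝ}
    (hs : s ∈ Icc (0 : ℝ) 1) :
    velocity (γ q) s = frame (normalCoord n p γ) (normalCoord n p γ q) (γ q s) := by
  rw [← h.mvfderiv_velocity hcov hq hs,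
    (h.isCoord_normalCoord hcov).frame_apply (h.mapsTo q hq hs)]

end NormalCoordinates

end GeomOsc
end

noncomputable section

set_option linter.unusedSectionVars false

namespace GeomOsc

universe u v

/-! ### Parallel transport along radial geodesics -/

section Transport

open Set Filter Bundle

variable {n : ℕ} {M : Type u} [TopologicalSpace M] [ChartedSpace (EuclideanSpace ℝ (Fin n)) M]
  [IsManifold (𝓡 n) ∞ M]
variable {F : Type} [NormedAddCommGroup F] [NormedSpace ℝ F]

local notation "𝔼" => EuclideanSpace ℝ (Fin n)
local notation "φ" => extChartAt (𝓡 n)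

variable {cov : Connection n M} {p : M} {Ω₀ : Set M} {γ : M → ℝ → M}

lemma IsNormalNhd.contMDiffOn_comp (h : IsNormalNhd cov p Ω₀ γ) {f : M → F}
    (hf : ∀ q ∈ Ω₀, ContMDiffAt (𝓡 n) 𝓘(ℝ, F) ∞ f q) :
    ContMDiffOn (𝓘(ℝ, ℝ).prod (𝓡 n)) 𝓘(ℝ, F) ∞ (fun z : ℝ × M => f (γ z.2 z.1))
      (Icc 0 1 ×ˢ Ω₀) :=
  fun z hz => (hf _ (h.mapsTo z.2 hz.2 hz.1)).comp_contMDiffWithinAt z (h.smooth z hz)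

lemma contMDiffOn_snd_comp {f : M → F} {S : Set ℝ}
    (hf : ∀ q ∈ Ω₀, ContMDiffAt (𝓡 n) 𝓘(ℝ, F) ∞ f q) :
    ContMDiffOn (𝓘(ℝ, ℝ).prod (𝓡 n)) 𝓘(ℝ, F) ∞ (fun z : ℝ × M => f z.2) (S ×ˢ Ω₀) :=
  fun z hz => (hf _ hz.2).comp_contMDiffWithinAt z contMDiffWithinAt_snd

lemma contMDiffOn_slice {G : ℝ → M → F}
    (hG : ContMDiffOn (𝓘(ℝ, ℝ).prod (𝓡 n)) 𝓘(ℝ, F) ∞ (fun z : ℝ × M => G z.1 z.2)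
      (Icc 0 1 ×ˢ Ω₀)) {q : M} (hq : q ∈ Ω₀) : ContDiffOn ℝ ∞ (fun s => G s q) (Icc 0 1) := by
  rw [← contMDiffOn_iff_contDiffOn]
  exact hG.comp (f := fun s => (s, q)) (contMDiff_id.prodMk contMDiff_const).contMDiffOn
    (fun s hs => ⟨hs, hq⟩)

variable (cov p γ) in
/-- The matrix of the equation of parallel transport along radial geodesics. -/
def transportGen (q : M) (s : ℝ) : EuclideanSpace ℝ (Fin n) →L[ℝ] EuclideanSpace ℝ (Fin n) :=
  christoffelMap cov (normalCoord n p γ) (normalCoord n p γ q) (γ q s)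

lemma IsNormalNhd.contMDiffOn_transportGen [T2Space M] (h : IsNormalNhd cov p Ω₀ γ)
    (hcov : cov.ContMDiffCovariantDerivative ∞) :
    ContMDiffOn (𝓘(ℝ, ℝ).prod (𝓡 n)) 𝓘(ℝ, 𝔼 →L[ℝ] 𝔼) ∞
      (fun z : ℝ × M => transportGen cov p γ z.2 z.1) (Icc 0 1 ×ˢ Ω₀) := by
  unfold transportGen christoffelMap
  intro z hz
  refine ContMDiffWithinAt.sum fun i _ => ContMDiffWithinAt.sum fun j _ => ?_
  have h1 : ContMDiffOn (𝓘(ℝ, ℝ).prod (𝓡 n)) 𝓘(ℝ, ℝ) ∞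
      (fun z : ℝ × M => normalCoord n p γ z.2 i) (Icc 0 1 ×ˢ Ω₀) :=
    (EuclideanSpace.proj (𝕜 := ℝ) i : 𝔼 →L[ℝ] ℝ).contDiff.contMDiff.comp_contMDiffOn
      (contMDiffOn_snd_comp (f := normalCoord n p γ) fun q hq => h.contMDiffAt_normalCoord hcov hq)
  have h2 := h.contMDiffOn_comp (f := christoffel cov (normalCoord n p γ)
    (EuclideanSpace.single i 1) (EuclideanSpace.single j 1)) fun q hq =>
      contMDiffAt_christoffel hcov (h.isCoord_normalCoord hcov) hq _ _
  have h3 := (ContinuousLinearMap.smulRightL ℝ 𝔼 𝔼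
    (EuclideanSpace.proj (𝕜 := ℝ) j)).contDiff.contMDiff.comp_contMDiffOn h2
  exact (h1.smul h3) z hz

variable (cov p γ) in
/-- The components of the parallel field along `γ q` that ends in the vector with components
`v`. -/
def parallelCoord (v : EuclideanSpace ℝ (Fin n)) (q : M) : C(UI, EuclideanSpace ℝ (Fin n)) :=
  linSol (toUI (transportGen cov p γ q)) v

lemma IsNormalNhd.contMDiffAt_parallelCoord [T2Space M] (h : IsNormalNhd cov p Ω₀ γ)
    (hcov : cov.ContMDiffCovariantDerivative ∞) (v : 𝔼) {q : M} (hq : q ∈ Ω₀) :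
    ContMDiffAt (𝓡 n) 𝓘(ℝ, C(UI, 𝔼)) ∞ (parallelCoord cov p γ v) q :=
  (contDiff_linSol v).contMDiff.contMDiffAt.comp q
    (contMDiffAt_toUI (G := fun s q => transportGen cov p γ q s) h.isOpen
      (h.contMDiffOn_transportGen hcov) hq)

lemma IsNormalNhd.contDiffOn_transportGen [T2Space M] (h : IsNormalNhd cov p Ω₀ γ)
    (hcov : cov.ContMDiffCovariantDerivative ∞) {q : M} (hq : q ∈ Ω₀) :
    ContDiffOn ℝ ∞ (transportGen cov p γ q) (Icc 0 1) :=
  contMDiffOn_slice (G := fun s q => transportGen cov p γ q s) (h.contMDiffOn_transportGen hcov) hq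

lemma IsNormalNhd.hasDerivWithinAt_parallelCoord [T2Space M] (h : IsNormalNhd cov p Ω₀ γ)
    (hcov : cov.ContMDiffCovariantDerivative ∞) (v : 𝔼) {q : M} (hq : q ∈ Ω₀) {s : ℝ}
    (hs : s ∈ Icc (0 : ℝ) 1) :
    HasDerivWithinAt (extUI (parallelCoord cov p γ v q))
      (-(transportGen cov p γ q s (extUI (parallelCoord cov p γ v q) s))) (Icc 0 1) s := by
  have h1 := hasDerivWithinAt_linSol (toUI (transportGen cov p γ q)) v hs
  rwa [extUI_toUI (h.contDiffOn_transportGen hcov hq).continuousOn hs] at h1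

lemma IsNormalNhd.eq_parallelCoord [T2Space M] (h : IsNormalNhd cov p Ω₀ γ)
    (hcov : cov.ContMDiffCovariantDerivative ∞) {q : M} (hq : q ∈ Ω₀) {w : ℝ → 𝔼}
    (hw : ∀ s ∈ Icc (0 : ℝ) 1, HasDerivWithinAt w (-(transportGen cov p γ q s (w s))) (Icc 0 1) s)
    {s : ℝ} (hs : s ∈ Icc (0 : ℝ) 1) : w s = extUI (parallelCoord cov p γ (w 1) q) s :=
  eq_linSol_of_hasDerivWithinAt (fun s hs => by
    rw [extUI_toUI (h.contDiffOn_transportGen hcov hq).continuousOn hs]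
    exact hw s hs) hs

lemma parallelCoord_one (v : 𝔼) (q : M) : extUI (parallelCoord cov p γ v q) 1 = v :=
  linSol_one _ _

lemma IsNormalNhd.contDiffOn_parallelCoord [T2Space M] (h : IsNormalNhd cov p Ω₀ γ)
    (hcov : cov.ContMDiffCovariantDerivative ∞) (v : 𝔼) {q : M} (hq : q ∈ Ω₀) :
    ContDiffOn ℝ ∞ (extUI (parallelCoord cov p γ v q)) (Icc 0 1) :=
  contDiffOn_of_hasDerivWithinAt (h.contDiffOn_transportGen hcov hq)
    fun _ hs => h.hasDerivWithinAt_parallelCoord hcov v hq hs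

lemma IsNormalNhd.covDerivAlong_curve [T2Space M] (h : IsNormalNhd cov p Ω₀ γ)
    (hcov : cov.ContMDiffCovariantDerivative ∞) {q : M} (hq : q ∈ Ω₀)
    {V : ∀ s, TangentSpace (𝓡 n) (γ q s)} {s : ℝ} (hs : s ∈ Icc (0 : ℝ) 1) {v : 𝔼}
    (hv : HasDerivWithinAt (fun r => mvfderiv (𝓡 n) (normalCoord n p γ) (γ q r) (V r)) v
      (Icc 0 1) s) :
    covDerivAlong cov (γ q) V s = frame (normalCoord n p γ)
      (v + transportGen cov p γ q s (mvfderiv (𝓡 n) (normalCoord n p γ) (γ q s) (V s)))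
      (γ q s) := by
  have hΘ := h.isCoord_normalCoord hcov
  have hs' := h.mapsTo q hq hs
  rw [covDerivAlong_eq hΘ hs hs' (mdiffWithinAt_curve (h.geodesic q hq).smooth hs)
    hv.differentiableWithinAt, hv.derivWithin (uniqueDiffOn_Icc zero_lt_one s hs), frame_add,
    transportGen, h.velocity_eq hcov hq hs, cov_frame_frame hΘ hs']

lemma IsNormalNhd.isParallel [T2Space M] (h : IsNormalNhd cov p Ω₀ γ)
    (hcov : cov.ContMDiffCovariantDerivative ∞) (v : 𝔼) {q : M} (hq : q ∈ Ω₀) :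
    IsParallel cov (γ q) fun s =>
      frame (normalCoord n p γ) (extUI (parallelCoord cov p γ v q) s) (γ q s) where
  smooth := smoothAlong_frame (h.isCoord_normalCoord hcov) (h.geodesic q hq).smooth
    (h.mapsTo q hq) (h.contDiffOn_parallelCoord hcov v hq)
  eq_zero s hs := by
    have hΘ := h.isCoord_normalCoord hcov
    have e : ∀ r ∈ Icc (0 : ℝ) 1, mvfderiv (𝓡 n) (normalCoord n p γ) (γ q r)
        (frame (normalCoord n p γ) (extUI (parallelCoord cov p γ v q) r) (γ q r)) =
        extUI (parallelCoord cov p γ v q) r := fun r hr => hΘ.apply_frame (h.mapsTo q hq hr) _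
    have h1 := (h.hasDerivWithinAt_parallelCoord hcov v hq hs).congr e (e s hs)
    rw [h.covDerivAlong_curve hcov hq hs h1, e s hs, neg_add_cancel]
    exact map_zero _

/-- Parallel transport along radial geodesics in normal coordinates. -/
lemma IsNormalNhd.transport_eq [T2Space M] (h : IsNormalNhd cov p Ω₀ γ)
    (hcov : cov.ContMDiffCovariantDerivative ∞) {q : M} (hq : q ∈ Ω₀)
    (X : TangentSpace (𝓡 n) (γ q 1)) {s : ℝ} (hs : s ∈ Icc (0 : ℝ) 1) :
    transport cov (γ q) X s = frame (normalCoord n p γ)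
      (extUI (parallelCoord cov p γ (mvfderiv (𝓡 n) (normalCoord n p γ) (γ q 1) X) q) s)
      (γ q s) := by
  have hΘ := h.isCoord_normalCoord hcov
  have h1 : (1 : ℝ) ∈ Icc (0 : ℝ) 1 := ⟨zero_le_one, le_rfl⟩
  have hex : ∃ V : ∀ s, TangentSpace (𝓡 n) (γ q s), IsParallel cov (γ q) V ∧ V 1 = X :=
    ⟨_, h.isParallel hcov (mvfderiv (𝓡 n) (normalCoord n p γ) (γ q 1) X) hq, by
      rw [parallelCoord_one, hΘ.frame_apply (h.mapsTo q hq h1)]⟩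
  rw [transport, dif_pos hex]
  -- The field in `transport` is an arbitrary choice; uniqueness for the linear equation identifies
  -- it.
  obtain ⟨hV, hV1⟩ := hex.choose_spec
  set V := hex.choose
  have hd : ∀ s ∈ Icc (0 : ℝ) 1, HasDerivWithinAt
      (fun r => mvfderiv (𝓡 n) (normalCoord n p γ) (γ q r) (V r))
      (-(transportGen cov p γ q s (mvfderiv (𝓡 n) (normalCoord n p γ) (γ q s) (V s))))
      (Icc 0 1) s := by
    intro s hs
    have h2 := ((hV.smooth.contDiffWithinAt hΘ hs (h.mapsTo q hq hs)).differentiableWithinAt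
      (by simp)).hasDerivWithinAt
    have h3 := h.covDerivAlong_curve hcov hq hs h2
    rw [hV.eq_zero s hs] at h3
    have h4 := congrArg (mvfderiv (𝓡 n) (normalCoord n p γ) (γ q s)) h3
    rw [hΘ.apply_frame (h.mapsTo q hq hs), map_zero] at h4
    rwa [eq_neg_of_add_eq_zero_left h4.symm] at h2
  have h5 := h.eq_parallelCoord hcov hq hd hs
  rw [hV1] at h5
  rw [← h5, hΘ.frame_apply (h.mapsTo q hq hs)]

/-- The velocity of a geodesic is parallel, and in normal coordinates its components along a radial
geodesic are constant. -/
lemma IsNormalNhd.transportGen_normalCoord [T2Space M] (h : IsNormalNhd cov p Ω₀ γ)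
    (hcov : cov.ContMDiffCovariantDerivative ∞) {q : M} (hq : q ∈ Ω₀) {s : ℝ}
    (hs : s ∈ Icc (0 : ℝ) 1) : transportGen cov p γ q s (normalCoord n p γ q) = 0 := by
  have hΘ := h.isCoord_normalCoord hcov
  have e : ∀ r ∈ Icc (0 : ℝ) 1, mvfderiv (𝓡 n) (normalCoord n p γ) (γ q r) (velocity (γ q) r) =
      normalCoord n p γ q := fun r hr => h.mvfderiv_velocity hcov hq hr
  have h1 := (hasDerivWithinAt_const s (Icc (0 : ℝ) 1) (normalCoord n p γ q)).congr e (e s hs)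
  have h3 := h.covDerivAlong_curve hcov hq hs h1
  rw [(h.geodesic q hq).eq_zero s hs, e s hs, zero_add] at h3
  have h4 := congrArg (mvfderiv (𝓡 n) (normalCoord n p γ) (γ q s)) h3
  rw [hΘ.apply_frame (h.mapsTo q hq hs), map_zero] at h4
  exact h4.symm

lemma IsNormalNhd.parallelCoord_normalCoord [T2Space M] (h : IsNormalNhd cov p Ω₀ γ)
    (hcov : cov.ContMDiffCovariantDerivative ∞) {q : M} (hq : q ∈ Ω₀) {s : ℝ}
    (hs : s ∈ Icc (0 : ℝ) 1) :
    extUI (parallelCoord cov p γ (normalCoord n p γ q) q) s = normalCoord n p γ q := by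
  refine (h.eq_parallelCoord hcov hq (w := fun _ => normalCoord n p γ q) (fun s hs => ?_) hs).symm
  rw [h.transportGen_normalCoord hcov hq hs, neg_zero]
  exact hasDerivWithinAt_const _ _ _

/-- The generator is linear in the normal coordinates of the end point, which vanish at p. -/
lemma IsNormalNhd.parallelCoord_center [T2Space M] (h : IsNormalNhd cov p Ω₀ γ)
    (hcov : cov.ContMDiffCovariantDerivative ∞) (v : 𝔼) {s : ℝ}
    (hs : s ∈ Icc (0 : ℝ) 1) : extUI (parallelCoord cov p γ v p) s = v := by
  refine (h.eq_parallelCoord hcov h.mem (w := fun _ => v) (fun s hs => ?_) hs).symm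
  have : transportGen cov p γ p s v = 0 := by
    rw [transportGen, h.normalCoord_center]
    have h0 := christoffelMap_smul (cov := cov) (Θ := normalCoord n p γ) 0 (0 : 𝔼) (γ p s)
    rw [smul_zero] at h0
    rw [h0]
    exact zero_smul ℝ (christoffelMap cov (normalCoord n p γ) 0 (γ p s) v)
  rw [this, neg_zero]
  exact hasDerivWithinAt_const _ _ _

end Transport

end GeomOsc
end

noncomputable section

set_option linter.unusedSectionVars false

namespace GeomOsc

universe u v

/-! ### Weighted Hessians in normal coordinates -/

section WeightedForms

open Set Filter Bundle

variable {n : ℕ} {M : Type u} [TopologicalSpace M] [ChartedSpace (EuclideanSpace ℝ (Fin n)) M]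
  [IsManifold (𝓡 n) ∞ M]
variable {F : Type v} [NormedAddCommGroup F] [NormedSpace ℝ F]

local notation "𝔼" => EuclideanSpace ℝ (Fin n)
local notation "φ" => extChartAt (𝓡 n)

variable {cov : Connection n M} {p : M} {Ω₀ : Set M} {γ : M → ℝ → M}
variable {Θ : M → EuclideanSpace ℝ (Fin n)} {U : Set M}

/-- The derivative along a coordinate field. -/
def frameDeriv (Θ : M → EuclideanSpace ℝ (Fin n)) (i : Fin n) (f : M → F) (y : M) : F :=
  mvfderiv (𝓡 n) f y (frame Θ (EuclideanSpace.single i 1) y)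

lemma contMDiffAt_frameDeriv (hΘ : IsCoord Θ U) {f : M → F} {q : M} (hq : q ∈ U)
    (hf : ContMDiffAt (𝓡 n) 𝓘(ℝ, F) ∞ f q) (i : Fin n) :
    ContMDiffAt (𝓡 n) 𝓘(ℝ, F) ∞ (frameDeriv Θ i f) q :=
  contMDiffAt_mvfderiv hf (hΘ.vfSmoothAt_frame hq _)

lemma mvfderiv_frame (f : M → F) (v : 𝔼) (y : M) :
    mvfderiv (𝓡 n) f y (frame Θ v y) = ∑ i, v i • frameDeriv Θ i f y := by
  rw [frame_eq_sum v]
  simp only [map_sum, map_smul, frameDeriv]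

variable (cov Θ) in
/-- The components of the Hessian in coordinates. -/
def hessComp (f : M → F) (i j : Fin n) (y : M) : F :=
  hess cov f y (frame Θ (EuclideanSpace.single i 1) y) (frame Θ (EuclideanSpace.single j 1) y)

lemma hess_sum_left {f : M → F} {x : M} (hf : ContMDiffAt (𝓡 n) 𝓘(ℝ, F) ∞ f x) {ι : Type*}
    (s : Finset ι) (c : ι → ℝ) (X : ι → TangentSpace (𝓡 n) x) (Y : TangentSpace (𝓡 n) x) :
    hess cov f x (∑ i ∈ s, c i • X i) Y = ∑ i ∈ s, c i • hess cov f x (X i) Y := by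
  let L : TangentSpace (𝓡 n) x →ₗ[ℝ] F :=
    { toFun := fun X => hess cov f x X Y
      map_add' := fun X Z => hess_add_left hf X Z Y
      map_smul' := fun c X => hess_smul_left hf c X Y }
  change L _ = ∑ i ∈ s, c i • L (X i)
  simp only [map_sum, map_smul]

lemma hess_sum_right {f : M → F} {x : M} {ι : Type*}
    (s : Finset ι) (c : ι → ℝ) (Y : ι → TangentSpace (𝓡 n) x) (X : TangentSpace (𝓡 n) x) :
    hess cov f x X (∑ i ∈ s, c i • Y i) = ∑ i ∈ s, c i • hess cov f x X (Y i) := by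
  let L : TangentSpace (𝓡 n) x →ₗ[ℝ] F :=
    { toFun := fun Y => hess cov f x X Y
      map_add' := fun Y Z => hess_add_right X Y Z
      map_smul' := fun c Y => hess_smul_right c X Y }
  change L _ = ∑ i ∈ s, c i • L (Y i)
  simp only [map_sum, map_smul]

lemma hess_frame_frame {f : M → F} {x : M} (hf : ContMDiffAt (𝓡 n) 𝓘(ℝ, F) ∞ f x) (v w : 𝔼) :
    hess cov f x (frame Θ v x) (frame Θ w x) = ∑ i, ∑ j, (v i * w j) • hessComp cov Θ f i j x := by
  rw [frame_eq_sum v, frame_eq_sum w, hess_sum_left hf]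
  refine Finset.sum_congr rfl fun i _ => ?_
  rw [hess_sum_right, Finset.smul_sum]
  exact Finset.sum_congr rfl fun j _ => smul_smul _ _ _

lemma hessComp_eq (hΘ : IsCoord Θ U) {f : M → F} {x : M} (hx : x ∈ U)
    (hf : ContMDiffAt (𝓡 n) 𝓘(ℝ, F) ∞ f x) (i j : Fin n) :
    hessComp cov Θ f i j x = frameDeriv Θ j (frameDeriv Θ i f) x - ∑ k,
      christoffel cov Θ (EuclideanSpace.single j 1) (EuclideanSpace.single i 1) x k
        • frameDeriv Θ k f x := by
  rw [hessComp, hess_eq_frame hΘ hx hf, ← mvfderiv_frame, christoffel, hΘ.frame_apply hx]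
  rfl

lemma contMDiffAt_hessComp [T2Space M] (hcov : cov.ContMDiffCovariantDerivative ∞)
    (hΘ : IsCoord Θ U) {f : M → F} (hf : ∀ x ∈ U, ContMDiffAt (𝓡 n) 𝓘(ℝ, F) ∞ f x) {x : M}
    (hx : x ∈ U) (i j : Fin n) :
    ContMDiffAt (𝓡 n) 𝓘(ℝ, F) ∞ (hessComp cov Θ f i j) x := by
  have h1 : ContMDiffAt (𝓡 n) 𝓘(ℝ, F) ∞ (fun y => frameDeriv Θ j (frameDeriv Θ i f) y - ∑ k,
      christoffel cov Θ (EuclideanSpace.single j 1) (EuclideanSpace.single i 1) y k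
        • frameDeriv Θ k f y) x := by
    refine (contMDiffAt_frameDeriv hΘ hx (contMDiffAt_frameDeriv hΘ hx (hf x hx) i) j).sub ?_
    refine ContMDiffAt.sum fun k _ => ?_
    have h2 : ContMDiffAt (𝓡 n) 𝓘(ℝ, ℝ) ∞ (fun y => christoffel cov Θ
        (EuclideanSpace.single j 1) (EuclideanSpace.single i 1) y k) x :=
      (EuclideanSpace.proj (𝕜 := ℝ) k : 𝔼 →L[ℝ] ℝ).contDiff.contMDiff.contMDiffAt.comp x
        (contMDiffAt_christoffel hcov hΘ hx _ _)
    exact h2.smul (contMDiffAt_frameDeriv hΘ hx (hf x hx) k)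
  refine h1.congr_of_eventuallyEq ?_
  filter_upwards [hΘ.isOpen.mem_nhds hx] with y hy using hessComp_eq hΘ hy (hf y hy) i j

/-- Integration over [0,1] is a continuous linear functional on C([0,1]): the primitive ∫ₛ¹
evaluated at s = 0. -/
lemma contMDiffAt_integral {T : M → C(UI, ℝ)} {q : M}
    (hT : ContMDiffAt (𝓡 n) 𝓘(ℝ, C(UI, ℝ)) ∞ T q) :
    ContMDiffAt (𝓡 n) 𝓘(ℝ, ℝ) ∞ (fun q => ∫ s in (0 : ℝ)..1, extUI (T q) s) q := by
  let L : C(UI, ℝ) →L[ℝ] ℝ := (ContinuousMap.evalCLM ℝ (⟨0, le_rfl, zero_le_one⟩ : UI)).comp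
    primitiveUI
  exact L.contDiff.contMDiff.contMDiffAt.comp q hT

lemma integral_extUI_toUI {g : ℝ → ℝ} (hg : ContinuousOn g (Icc 0 1)) :
    ∫ s in (0 : ℝ)..1, extUI (toUI g) s = ∫ s in (0 : ℝ)..1, g s := by
  refine intervalIntegral.integral_congr fun s hs => ?_
  rw [uIcc_of_le zero_le_one] at hs
  exact extUI_toUI hg hs

/-- The mean of a function over radial geodesics. -/
def radialMean (γ : M → ℝ → M) (f : M → ℝ) (q : M) : ℝ := ∫ s in (0 : ℝ)..1, f (γ q s)

lemma IsNormalNhd.contMDiffAt_radialMean (h : IsNormalNhd cov p Ω₀ γ) {f : M → ℝ}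
    (hf : ∀ q ∈ Ω₀, ContMDiffAt (𝓡 n) 𝓘(ℝ, ℝ) ∞ f q) {q : M} (hq : q ∈ Ω₀) :
    ContMDiffAt (𝓡 n) 𝓘(ℝ, ℝ) ∞ (radialMean γ f) q := by
  have h1 := h.contMDiffOn_comp hf
  refine (contMDiffAt_integral (contMDiffAt_toUI (G := fun s q => f (γ q s)) h.isOpen h1
    hq)).congr_of_eventuallyEq ?_
  filter_upwards [h.isOpen.mem_nhds hq] with y hy
  exact (integral_extUI_toUI
    (contMDiffOn_slice (G := fun s q => f (γ q s)) h1 hy).continuousOn).symm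

lemma IsNormalNhd.continuousOn_comp (h : IsNormalNhd cov p Ω₀ γ) {f : M → ℝ}
    (hf : ∀ q ∈ Ω₀, ContMDiffAt (𝓡 n) 𝓘(ℝ, ℝ) ∞ f q) {q : M} (hq : q ∈ Ω₀) :
    ContinuousOn (fun s => f (γ q s)) (Icc 0 1) :=
  (contMDiffOn_slice (G := fun s q => f (γ q s)) (h.contMDiffOn_comp hf) hq).continuousOn

variable (cov p γ) in
/-- The Hessian averaged over radial geodesics with a weight, in normal coordinates. -/
def weightedForm (w : ℝ → ℝ) (f : M → ℝ) (q : M) (v v' : EuclideanSpace ℝ (Fin n)) : ℝ :=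
  ∫ s in (0 : ℝ)..1, w s * ∑ i, ∑ j,
    extUI (parallelCoord cov p γ v q) s i * extUI (parallelCoord cov p γ v' q) s j
      * hessComp cov (normalCoord n p γ) f i j (γ q s)

lemma IsNormalNhd.weightedHess_eq [T2Space M] (h : IsNormalNhd cov p Ω₀ γ)
    (hcov : cov.ContMDiffCovariantDerivative ∞) {f : M → ℝ}
    (hf : ∀ q ∈ Ω₀, ContMDiffAt (𝓡 n) 𝓘(ℝ, ℝ) ∞ f q) {q : M} (hq : q ∈ Ω₀) (σ : ℝ)
    (X Y : TangentSpace (𝓡 n) (γ q 1)) :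
    weightedHess cov σ f (γ q) X Y = weightedForm cov p γ (fun s => σ * (1 - s) ^ (σ - 1)) f q
      (mvfderiv (𝓡 n) (normalCoord n p γ) (γ q 1) X)
      (mvfderiv (𝓡 n) (normalCoord n p γ) (γ q 1) Y) := by
  rw [weightedHess, weightedForm, ← intervalIntegral.integral_const_mul]
  refine intervalIntegral.integral_congr fun s hs => ?_
  rw [uIcc_of_le zero_le_one] at hs
  simp only
  rw [h.transport_eq hcov hq X hs, h.transport_eq hcov hq Y hs,
    hess_frame_frame (hf _ (h.mapsTo q hq hs)), mul_assoc]
  rfl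

lemma linSol_add {E : Type*} [NormedAddCommGroup E] [NormedSpace ℝ E] [CompleteSpace E]
    (A : C(UI, E →L[ℝ] E)) (X Y : E) : linSol A (X + Y) = linSol A X + linSol A Y := by
  rw [linSol, linSol, linSol, ← map_add]
  rfl

lemma linSol_smul {E : Type*} [NormedAddCommGroup E] [NormedSpace ℝ E] [CompleteSpace E]
    (A : C(UI, E →L[ℝ] E)) (c : ℝ) (X : E) : linSol A (c • X) = c • linSol A X := by
  rw [linSol, linSol, ← map_smul]
  rfl

lemma extUI_parallelCoord (v : 𝔼) (q : M) (s : ℝ) (a : Fin n) :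
    extUI (parallelCoord cov p γ v q) s a =
      ∑ i, v i * extUI (parallelCoord cov p γ (EuclideanSpace.single i 1) q) s a := by
  let L : 𝔼 →ₗ[ℝ] ℝ :=
    { toFun := fun v => extUI (parallelCoord cov p γ v q) s a
      map_add' := fun v w => by
        unfold parallelCoord; rw [linSol_add]; rfl
      map_smul' := fun c v => by
        unfold parallelCoord; rw [linSol_smul]; rfl }
  change L v = ∑ i, v i * L (EuclideanSpace.single i 1)
  conv_lhs => rw [sum_single_smul v]
  simp only [map_sum, map_smul, smul_eq_mul]

variable (cov p γ) in
/-- The matrix of the weighted Hessian in normal coordinates. -/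
def weightedMatrix (w : ℝ → ℝ) (f : M → ℝ) (q : M) : Matrix (Fin n) (Fin n) ℝ :=
  Matrix.of fun i j =>
    weightedForm cov p γ w f q (EuclideanSpace.single i 1) (EuclideanSpace.single j 1)

/-- The matrix of the weighted Hessian depends smoothly on the end point. -/
lemma IsNormalNhd.contMDiffAt_weightedMatrix [T2Space M] (h : IsNormalNhd cov p Ω₀ γ)
    (hcov : cov.ContMDiffCovariantDerivative ∞) {f : M → ℝ}
    (hf : ∀ q ∈ Ω₀, ContMDiffAt (𝓡 n) 𝓘(ℝ, ℝ) ∞ f q) {w : ℝ → ℝ} (hw : Continuous w) {q : M}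
    (hq : q ∈ Ω₀) (i j : Fin n) :
    ContMDiffAt (𝓡 n) 𝓘(ℝ, ℝ) ∞ (fun q => weightedMatrix cov p γ w f q i j) q := by
  have hΘ := h.isCoord_normalCoord hcov
  have hmul : ∀ {S T : M → C(UI, ℝ)}, ContMDiffAt (𝓡 n) 𝓘(ℝ, C(UI, ℝ)) ∞ S q →
      ContMDiffAt (𝓡 n) 𝓘(ℝ, C(UI, ℝ)) ∞ T q →
      ContMDiffAt (𝓡 n) 𝓘(ℝ, C(UI, ℝ)) ∞ (fun y => S y * T y) q := by
    intro S T hS hT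
    exact (contDiff_mul (𝕜 := ℝ) (𝔸 := C(UI, ℝ)) (n := ∞)).contMDiff.contMDiffAt.comp q
      (hS.prodMk_space hT)
  have hx : ∀ i a, ContMDiffAt (𝓡 n) 𝓘(ℝ, C(UI, ℝ)) ∞ (fun y =>
      ContinuousLinearMap.compLeftContinuous ℝ UI (EuclideanSpace.proj (𝕜 := ℝ) a : 𝔼 →L[ℝ] ℝ)
        (parallelCoord cov p γ (EuclideanSpace.single i 1) y)) q := fun i a =>
    (ContinuousLinearMap.compLeftContinuous ℝ UI
      (EuclideanSpace.proj (𝕜 := ℝ) a : 𝔼 →L[ℝ] ℝ)).contDiff.contMDiff.contMDiffAt.comp q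
      (h.contMDiffAt_parallelCoord hcov _ hq)
  have hh : ∀ a b, ContMDiffAt (𝓡 n) 𝓘(ℝ, C(UI, ℝ)) ∞ (fun y =>
      toUI fun s => hessComp cov (normalCoord n p γ) f a b (γ y s)) q := fun a b =>
    contMDiffAt_toUI (G := fun s y => hessComp cov (normalCoord n p γ) f a b (γ y s)) h.isOpen
      (h.contMDiffOn_comp fun q hq => contMDiffAt_hessComp hcov hΘ hf hq a b) hq
  have h1 := contMDiffAt_integral (hmul (contMDiffAt_const (c := toUI w))
    (ContMDiffAt.sum (t := Finset.univ) fun a _ => ContMDiffAt.sum (t := Finset.univ) fun b _ =>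
      hmul (hmul (hx i a) (hx j b)) (hh a b)))
  refine h1.congr_of_eventuallyEq ?_
  filter_upwards [h.isOpen.mem_nhds hq] with y hy
  refine intervalIntegral.integral_congr fun s hs => ?_
  rw [uIcc_of_le zero_le_one] at hs
  have e1 : toUI w ⟨s, hs⟩ = w s := toUI_apply hw.continuousOn _
  have e2 : ∀ a b, toUI (fun s => hessComp cov (normalCoord n p γ) f a b (γ y s)) ⟨s, hs⟩ =
      hessComp cov (normalCoord n p γ) f a b (γ y s) := fun a b =>
    toUI_apply (h.continuousOn_comp (fun q hq => contMDiffAt_hessComp hcov hΘ hf hq a b) hy) _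
  rw [extUI_of_mem _ hs]
  simp only [ContinuousMap.mul_apply, ContinuousMap.sum_apply, e1, e2, extUI_of_mem _ hs]
  rfl

end WeightedForms

end GeomOsc
end

noncomputable section

set_option linter.unusedSectionVars false

namespace GeomOsc

universe u v

/-! ### The coefficients of □ in normal coordinates -/

section BoxMatrix

open Set Filter Bundle

variable {n : ℕ} {M : Type u} [TopologicalSpace M] [ChartedSpace (EuclideanSpace ℝ (Fin n)) M]
  [IsManifold (𝓡 n) ∞ M]
variable {F : Type v} [NormedAddCommGroup F] [NormedSpace ℝ F]

local notation "𝔼" => EuclideanSpace ℝ (Fin n)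
local notation "φ" => extChartAt (𝓡 n)

variable {cov : Connection n M} {p : M} {Ω₀ : Set M} {γ : M → ℝ → M}
variable {Θ : M → EuclideanSpace ℝ (Fin n)} {U : Set M}

lemma sum_comm_four {ι κ E : Type*} [Fintype ι] [Fintype κ] [AddCommMonoid E]
    (f : ι → ι → κ → κ → E) :
    ∑ a, ∑ b, ∑ i, ∑ j, f a b i j = ∑ i, ∑ j, ∑ a, ∑ b, f a b i j := by
  calc ∑ a, ∑ b, ∑ i, ∑ j, f a b i j = ∑ a, ∑ i, ∑ b, ∑ j, f a b i j :=
        Finset.sum_congr rfl fun a _ => Finset.sum_comm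
    _ = ∑ i, ∑ a, ∑ b, ∑ j, f a b i j := Finset.sum_comm
    _ = ∑ i, ∑ a, ∑ j, ∑ b, f a b i j :=
        Finset.sum_congr rfl fun i _ => Finset.sum_congr rfl fun a _ => Finset.sum_comm
    _ = ∑ i, ∑ j, ∑ a, ∑ b, f a b i j := Finset.sum_congr rfl fun i _ => Finset.sum_comm

lemma IsNormalNhd.continuousOn_weightedForm [T2Space M] (h : IsNormalNhd cov p Ω₀ γ)
    (hcov : cov.ContMDiffCovariantDerivative ∞) {f : M → ℝ}
    (hf : ∀ q ∈ Ω₀, ContMDiffAt (𝓡 n) 𝓘(ℝ, ℝ) ∞ f q) {w : ℝ → ℝ} (hw : Continuous w) {q : M}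
    (hq : q ∈ Ω₀) (v v' : 𝔼) :
    ContinuousOn (fun s => w s * ∑ i, ∑ j,
      extUI (parallelCoord cov p γ v q) s i * extUI (parallelCoord cov p γ v' q) s j
        * hessComp cov (normalCoord n p γ) f i j (γ q s)) (Icc 0 1) := by
  refine hw.continuousOn.mul (continuousOn_finsetSum _ fun i _ => continuousOn_finsetSum _
    fun j _ => ContinuousOn.mul (Continuous.continuousOn ?_) ?_)
  · have h1 := extUI_continuous (parallelCoord cov p γ v q)
    have h2 := extUI_continuous (parallelCoord cov p γ v' q)
    fun_prop
  · exact h.continuousOn_comp (fun q hq => contMDiffAt_hessComp hcov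
      (h.isCoord_normalCoord hcov) hf hq i j) hq

lemma IsNormalNhd.weightedForm_eq_sum [T2Space M] (h : IsNormalNhd cov p Ω₀ γ)
    (hcov : cov.ContMDiffCovariantDerivative ∞) {f : M → ℝ}
    (hf : ∀ q ∈ Ω₀, ContMDiffAt (𝓡 n) 𝓘(ℝ, ℝ) ∞ f q) {w : ℝ → ℝ} (hw : Continuous w) {q : M}
    (hq : q ∈ Ω₀) (v v' : 𝔼) :
    weightedForm cov p γ w f q v v' = ∑ i, ∑ j, v i * v' j * weightedMatrix cov p γ w f q i j := by
  have hint : ∀ v v' : 𝔼, IntervalIntegrable (fun s => w s * ∑ a, ∑ b,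
      extUI (parallelCoord cov p γ v q) s a * extUI (parallelCoord cov p γ v' q) s b
        * hessComp cov (normalCoord n p γ) f a b (γ q s)) volume 0 1 := fun v v' =>
    ContinuousOn.intervalIntegrable (by
      rw [uIcc_of_le zero_le_one]
      exact h.continuousOn_weightedForm hcov hf hw hq v v')
  simp only [weightedMatrix, Matrix.of_apply, weightedForm]
  have e : ∀ s, (w s * ∑ a, ∑ b,
      extUI (parallelCoord cov p γ v q) s a * extUI (parallelCoord cov p γ v' q) s b
        * hessComp cov (normalCoord n p γ) f a b (γ q s)) = ∑ i, ∑ j, v i * v' j *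
      (w s * ∑ a, ∑ b, extUI (parallelCoord cov p γ (EuclideanSpace.single i 1) q) s a
        * extUI (parallelCoord cov p γ (EuclideanSpace.single j 1) q) s b
        * hessComp cov (normalCoord n p γ) f a b (γ q s)) := by
    intro s
    simp_rw [extUI_parallelCoord v, extUI_parallelCoord v', Finset.sum_mul_sum, Finset.sum_mul,
      Finset.mul_sum]
    rw [sum_comm_four]
    exact Finset.sum_congr rfl fun i _ => Finset.sum_congr rfl fun j _ =>
      Finset.sum_congr rfl fun a _ => Finset.sum_congr rfl fun b _ => by ring
  simp_rw [e]
  rw [intervalIntegral.integral_finsetSum fun i _ => by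
    simpa only [Finset.sum_fn] using
      IntervalIntegrable.sum Finset.univ fun j _ => (hint _ _).const_mul _]
  refine Finset.sum_congr rfl fun i _ => ?_
  rw [intervalIntegral.integral_finsetSum fun j _ => (hint _ _).const_mul _]
  exact Finset.sum_congr rfl fun j _ => intervalIntegral.integral_const_mul _ _

/-- The components of the standard basis in coordinates. -/
def stdMatrix (Θ : M → EuclideanSpace ℝ (Fin n)) (q : M) : Matrix (Fin n) (Fin n) ℝ :=
  Matrix.of fun a i => mvfderiv (𝓡 n) Θ q (stdFrame q i) a

lemma IsNormalNhd.weightedHessMatrix_eq [T2Space M] (h : IsNormalNhd cov p Ω₀ γ)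
    (hcov : cov.ContMDiffCovariantDerivative ∞) {f : M → ℝ}
    (hf : ∀ q ∈ Ω₀, ContMDiffAt (𝓡 n) 𝓘(ℝ, ℝ) ∞ f q) {q : M} (hq : q ∈ Ω₀) {σ : ℝ}
    (hσ : Continuous fun s : ℝ => σ * (1 - s) ^ (σ - 1)) :
    weightedHessMatrix cov σ f (γ q) = (stdMatrix (normalCoord n p γ) q).transpose *
      weightedMatrix cov p γ (fun s => σ * (1 - s) ^ (σ - 1)) f q
        * stdMatrix (normalCoord n p γ) q := by
  conv_rhs => rw [← h.target q hq]
  rw [h.target q hq]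
  have e : stdMatrix (normalCoord n p γ) q = stdMatrix (normalCoord n p γ) (γ q 1) := by
    rw [h.target q hq]
  rw [e]
  ext i j
  simp only [weightedHessMatrix, Matrix.of_apply, h.weightedHess_eq hcov hf hq,
    h.weightedForm_eq_sum hcov hf hσ hq, Matrix.mul_apply, Matrix.transpose_apply, stdMatrix,
    Finset.sum_mul]
  rw [Finset.sum_comm]
  exact Finset.sum_congr rfl fun b _ => Finset.sum_congr rfl fun a _ => by ring

lemma one_weight : (fun s : ℝ => (1 : ℝ) * (1 - s) ^ ((1 : ℝ) - 1)) = fun _ => 1 := by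
  ext s; simp

lemma two_weight : (fun s : ℝ => (2 : ℝ) * (1 - s) ^ ((2 : ℝ) - 1)) = fun s => 2 * (1 - s) := by
  ext s
  norm_num

variable (cov p γ) in
/-- The matrix of the first weighted Hessian in normal coordinates. -/
def firstMatrix (f : M → ℝ) (q : M) : Matrix (Fin n) (Fin n) ℝ :=
  weightedMatrix cov p γ (fun _ => 1) f q

variable (cov p γ) in
/-- The matrix of the second weighted Hessian in normal coordinates. -/
def secondMatrix (f : M → ℝ) (q : M) : Matrix (Fin n) (Fin n) ℝ :=
  weightedMatrix cov p γ (fun s => 2 * (1 - s)) f q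

variable (cov p γ) in
/-- The symbol of the operator `□` in normal coordinates. -/
def boxMatrix (f : M → ℝ) (q : M) : Matrix (Fin n) (Fin n) ℝ :=
  (firstMatrix cov p γ f q)⁻¹ * secondMatrix cov p γ f q * (firstMatrix cov p γ f q)⁻¹

lemma IsNormalNhd.weightedHessMatrix_one [T2Space M] (h : IsNormalNhd cov p Ω₀ γ)
    (hcov : cov.ContMDiffCovariantDerivative ∞) {f : M → ℝ}
    (hf : ∀ q ∈ Ω₀, ContMDiffAt (𝓡 n) 𝓘(ℝ, ℝ) ∞ f q) {q : M} (hq : q ∈ Ω₀) :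
    weightedHessMatrix cov 1 f (γ q) = (stdMatrix (normalCoord n p γ) q).transpose *
      firstMatrix cov p γ f q * stdMatrix (normalCoord n p γ) q := by
  rw [h.weightedHessMatrix_eq hcov hf hq (by rw [one_weight]; fun_prop), one_weight, firstMatrix]

lemma IsNormalNhd.weightedHessMatrix_two [T2Space M] (h : IsNormalNhd cov p Ω₀ γ)
    (hcov : cov.ContMDiffCovariantDerivative ∞) {f : M → ℝ}
    (hf : ∀ q ∈ Ω₀, ContMDiffAt (𝓡 n) 𝓘(ℝ, ℝ) ∞ f q) {q : M} (hq : q ∈ Ω₀) :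
    weightedHessMatrix cov 2 f (γ q) = (stdMatrix (normalCoord n p γ) q).transpose *
      secondMatrix cov p γ f q * stdMatrix (normalCoord n p γ) q := by
  rw [h.weightedHessMatrix_eq hcov hf hq (by rw [two_weight]; fun_prop), two_weight, secondMatrix]

/-- Forms transform by congruence and their inverses contragrediently. This is what makes the
contractions defining □ independent of the basis. -/
lemma inv_congruence {P B : Matrix (Fin n) (Fin n) ℝ}
    (hd : (P.transpose * B * P).det ≠ 0) :
    B.det ≠ 0 ∧ P * (P.transpose * B * P)⁻¹ * P.transpose = B⁻¹ := by
  rw [Matrix.det_mul, Matrix.det_mul, Matrix.det_transpose] at hd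
  have hP : IsUnit P.det := isUnit_iff_ne_zero.2 (right_ne_zero_of_mul hd)
  have hP' : IsUnit P.transpose.det := by rwa [Matrix.det_transpose]
  refine ⟨right_ne_zero_of_mul (left_ne_zero_of_mul hd), ?_⟩
  rw [Matrix.mul_inv_rev, Matrix.mul_inv_rev, ← mul_assoc, Matrix.mul_nonsing_inv _ hP, one_mul,
    mul_assoc, Matrix.nonsing_inv_mul _ hP', mul_one]

lemma IsNormalNhd.firstMatrix_det [T2Space M] (h : IsNormalNhd cov p Ω₀ γ)
    (hcov : cov.ContMDiffCovariantDerivative ∞) {f : M → ℝ}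
    (hf : ∀ q ∈ Ω₀, ContMDiffAt (𝓡 n) 𝓘(ℝ, ℝ) ∞ f q) {q : M} (hq : q ∈ Ω₀)
    (hd : (weightedHessMatrix cov 1 f (γ q)).det ≠ 0) : (firstMatrix cov p γ f q).det ≠ 0 := by
  rw [h.weightedHessMatrix_one hcov hf hq] at hd
  exact (inv_congruence hd).1

lemma hess_std (hΘ : IsCoord Θ U) {f : M → F} {x : M} (hx : x ∈ U)
    (hf : ContMDiffAt (𝓡 n) 𝓘(ℝ, F) ∞ f x) (i j : Fin n) :
    hess cov f x (stdFrame x i) (stdFrame x j) =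
      ∑ a, ∑ b, (stdMatrix Θ x a i * stdMatrix Θ x b j) • hessComp cov Θ f a b x := by
  rw [← hΘ.frame_apply hx (stdFrame x i), ← hΘ.frame_apply hx (stdFrame x j),
    hess_frame_frame hf]
  rfl

lemma mvfderiv_std (hΘ : IsCoord Θ U) (f : M → F) {x : M} (hx : x ∈ U) (i : Fin n) :
    mvfderiv (𝓡 n) f x (stdFrame x i) = ∑ a, stdMatrix Θ x a i • frameDeriv Θ a f x := by
  rw [← hΘ.frame_apply hx (stdFrame x i), mvfderiv_frame]
  rfl

lemma IsNormalNhd.box₀_eq [T2Space M] (h : IsNormalNhd cov p Ω₀ γ)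
    (hcov : cov.ContMDiffCovariantDerivative ∞) {Φ : M → ℝ}
    (hΦ : ∀ q ∈ Ω₀, ContMDiffAt (𝓡 n) 𝓘(ℝ, ℝ) ∞ Φ q) {q : M} (hq : q ∈ Ω₀)
    (hd : (weightedHessMatrix cov 1 Φ (γ q)).det ≠ 0) {f : M → F}
    (hf : ContMDiffAt (𝓡 n) 𝓘(ℝ, F) ∞ f q) :
    box₀ cov Φ γ f q =
      ∑ i, ∑ j, boxMatrix cov p γ Φ q i j • hessComp cov (normalCoord n p γ) f j i q := by
  have hΘ := h.isCoord_normalCoord hcov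
  have h1 := h.weightedHessMatrix_one hcov hΦ hq
  have h2 := h.weightedHessMatrix_two hcov hΦ hq
  rw [h1] at hd
  have h3 := (inv_congruence hd).2
  set P := stdMatrix (normalCoord n p γ) q
  set C := (weightedHessMatrix cov 1 Φ (γ q))⁻¹ * weightedHessMatrix cov 2 Φ (γ q)
        * (weightedHessMatrix cov 1 Φ (γ q))⁻¹ with hC
  have hK : boxMatrix cov p γ Φ q = P * C * P.transpose := by
    rw [boxMatrix, ← h3, hC, h1, h2]
    simp only [mul_assoc]
  rw [box₀]
  simp_rw [← hC, hess_std hΘ hq hf, Finset.smul_sum, smul_smul]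
  rw [sum_comm_four, Finset.sum_comm]
  refine Finset.sum_congr rfl fun b _ => Finset.sum_congr rfl fun a _ => ?_
  simp_rw [← Finset.sum_smul]
  congr 1
  rw [hK, Matrix.mul_apply, Finset.sum_comm]
  refine Finset.sum_congr rfl fun j _ => ?_
  rw [Matrix.mul_apply, Finset.sum_mul]
  exact Finset.sum_congr rfl fun i _ => by rw [Matrix.transpose_apply]; ring

lemma IsNormalNhd.zField_eq [T2Space M] (h : IsNormalNhd cov p Ω₀ γ)
    (hcov : cov.ContMDiffCovariantDerivative ∞) {Φ : M → ℝ}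
    (hΦ : ∀ q ∈ Ω₀, ContMDiffAt (𝓡 n) 𝓘(ℝ, ℝ) ∞ Φ q) {q : M} (hq : q ∈ Ω₀)
    (hd : (weightedHessMatrix cov 1 Φ (γ q)).det ≠ 0) (g : M → ℝ) (f : M → F) :
    zField cov Φ γ g f q = ∑ i, ∑ j,
      ((firstMatrix cov p γ Φ q)⁻¹ i j * frameDeriv (normalCoord n p γ) i g q)
        • frameDeriv (normalCoord n p γ) j f q := by
  have hΘ := h.isCoord_normalCoord hcov
  have h1 := h.weightedHessMatrix_one hcov hΦ hq
  rw [h1] at hd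
  have h3 := (inv_congruence hd).2
  set P := stdMatrix (normalCoord n p γ) q
  set C := (weightedHessMatrix cov 1 Φ (γ q))⁻¹ with hC
  rw [← h1, ← hC] at h3
  rw [zField]
  have e : ∀ i j, (C i j * mvfderiv (𝓡 n) g q (stdFrame q i)) • mvfderiv (𝓡 n) f q (stdFrame q j)
      = ∑ a, ∑ b, (P a i * C i j * P b j * frameDeriv (normalCoord n p γ) a g q)
        • frameDeriv (normalCoord n p γ) b f q := by
    intro i j
    rw [mvfderiv_std hΘ _ hq, mvfderiv_std hΘ _ hq, Finset.mul_sum, Finset.sum_smul_sum]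
    refine Finset.sum_congr rfl fun a _ => Finset.sum_congr rfl fun b _ => ?_
    rw [smul_smul, smul_eq_mul]
    congr 1
    ring
  simp_rw [← hC, e]
  rw [sum_comm_four]
  refine Finset.sum_congr rfl fun a _ => Finset.sum_congr rfl fun b _ => ?_
  simp_rw [← Finset.sum_smul]
  congr 1
  rw [← h3, Matrix.mul_apply, Finset.sum_comm, Finset.sum_mul]
  refine Finset.sum_congr rfl fun j _ => ?_
  rw [Matrix.mul_apply, Finset.sum_mul, Finset.sum_mul]
  exact Finset.sum_congr rfl fun i _ => by rw [Matrix.transpose_apply]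

lemma contMDiffAt_det {B : M → Matrix (Fin n) (Fin n) ℝ} {q : M}
    (hB : ∀ i j, ContMDiffAt (𝓡 n) 𝓘(ℝ, ℝ) ∞ (fun y => B y i j) q) :
    ContMDiffAt (𝓡 n) 𝓘(ℝ, ℝ) ∞ (fun y => (B y).det) q := by
  simp_rw [Matrix.det_apply']
  refine ContMDiffAt.sum fun σ _ => contMDiffAt_const.mul ?_
  exact contMDiffAt_finsetProd fun i _ => hB _ _

/-- By Cramer's rule the entries of the inverse are quotients of polynomials in the entries. -/
lemma contMDiffAt_inv_matrix {B : M → Matrix (Fin n) (Fin n) ℝ} {q : M}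
    (hB : ∀ i j, ContMDiffAt (𝓡 n) 𝓘(ℝ, ℝ) ∞ (fun y => B y i j) q) (hd : (B q).det ≠ 0)
    (i j : Fin n) : ContMDiffAt (𝓡 n) 𝓘(ℝ, ℝ) ∞ (fun y => (B y)⁻¹ i j) q := by
  simp_rw [Matrix.inv_def, Ring.inverse_eq_inv', Matrix.smul_apply, Matrix.adjugate_apply,
    smul_eq_mul]
  refine ((contMDiffAt_det hB).inv₀ hd).mul (contMDiffAt_det fun a b => ?_)
  by_cases hab : a = j
  · subst hab
    simp only [Matrix.updateRow_self]
    exact contMDiffAt_const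
  · simp only [Matrix.updateRow_ne hab]
    exact hB a b

lemma contMDiffAt_mul_matrix {B C : M → Matrix (Fin n) (Fin n) ℝ} {q : M}
    (hB : ∀ i j, ContMDiffAt (𝓡 n) 𝓘(ℝ, ℝ) ∞ (fun y => B y i j) q)
    (hC : ∀ i j, ContMDiffAt (𝓡 n) 𝓘(ℝ, ℝ) ∞ (fun y => C y i j) q)
    (i j : Fin n) : ContMDiffAt (𝓡 n) 𝓘(ℝ, ℝ) ∞ (fun y => (B y * C y) i j) q := by
  simp_rw [Matrix.mul_apply]
  exact ContMDiffAt.sum fun a _ => (hB i a).mul (hC a j)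

lemma IsNormalNhd.contMDiffAt_firstMatrix_inv [T2Space M] (h : IsNormalNhd cov p Ω₀ γ)
    (hcov : cov.ContMDiffCovariantDerivative ∞) {Φ : M → ℝ}
    (hΦ : ∀ q ∈ Ω₀, ContMDiffAt (𝓡 n) 𝓘(ℝ, ℝ) ∞ Φ q) {q : M} (hq : q ∈ Ω₀)
    (hd : (weightedHessMatrix cov 1 Φ (γ q)).det ≠ 0) (i j : Fin n) :
    ContMDiffAt (𝓡 n) 𝓘(ℝ, ℝ) ∞ (fun y => (firstMatrix cov p γ Φ y)⁻¹ i j) q :=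
  contMDiffAt_inv_matrix (h.contMDiffAt_weightedMatrix hcov hΦ continuous_const hq)
    (h.firstMatrix_det hcov hΦ hq hd) i j

lemma IsNormalNhd.contMDiffAt_boxMatrix [T2Space M] (h : IsNormalNhd cov p Ω₀ γ)
    (hcov : cov.ContMDiffCovariantDerivative ∞) {Φ : M → ℝ}
    (hΦ : ∀ q ∈ Ω₀, ContMDiffAt (𝓡 n) 𝓘(ℝ, ℝ) ∞ Φ q) {q : M} (hq : q ∈ Ω₀)
    (hd : (weightedHessMatrix cov 1 Φ (γ q)).det ≠ 0) (i j : Fin n) :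
    ContMDiffAt (𝓡 n) 𝓘(ℝ, ℝ) ∞ (fun y => boxMatrix cov p γ Φ y i j) q :=
  contMDiffAt_mul_matrix (contMDiffAt_mul_matrix (h.contMDiffAt_firstMatrix_inv hcov hΦ hq hd)
    (h.contMDiffAt_weightedMatrix hcov hΦ (by fun_prop) hq))
    (h.contMDiffAt_firstMatrix_inv hcov hΦ hq hd) i j

end BoxMatrix

end GeomOsc
end

noncomputable section

set_option linter.unusedSectionVars false

namespace GeomOsc

universe u v

/-! ### The phase along radial geodesics -/

section RadialIdentities

open Set Filter Bundle

variable {n : ℕ} {M : Type u} [TopologicalSpace M] [ChartedSpace (EuclideanSpace ℝ (Fin n)) M]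
  [IsManifold (𝓡 n) ∞ M]
variable {F : Type v} [NormedAddCommGroup F] [NormedSpace ℝ F]

local notation "𝔼" => EuclideanSpace ℝ (Fin n)
local notation "φ" => extChartAt (𝓡 n)

variable {cov : Connection n M} {p : M} {Ω₀ : Set M} {γ : M → ℝ → M}

lemma integral_eq_sub_of_hasDerivWithinAt_unit {f f' : ℝ → ℝ}
    (h : ∀ s ∈ Icc (0 : ℝ) 1, HasDerivWithinAt f (f' s) (Icc 0 1) s)
    (hc : ContinuousOn f' (Icc 0 1)) : ∫ s in (0 : ℝ)..1, f' s = f 1 - f 0 :=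
  intervalIntegral.integral_eq_sub_of_hasDeriv_right_of_le zero_le_one
    (fun s hs => (h s hs).continuousWithinAt)
    (fun s hs => ((h s ⟨hs.1.le, hs.2.le⟩).hasDerivAt (Icc_mem_nhds hs.1 hs.2)).hasDerivWithinAt)
    (ContinuousOn.intervalIntegrable (by rwa [uIcc_of_le zero_le_one]))

lemma IsNormalNhd.hasDerivWithinAt_radial [T2Space M] (h : IsNormalNhd cov p Ω₀ γ)
    (hcov : cov.ContMDiffCovariantDerivative ∞) {f : M → ℝ}
    (hf : ∀ q ∈ Ω₀, ContMDiffAt (𝓡 n) 𝓘(ℝ, ℝ) ∞ f q) {q : M} (hq : q ∈ Ω₀) {s : ℝ}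
    (hs : s ∈ Icc (0 : ℝ) 1) :
    HasDerivWithinAt (fun s => f (γ q s))
      (∑ i, normalCoord n p γ q i * frameDeriv (normalCoord n p γ) i f (γ q s)) (Icc 0 1) s := by
  have h1 := hasDerivWithinAt_comp_curve ((hf _ (h.mapsTo q hq hs)).mdifferentiableAt (by simp))
    (mdiffWithinAt_curve (h.geodesic q hq).smooth hs)
  rwa [h.velocity_eq hcov hq hs, mvfderiv_frame] at h1

/-- For a parallel field X along γ the derivative of df(X) is ∇²f(X, γ'): the derivative of the
components of X supplies exactly the Christoffel term of the Hessian. Both radial identities are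
integrals of this one. -/
lemma IsNormalNhd.hasDerivWithinAt_parallel [T2Space M] (h : IsNormalNhd cov p Ω₀ γ)
    (hcov : cov.ContMDiffCovariantDerivative ∞) {f : M → ℝ}
    (hf : ∀ q ∈ Ω₀, ContMDiffAt (𝓡 n) 𝓘(ℝ, ℝ) ∞ f q) (v : 𝔼) {q : M} (hq : q ∈ Ω₀) {s : ℝ}
    (hs : s ∈ Icc (0 : ℝ) 1) :
    HasDerivWithinAt (fun s => ∑ a, extUI (parallelCoord cov p γ v q) s a
        * frameDeriv (normalCoord n p γ) a f (γ q s))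
      (∑ a, ∑ b, extUI (parallelCoord cov p γ v q) s a * normalCoord n p γ q b
        * hessComp cov (normalCoord n p γ) f a b (γ q s)) (Icc 0 1) s := by
  have hΘ := h.isCoord_normalCoord hcov
  set Θ : M → 𝔼 := normalCoord n p γ
  set x := extUI (parallelCoord cov p γ v q)
  have hx := h.hasDerivWithinAt_parallelCoord hcov v hq hs
  have h1 : ∀ a, HasDerivWithinAt (fun s => x s a * frameDeriv Θ a f (γ q s))
      (-(transportGen cov p γ q s (x s)) a * frameDeriv Θ a f (γ q s) +
        x s a * ∑ b, Θ q b * frameDeriv Θ b (frameDeriv Θ a f) (γ q s)) (Icc 0 1) s := fun a =>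
    HasDerivWithinAt.fun_mul ((EuclideanSpace.proj (𝕜 := ℝ) a).hasFDerivAt.comp_hasDerivWithinAt s hx)
      (h.hasDerivWithinAt_radial hcov (fun q hq => contMDiffAt_frameDeriv hΘ hq (hf q hq) a) hq hs)
  have h2 := HasDerivWithinAt.fun_sum fun a (_ : a ∈ Finset.univ) => h1 a
  refine h2.congr_deriv (Eq.symm ?_)
  have e : ∀ k, transportGen cov p γ q s (x s) k = ∑ a, ∑ b, x s a * Θ q b *
      christoffel cov Θ (EuclideanSpace.single b 1) (EuclideanSpace.single a 1) (γ q s) k := by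
    intro k
    have e2 : transportGen cov p γ q s (x s) = ∑ b, ∑ a, Θ q b • x s a •
      christoffel cov Θ (EuclideanSpace.single b 1) (EuclideanSpace.single a 1) (γ q s) := by
      simp only [transportGen, christoffelMap, sum_apply, smul_apply,
        ContinuousLinearMap.smulRight_apply, PiLp.proj_apply, Θ]
    rw [e2, Finset.sum_comm]
    simp only [WithLp.ofLp_sum, Finset.sum_apply, PiLp.smul_apply, smul_eq_mul]
    exact Finset.sum_congr rfl fun a _ => Finset.sum_congr rfl fun b _ => by ring
  rw [Finset.sum_add_distrib]
  simp_rw [hessComp_eq hΘ (h.mapsTo q hq hs) (hf _ (h.mapsTo q hq hs)), mul_sub,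
    Finset.sum_sub_distrib, e, neg_mul, Finset.sum_neg_distrib, Finset.mul_sum, Finset.sum_mul]
  rw [neg_add_eq_sub]
  congr 1
  · exact Finset.sum_congr rfl fun a _ => Finset.sum_congr rfl fun b _ => by ring
  · conv_rhs => rw [Finset.sum_comm]
    refine Finset.sum_congr rfl fun a _ => ?_
    conv_rhs => rw [Finset.sum_comm]
    exact Finset.sum_congr rfl fun b _ => Finset.sum_congr rfl fun k _ => by
      rw [smul_eq_mul]; ring

lemma IsNormalNhd.frameDeriv_center (h : IsNormalNhd cov p Ω₀ γ) {Φ : M → ℝ}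
    (hcrit : mvfderiv (𝓡 n) Φ p = 0) {q : M} (hq : q ∈ Ω₀) (a : Fin n) :
    frameDeriv (normalCoord n p γ) a Φ (γ q 0) = 0 := by
  rw [h.source q hq, frameDeriv, hcrit]
  rfl

lemma IsNormalNhd.continuousOn_parallel [T2Space M] (h : IsNormalNhd cov p Ω₀ γ)
    (hcov : cov.ContMDiffCovariantDerivative ∞) {f : M → ℝ}
    (hf : ∀ q ∈ Ω₀, ContMDiffAt (𝓡 n) 𝓘(ℝ, ℝ) ∞ f q) (v : 𝔼) {q : M} (hq : q ∈ Ω₀) :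
    ContinuousOn (fun s => ∑ a, ∑ b, extUI (parallelCoord cov p γ v q) s a * normalCoord n p γ q b
        * hessComp cov (normalCoord n p γ) f a b (γ q s)) (Icc 0 1) := by
  refine continuousOn_finsetSum _ fun i _ => continuousOn_finsetSum _
    fun j _ => ContinuousOn.mul (Continuous.continuousOn ?_) ?_
  · have h1 := extUI_continuous (parallelCoord cov p γ v q)
    fun_prop
  · exact h.continuousOn_comp (fun q hq => contMDiffAt_hessComp hcov
      (h.isCoord_normalCoord hcov) hf hq i j) hq

/-- The first weighted Hessian in the radial direction is the differential. -/
lemma IsNormalNhd.frameDeriv_eq [T2Space M] (h : IsNormalNhd cov p Ω₀ γ)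
    (hcov : cov.ContMDiffCovariantDerivative ∞) {Φ : M → ℝ}
    (hΦ : ∀ q ∈ Ω₀, ContMDiffAt (𝓡 n) 𝓘(ℝ, ℝ) ∞ Φ q) (hcrit : mvfderiv (𝓡 n) Φ p = 0) {q : M}
    (hq : q ∈ Ω₀) (i : Fin n) :
    frameDeriv (normalCoord n p γ) i Φ q =
      ∑ j, firstMatrix cov p γ Φ q i j * normalCoord n p γ q j := by
  have h1 := h.weightedForm_eq_sum hcov hΦ (w := fun _ => 1) continuous_const hq
    (EuclideanSpace.single i 1) (normalCoord n p γ q)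
  have h2 := integral_eq_sub_of_hasDerivWithinAt_unit
    (fun s hs => h.hasDerivWithinAt_parallel hcov hΦ (EuclideanSpace.single i 1) hq hs)
    (h.continuousOn_parallel hcov hΦ (EuclideanSpace.single i 1) hq)
  have h3 : weightedForm cov p γ (fun _ => 1) Φ q (EuclideanSpace.single i 1)
      (normalCoord n p γ q) = ∫ s in (0 : ℝ)..1, ∑ a, ∑ b,
        extUI (parallelCoord cov p γ (EuclideanSpace.single i 1) q) s a * normalCoord n p γ q b
        * hessComp cov (normalCoord n p γ) Φ a b (γ q s) := by
    -- The radial vector is its own parallel transport, which puts γ' in the second slot of the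
    -- Hessian.
    refine intervalIntegral.integral_congr fun s hs => ?_
    rw [uIcc_of_le zero_le_one] at hs
    simp only [h.parallelCoord_normalCoord hcov hq hs, one_mul]
  rw [h3, h2] at h1
  simp only [parallelCoord_one, h.target q hq, h.frameDeriv_center hcrit hq, mul_zero,
    Finset.sum_const_zero, sub_zero, PiLp.single_apply, ite_mul, one_mul, zero_mul,
    Finset.sum_ite_irrel, Finset.sum_ite_eq', Finset.mem_univ, if_true] at h1
  rw [h1]
  exact Finset.sum_congr rfl fun j _ => mul_comm _ _

/-- The second weighted Hessian in the radial direction. -/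
lemma IsNormalNhd.secondMatrix_radial [T2Space M] (h : IsNormalNhd cov p Ω₀ γ)
    (hcov : cov.ContMDiffCovariantDerivative ∞) {Φ : M → ℝ}
    (hΦ : ∀ q ∈ Ω₀, ContMDiffAt (𝓡 n) 𝓘(ℝ, ℝ) ∞ Φ q) (hcrit : mvfderiv (𝓡 n) Φ p = 0) {q : M}
    (hq : q ∈ Ω₀) :
    ∑ i, ∑ j, normalCoord n p γ q i * normalCoord n p γ q j * secondMatrix cov p γ Φ q i j =
      2 * (Φ q - Φ p) := by
  rw [secondMatrix, ← h.weightedForm_eq_sum hcov hΦ (by fun_prop) hq]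
  have hcont := h.continuousOn_parallel hcov hΦ (normalCoord n p γ q) hq
  -- Integration by parts in the Taylor formula: 2(1-s) dΦ(γ') + 2Φ is a primitive of 2(1-s) ∇²Φ(γ',
  -- γ'), and its boundary term at s = 0 vanishes since p is critical.
  have h2 := integral_eq_sub_of_hasDerivWithinAt_unit
    (f := fun s => 2 * (1 - s) * (∑ a, extUI (parallelCoord cov p γ (normalCoord n p γ q) q) s a
        * frameDeriv (normalCoord n p γ) a Φ (γ q s)) + 2 * Φ (γ q s))
    (f' := fun s => 2 * (1 - s) * ∑ a, ∑ b,
      extUI (parallelCoord cov p γ (normalCoord n p γ q) q) s a * normalCoord n p γ q b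
        * hessComp cov (normalCoord n p γ) Φ a b (γ q s))
    (fun s hs => by
      have hd := h.hasDerivWithinAt_parallel hcov hΦ (normalCoord n p γ q) hq hs
      have hw : HasDerivWithinAt (fun s : ℝ => 2 * (1 - s)) (-2) (Icc 0 1) s := by
        simpa using (((hasDerivWithinAt_id s (Icc (0 : ℝ) 1)).const_sub 1).const_mul 2)
      have hr := (h.hasDerivWithinAt_radial hcov hΦ hq hs).const_mul 2
      have := (hw.fun_mul hd).fun_add hr
      refine this.congr_deriv ?_
      rw [h.parallelCoord_normalCoord hcov hq hs]
      ring)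
    ((by fun_prop : Continuous fun s : ℝ => 2 * (1 - s)).continuousOn.mul hcont)
  have h3 : weightedForm cov p γ (fun s => 2 * (1 - s)) Φ q (normalCoord n p γ q)
      (normalCoord n p γ q) = ∫ s in (0 : ℝ)..1, 2 * (1 - s) * ∑ a, ∑ b,
        extUI (parallelCoord cov p γ (normalCoord n p γ q) q) s a * normalCoord n p γ q b
        * hessComp cov (normalCoord n p γ) Φ a b (γ q s) := by
    refine intervalIntegral.integral_congr fun s hs => ?_
    rw [uIcc_of_le zero_le_one] at hs
    simp only [h.parallelCoord_normalCoord hcov hq hs]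
  rw [h3, h2]
  simp only [h.target q hq, h.source q hq]
  have := h.frameDeriv_center hcrit hq
  rw [h.source q hq] at this
  simp only [this, mul_zero, Finset.sum_const_zero]
  ring

lemma IsNormalNhd.firstMatrix_symm [T2Space M] (h : IsNormalNhd cov p Ω₀ γ)
    (htor : cov.torsion = 0) {Φ : M → ℝ}
    (hΦ : ∀ q ∈ Ω₀, ContMDiffAt (𝓡 n) 𝓘(ℝ, ℝ) ∞ Φ q) {q : M} (hq : q ∈ Ω₀) (i j : Fin n) :
    firstMatrix cov p γ Φ q i j = firstMatrix cov p γ Φ q j i := by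
  refine intervalIntegral.integral_congr fun s hs => ?_
  rw [uIcc_of_le zero_le_one] at hs
  simp only
  rw [Finset.sum_comm]
  congr 1
  refine Finset.sum_congr rfl fun a _ => Finset.sum_congr rfl fun b _ => ?_
  have : hessComp cov (normalCoord n p γ) Φ a b (γ q s) =
      hessComp cov (normalCoord n p γ) Φ b a (γ q s) :=
    hess_symm htor (hΦ _ (h.mapsTo q hq hs)) _ _
  rw [this]
  ring

lemma IsNormalNhd.weightedMatrix_center [T2Space M] (h : IsNormalNhd cov p Ω₀ γ)
    (hcov : cov.ContMDiffCovariantDerivative ∞) {w : ℝ → ℝ} (hw : ∫ s in (0 : ℝ)..1, w s = 1)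
    (Φ : M → ℝ) (i j : Fin n) :
    weightedMatrix cov p γ w Φ p i j = hessComp cov (normalCoord n p γ) Φ i j p := by
  have : weightedMatrix cov p γ w Φ p i j =
      ∫ s in (0 : ℝ)..1, w s * hessComp cov (normalCoord n p γ) Φ i j p := by
    refine intervalIntegral.integral_congr fun s hs => ?_
    rw [uIcc_of_le zero_le_one] at hs
    simp only [h.parallelCoord_center hcov _ hs, h.curve_center hs, PiLp.single_apply, ite_mul,
      one_mul, zero_mul, Finset.sum_ite_irrel, Finset.sum_ite_eq',
      Finset.mem_univ, if_true, Finset.sum_const_zero]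
  rw [this, intervalIntegral.integral_mul_const, hw, one_mul]

/-- The value of `□₀Φ` at the critical point. -/
lemma IsNormalNhd.box₀_center [T2Space M] (h : IsNormalNhd cov p Ω₀ γ)
    (hcov : cov.ContMDiffCovariantDerivative ∞) {Φ : M → ℝ}
    (hΦ : ∀ q ∈ Ω₀, ContMDiffAt (𝓡 n) 𝓘(ℝ, ℝ) ∞ Φ q)
    (hd : ∀ q ∈ Ω₀, (weightedHessMatrix cov 1 Φ (γ q)).det ≠ 0) :
    box₀ cov Φ γ Φ p = n := by
  have hdp := h.firstMatrix_det hcov hΦ h.mem (hd p h.mem)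
  have h1 : firstMatrix cov p γ Φ p = Matrix.of fun i j =>
      hessComp cov (normalCoord n p γ) Φ i j p := by
    ext i j
    exact h.weightedMatrix_center hcov (by simp) Φ i j
  have h2 : secondMatrix cov p γ Φ p = firstMatrix cov p γ Φ p := by
    rw [h1]
    ext i j
    refine h.weightedMatrix_center hcov ?_ Φ i j
    have e : ∀ s ∈ Icc (0 : ℝ) 1, HasDerivWithinAt (fun s : ℝ => 2 * s - s ^ 2) (2 * (1 - s))
        (Icc 0 1) s := fun s _ => by
      have := ((hasDerivAt_id s).const_mul 2).sub (hasDerivAt_pow 2 s)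
      simp only [id, Nat.cast_ofNat, mul_one] at this
      exact this.hasDerivWithinAt.congr_deriv (by ring)
    rw [integral_eq_sub_of_hasDerivWithinAt_unit e (by fun_prop)]
    norm_num
  -- At p both weights have total mass one on a constant geodesic, so both weighted Hessians equal
  -- ∇²Φ(p). The symbol of □₀ is then its inverse, and □₀Φ(p) is the trace of the identity.
  have h3 : boxMatrix cov p γ Φ p = (firstMatrix cov p γ Φ p)⁻¹ := by
    rw [boxMatrix, h2, Matrix.nonsing_inv_mul _ (isUnit_iff_ne_zero.2 hdp), one_mul]
  rw [h.box₀_eq hcov hΦ h.mem (hd p h.mem) (hΦ p h.mem), h3]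
  have h4 : ((firstMatrix cov p γ Φ p)⁻¹ * firstMatrix cov p γ Φ p).trace = n := by
    rw [Matrix.nonsing_inv_mul _ (isUnit_iff_ne_zero.2 hdp), Matrix.trace_one, Fintype.card_fin]
  rw [← h4, Matrix.trace]
  refine Finset.sum_congr rfl fun i _ => ?_
  rw [Matrix.diag_apply, Matrix.mul_apply]
  refine Finset.sum_congr rfl fun j _ => ?_
  rw [smul_eq_mul]
  conv_rhs => rw [h1]
  rw [h1]
  rfl

end RadialIdentities

end GeomOsc
end

noncomputable section

set_option linter.unusedSectionVars false

namespace GeomOsc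

universe u v

/-! ### The function η and the action of □ on functions of the phase -/

section BoxIdentities

open Set Filter Bundle

variable {n : ℕ} {M : Type u} [TopologicalSpace M] [ChartedSpace (EuclideanSpace ℝ (Fin n)) M]
  [IsManifold (𝓡 n) ∞ M]
variable {F : Type v} [NormedAddCommGroup F] [NormedSpace ℝ F]

local notation "𝔼" => EuclideanSpace ℝ (Fin n)
local notation "φ" => extChartAt (𝓡 n)

variable {cov : Connection n M} {p : M} {Ω₀ : Set M} {γ : M → ℝ → M}

/-- First order Taylor formula along radial geodesics. -/
lemma IsNormalNhd.sub_center_eq [T2Space M] (h : IsNormalNhd cov p Ω₀ γ)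
    (hcov : cov.ContMDiffCovariantDerivative ∞) {f : M → ℝ}
    (hf : ∀ q ∈ Ω₀, ContMDiffAt (𝓡 n) 𝓘(ℝ, ℝ) ∞ f q) {q : M} (hq : q ∈ Ω₀) :
    f q - f p = ∑ i, normalCoord n p γ q i *
      radialMean γ (frameDeriv (normalCoord n p γ) i f) q := by
  have hc : ∀ i, ContinuousOn (fun s => frameDeriv (normalCoord n p γ) i f (γ q s)) (Icc 0 1) :=
    fun i => h.continuousOn_comp
      (fun q hq => contMDiffAt_frameDeriv (h.isCoord_normalCoord hcov) hq (hf q hq) i) hq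
  have h1 := integral_eq_sub_of_hasDerivWithinAt_unit
    (fun s hs => h.hasDerivWithinAt_radial hcov hf hq hs)
    (continuousOn_finsetSum _ fun i _ => continuousOn_const.mul (hc i))
  rw [h.target q hq, h.source q hq, intervalIntegral.integral_finsetSum fun i _ =>
    ContinuousOn.intervalIntegrable (by
      rw [uIcc_of_le zero_le_one]; exact continuousOn_const.mul (hc i))] at h1
  simp_rw [intervalIntegral.integral_const_mul] at h1
  exact h1.symm

/-- A radial primitive. -/
lemma IsNormalNhd.integral_div_eq [T2Space M] (h : IsNormalNhd cov p Ω₀ γ)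
    (hcov : cov.ContMDiffCovariantDerivative ∞) {f : M → ℝ}
    (hf : ∀ q ∈ Ω₀, ContMDiffAt (𝓡 n) 𝓘(ℝ, ℝ) ∞ f q) (hfp : f p = 0) {q : M} (hq : q ∈ Ω₀) :
    ∫ s in (0 : ℝ)..1, f (γ q s) / s = ∑ i, normalCoord n p γ q i *
      radialMean γ (radialMean γ (frameDeriv (normalCoord n p γ) i f)) q := by
  have hsm : ∀ i, ∀ q ∈ Ω₀, ContMDiffAt (𝓡 n) 𝓘(ℝ, ℝ) ∞
      (radialMean γ (frameDeriv (normalCoord n p γ) i f)) q := fun i q hq =>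
    h.contMDiffAt_radialMean
      (fun q hq => contMDiffAt_frameDeriv (h.isCoord_normalCoord hcov) hq (hf q hq) i) hq
  -- Since f(p) = 0, the first order Taylor formula at γ_q(s) contains a factor s that cancels the
  -- denominator. The result is visibly smooth in q.
  have e : ∫ s in (0 : ℝ)..1, f (γ q s) / s = ∫ s in (0 : ℝ)..1, ∑ i, normalCoord n p γ q i *
      radialMean γ (frameDeriv (normalCoord n p γ) i f) (γ q s) := by
    rw [intervalIntegral.integral_of_le zero_le_one, intervalIntegral.integral_of_le zero_le_one]
    refine setIntegral_congr_fun measurableSet_Ioc fun s hs => ?_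
    have hsI : s ∈ Icc (0 : ℝ) 1 := ⟨hs.1.le, hs.2⟩
    have h1 := h.sub_center_eq hcov hf (h.mapsTo q hq hsI)
    rw [hfp, sub_zero, h.normalCoord_curve hq hsI] at h1
    simp only [h1, PiLp.smul_apply, smul_eq_mul, Finset.sum_div]
    refine Finset.sum_congr rfl fun i _ => ?_
    have := hs.1.ne'
    field_simp
  rw [e, intervalIntegral.integral_finsetSum fun i _ =>
    ContinuousOn.intervalIntegrable (by
      rw [uIcc_of_le zero_le_one]
      exact continuousOn_const.mul (h.continuousOn_comp (hsm i) hq))]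
  simp_rw [intervalIntegral.integral_const_mul]
  rfl

/-- By the scaling of radial geodesics, τ times the mean up to γ_q(τ) is ∫₀^τ f(γ_q(r)) dr; the
fundamental theorem of calculus gives the derivative at τ = 1. -/
lemma IsNormalNhd.hasDerivWithinAt_radialMean [T2Space M] (h : IsNormalNhd cov p Ω₀ γ)
    {f : M → ℝ} (hf : ∀ q ∈ Ω₀, ContMDiffAt (𝓡 n) 𝓘(ℝ, ℝ) ∞ f q) {q : M} (hq : q ∈ Ω₀) :
    HasDerivWithinAt (fun τ => τ * radialMean γ f (γ q τ)) (f q) (Icc 0 1) 1 := by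
  have hc := h.continuousOn_comp hf hq
  have h1 : (1 : ℝ) ∈ Icc (0 : ℝ) 1 := ⟨zero_le_one, le_rfl⟩
  set g := extUI (toUI fun s => f (γ q s))
  have hg : Continuous g := extUI_continuous _
  have hg1 : g 1 = f q := by
    rw [show g 1 = f (γ q 1) from extUI_toUI hc h1, h.target q hq]
  have h2 : HasDerivAt (fun τ => ∫ r in (0 : ℝ)..τ, g r) (g 1) 1 :=
    intervalIntegral.integral_hasDerivAt_right (hg.intervalIntegrable _ _)
      hg.aestronglyMeasurable.stronglyMeasurableAtFilter hg.continuousAt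
  rw [hg1] at h2
  have e : ∀ τ ∈ Icc (0 : ℝ) 1, τ * radialMean γ f (γ q τ) = ∫ r in (0 : ℝ)..τ, g r := by
    intro τ hτ
    have h3 := intervalIntegral.mul_integral_comp_mul_left (a := 0) (b := 1) (f := g) τ
    rw [mul_zero, mul_one] at h3
    rw [← h3, radialMean]
    congr 1
    refine intervalIntegral.integral_congr fun s hs => ?_
    rw [uIcc_of_le zero_le_one] at hs
    have hm : τ * s ∈ Icc (0 : ℝ) 1 := ⟨mul_nonneg hτ.1 hs.1, mul_le_one₀ hτ.2 hs.1 hs.2⟩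
    rw [h.curve_curve hq hτ hs, show g (τ * s) = f (γ q (τ * s)) from extUI_toUI hc hm]
  exact h2.hasDerivWithinAt.congr e (e 1 h1)

section Eta

variable {Φ : M → ℝ}

lemma IsNormalNhd.contMDiffAt_box₀ [T2Space M] (h : IsNormalNhd cov p Ω₀ γ)
    (hcov : cov.ContMDiffCovariantDerivative ∞)
    (hΦ : ∀ q ∈ Ω₀, ContMDiffAt (𝓡 n) 𝓘(ℝ, ℝ) ∞ Φ q)
    (hd : ∀ q ∈ Ω₀, (weightedHessMatrix cov 1 Φ (γ q)).det ≠ 0) {q : M} (hq : q ∈ Ω₀) :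
    ContMDiffAt (𝓡 n) 𝓘(ℝ, ℝ) ∞ (fun y => (n : ℝ) - box₀ cov Φ γ Φ y) q := by
  refine contMDiffAt_const.sub ?_
  have h1 : ContMDiffAt (𝓡 n) 𝓘(ℝ, ℝ) ∞ (fun y => ∑ i, ∑ j, boxMatrix cov p γ Φ y i j •
      hessComp cov (normalCoord n p γ) Φ j i y) q := by
    refine ContMDiffAt.sum fun i _ => ContMDiffAt.sum fun j _ => ?_
    exact (h.contMDiffAt_boxMatrix hcov hΦ hq (hd q hq) i j).smul
      (contMDiffAt_hessComp hcov (h.isCoord_normalCoord hcov) hΦ hq j i)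
  refine h1.congr_of_eventuallyEq ?_
  filter_upwards [h.isOpen.mem_nhds hq] with y hy
  exact h.box₀_eq hcov hΦ hy (hd y hy) (hΦ y hy)

lemma IsNormalNhd.eta_eq [T2Space M] (h : IsNormalNhd cov p Ω₀ γ)
    (hcov : cov.ContMDiffCovariantDerivative ∞)
    (hΦ : ∀ q ∈ Ω₀, ContMDiffAt (𝓡 n) 𝓘(ℝ, ℝ) ∞ Φ q)
    (hd : ∀ q ∈ Ω₀, (weightedHessMatrix cov 1 Φ (γ q)).det ≠ 0) {q : M} (hq : q ∈ Ω₀) :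
    eta cov Φ γ q = ∑ i, normalCoord n p γ q i * radialMean γ (radialMean γ
      (frameDeriv (normalCoord n p γ) i fun y => (n : ℝ) - box₀ cov Φ γ Φ y)) q :=
  h.integral_div_eq hcov (fun q hq => h.contMDiffAt_box₀ hcov hΦ hd hq)
    (by rw [h.box₀_center hcov hΦ hd, sub_self]) hq

lemma IsNormalNhd.contMDiffAt_eta [T2Space M] (h : IsNormalNhd cov p Ω₀ γ)
    (hcov : cov.ContMDiffCovariantDerivative ∞)
    (hΦ : ∀ q ∈ Ω₀, ContMDiffAt (𝓡 n) 𝓘(ℝ, ℝ) ∞ Φ q)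
    (hd : ∀ q ∈ Ω₀, (weightedHessMatrix cov 1 Φ (γ q)).det ≠ 0) {q : M} (hq : q ∈ Ω₀) :
    ContMDiffAt (𝓡 n) 𝓘(ℝ, ℝ) ∞ (eta cov Φ γ) q := by
  have h1 : ContMDiffAt (𝓡 n) 𝓘(ℝ, ℝ) ∞ (fun q => ∑ i, normalCoord n p γ q i *
      radialMean γ (radialMean γ (frameDeriv (normalCoord n p γ) i
        fun y => (n : ℝ) - box₀ cov Φ γ Φ y)) q) q := by
    refine ContMDiffAt.sum fun i _ => ContMDiffAt.mul ?_ ?_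
    · exact (EuclideanSpace.proj (𝕜 := ℝ) i : 𝔼 →L[ℝ] ℝ).contDiff.contMDiff.contMDiffAt.comp q
        (h.contMDiffAt_normalCoord hcov hq)
    · exact h.contMDiffAt_radialMean (fun q hq => h.contMDiffAt_radialMean (fun q hq =>
        contMDiffAt_frameDeriv (h.isCoord_normalCoord hcov) hq
          (h.contMDiffAt_box₀ hcov hΦ hd hq) i) hq) hq
  refine h1.congr_of_eventuallyEq ?_
  filter_upwards [h.isOpen.mem_nhds hq] with y hy using h.eta_eq hcov hΦ hd hy

/-- The radial derivative of `η`. -/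
lemma IsNormalNhd.eta_radial [T2Space M] (h : IsNormalNhd cov p Ω₀ γ)
    (hcov : cov.ContMDiffCovariantDerivative ∞)
    (hΦ : ∀ q ∈ Ω₀, ContMDiffAt (𝓡 n) 𝓘(ℝ, ℝ) ∞ Φ q)
    (hd : ∀ q ∈ Ω₀, (weightedHessMatrix cov 1 Φ (γ q)).det ≠ 0) {q : M} (hq : q ∈ Ω₀) :
    ∑ i, normalCoord n p γ q i * frameDeriv (normalCoord n p γ) i (eta cov Φ γ) q =
      n - box₀ cov Φ γ Φ q := by
  have h1 : (1 : ℝ) ∈ Icc (0 : ℝ) 1 := ⟨zero_le_one, le_rfl⟩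
  set k : M → ℝ := fun y => (n : ℝ) - box₀ cov Φ γ Φ y with hk
  have hks : ∀ q ∈ Ω₀, ContMDiffAt (𝓡 n) 𝓘(ℝ, ℝ) ∞ k q :=
    fun q hq => h.contMDiffAt_box₀ hcov hΦ hd hq
  have hkp : k p = 0 := by rw [hk]; simp only; rw [h.box₀_center hcov hΦ hd, sub_self]
  have h2 := h.hasDerivWithinAt_radial hcov (fun q hq => h.contMDiffAt_eta hcov hΦ hd hq) hq h1
  rw [h.target q hq] at h2
  have h3 := HasDerivWithinAt.fun_sum fun i (_ : i ∈ Finset.univ) =>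
    (h.hasDerivWithinAt_radialMean (f := radialMean γ (frameDeriv (normalCoord n p γ) i k))
      (fun q hq => h.contMDiffAt_radialMean (fun q hq =>
        contMDiffAt_frameDeriv (h.isCoord_normalCoord hcov) hq (hks q hq) i) hq)
      hq).const_mul (normalCoord n p γ q i)
  -- The derivative of η along its own geodesic at time 1 is computed in two ways: by the chain
  -- rule, and from the representation of η by means, which returns the integrand n - □₀Φ.
  have e : ∀ τ ∈ Icc (0 : ℝ) 1, eta cov Φ γ (γ q τ) = ∑ i, normalCoord n p γ q i * (τ *
      radialMean γ (radialMean γ (frameDeriv (normalCoord n p γ) i k)) (γ q τ)) := by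
    intro τ hτ
    rw [h.eta_eq hcov hΦ hd (h.mapsTo q hq hτ)]
    refine Finset.sum_congr rfl fun i _ => ?_
    rw [h.normalCoord_curve hq hτ, PiLp.smul_apply, smul_eq_mul]
    ring
  have h4 := (uniqueDiffOn_Icc zero_lt_one 1 h1).eq_deriv _ h2 (h3.congr e (e 1 h1))
  rw [h4, ← h.sub_center_eq hcov hks hq, hkp, sub_zero]

/-- The radial field is the gradient of `Φ` with respect to the first weighted Hessian. -/
lemma IsNormalNhd.normalCoord_eq [T2Space M] (h : IsNormalNhd cov p Ω₀ γ)
    (hcov : cov.ContMDiffCovariantDerivative ∞)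
    (hΦ : ∀ q ∈ Ω₀, ContMDiffAt (𝓡 n) 𝓘(ℝ, ℝ) ∞ Φ q) (hcrit : mvfderiv (𝓡 n) Φ p = 0)
    {q : M} (hq : q ∈ Ω₀) (hd : (weightedHessMatrix cov 1 Φ (γ q)).det ≠ 0) :
    (firstMatrix cov p γ Φ q)⁻¹.mulVec (fun j => frameDeriv (normalCoord n p γ) j Φ q) =
      fun i => normalCoord n p γ q i := by
  have hd' := h.firstMatrix_det hcov hΦ hq hd
  have e : (fun j => frameDeriv (normalCoord n p γ) j Φ q) =
      (firstMatrix cov p γ Φ q).mulVec fun i => normalCoord n p γ q i := by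
    ext i
    exact h.frameDeriv_eq hcov hΦ hcrit hq i
  rw [e, Matrix.mulVec_mulVec, Matrix.nonsing_inv_mul _ (isUnit_iff_ne_zero.2 hd'),
    Matrix.one_mulVec]

/-- The radial field is the gradient of Φ, so Z_ηΦ is the radial derivative of η, that is, n - □₀Φ.
This is the purpose of η. -/
lemma IsNormalNhd.box_phase [T2Space M] (h : IsNormalNhd cov p Ω₀ γ)
    (hcov : cov.ContMDiffCovariantDerivative ∞)
    (hΦ : ∀ q ∈ Ω₀, ContMDiffAt (𝓡 n) 𝓘(ℝ, ℝ) ∞ Φ q) (hcrit : mvfderiv (𝓡 n) Φ p = 0)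
    (hd : ∀ q ∈ Ω₀, (weightedHessMatrix cov 1 Φ (γ q)).det ≠ 0) {q : M} (hq : q ∈ Ω₀) :
    box cov Φ γ Φ q = n := by
  rw [box, h.zField_eq hcov hΦ hq (hd q hq)]
  have h1 := h.eta_radial hcov hΦ hd hq
  have h2 := h.normalCoord_eq hcov hΦ hcrit hq (hd q hq)
  have h3 : ∑ i, ∑ j, ((firstMatrix cov p γ Φ q)⁻¹ i j *
      frameDeriv (normalCoord n p γ) i (eta cov Φ γ) q) • frameDeriv (normalCoord n p γ) j Φ q =
      ∑ i, normalCoord n p γ q i * frameDeriv (normalCoord n p γ) i (eta cov Φ γ) q := by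
    refine Finset.sum_congr rfl fun i _ => ?_
    rw [← congrFun h2 i, Matrix.mulVec, dotProduct, Finset.sum_mul]
    exact Finset.sum_congr rfl fun j _ => by rw [smul_eq_mul]; ring
  rw [h3, h1]
  ring

/-- The symbol of `□` at the differential of `Φ`. -/
lemma IsNormalNhd.boxMatrix_phase [T2Space M] (h : IsNormalNhd cov p Ω₀ γ)
    (hcov : cov.ContMDiffCovariantDerivative ∞) (htor : cov.torsion = 0)
    (hΦ : ∀ q ∈ Ω₀, ContMDiffAt (𝓡 n) 𝓘(ℝ, ℝ) ∞ Φ q) (hcrit : mvfderiv (𝓡 n) Φ p = 0)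
    {q : M} (hq : q ∈ Ω₀) (hd : (weightedHessMatrix cov 1 Φ (γ q)).det ≠ 0) :
    ∑ i, ∑ j, boxMatrix cov p γ Φ q i j *
      (frameDeriv (normalCoord n p γ) j Φ q * frameDeriv (normalCoord n p γ) i Φ q) =
      2 * (Φ q - Φ p) := by
  have h2 := h.normalCoord_eq hcov hΦ hcrit hq hd
  set v : Fin n → ℝ := fun j => frameDeriv (normalCoord n p γ) j Φ q with hv
  set B := firstMatrix cov p γ Φ q with hB
  have hsymm : B⁻¹.transpose = B⁻¹ := by
    -- Symmetry of the first weighted Hessian, where the vanishing torsion enters, allows both of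
    -- its inverses to act on dΦ. Each of them produces the radial vector.
    rw [Matrix.transpose_nonsing_inv]
    congr 1
    ext i j
    exact h.firstMatrix_symm htor hΦ hq j i
  have h3 : ∑ i, ∑ j, boxMatrix cov p γ Φ q i j * (v j * v i) =
      dotProduct v ((boxMatrix cov p γ Φ q).mulVec v) := by
    simp only [dotProduct, Matrix.mulVec, Finset.mul_sum]
    exact Finset.sum_congr rfl fun i _ => Finset.sum_congr rfl fun j _ => by ring
  have h4 := h.secondMatrix_radial hcov hΦ hcrit hq
  change ∑ i, ∑ j, boxMatrix cov p γ Φ q i j * (v j * v i) = _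
  rw [h3, ← h4, boxMatrix, ← hB, ← Matrix.mulVec_mulVec, h2, ← Matrix.mulVec_mulVec,
    Matrix.dotProduct_mulVec, ← Matrix.mulVec_transpose, hsymm, h2]
  simp only [dotProduct, Matrix.mulVec, Finset.mul_sum]
  exact Finset.sum_congr rfl fun i _ => Finset.sum_congr rfl fun j _ => by ring

/-- The operator `□` on functions of the phase. -/
lemma IsNormalNhd.box_comp [T2Space M] (h : IsNormalNhd cov p Ω₀ γ)
    (hcov : cov.ContMDiffCovariantDerivative ∞) (htor : cov.torsion = 0)
    (hΦ : ∀ q ∈ Ω₀, ContMDiffAt (𝓡 n) 𝓘(ℝ, ℝ) ∞ Φ q) (hcrit : mvfderiv (𝓡 n) Φ p = 0)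
    (hd : ∀ q ∈ Ω₀, (weightedHessMatrix cov 1 Φ (γ q)).det ≠ 0) {g g' g'' : ℝ → ℂ}
    (hgs : ContDiff ℝ ∞ g) (hg : ∀ s, HasDerivAt g (g' s) s)
    (hg' : ∀ s, HasDerivAt g' (g'' s) s) {q : M} (hq : q ∈ Ω₀) :
    box cov Φ γ (fun y => g (Φ y)) q =
      (2 * (Φ q - Φ p)) • g'' (Φ q) + (n : ℝ) • g' (Φ q) := by
  have hs : ContMDiffAt (𝓡 n) 𝓘(ℝ, ℂ) ∞ (fun y => g (Φ y)) q :=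
    hgs.contMDiff.contMDiffAt.comp q (hΦ q hq)
  have h1 : ∀ j, frameDeriv (normalCoord n p γ) j (fun y => g (Φ y)) q =
      frameDeriv (normalCoord n p γ) j Φ q • g' (Φ q) := by
    intro j
    rw [frameDeriv, mvfderiv_comp_fderiv (hg _).differentiableAt
      ((hΦ q hq).mdifferentiableAt (by simp)), (hg _).hasFDerivAt.fderiv]
    simp [frameDeriv]
  -- By the chain rule for the Hessian, g'' is multiplied by the symbol at dΦ and g' by □Φ; these
  -- are the two quantities computed above.
  rw [← h.box_phase hcov hΦ hcrit hd hq, ← h.boxMatrix_phase hcov htor hΦ hcrit hq (hd q hq),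
    box, box, h.zField_eq hcov hΦ hq (hd q hq), h.zField_eq hcov hΦ hq (hd q hq),
    h.box₀_eq hcov hΦ hq (hd q hq) hs, h.box₀_eq hcov hΦ hq (hd q hq) (hΦ q hq)]
  simp only [hessComp, hess_comp (hΦ q hq) hg hg', h1, add_smul, Finset.sum_smul, smul_add,
    Finset.sum_add_distrib, smul_smul, smul_eq_mul]
  rw [add_assoc]
  rfl

/-- The operator `□` in the frame of normal coordinates. -/
lemma IsNormalNhd.box_eq [T2Space M] (h : IsNormalNhd cov p Ω₀ γ)
    (hcov : cov.ContMDiffCovariantDerivative ∞)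
    (hΦ : ∀ q ∈ Ω₀, ContMDiffAt (𝓡 n) 𝓘(ℝ, ℝ) ∞ Φ q)
    (hd : ∀ q ∈ Ω₀, (weightedHessMatrix cov 1 Φ (γ q)).det ≠ 0) :
    ∃ (a : Fin n → Fin n → M → ℝ) (b : Fin n → M → ℝ),
      (∀ i j, ∀ q ∈ Ω₀, ContMDiffAt (𝓡 n) 𝓘(ℝ, ℝ) ∞ (a i j) q) ∧
      (∀ i, ∀ q ∈ Ω₀, ContMDiffAt (𝓡 n) 𝓘(ℝ, ℝ) ∞ (b i) q) ∧
      ∀ f : M → ℂ, ∀ q ∈ Ω₀, ContMDiffAt (𝓡 n) 𝓘(ℝ, ℂ) ∞ f q →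
        box cov Φ γ f q = ∑ i, ∑ j, a i j q • frameDeriv (normalCoord n p γ) i
            (frameDeriv (normalCoord n p γ) j f) q
          + ∑ k, b k q • frameDeriv (normalCoord n p γ) k f q := by
  have hΘ := h.isCoord_normalCoord hcov
  refine ⟨fun i j q => boxMatrix cov p γ Φ q i j, fun k q =>
    ∑ i, (firstMatrix cov p γ Φ q)⁻¹ i k * frameDeriv (normalCoord n p γ) i (eta cov Φ γ) q
    - ∑ i, ∑ j, boxMatrix cov p γ Φ q i j * christoffel cov (normalCoord n p γ)
      (EuclideanSpace.single i 1) (EuclideanSpace.single j 1) q k,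
    fun i j q hq => h.contMDiffAt_boxMatrix hcov hΦ hq (hd q hq) i j, fun k q hq => ?_,
    fun f q hq hf => ?_⟩
  · refine ContMDiffAt.sub (ContMDiffAt.sum fun i _ => ?_)
      (ContMDiffAt.sum fun i _ => ContMDiffAt.sum fun j _ => ?_)
    · exact (h.contMDiffAt_firstMatrix_inv hcov hΦ hq (hd q hq) i k).mul
        (contMDiffAt_frameDeriv hΘ hq (h.contMDiffAt_eta hcov hΦ hd hq) i)
    · refine (h.contMDiffAt_boxMatrix hcov hΦ hq (hd q hq) i j).mul ?_
      exact (EuclideanSpace.proj (𝕜 := ℝ) k : 𝔼 →L[ℝ] ℝ).contDiff.contMDiff.contMDiffAt.comp q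
        (contMDiffAt_christoffel hcov hΘ hq _ _)
  · rw [box, h.box₀_eq hcov hΦ hq (hd q hq) hf, h.zField_eq hcov hΦ hq (hd q hq)]
    simp_rw [hessComp_eq hΘ hq hf, smul_sub, Finset.sum_sub_distrib, sub_smul,
      Finset.sum_sub_distrib, Finset.smul_sum, smul_smul, Finset.sum_smul]
    rw [Finset.sum_comm (f := fun i j => ((firstMatrix cov p γ Φ q)⁻¹ i j *
      frameDeriv (normalCoord n p γ) i (eta cov Φ γ) q) • frameDeriv (normalCoord n p γ) j f q)]
    have e : ∑ i, ∑ j, ∑ k, (boxMatrix cov p γ Φ q i j * christoffel cov (normalCoord n p γ)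
        (EuclideanSpace.single i 1) (EuclideanSpace.single j 1) q k) •
          frameDeriv (normalCoord n p γ) k f q =
        ∑ k, ∑ i, ∑ j, (boxMatrix cov p γ Φ q i j * christoffel cov (normalCoord n p γ)
        (EuclideanSpace.single i 1) (EuclideanSpace.single j 1) q k) •
          frameDeriv (normalCoord n p γ) k f q := by
      rw [Finset.sum_comm]
      conv_rhs => rw [Finset.sum_comm]
      conv_rhs => enter [2, i]; rw [Finset.sum_comm]
      exact Finset.sum_comm
    rw [e]
    abel

end Eta

end BoxIdentities

end GeomOsc
end

noncomputable section

set_option linter.unusedSectionVars false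

namespace GeomOsc

universe u v

/-! ### Normal coordinates as a chart of Ω₀ -/

section GlobalChart

open Set Filter Bundle

variable {n : ℕ} {M : Type u} [TopologicalSpace M] [ChartedSpace (EuclideanSpace ℝ (Fin n)) M]
  [IsManifold (𝓡 n) ∞ M]
variable {F : Type v} [NormedAddCommGroup F] [NormedSpace ℝ F]

local notation "𝔼" => EuclideanSpace ℝ (Fin n)
local notation "φ" => extChartAt (𝓡 n)

variable {cov : Connection n M} {p : M} {Ω₀ : Set M} {γ : M → ℝ → M}
variable {Θ : M → EuclideanSpace ℝ (Fin n)} {U : Set M}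

lemma IsCoord.injective_fderiv (h : IsCoord Θ U) {x₀ q : M} (hq : q ∈ U) (hs : q ∈ (φ x₀).source) :
    Function.Injective (fderiv ℝ (inCoord x₀ Θ) (φ x₀ q)) := by
  intro a b hab
  have := mvfderiv_eq_fderiv_inCoord hs ((h.smooth q hq).mdifferentiableAt (by simp))
  rw [← chart_triv_symm hs a, ← chart_triv_symm hs b, ← this, ← this] at hab
  rw [← chart_triv_symm hs a, h.injective q hq hab, chart_triv_symm hs b]

/-- Coordinates have smooth local inverses. -/
lemma IsCoord.exists_local_inverse (h : IsCoord Θ U) {q : M} (hq : q ∈ U) :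
    ∃ Ψ : 𝔼 → M, ContMDiffAt 𝓘(ℝ, 𝔼) (𝓡 n) ∞ Ψ (Θ q) ∧ Ψ (Θ q) = q ∧
      (∀ᶠ y in 𝓝 (Θ q), Θ (Ψ y) = y) ∧ ∀ᶠ x in 𝓝 q, Ψ (Θ x) = x := by
  have hs := mem_extChartAt_source (I := 𝓡 n) q
  have hg := contDiffAt_inCoord hs (h.smooth q hq)
  have hi := h.injective_fderiv hq hs
  let e : 𝔼 ≃L[ℝ] 𝔼 := (LinearEquiv.ofInjectiveEndo
    (fderiv ℝ (inCoord q Θ) (φ q q)).toLinearMap hi).toContinuousLinearEquiv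
  have he : (e : 𝔼 →L[ℝ] 𝔼) = fderiv ℝ (inCoord q Θ) (φ q q) := by ext; rfl
  have hd : HasFDerivAt (inCoord q Θ) (e : 𝔼 →L[ℝ] 𝔼) (φ q q) := by
    rw [he]; exact (hg.differentiableAt (by simp)).hasFDerivAt
  have hst := hg.hasStrictFDerivAt' hd (by simp)
  have h0 : inCoord q Θ (φ q q) = Θ q := inCoord_chart hs Θ
  have hloc := hg.to_localInverse hd (by simp)
  have hl0 := hg.localInverse_apply_image hd (by simp)
  have hr := hst.eventually_right_inverse
  have hl := hst.eventually_left_inverse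
  change ContDiffAt ℝ ∞ (hst.localInverse _ _ _) _ at hloc
  change hst.localInverse _ _ _ _ = _ at hl0
  rw [h0] at hloc hr hl0
  refine ⟨fun y => (φ q).symm (hst.localInverse _ _ _ y), ?_, ?_, ?_, ?_⟩
  · refine ContMDiffAt.comp (I' := 𝓘(ℝ, 𝔼)) (Θ q) (g := (φ q).symm) ?_ hloc.contMDiffAt
    rw [hl0]
    exact contMDiffAt_chart_symm ((φ q).map_source hs)
  · simp only [hl0, (φ q).left_inv hs]
  · exact hr
  · filter_upwards [(contMDiffAt_chart hs).continuousAt.eventually hl, source_mem_nhds hs]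
      with x hx hxs
    rw [inCoord_chart hxs] at hx
    rw [hx, (φ q).left_inv hxs]

/-- A point of a normal neighborhood is determined by its normal coordinates. -/
lemma IsNormalNhd.injOn_normalCoord [T2Space M] (h : IsNormalNhd cov p Ω₀ γ)
    (hcov : cov.ContMDiffCovariantDerivative ∞) : InjOn (normalCoord n p γ) Ω₀ := by
  intro q hq q' hq' hqq
  have h1 : (1 : ℝ) ∈ Icc (0 : ℝ) 1 := ⟨zero_le_one, le_rfl⟩
  have hc : ContinuousOn (γ q) (Icc 0 1) := (h.geodesic q hq).smooth.continuousOn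
  have hc' : ContinuousOn (γ q') (Icc 0 1) := (h.geodesic q' hq').smooth.continuousOn
  -- Two geodesics with the same initial vector have the same normal coordinates at all times. The
  -- set where they agree is closed, and local invertibility of Θ extends it to the right.
  have key : Icc (0 : ℝ) 1 ⊆ {s | γ q s = γ q' s} := by
    refine IsClosed.Icc_subset_of_forall_mem_nhdsWithin ?_ ?_ ?_
    · rw [inter_comm]
      exact (hc.prodMk hc').preimage_isClosed_of_isClosed isClosed_Icc isClosed_diagonal
    · change γ q 0 = γ q' 0
      rw [h.source q hq, h.source q' hq']
    · rintro s ⟨hs, hsI⟩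
      have hsI' : s ∈ Icc (0 : ℝ) 1 := ⟨hsI.1, hsI.2.le⟩
      change γ q s = γ q' s at hs
      obtain ⟨Ψ, -, -, -, hΨ⟩ := (h.isCoord_normalCoord hcov).exists_local_inverse
        (h.mapsTo q hq hsI')
      have e1 := (hc s hsI').eventually hΨ
      have e2 := (hc' s hsI').eventually (hs ▸ hΨ)
      have hle : 𝓝[>] s ≤ 𝓝[Icc 0 1] s := by
        rw [← nhdsWithin_Ioc_eq_nhdsGT hsI.2]
        exact nhdsWithin_mono _ fun r hr => ⟨hsI.1.trans hr.1.le, hr.2⟩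
      have e3 : ∀ᶠ r in 𝓝[Icc 0 1] s, r ∈ Icc (0 : ℝ) 1 := self_mem_nhdsWithin
      filter_upwards [hle e1, hle e2, hle e3] with r hr1 hr2 hr
      rw [← hr1, ← hr2, h.normalCoord_curve hq hr, h.normalCoord_curve hq' hr, hqq]
  have := key h1
  change γ q 1 = γ q' 1 at this
  rwa [h.target q hq, h.target q' hq'] at this

/-- Injective coordinates, that is, a chart. -/
structure IsChart (Θ : M → EuclideanSpace ℝ (Fin n)) (U : Set M) : Prop extends IsCoord Θ U where
  injOn : InjOn Θ U

lemma IsNormalNhd.isChart [T2Space M] (h : IsNormalNhd cov p Ω₀ γ)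
    (hcov : cov.ContMDiffCovariantDerivative ∞) : IsChart (normalCoord n p γ) Ω₀ :=
  ⟨h.isCoord_normalCoord hcov, h.injOn_normalCoord hcov⟩

open Classical in
/-- The inverse of the chart `Θ` on `U`, with the constant value `p` elsewhere. -/
def chartInv (Θ : M → EuclideanSpace ℝ (Fin n)) (U : Set M) (p : M)
    (y : EuclideanSpace ℝ (Fin n)) : M :=
  if h : ∃ q ∈ U, Θ q = y then h.choose else p

lemma IsChart.left_inv (h : IsChart Θ U) {q : M} (hq : q ∈ U) : chartInv Θ U p (Θ q) = q := by
  have hex : ∃ x ∈ U, Θ x = Θ q := ⟨q, hq, rfl⟩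
  rw [chartInv, dif_pos hex]
  exact h.injOn hex.choose_spec.1 hq hex.choose_spec.2

lemma IsChart.mem {y : 𝔼} (h : IsChart Θ U) (hy : y ∈ Θ '' U) : chartInv Θ U p y ∈ U := by
  obtain ⟨q, hq, rfl⟩ := hy
  rwa [h.left_inv hq]

lemma IsChart.right_inv {y : 𝔼} (h : IsChart Θ U) (hy : y ∈ Θ '' U) :
    Θ (chartInv Θ U p y) = y := by
  obtain ⟨q, hq, rfl⟩ := hy
  rw [h.left_inv hq]

lemma IsChart.eventually_image (h : IsChart Θ U) {W : Set M} (hW : IsOpen W) (hWU : W ⊆ U)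
    {q : M} (hq : q ∈ W) : ∀ᶠ y in 𝓝 (Θ q), y ∈ Θ '' W := by
  obtain ⟨Ψ, hΨ, hΨq, hr, -⟩ := h.toIsCoord.exists_local_inverse (hWU hq)
  have hc := hΨ.continuousAt
  rw [ContinuousAt, hΨq] at hc
  filter_upwards [hr, hc (hW.mem_nhds hq)] with y hy hy'
  exact ⟨Ψ y, hy', hy⟩

lemma IsChart.isOpen_image (h : IsChart Θ U) {W : Set M} (hW : IsOpen W) (hWU : W ⊆ U) :
    IsOpen (Θ '' W) := by
  rw [isOpen_iff_mem_nhds]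
  rintro _ ⟨q, hq, rfl⟩
  exact h.eventually_image hW hWU hq

lemma IsChart.contMDiffAt_chartInv (h : IsChart Θ U) {y : 𝔼} (hy : y ∈ Θ '' U) :
    ContMDiffAt 𝓘(ℝ, 𝔼) (𝓡 n) ∞ (chartInv Θ U p) y := by
  obtain ⟨q, hq, rfl⟩ := hy
  obtain ⟨Ψ, hΨ, hΨq, hr, -⟩ := h.toIsCoord.exists_local_inverse hq
  have hc := hΨ.continuousAt
  rw [ContinuousAt, hΨq] at hc
  refine hΨ.congr_of_eventuallyEq ?_
  filter_upwards [hr, hc (h.isOpen.mem_nhds hq)] with y hy hy'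
  conv_lhs => rw [← hy]
  exact h.left_inv hy'

lemma IsChart.contDiffAt_comp (h : IsChart Θ U) {q : M} (hq : q ∈ U) {f : M → F}
    (hf : ContMDiffAt (𝓡 n) 𝓘(ℝ, F) ∞ f q) :
    ContDiffAt ℝ ∞ (fun y => f (chartInv Θ U p y)) (Θ q) := by
  rw [← contMDiffAt_iff_contDiffAt]
  refine ContMDiffAt.comp (Θ q) (g := f) ?_ (h.contMDiffAt_chartInv ⟨q, hq, rfl⟩)
  rwa [h.left_inv hq]

lemma IsChart.mvfderiv_eq (h : IsChart Θ U) {q : M} (hq : q ∈ U) {f : M → F}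
    (hf : ContMDiffAt (𝓡 n) 𝓘(ℝ, F) ∞ f q) (v : TangentSpace (𝓡 n) q) :
    mvfderiv (𝓡 n) f q v =
      fderiv ℝ (fun y => f (chartInv Θ U p y)) (Θ q) (mvfderiv (𝓡 n) Θ q v) := by
  rw [← mvfderiv_comp_fderiv ((h.contDiffAt_comp hq hf).differentiableAt (by simp))
    ((h.smooth q hq).mdifferentiableAt (by simp))]
  refine mvfderiv_congr ?_ v
  filter_upwards [h.isOpen.mem_nhds hq] with y hy
  rw [h.left_inv hy]

lemma IsChart.frameDeriv_eq (h : IsChart Θ U) {q : M} (hq : q ∈ U) {f : M → F}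
    (hf : ContMDiffAt (𝓡 n) 𝓘(ℝ, F) ∞ f q) (i : Fin n) :
    frameDeriv Θ i f q = fderiv ℝ (fun y => f (chartInv Θ U p y)) (Θ q)
      (EuclideanSpace.single i 1) := by
  rw [frameDeriv, h.mvfderiv_eq (p := p) hq hf, h.apply_frame hq]

end GlobalChart

end GeomOsc
end

noncomputable section

set_option linter.unusedSectionVars false

namespace GeomOsc

universe u v

/-! ### Densities in coordinates -/

section DensityInChart

open Set Filter Bundle

variable {n : ℕ} {M : Type u} [TopologicalSpace M] [ChartedSpace (EuclideanSpace ℝ (Fin n)) M]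
  [IsManifold (𝓡 n) ∞ M]

local notation "𝔼" => EuclideanSpace ℝ (Fin n)
local notation "φ" => extChartAt (𝓡 n)

variable {p : M} {Θ : M → EuclideanSpace ℝ (Fin n)} {U : Set M}

/-- The density with respect to the coordinates `Θ`. -/
def densityIn (ρ : SmoothDensity n M) (Θ : M → EuclideanSpace ℝ (Fin n)) (q : M) : ℝ :=
  ρ.toFun q fun i => frame Θ (EuclideanSpace.single i 1) q

/-- The equality is heterogeneous because the two vectors belong to the tangent spaces at (φ
x₀).symm (φ x₀ q) and at q, which agree only after rewriting. -/
lemma mfderiv_chart_symm {x₀ q : M} (hq : q ∈ (φ x₀).source) (v : 𝔼) :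
    HEq (mfderiv 𝓘(ℝ, 𝔼) (𝓡 n) (φ x₀).symm (φ x₀ q) v) (frame (φ x₀) v q) := by
  have hy := (φ x₀).map_source hq
  have hs := (contMDiffAt_chart_symm hy).mdifferentiableAt (by simp : (∞ : WithTop ℕ∞) ≠ 0)
  have key : mvfderiv (𝓡 n) (φ x₀) ((φ x₀).symm (φ x₀ q))
      (mfderiv 𝓘(ℝ, 𝔼) (𝓡 n) (φ x₀).symm (φ x₀ q) v) = v := by
    have h := mfderiv_comp_apply (I := 𝓘(ℝ, 𝔼)) (I' := 𝓡 n) (I'' := 𝓘(ℝ, 𝔼)) (φ x₀ q)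
      (g := φ x₀) (f := (φ x₀).symm)
      ((contMDiffAt_chart ((φ x₀).map_target hy)).mdifferentiableAt (by simp)) hs v
    have h2 : (φ x₀ ∘ (φ x₀).symm) =ᶠ[𝓝 (φ x₀ q)] id := by
      filter_upwards [target_mem_nhds hq] with y hy
      exact (φ x₀).right_inv hy
    have h3 : mfderiv 𝓘(ℝ, 𝔼) 𝓘(ℝ, 𝔼) (φ x₀ ∘ (φ x₀).symm) (φ x₀ q)
        = mfderiv 𝓘(ℝ, 𝔼) 𝓘(ℝ, 𝔼) id (φ x₀ q) := h2.mfderiv_eq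
    rw [mfderiv_id] at h3
    have h4 := congrArg (fun L : 𝔼 →L[ℝ] 𝔼 => L v) h3
    exact h.symm.trans h4
  have e := (φ x₀).left_inv hq
  have h5 := (isCoord_chart x₀).frame_apply ((φ x₀).map_target hy)
    (mfderiv 𝓘(ℝ, 𝔼) (𝓡 n) (φ x₀).symm (φ x₀ q) v)
  rw [key] at h5
  rw [← h5]
  rw [e]

lemma inChart_eq (ρ : SmoothDensity n M) {x₀ q : M} (hq : q ∈ (φ x₀).source) :
    ρ.inChart x₀ (φ x₀ q) = densityIn ρ (φ x₀) q := by
  have e := (φ x₀).left_inv hq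
  rw [SmoothDensity.inChart, densityIn]
  congr 1
  funext i
  exact eq_of_heq (mfderiv_chart_symm hq _)

lemma IsCoord.densityIn_pos (h : IsCoord Θ U) (ρ : SmoothDensity n M) {q : M} (hq : q ∈ U) :
    0 < densityIn ρ Θ q := by
  refine ρ.pos q _ ?_
  have h1 : LinearIndependent ℝ fun i : Fin n => (EuclideanSpace.single i (1 : ℝ) : 𝔼) := by
    have e : (fun i : Fin n => (EuclideanSpace.single i (1 : ℝ) : 𝔼)) =
        EuclideanSpace.basisFun (Fin n) ℝ := by
      funext i
      simp
    rw [e]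
    exact (EuclideanSpace.basisFun (Fin n) ℝ).orthonormal.linearIndependent
  refine LinearIndependent.of_comp (mvfderiv (𝓡 n) Θ q).toLinearMap ?_
  have e : (mvfderiv (𝓡 n) Θ q).toLinearMap ∘ (fun i => frame Θ (EuclideanSpace.single i 1) q) =
      fun i : Fin n => (EuclideanSpace.single i (1 : ℝ) : 𝔼) :=
    funext fun i => h.apply_frame hq _
  rw [e]
  exact h1

lemma IsCoord.densityIn_chart (h : IsCoord Θ U) (ρ : SmoothDensity n M) {x₀ q : M} (hq : q ∈ U)
    (hs : q ∈ (φ x₀).source) :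
    densityIn ρ (φ x₀) q =
      |(fderiv ℝ (inCoord x₀ Θ) (φ x₀ q)).det| * densityIn ρ Θ q := by
  have hc := isCoord_chart (n := n) (M := M) x₀
  let e : TangentSpace (𝓡 n) q ≃ₗ[ℝ] 𝔼 :=
    LinearEquiv.ofBijective (mvfderiv (𝓡 n) (φ x₀) q).toLinearMap
      ⟨hc.injective q hs, fun w => ⟨frame (φ x₀) w q, hc.apply_frame hs w⟩⟩
  have he : ∀ v, e v = mvfderiv (𝓡 n) (φ x₀) q v := fun v => rfl
  have hes : ∀ v, e.symm v = frame (φ x₀) v q := fun v => by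
    rw [LinearEquiv.symm_apply_eq, he, hc.apply_frame hs]
  let A : TangentSpace (𝓡 n) q →ₗ[ℝ] TangentSpace (𝓡 n) q :=
    e.symm.toLinearMap ∘ₗ (mvfderiv (𝓡 n) Θ q).toLinearMap
  have hA : ∀ v, A v = frame (φ x₀) (mvfderiv (𝓡 n) Θ q v) q := fun v => hes _
  have h1 := ρ.map_linear q A fun i => frame Θ (EuclideanSpace.single i 1) q
  have h2 : (fun i : Fin n => A (frame Θ (EuclideanSpace.single i 1) q)) =
      fun i => frame (φ x₀) (EuclideanSpace.single i 1) q := by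
    funext i
    rw [hA, h.apply_frame hq]
  rw [h2] at h1
  rw [densityIn, h1, densityIn]
  congr 2
  rw [← LinearMap.det_conj A e, ContinuousLinearMap.det]
  congr 1
  ext1 v
  change e (A (e.symm v)) = fderiv ℝ (inCoord x₀ Θ) (φ x₀ q) v
  rw [hA, he, hc.apply_frame hs, hes,
    mvfderiv_eq_fderiv_inCoord hs ((h.smooth q hq).mdifferentiableAt (by simp)),
    hc.apply_frame hs]

/-- Smoothness is given for the preferred charts; dividing by the Jacobian, whose absolute value is
smooth because it does not vanish, transfers it to Θ. -/
lemma IsCoord.contMDiffAt_densityIn (h : IsCoord Θ U) (ρ : SmoothDensity n M) {q : M}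
    (hq : q ∈ U) : ContMDiffAt (𝓡 n) 𝓘(ℝ, ℝ) ∞ (densityIn ρ Θ) q := by
  have hs := mem_extChartAt_source (I := 𝓡 n) q
  have hne : ∀ x ∈ U, x ∈ (φ q).source → (fderiv ℝ (inCoord q Θ) (φ q x)).det ≠ 0 := by
    intro x hx hxs h0
    have hi := h.injective_fderiv hx hxs
    have := LinearMap.bot_lt_ker_of_det_eq_zero h0
    rw [LinearMap.ker_eq_bot.2 hi] at this
    exact lt_irrefl _ this
  have h1 : ContMDiffAt (𝓡 n) 𝓘(ℝ, ℝ) ∞ (fun x => ρ.inChart q (φ q x)) q := by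
    refine ContMDiffAt.comp (I' := 𝓘(ℝ, 𝔼)) q (g := ρ.inChart q) ?_ (contMDiffAt_chart hs)
    exact ((ρ.smooth q).contDiffAt (target_mem_nhds hs)).contMDiffAt
  have h2 : ContMDiffAt (𝓡 n) 𝓘(ℝ, ℝ) ∞ (fun x => (fderiv ℝ (inCoord q Θ) (φ q x)).det) q := by
    have e : ∀ L : 𝔼 →L[ℝ] 𝔼, L.det =
        (Matrix.of fun i j : Fin n => L (EuclideanSpace.single j 1) i).det := by
      intro L
      rw [ContinuousLinearMap.det,
        ← LinearMap.det_toMatrix (EuclideanSpace.basisFun (Fin n) ℝ).toBasis]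
      congr 1
    simp_rw [e]
    refine contMDiffAt_det fun i j => ?_
    have h3 := (contMDiffAt_fderiv_inCoord (h.smooth q hq)).clm_apply
      (contMDiffAt_const (c := (EuclideanSpace.single j (1 : ℝ) : 𝔼)))
    exact (EuclideanSpace.proj (𝕜 := ℝ) i : 𝔼 →L[ℝ] ℝ).contDiff.contMDiff.contMDiffAt.comp q h3
  have h4 : ContMDiffAt (𝓡 n) 𝓘(ℝ, ℝ) ∞ (fun x => |(fderiv ℝ (inCoord q Θ) (φ q x)).det|) q :=
    ContMDiffAt.comp (I' := 𝓘(ℝ, ℝ)) q (g := fun x : ℝ => |x|)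
      (contDiffAt_abs (hne q hq hs)).contMDiffAt h2
  refine (h1.mul (h4.inv₀ (abs_ne_zero.2 (hne q hq hs)))).congr_of_eventuallyEq ?_
  filter_upwards [source_mem_nhds hs, h.isOpen.mem_nhds hq] with x hxs hx
  have := abs_ne_zero.2 (hne x hx hxs)
  change _ = ρ.inChart q (φ q x) * |(fderiv ℝ (inCoord q Θ) (φ q x)).det|⁻¹
  rw [inChart_eq ρ hxs, h.densityIn_chart ρ hx hxs]
  field_simp

end DensityInChart

/-! ### Integration in a chart -/

section MeasureInChart

open Set Filter Bundle

variable {n : ℕ} {M : Type u} [TopologicalSpace M] [ChartedSpace (EuclideanSpace ℝ (Fin n)) M]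
  [IsManifold (𝓡 n) ∞ M] [SecondCountableTopology M] [MeasurableSpace M] [BorelSpace M]

local notation "𝔼" => EuclideanSpace ℝ (Fin n)
local notation "φ" => extChartAt (𝓡 n)

variable {p : M} {Θ : M → EuclideanSpace ℝ (Fin n)} {U : Set M}
variable {ρ : SmoothDensity n M} {μ : Measure M}

lemma IsChart.image_eq (h : IsChart Θ U) {s : Set M} (hs : s ⊆ U) :
    Θ '' s = chartInv Θ U p ⁻¹' s ∩ Θ '' U := by
  ext y
  constructor
  · rintro ⟨q, hq, rfl⟩
    exact ⟨by rwa [mem_preimage, h.left_inv (hs hq)], q, hs hq, rfl⟩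
  · rintro ⟨hy, hyU⟩
    exact ⟨_, hy, h.right_inv hyU⟩

/-- The measure in a chart, for sets in the domain of a preferred chart. -/
lemma IsChart.measure_eq_of_subset (h : IsChart Θ U) (hρ : ρ.Generates μ) {x₀ : M} {s : Set M}
    (hs : MeasurableSet s) (hsU : s ⊆ U) (hsx : s ⊆ (φ x₀).source) :
    μ s = ∫⁻ y in Θ '' s, ENNReal.ofReal (densityIn ρ Θ (chartInv Θ U p y)) := by
  rw [hρ x₀ s hs hsx]
  have himg : φ x₀ '' s = (φ x₀).target ∩ (φ x₀).symm ⁻¹' s := by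
    rw [← (φ x₀).image_source_inter_eq', inter_eq_right.2 hsx]
  have hm : MeasurableSet (φ x₀ '' s) := by
    rw [himg, inter_comm]
    have hc : ContinuousOn (φ x₀).symm (φ x₀).target := continuousOn_extChartAt_symm x₀
    have hmT : MeasurableSet (φ x₀).target := (isOpen_extChartAt_target x₀).measurableSet
    have := (continuousOn_iff_continuous_domRestrict.1 hc).measurable hs
    have h2 := hmT.subtype_image this
    convert h2 using 1
    ext y
    constructor
    · rintro ⟨h1, h2⟩
      exact ⟨⟨y, h2⟩, h1, rfl⟩
    · rintro ⟨⟨y, h2⟩, h1, rfl⟩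
      exact ⟨h1, h2⟩
  have hΘ : Θ '' s = inCoord x₀ Θ '' (φ x₀ '' s) := by
    rw [image_image]
    exact image_congr fun q hq => (inCoord_chart (hsx hq) Θ).symm
  have hd : ∀ y ∈ φ x₀ '' s, HasFDerivWithinAt (inCoord x₀ Θ) (fderiv ℝ (inCoord x₀ Θ) y)
      (φ x₀ '' s) y := by
    rintro _ ⟨q, hq, rfl⟩
    exact ((contDiffAt_inCoord (hsx hq) (h.smooth q (hsU hq))).differentiableAt
      (by simp)).hasFDerivAt.hasFDerivWithinAt
  have hinj : InjOn (inCoord x₀ Θ) (φ x₀ '' s) := by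
    rintro _ ⟨q, hq, rfl⟩ _ ⟨q', hq', rfl⟩ hqq
    rw [inCoord_chart (hsx hq), inCoord_chart (hsx hq')] at hqq
    rw [h.injOn (hsU hq) (hsU hq') hqq]
  rw [hΘ, lintegral_image_eq_lintegral_abs_det_fderiv_mul volume hm hd hinj]
  refine setLIntegral_congr_fun hm ?_
  rintro _ ⟨q, hq, rfl⟩
  simp only [inCoord_chart (hsx hq), h.left_inv (hsU hq)]
  rw [inChart_eq ρ (hsx hq), h.densityIn_chart ρ (hsU hq) (hsx hq), ENNReal.ofReal_mul (abs_nonneg _)]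

lemma IsChart.aemeasurable_chartInv (h : IsChart Θ U) :
    AEMeasurable (chartInv Θ U p) (volume.restrict (Θ '' U)) := by
  have hc : ContinuousOn (chartInv Θ U p) (Θ '' U) := fun y hy =>
    (h.contMDiffAt_chartInv hy).continuousAt.continuousWithinAt
  exact hc.aemeasurable (h.isOpen_image h.isOpen subset_rfl).measurableSet

/-- The density determines the measure only inside preferred charts. Countably many of these cover
M, and the two measures are compared on each of them by the change of variables formula. -/
lemma IsChart.restrict_measure_eq (h : IsChart Θ U) (p : M) (hρ : ρ.Generates μ) :
    μ.restrict U = ((volume.restrict (Θ '' U)).withDensity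
      fun y => ENNReal.ofReal (densityIn ρ Θ (chartInv Θ U p y))).map (chartInv Θ U p) := by
  have hm : AEMeasurable (chartInv Θ U p) ((volume.restrict (Θ '' U)).withDensity
      fun y => ENNReal.ofReal (densityIn ρ Θ (chartInv Θ U p y))) :=
    h.aemeasurable_chartInv.mono_ac (withDensity_absolutelyContinuous _ _)
  obtain ⟨S, hS, hcover⟩ := TopologicalSpace.countable_cover_nhds
    (f := fun x : M => (φ x).source) fun x => extChartAt_source_mem_nhds x
  have key := (Measure.restrict_biUnion_congr (μ := μ.restrict U) (ν := (
    (volume.restrict (Θ '' U)).withDensity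
      fun y => ENNReal.ofReal (densityIn ρ Θ (chartInv Θ U p y))).map (chartInv Θ U p))
    (t := fun x : M => (φ x).source) hS).2 ?_
  · simpa only [hcover, Measure.restrict_univ] using key
  intro x₀ _
  have hso : MeasurableSet (φ x₀).source := (isOpen_extChartAt_source x₀).measurableSet
  ext s hs
  rw [Measure.restrict_apply hs, Measure.restrict_apply hs,
    Measure.restrict_apply (hs.inter hso), Measure.map_apply_of_aemeasurable hm (hs.inter hso),
    withDensity_apply', Measure.restrict_restrict'
      (h.isOpen_image h.isOpen subset_rfl).measurableSet,
    h.measure_eq_of_subset (p := p) hρ ((hs.inter hso).inter h.isOpen.measurableSet)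
      inter_subset_right (inter_subset_left.trans inter_subset_right),
    h.image_eq (p := p) inter_subset_right, preimage_inter, inter_assoc]
  congr 3
  ext y
  constructor
  · rintro ⟨h1, h2⟩; exact h2
  · intro h2; exact ⟨h.mem h2, h2⟩

/-- Integrals in a chart. -/
lemma IsChart.setIntegral_eq (h : IsChart Θ U) (p : M) (hρ : ρ.Generates μ) {Ω : Set M} (hΩ : IsOpen Ω)
    (hΩU : Ω ⊆ U) {F : Type*} [NormedAddCommGroup F] [NormedSpace ℝ F] {f : M → F}
    (hf : AEStronglyMeasurable f (μ.restrict Ω)) :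
    ∫ x in Ω, f x ∂μ =
      ∫ y in Θ '' Ω, densityIn ρ Θ (chartInv Θ U p y) • f (chartInv Θ U p y) := by
  have h' : IsChart Θ Ω := ⟨⟨hΩ, fun q hq => h.smooth q (hΩU hq),
    fun q hq => h.injective q (hΩU hq)⟩, h.injOn.mono hΩU⟩
  have e : ∀ y ∈ Θ '' Ω, chartInv Θ Ω p y = chartInv Θ U p y := by
    rintro _ ⟨q, hq, rfl⟩
    rw [h'.left_inv hq, h.left_inv (hΩU hq)]
  have hm := (h'.aemeasurable_chartInv (p := p)).mono_ac (withDensity_absolutelyContinuous _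
      fun y => ENNReal.ofReal (densityIn ρ Θ (chartInv Θ Ω p y)))
  have hc : ContinuousOn (fun y => densityIn ρ Θ (chartInv Θ Ω p y)) (Θ '' Ω) := by
    rintro _ ⟨q, hq, rfl⟩
    exact (h'.contDiffAt_comp hq
      (h'.toIsCoord.contMDiffAt_densityIn ρ hq)).continuousAt.continuousWithinAt
  have hmΩ := (h'.isOpen_image hΩ subset_rfl).measurableSet
  rw [h'.restrict_measure_eq p hρ] at hf ⊢
  rw [integral_map hm hf, integral_withDensity_eq_integral_toReal_smul₀
    (hc.aemeasurable hmΩ).ennreal_ofReal (by simp)]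
  refine setIntegral_congr_fun hmΩ fun y hy => ?_
  rw [ENNReal.toReal_ofReal (h'.toIsCoord.densityIn_pos ρ (h'.mem hy)).le, e y hy]

end MeasureInChart

end GeomOsc
end

noncomputable section

set_option linter.unusedSectionVars false

namespace GeomOsc

universe u v

/-! ### Test functions and integration by parts on ℝⁿ -/

section EuclideanTest

open Set Filter

variable {n : ℕ} {F : Type v} [NormedAddCommGroup F] [NormedSpace ℝ F]

local notation "𝔼" => EuclideanSpace ℝ (Fin n)

/-- The `i`-th partial derivative. -/
def pd (i : Fin n) (f : EuclideanSpace ℝ (Fin n) → F) (y : EuclideanSpace ℝ (Fin n)) : F :=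
  fderiv ℝ f y (EuclideanSpace.single i 1)

/-- Smooth functions on `ℝⁿ` with compact support in `V`. -/
structure IsTest (V : Set (EuclideanSpace ℝ (Fin n))) (f : EuclideanSpace ℝ (Fin n) → ℂ) :
    Prop where
  smooth : ContDiff ℝ ∞ f
  compact : HasCompactSupport f
  subset : tsupport f ⊆ V

variable {V : Set (EuclideanSpace ℝ (Fin n))} {f g : EuclideanSpace ℝ (Fin n) → ℂ}

lemma IsTest.integrable (hf : IsTest V f) : Integrable f :=
  hf.smooth.continuous.integrable_of_hasCompactSupport hf.compact

lemma IsTest.mono {V' : Set 𝔼} (hf : IsTest V f) (h : V ⊆ V') : IsTest V' f :=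
  ⟨hf.smooth, hf.compact, hf.subset.trans h⟩

lemma IsTest.zero : IsTest V fun _ => 0 :=
  ⟨contDiff_const, HasCompactSupport.zero, by simp [tsupport]⟩

lemma IsTest.add (hf : IsTest V f) (hg : IsTest V g) : IsTest V fun y => f y + g y :=
  ⟨hf.smooth.add hg.smooth, hf.compact.add hg.compact,
    (tsupport_add f g).trans (union_subset hf.subset hg.subset)⟩

lemma IsTest.sum {ι : Type*} {s : Finset ι} {f : ι → 𝔼 → ℂ} (hf : ∀ i ∈ s, IsTest V (f i)) :
    IsTest V fun y => ∑ i ∈ s, f i y := by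
  classical
  induction s using Finset.induction_on with
  | empty => simpa using IsTest.zero
  | insert a s ha ih =>
    simp only [Finset.sum_insert ha]
    exact (hf a (Finset.mem_insert_self a s)).add
      (ih fun i hi => hf i (Finset.mem_insert_of_mem hi))

lemma IsTest.mul (hV : IsOpen V) {a : 𝔼 → ℂ} (ha : ContDiffOn ℝ ∞ a V) (hf : IsTest V f) :
    IsTest V fun y => a y * f y := by
  refine ⟨contDiff_iff_contDiffAt.2 fun y => ?_, hf.compact.mul_left,
    (tsupport_mul_subset_right).trans hf.subset⟩
  by_cases hy : y ∈ tsupport f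
  · exact (ha.contDiffAt (hV.mem_nhds (hf.subset hy))).mul hf.smooth.contDiffAt
  · have : (fun y => a y * f y) =ᶠ[𝓝 y] fun _ => 0 := by
      filter_upwards [(notMem_tsupport_iff_eventuallyEq.1 hy)] with z hz
      rw [hz, Pi.zero_apply, mul_zero]
    exact contDiffAt_const.congr_of_eventuallyEq this

lemma ContDiffOn.ofReal' {a : 𝔼 → ℝ} (ha : ContDiffOn ℝ ∞ a V) :
    ContDiffOn ℝ ∞ (fun y => (a y : ℂ)) V :=
  Complex.ofRealCLM.contDiff.comp_contDiffOn ha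

lemma IsTest.real_mul (hV : IsOpen V) {a : 𝔼 → ℝ} (ha : ContDiffOn ℝ ∞ a V) (hf : IsTest V f) :
    IsTest V fun y => (a y : ℂ) * f y :=
  hf.mul hV (ContDiffOn.ofReal' ha)

lemma IsTest.const_mul (c : ℂ) (hf : IsTest V f) : IsTest V fun y => c * f y :=
  ⟨contDiff_const.mul hf.smooth, hf.compact.mul_left, (tsupport_mul_subset_right).trans hf.subset⟩

lemma IsTest.sub (hf : IsTest V f) (hg : IsTest V g) : IsTest V fun y => f y - g y := by
  simpa [sub_eq_add_neg] using hf.add (hg.const_mul (-1))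

lemma IsTest.pderiv (i : Fin n) (hf : IsTest V f) : IsTest V (pd i f) := by
  refine ⟨(hf.smooth.fderiv_right (m := ∞) (by simp)).clm_apply contDiff_const,
    hf.compact.fderiv_apply (𝕜 := ℝ) _,
    (tsupport_fderiv_apply_subset (𝕜 := ℝ) _).trans hf.subset⟩

lemma contDiffOn_pd (hV : IsOpen V) (i : Fin n) {f : 𝔼 → F} (hf : ContDiffOn ℝ ∞ f V) :
    ContDiffOn ℝ ∞ (pd i f) V := by
  have := hf.fderiv_of_isOpen hV (m := ∞) (by simp)
  exact this.clm_apply contDiffOn_const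

/-- Integration by parts. -/
lemma IsTest.integral_pd_mul (hV : IsOpen V) (hg : IsTest V g) (hf : ContDiffOn ℝ ∞ f V)
    (i : Fin n) : ∫ y, pd i f y * g y = -∫ y, f y * pd i g y := by
  have h := integral_mul_fderiv_eq_neg_fderiv_mul_of_integrable (𝕜 := ℂ) (μ := volume)
    (f := f) (g := g) (v := EuclideanSpace.single i (1 : ℝ))
    (hg.mul hV (contDiffOn_pd hV i hf)).integrable ((hg.pderiv i).mul hV hf).integrable
    (hg.mul hV hf).integrable
    (fun y hy => (hf.contDiffAt (hV.mem_nhds (hg.subset hy))).differentiableAt (by simp))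
    fun y _ => hg.smooth.differentiable (by simp) y
  exact (neg_eq_iff_eq_neg.2 h).symm

end EuclideanTest

/-! ### Oscillatory integrals and their evolution in t -/

section PhaseOperator

open Set Filter

variable {n : ℕ}

local notation "𝔼" => EuclideanSpace ℝ (Fin n)

/-- The second order differential operator with the coefficients `a`, `b`. -/
def diffOp (a : Fin n → Fin n → EuclideanSpace ℝ (Fin n) → ℝ)
    (b : Fin n → EuclideanSpace ℝ (Fin n) → ℝ) (f : EuclideanSpace ℝ (Fin n) → ℂ)
    (y : EuclideanSpace ℝ (Fin n)) : ℂ :=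
  ∑ i, ∑ j, (a i j y : ℂ) * pd i (pd j f) y + ∑ k, (b k y : ℂ) * pd k f y

/-- The formal transpose of `diffOp a b`. -/
def diffOpT (a : Fin n → Fin n → EuclideanSpace ℝ (Fin n) → ℝ)
    (b : Fin n → EuclideanSpace ℝ (Fin n) → ℝ) (g : EuclideanSpace ℝ (Fin n) → ℂ)
    (y : EuclideanSpace ℝ (Fin n)) : ℂ :=
  ∑ i, ∑ j, pd j (pd i fun z => (a i j z : ℂ) * g z) y - ∑ k, pd k (fun z => (b k z : ℂ) * g z) y

/-- The phase function `ϕ` and the operator with the coefficients `a`, `b` are smooth on the open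
set `U`, and the operator acts on functions of `ϕ` like `2ϕ ∂² + n ∂`. -/
structure IsPhase (U : Set (EuclideanSpace ℝ (Fin n))) (ϕ : EuclideanSpace ℝ (Fin n) → ℝ)
    (a : Fin n → Fin n → EuclideanSpace ℝ (Fin n) → ℝ)
    (b : Fin n → EuclideanSpace ℝ (Fin n) → ℝ) : Prop where
  isOpen : IsOpen U
  phase : ContDiffOn ℝ ∞ ϕ U
  coeff₂ : ∀ i j, ContDiffOn ℝ ∞ (a i j) U
  coeff₁ : ∀ k, ContDiffOn ℝ ∞ (b k) U
  op_exp : ∀ (c : ℝ), ∀ y ∈ U, diffOp a b (fun z => Complex.exp (Complex.I * (c * ϕ z : ℝ))) y =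
    (-2 * c ^ 2 * ϕ y + Complex.I * n * c) * Complex.exp (Complex.I * (c * ϕ y : ℝ))

/-- The integral `∫ e^{icϕ} g`. -/
def osc (ϕ : EuclideanSpace ℝ (Fin n) → ℝ) (g : EuclideanSpace ℝ (Fin n) → ℂ) (c : ℝ) : ℂ :=
  ∫ y, Complex.exp (Complex.I * (c * ϕ y : ℝ)) * g y

/-- The normalized integral `∫ t^{-n/2} e^{iϕ/t} g`. -/
def oscN (ϕ : EuclideanSpace ℝ (Fin n) → ℝ) (g : EuclideanSpace ℝ (Fin n) → ℂ) (t : ℝ) : ℂ :=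
  ((t ^ (-((n : ℝ) / 2)) : ℝ) : ℂ) * osc ϕ g t⁻¹

variable {U : Set (EuclideanSpace ℝ (Fin n))} {ϕ : EuclideanSpace ℝ (Fin n) → ℝ}
  {a : Fin n → Fin n → EuclideanSpace ℝ (Fin n) → ℝ} {b : Fin n → EuclideanSpace ℝ (Fin n) → ℝ}
  {f g : EuclideanSpace ℝ (Fin n) → ℂ}

lemma contDiffOn_exp (hϕ : ContDiffOn ℝ ∞ ϕ U) (c : ℝ) :
    ContDiffOn ℝ ∞ (fun z => Complex.exp (Complex.I * (c * ϕ z : ℝ))) U :=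
  (contDiffOn_const.mul (ContDiffOn.ofReal' (contDiffOn_const.mul hϕ))).cexp

lemma norm_exp_phase (x : ℝ) : ‖Complex.exp (Complex.I * (x : ℝ))‖ = 1 := by
  rw [mul_comm]; exact Complex.norm_exp_ofReal_mul_I x

lemma norm_osc_le (ϕ : 𝔼 → ℝ) (g : 𝔼 → ℂ) (c : ℝ) : ‖osc ϕ g c‖ ≤ ∫ y, ‖g y‖ := by
  refine (norm_integral_le_integral_norm _).trans (le_of_eq ?_)
  simp only [norm_mul, norm_exp_phase, one_mul]

lemma norm_oscN_le (ϕ : 𝔼 → ℝ) (g : 𝔼 → ℂ) {t : ℝ} (ht : 0 < t) :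
    ‖oscN ϕ g t‖ ≤ (∫ y, ‖g y‖) * t ^ (-((n : ℝ) / 2)) := by
  rw [oscN, norm_mul, Complex.norm_real, Real.norm_of_nonneg (Real.rpow_nonneg ht.le _), mul_comm]
  exact mul_le_mul_of_nonneg_right (norm_osc_le _ _ _) (Real.rpow_nonneg ht.le _)

lemma IsTest.osc_integrable (hU : IsOpen U) (hϕ : ContDiffOn ℝ ∞ ϕ U) (hg : IsTest U g) (c : ℝ) :
    Integrable fun y => Complex.exp (Complex.I * (c * ϕ y : ℝ)) * g y :=
  (hg.mul hU (contDiffOn_exp hϕ c)).integrable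

lemma IsTest.osc_add (hU : IsOpen U) (hϕ : ContDiffOn ℝ ∞ ϕ U) (hf : IsTest U f)
    (hg : IsTest U g) (c : ℝ) : osc ϕ (fun y => f y + g y) c = osc ϕ f c + osc ϕ g c := by
  rw [osc, osc, osc, ← integral_add (hf.osc_integrable hU hϕ c) (hg.osc_integrable hU hϕ c)]
  simp only [mul_add]

lemma IsTest.osc_sub (hU : IsOpen U) (hϕ : ContDiffOn ℝ ∞ ϕ U) (hf : IsTest U f)
    (hg : IsTest U g) (c : ℝ) : osc ϕ (fun y => f y - g y) c = osc ϕ f c - osc ϕ g c := by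
  rw [osc, osc, osc, ← integral_sub (hf.osc_integrable hU hϕ c) (hg.osc_integrable hU hϕ c)]
  simp only [mul_sub]

lemma osc_const_mul (k : ℂ) (c : ℝ) : osc ϕ (fun y => k * g y) c = k * osc ϕ g c := by
  rw [osc, osc, ← integral_const_mul]
  congr 1
  funext y
  ring

lemma IsTest.transpose (h : IsPhase U ϕ a b) (hg : IsTest U g) : IsTest U (diffOpT a b g) :=
  (IsTest.sum fun i _ => IsTest.sum fun j _ => ((hg.real_mul h.isOpen (h.coeff₂ i j)).pderiv i).pderiv j).sub
    (IsTest.sum fun k _ => (hg.real_mul h.isOpen (h.coeff₁ k)).pderiv k)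

lemma IsTest.transpose_iterate (h : IsPhase U ϕ a b) (hg : IsTest U g) (k : ℕ) :
    IsTest U ((diffOpT a b)^[k] g) := by
  induction k with
  | zero => exact hg
  | succ k ih => rw [Function.iterate_succ_apply']; exact ih.transpose h

/-- The defining property of the transposed operator. -/
lemma IsTest.integral_diffOp_mul (h : IsPhase U ϕ a b) (hf : ContDiffOn ℝ ∞ f U)
    (hg : IsTest U g) : ∫ y, diffOp a b f y * g y = ∫ y, f y * diffOpT a b g y := by
  have hU := h.isOpen
  have hpf : ∀ j, ContDiffOn ℝ ∞ (pd j f) U := fun j => contDiffOn_pd hU j hf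
  have hag : ∀ i j, IsTest U fun y => (a i j y : ℂ) * g y := fun i j =>
    hg.real_mul hU (h.coeff₂ i j)
  have hbg : ∀ k, IsTest U fun y => (b k y : ℂ) * g y := fun k => hg.real_mul hU (h.coeff₁ k)
  have i1 : ∀ i j, Integrable fun y => pd i (pd j f) y * ((a i j y : ℂ) * g y) :=
    fun i j => ((hag i j).mul hU (contDiffOn_pd hU i (hpf j))).integrable
  have i2 : ∀ k, Integrable fun y => pd k f y * ((b k y : ℂ) * g y) :=
    fun k => ((hbg k).mul hU (hpf k)).integrable
  have i3 : ∀ i j, Integrable fun y => f y * pd j (pd i fun z => (a i j z : ℂ) * g z) y :=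
    fun i j => ((((hag i j).pderiv i).pderiv j).mul hU hf).integrable
  have i4 : ∀ k, Integrable fun y => f y * pd k (fun z => (b k z : ℂ) * g z) y :=
    fun k => (((hbg k).pderiv k).mul hU hf).integrable
  have e1 : ∀ y, diffOp a b f y * g y =
      ∑ i, ∑ j, pd i (pd j f) y * ((a i j y : ℂ) * g y) +
        ∑ k, pd k f y * ((b k y : ℂ) * g y) := by
    intro y
    simp only [diffOp, add_mul, Finset.sum_mul]
    congr 1
    · exact Finset.sum_congr rfl fun i _ => Finset.sum_congr rfl fun j _ => by ring
    · exact Finset.sum_congr rfl fun k _ => by ring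
  have e2 : ∀ y, f y * diffOpT a b g y =
      ∑ i, ∑ j, f y * pd j (pd i fun z => (a i j z : ℂ) * g z) y -
        ∑ k, f y * pd k (fun z => (b k z : ℂ) * g z) y := by
    intro y
    simp only [diffOpT, mul_sub, Finset.mul_sum]
  simp only [e1, e2]
  rw [integral_add (integrable_finsetSum _ fun i _ => integrable_finsetSum _ fun j _ => i1 i j)
      (integrable_finsetSum _ fun k _ => i2 k),
    integral_sub (integrable_finsetSum _ fun i _ => integrable_finsetSum _ fun j _ => i3 i j)
      (integrable_finsetSum _ fun k _ => i4 k),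
    integral_finsetSum _ fun i _ => integrable_finsetSum _ fun j _ => i1 i j,
    integral_finsetSum _ fun i _ => integrable_finsetSum _ fun j _ => i3 i j,
    integral_finsetSum _ fun k _ => i2 k, integral_finsetSum _ fun k _ => i4 k,
    sub_eq_add_neg, ← Finset.sum_neg_distrib]
  congr 1
  · refine Finset.sum_congr rfl fun i _ => ?_
    rw [integral_finsetSum _ fun j _ => i1 i j, integral_finsetSum _ fun j _ => i3 i j]
    refine Finset.sum_congr rfl fun j _ => ?_
    rw [(hag i j).integral_pd_mul hU (hpf j), ((hag i j).pderiv i).integral_pd_mul hU hf, neg_neg]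
  · exact Finset.sum_congr rfl fun k _ => (hbg k).integral_pd_mul hU hf k

/-- Transposing moves the operator to the exponential, where it acts by `op_exp`. Its action is only
known on U, but g vanishes elsewhere. -/
lemma IsPhase.osc_diffOpT (h : IsPhase U ϕ a b) (hg : IsTest U g) (c : ℝ) :
    osc ϕ (diffOpT a b g) c =
      -2 * c ^ 2 * osc ϕ (fun y => (ϕ y : ℂ) * g y) c + Complex.I * n * c * osc ϕ g c := by
  rw [← osc_const_mul, ← osc_const_mul, ← IsTest.osc_add h.isOpen h.phase
    ((hg.real_mul h.isOpen h.phase).const_mul _) (hg.const_mul _), osc, osc,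
    ← hg.integral_diffOp_mul h (contDiffOn_exp h.phase c)]
  refine integral_congr_ae (Eventually.of_forall fun y => ?_)
  by_cases hy : y ∈ U
  · simp only [h.op_exp c y hy]
    ring
  · have : g y = 0 := image_eq_zero_of_notMem_tsupport fun hy' => hy (hg.subset hy')
    simp [this]

lemma IsTest.hasDerivAt_osc (hU : IsOpen U) (hϕ : ContDiffOn ℝ ∞ ϕ U) (hg : IsTest U g) (c : ℝ) :
    HasDerivAt (osc ϕ g) (Complex.I * osc ϕ (fun y => (ϕ y : ℂ) * g y) c) c := by
  have hint := hg.real_mul hU hϕ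
  have h := (hasDerivAt_integral_of_dominated_loc_of_deriv_le (μ := volume)
    (F := fun c y => Complex.exp (Complex.I * (c * ϕ y : ℝ)) * g y)
    (F' := fun c y => Complex.I * (Complex.exp (Complex.I * (c * ϕ y : ℝ)) * ((ϕ y : ℂ) * g y)))
    (x₀ := c) (s := univ) (bound := fun y => ‖(ϕ y : ℂ) * g y‖) univ_mem
    (Eventually.of_forall fun c => (hg.osc_integrable hU hϕ c).aestronglyMeasurable)
    (hg.osc_integrable hU hϕ c) ((hint.osc_integrable hU hϕ c).const_mul _).aestronglyMeasurable
    (Eventually.of_forall fun y c _ => ?_) hint.integrable.norm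
    (Eventually.of_forall fun y c _ => ?_)).2
  · refine h.congr_deriv ?_
    rw [osc, ← integral_const_mul]
  · rw [norm_mul, norm_mul, norm_exp_phase, Complex.norm_I, one_mul, one_mul]
  · have h1 : HasDerivAt (fun c : ℝ => Complex.I * ((c * ϕ y : ℝ) : ℂ)) (Complex.I * (ϕ y : ℂ)) c := by
      have := ((hasDerivAt_id c).mul_const (ϕ y)).ofReal_comp.const_mul Complex.I
      simpa using this
    refine (h1.cexp.mul_const (g y)).congr_deriv ?_
    ring

/-- The heart of the matter. Differentiating e^{iϕ/t} gives the factor -iϕ/t² and differentiating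
t^{-n/2} gives -n/(2t); together they are i/2 times the factor by which the operator acts on
e^{iϕ/t}. -/
lemma IsPhase.hasDerivAt_oscN (h : IsPhase U ϕ a b) (hg : IsTest U g) {t : ℝ} (ht : 0 < t) :
    HasDerivAt (oscN ϕ g) (Complex.I / 2 * oscN ϕ (diffOpT a b g) t) t := by
  have h1 := (hg.hasDerivAt_osc h.isOpen h.phase t⁻¹).scomp t (hasDerivAt_inv ht.ne')
  have h2 := (Real.hasDerivAt_rpow_const (p := -((n : ℝ) / 2)) (Or.inl ht.ne')).ofReal_comp
  refine (h2.mul h1).congr_deriv ?_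
  have e : (((t ^ (-((n : ℝ) / 2) - 1) : ℝ)) : ℂ) =
      ((t ^ (-((n : ℝ) / 2)) : ℝ) : ℂ) * (t : ℂ)⁻¹ := by
    rw [Real.rpow_sub_one ht.ne', div_eq_mul_inv]
    push_cast
    rfl
  have ht' : (t : ℂ) ≠ 0 := by exact_mod_cast ht.ne'
  rw [oscN, h.osc_diffOpT hg]
  simp only [Function.comp_apply, Complex.real_smul]
  push_cast
  rw [e]
  generalize osc ϕ g t⁻¹ = o₁
  generalize osc ϕ (fun y => (ϕ y : ℂ) * g y) t⁻¹ = o₂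
  field_simp
  linear_combination (-(((t ^ (-((n : ℝ) / 2)) : ℝ) : ℂ) * n * o₁ * t)) * Complex.I_sq

end PhaseOperator

end GeomOsc
end

noncomputable section

set_option linter.unusedSectionVars false

namespace GeomOsc

universe u v

/-! ### Uniform bounds, limits and nonstationary phase -/

section OscBounds

open Set Filter

variable {n : ℕ}

local notation "𝔼" => EuclideanSpace ℝ (Fin n)

variable {U : Set (EuclideanSpace ℝ (Fin n))} {ϕ : EuclideanSpace ℝ (Fin n) → ℝ}
  {a : Fin n → Fin n → EuclideanSpace ℝ (Fin n) → ℝ} {b : Fin n → EuclideanSpace ℝ (Fin n) → ℝ}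
  {f g : EuclideanSpace ℝ (Fin n) → ℂ}

lemma IsPhase.hasDerivAt_iterate (h : IsPhase U ϕ a b) (hg : IsTest U g) (j : ℕ) {t : ℝ}
    (ht : 0 < t) :
    HasDerivAt (fun t => (Complex.I / 2) ^ j * oscN ϕ ((diffOpT a b)^[j] g) t)
      ((Complex.I / 2) ^ (j + 1) * oscN ϕ ((diffOpT a b)^[j + 1] g) t) t := by
  refine ((h.hasDerivAt_oscN (hg.transpose_iterate h j) ht).const_mul _).congr_deriv ?_
  rw [Function.iterate_succ_apply']
  ring

lemma norm_I_div_two_pow_le (j : ℕ) : ‖(Complex.I / 2) ^ j‖ ≤ 1 := by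
  rw [norm_pow, norm_div, Complex.norm_I]
  refine pow_le_one₀ (by norm_num) (by norm_num)

/-- All derivatives in t are again normalized integrals, with the trivial bound by an L¹ norm times
t^{-n/2}; `interpolation_bound` with exponent n/2 applies. The factors (1/2)^k are discarded. -/
lemma IsPhase.norm_oscN_interpolate (h : IsPhase U ϕ a b) (hg : IsTest U g) {k : ℕ}
    (hk : (n : ℝ) / 2 < k) {t : ℝ} (ht : 0 < t) :
    ‖oscN ϕ g t‖ ≤ ((1 / (1 - (n : ℝ) / 2 / k)) ^ k + 2 ^ k) *
      (∫ y, ‖g y‖) ^ (1 - (n : ℝ) / 2 / k) *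
      (∫ y, ‖(diffOpT a b)^[k] g y‖) ^ ((n : ℝ) / 2 / k) := by
  have hnn : ∀ f : 𝔼 → ℂ, 0 ≤ ∫ y, ‖f y‖ := fun f => integral_nonneg fun y => norm_nonneg _
  have := interpolation_bound (a := (n : ℝ) / 2) (k := k) (by positivity) hk (hnn g)
    (hnn ((diffOpT a b)^[k] g))
    (fun j t => (Complex.I / 2) ^ j * oscN ϕ ((diffOpT a b)^[j] g) t)
    (fun j _ s hs => h.hasDerivAt_iterate hg j hs)
    (fun s hs => by simpa using norm_oscN_le ϕ g hs)
    (fun s hs => by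
      rw [norm_mul]
      refine (mul_le_of_le_one_left (norm_nonneg _) (norm_I_div_two_pow_le k)).trans ?_
      exact norm_oscN_le ϕ _ hs) ht
  simpa using this

/-- A bounded derivative makes f Lipschitz, hence Cauchy at 0. The explicit rate is what survives
the passage to the limit in the rescaling argument. -/
lemma exists_tendsto_of_norm_deriv_le {f f' : ℝ → ℂ} {K : ℝ} (hf : ∀ t > 0, HasDerivAt f (f' t) t)
    (hK : ∀ t > 0, ‖f' t‖ ≤ K) :
    ∃ L, Tendsto f (𝓝[>] 0) (𝓝 L) ∧ ∀ t > 0, ‖f t - L‖ ≤ K * t := by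
  have hK0 : 0 ≤ K := (norm_nonneg _).trans (hK 1 one_pos)
  have hl : ∀ s > 0, ∀ t > 0, ‖f t - f s‖ ≤ K * ‖t - s‖ := fun s hs t ht =>
    (convex_Ioi (0 : ℝ)).norm_image_sub_le_of_norm_hasDerivWithin_le
      (fun x hx => (hf x hx).hasDerivWithinAt) hK hs ht
  have hc : Cauchy (map f (𝓝[>] (0 : ℝ))) := by
    rw [Metric.cauchy_iff]
    refine ⟨inferInstance, fun ε hε => ?_⟩
    refine ⟨f '' Ioo 0 (ε / (K + 1)), image_mem_map (Ioo_mem_nhdsGT (by positivity)), ?_⟩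
    rintro _ ⟨s, hs, rfl⟩ _ ⟨t, ht, rfl⟩
    rw [dist_eq_norm]
    refine (hl t ht.1 s hs.1).trans_lt ?_
    have h1 : ‖s - t‖ < ε / (K + 1) := by
      rw [Real.norm_eq_abs, abs_sub_lt_iff]
      exact ⟨by linarith [hs.2, ht.1], by linarith [hs.1, ht.2]⟩
    calc K * ‖s - t‖ ≤ (K + 1) * ‖s - t‖ := by gcongr; linarith
      _ < (K + 1) * (ε / (K + 1)) := by gcongr
      _ = ε := by field_simp
  obtain ⟨L, hL⟩ := cauchy_map_iff_exists_tendsto.1 hc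
  refine ⟨L, hL, fun t ht => ?_⟩
  have h1 : Tendsto (fun s => ‖f t - f s‖) (𝓝[>] 0) (𝓝 ‖f t - L‖) := (hL.const_sub _).norm
  refine le_of_tendsto h1 ?_
  filter_upwards [Ioo_mem_nhdsGT ht] with s hs
  refine (hl s hs.1 t ht).trans ?_
  gcongr
  rw [Real.norm_eq_abs, abs_of_pos (sub_pos.2 hs.2)]
  linarith [hs.1]

/-- The normalized integrals have a limit at zero, with a linear rate of convergence. -/
lemma IsPhase.exists_limit (h : IsPhase U ϕ a b) (hg : IsTest U g) {K : ℝ}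
    (hK : ∀ t > 0, ‖oscN ϕ (diffOpT a b g) t‖ ≤ K) :
    ∃ L, Tendsto (oscN ϕ g) (𝓝[>] 0) (𝓝 L) ∧ ∀ t > 0, ‖oscN ϕ g t - L‖ ≤ K * t := by
  refine exists_tendsto_of_norm_deriv_le (fun t ht => h.hasDerivAt_oscN hg ht) fun t ht => ?_
  rw [norm_mul]
  refine (mul_le_of_le_one_left (norm_nonneg _) ?_).trans (hK t ht)
  simpa using norm_I_div_two_pow_le 1

/-- The squared length of the gradient. -/
def gradSq (ϕ : EuclideanSpace ℝ (Fin n) → ℝ) (y : EuclideanSpace ℝ (Fin n)) : ℝ :=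
  ∑ i, pd i ϕ y ^ 2

/-- The operator with `i c ∫ e^{icϕ} g = - ∫ e^{icϕ} (stepOp ϕ g)`. -/
def stepOp (ϕ : EuclideanSpace ℝ (Fin n) → ℝ) (g : EuclideanSpace ℝ (Fin n) → ℂ)
    (y : EuclideanSpace ℝ (Fin n)) : ℂ :=
  ∑ i, pd i (fun z => ((pd i ϕ z / gradSq ϕ z : ℝ) : ℂ) * g z) y

variable {V : Set (EuclideanSpace ℝ (Fin n))}

lemma contDiffOn_div_gradSq (hV : IsOpen V) (hϕ : ContDiffOn ℝ ∞ ϕ V)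
    (h0 : ∀ y ∈ V, gradSq ϕ y ≠ 0) (i : Fin n) :
    ContDiffOn ℝ ∞ (fun y => pd i ϕ y / gradSq ϕ y) V :=
  (contDiffOn_pd hV i hϕ).div (ContDiffOn.sum fun j _ => (contDiffOn_pd hV j hϕ).pow 2) h0

lemma IsTest.stepOp (hV : IsOpen V) (hϕ : ContDiffOn ℝ ∞ ϕ V) (h0 : ∀ y ∈ V, gradSq ϕ y ≠ 0)
    (hg : IsTest V g) : IsTest V (GeomOsc.stepOp ϕ g) :=
  IsTest.sum fun i _ => (hg.real_mul hV (contDiffOn_div_gradSq hV hϕ h0 i)).pderiv i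

/-- The field ∇ϕ/|∇ϕ|² maps e^{icϕ} to ic e^{icϕ}; integrate by parts. -/
lemma IsTest.osc_stepOp (hV : IsOpen V) (hϕ : ContDiffOn ℝ ∞ ϕ V) (h0 : ∀ y ∈ V, gradSq ϕ y ≠ 0)
    (hg : IsTest V g) (c : ℝ) :
    Complex.I * c * osc ϕ g c = -osc ϕ (GeomOsc.stepOp ϕ g) c := by
  have hh := fun i => hg.real_mul hV (contDiffOn_div_gradSq hV hϕ h0 i)
  have he := contDiffOn_exp hϕ c
  have e1 : ∀ y, Complex.exp (Complex.I * (c * ϕ y : ℝ)) * GeomOsc.stepOp ϕ g y =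
      ∑ i, Complex.exp (Complex.I * (c * ϕ y : ℝ)) *
        pd i (fun z => ((pd i ϕ z / gradSq ϕ z : ℝ) : ℂ) * g z) y := fun y => by
    rw [GeomOsc.stepOp, Finset.mul_sum]
  rw [← osc_const_mul, osc, osc]
  simp only [e1]
  rw [integral_finsetSum _ fun i _ => (((hh i).pderiv i).mul hV he).integrable,
    ← Finset.sum_neg_distrib]
  simp only [← (hh _).integral_pd_mul hV he]
  rw [← integral_finsetSum _ fun i _ => ((hh i).mul hV (contDiffOn_pd hV i he)).integrable]
  refine integral_congr_ae (Eventually.of_forall fun y => ?_)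
  by_cases hy : y ∈ V
  · have hd : ∀ i, pd i (fun z => Complex.exp (Complex.I * (c * ϕ z : ℝ))) y =
        Complex.I * c * Complex.exp (Complex.I * (c * ϕ y : ℝ)) * ((pd i ϕ y : ℝ) : ℂ) := by
      intro i
      have hdϕ := ((hϕ.contDiffAt (hV.mem_nhds hy)).differentiableAt (by simp)).hasFDerivAt
      have h1 : HasDerivAt (fun x : ℝ => Complex.exp (Complex.I * (c * x : ℝ)))
          (Complex.I * c * Complex.exp (Complex.I * (c * ϕ y : ℝ))) (ϕ y) := by
        have h2 : HasDerivAt (fun x : ℝ => Complex.I * ((c * x : ℝ) : ℂ)) (Complex.I * c) (ϕ y) := by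
          have := ((hasDerivAt_id (ϕ y)).const_mul c).ofReal_comp.const_mul Complex.I
          simpa using this
        refine h2.cexp.congr_deriv ?_
        ring
      have := (h1.hasFDerivAt.comp y hdϕ).fderiv
      rw [pd]
      change fderiv ℝ ((fun x : ℝ => Complex.exp (Complex.I * (c * x : ℝ))) ∘ ϕ) y _ = _
      rw [this]
      simp [pd, mul_comm]
    have h0' : (gradSq ϕ y : ℂ) ≠ 0 := by exact_mod_cast h0 y hy
    simp only [hd]
    have e : (gradSq ϕ y : ℂ) = ∑ i, ((pd i ϕ y : ℝ) : ℂ) ^ 2 := by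
      rw [gradSq]; push_cast; rfl
    have : ∀ i, Complex.I * c * Complex.exp (Complex.I * (c * ϕ y : ℝ)) * ((pd i ϕ y : ℝ) : ℂ) *
        (((pd i ϕ y / gradSq ϕ y : ℝ) : ℂ) * g y) =
        (Complex.I * c * Complex.exp (Complex.I * (c * ϕ y : ℝ)) * g y / gradSq ϕ y) *
          ((pd i ϕ y : ℝ) : ℂ) ^ 2 := fun i => by
      push_cast
      ring
    simp only [this]
    rw [← Finset.mul_sum, ← e]
    field_simp
  · have : g y = 0 := image_eq_zero_of_notMem_tsupport fun hy' => hy (hg.subset hy')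
    simp [this]

lemma IsTest.norm_osc_le_pow (hV : IsOpen V) (hϕ : ContDiffOn ℝ ∞ ϕ V)
    (h0 : ∀ y ∈ V, gradSq ϕ y ≠ 0) (m : ℕ) :
    ∀ {g : 𝔼 → ℂ}, IsTest V g → ∃ C : ℝ, ∀ c > 0, ‖osc ϕ g c‖ ≤ C * (c⁻¹) ^ m := by
  induction m with
  | zero =>
    intro g hg
    exact ⟨∫ y, ‖g y‖, fun c _ => by simpa using norm_osc_le ϕ g c⟩
  | succ m ih =>
    intro g hg
    obtain ⟨C, hC⟩ := ih (hg.stepOp hV hϕ h0)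
    refine ⟨C, fun c hc => ?_⟩
    have h1 := congrArg norm (hg.osc_stepOp hV hϕ h0 c)
    rw [norm_neg, norm_mul, norm_mul, Complex.norm_I, one_mul, Complex.norm_real,
      Real.norm_of_nonneg hc.le] at h1
    have h2 := hC c hc
    rw [← h1] at h2
    rw [pow_succ, ← mul_assoc, ← div_eq_mul_inv, le_div_iff₀ hc]
    linarith

/-- Integrals of functions that are supported away from the critical points tend to zero. -/
lemma IsTest.tendsto_oscN_zero (hV : IsOpen V) (hϕ : ContDiffOn ℝ ∞ ϕ V)
    (h0 : ∀ y ∈ V, gradSq ϕ y ≠ 0) (hg : IsTest V g) :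
    Tendsto (oscN ϕ g) (𝓝[>] 0) (𝓝 0) := by
  -- Decay of order n + 1 beats the normalizing factor t^{-n/2}.
  obtain ⟨C, hC⟩ := hg.norm_osc_le_pow hV hϕ h0 (n + 1)
  have hpos : (0 : ℝ) < (n : ℝ) / 2 + 1 := by positivity
  have h1 : Tendsto (fun t : ℝ => |C| * t ^ ((n : ℝ) / 2 + 1)) (𝓝[>] 0) (𝓝 0) := by
    have : Tendsto (fun t : ℝ => |C| * t ^ ((n : ℝ) / 2 + 1)) (𝓝 0)
        (𝓝 (|C| * (0 : ℝ) ^ ((n : ℝ) / 2 + 1))) :=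
      ((Real.continuous_rpow_const hpos.le).tendsto 0).const_mul _
    rw [Real.zero_rpow hpos.ne', mul_zero] at this
    exact this.mono_left nhdsWithin_le_nhds
  refine squeeze_zero_norm' ?_ h1
  filter_upwards [self_mem_nhdsWithin] with t ht
  have ht : 0 < t := ht
  rw [oscN, norm_mul, Complex.norm_real, Real.norm_of_nonneg (Real.rpow_nonneg ht.le _)]
  have h2 := hC t⁻¹ (inv_pos.2 ht)
  rw [inv_inv] at h2
  calc t ^ (-((n : ℝ) / 2)) * ‖osc ϕ g t⁻¹‖ ≤ t ^ (-((n : ℝ) / 2)) * (|C| * t ^ (n + 1)) := by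
        gcongr
        exact h2.trans (by gcongr; exact le_abs_self C)
    _ = |C| * t ^ ((n : ℝ) / 2 + 1) := by
        rw [← Real.rpow_natCast t (n + 1), mul_left_comm, ← Real.rpow_add ht]
        congr 2
        push_cast
        ring

end OscBounds

end GeomOsc
end

noncomputable section

set_option linter.unusedSectionVars false

namespace GeomOsc

universe u v

/-! ### Rescaling of the phase -/

section Rescaling

open Set Filter

variable {n : ℕ}

local notation "𝔼" => EuclideanSpace ℝ (Fin n)

variable {U : Set (EuclideanSpace ℝ (Fin n))} {ϕ : EuclideanSpace ℝ (Fin n) → ℝ}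
  {a : Fin n → Fin n → EuclideanSpace ℝ (Fin n) → ℝ} {b : Fin n → EuclideanSpace ℝ (Fin n) → ℝ}
  {f g ψ : EuclideanSpace ℝ (Fin n) → ℂ}

lemma pd_comp_smul {F : Type*} [NormedAddCommGroup F] [NormedSpace ℝ F] (i : Fin n) (f : 𝔼 → F)
    (ε : ℝ) (z : 𝔼) : pd i (fun z => f (ε • z)) z = ε • pd i f (ε • z) := by
  rw [pd, fderiv_comp_smul, pd]
  rfl

lemma pd_const_smul (i : Fin n) (f : 𝔼 → ℂ) (c : ℝ) (z : 𝔼) :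
    pd i (fun z => c • f z) z = c • pd i f z := by
  rcases eq_or_ne c 0 with rfl | hc
  · simp [pd]
  · have : Invertible c := invertibleOfNonzero hc
    have h := fderiv_const_smul_of_invertible (𝕜 := ℝ) (f := f) (x := z) c
    exact congrArg (fun L : 𝔼 →L[ℝ] ℂ => L (EuclideanSpace.single i 1)) h

/-- The rescaled phase function. -/
def scalePhase (ϕ : EuclideanSpace ℝ (Fin n) → ℝ) (ε : ℝ) (z : EuclideanSpace ℝ (Fin n)) : ℝ :=
  ϕ (ε • z) / ε ^ 2

/-- The rescaled second order coefficients. -/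
def scaleCoeff₂ (a : Fin n → Fin n → EuclideanSpace ℝ (Fin n) → ℝ) (ε : ℝ) (i j : Fin n)
    (z : EuclideanSpace ℝ (Fin n)) : ℝ := a i j (ε • z)

/-- The rescaled first order coefficients. -/
def scaleCoeff₁ (b : Fin n → EuclideanSpace ℝ (Fin n) → ℝ) (ε : ℝ) (k : Fin n)
    (z : EuclideanSpace ℝ (Fin n)) : ℝ := ε * b k (ε • z)

lemma diffOp_scale (ε : ℝ) (f : 𝔼 → ℂ) (z : 𝔼) :
    diffOp (scaleCoeff₂ a ε) (scaleCoeff₁ b ε) (fun z => f (ε • z)) z =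
      ε ^ 2 * diffOp a b f (ε • z) := by
  have h1 : ∀ j, (pd j fun z => f (ε • z)) = fun z => ε • pd j f (ε • z) := fun j => by
    funext z; exact pd_comp_smul j f ε z
  have h2 : ∀ i j, pd i (pd j fun z => f (ε • z)) z = ε • ε • pd i (pd j f) (ε • z) := by
    intro i j
    rw [h1, pd_const_smul i (fun z => pd j f (ε • z)), pd_comp_smul i (pd j f)]
  simp only [diffOp, scaleCoeff₂, scaleCoeff₁, h2, pd_comp_smul, mul_add, Finset.mul_sum,
    Complex.real_smul]
  congr 1
  · exact Finset.sum_congr rfl fun i _ => Finset.sum_congr rfl fun j _ => by ring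
  · refine Finset.sum_congr rfl fun k _ => ?_
    push_cast
    ring

lemma contDiffOn_comp_smul {F : Type*} [NormedAddCommGroup F] [NormedSpace ℝ F] {f : 𝔼 → F}
    (hf : ContDiffOn ℝ ∞ f U) (ε : ℝ) :
    ContDiffOn ℝ ∞ (fun z => f (ε • z)) ((fun z => ε • z) ⁻¹' U) :=
  hf.comp (contDiff_const_smul ε).contDiffOn fun _ hz => hz

/-- Rescaling preserves phases. -/
lemma IsPhase.scale (h : IsPhase U ϕ a b) {ε : ℝ} (hε : ε ≠ 0) :
    IsPhase ((fun z => ε • z) ⁻¹' U) (scalePhase ϕ ε) (scaleCoeff₂ a ε) (scaleCoeff₁ b ε) where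
  isOpen := h.isOpen.preimage (continuous_const_smul ε)
  phase := (contDiffOn_comp_smul h.phase ε).div_const _
  coeff₂ i j := contDiffOn_comp_smul (h.coeff₂ i j) ε
  coeff₁ k := contDiffOn_const.mul (contDiffOn_comp_smul (h.coeff₁ k) ε)
  op_exp c y hy := by
    -- Frequency c for the rescaled phase is frequency c/ε² for the original one; the factor ε²
    -- gained by the operator restores the normalization.
    have h1 := h.op_exp (c / ε ^ 2) (ε • y) hy
    have h2 := diffOp_scale (a := a) (b := b) ε
      (fun z => Complex.exp (Complex.I * (c / ε ^ 2 * ϕ z : ℝ))) y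
    have e : ∀ z, c * scalePhase ϕ ε z = c / ε ^ 2 * ϕ (ε • z) := fun z => by
      rw [scalePhase]; ring
    have hε' : (ε : ℂ) ≠ 0 := by exact_mod_cast hε
    simp only [e]
    rw [h2, h1, scalePhase]
    push_cast
    field_simp

/-- The Jacobian ε^{-n} of y = εz is absorbed by the normalizing factor t^{-n/2}, with t = ε²τ. -/
lemma oscN_scale (ϕ : 𝔼 → ℝ) (g : 𝔼 → ℂ) {ε τ : ℝ} (hε : 0 < ε) (hτ : 0 < τ) :
    oscN (scalePhase ϕ ε) (fun z => g (ε • z)) τ = oscN ϕ g (ε ^ 2 * τ) := by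
  have h1 : osc (scalePhase ϕ ε) (fun z => g (ε • z)) τ⁻¹ =
      ((ε ^ (-(n : ℝ)) : ℝ) : ℂ) * osc ϕ g (ε ^ 2 * τ)⁻¹ := by
    have h2 := Measure.integral_comp_smul (volume : Measure 𝔼)
      (fun y => Complex.exp (Complex.I * ((ε ^ 2 * τ)⁻¹ * ϕ y : ℝ)) * g y) ε
    rw [finrank_euclideanSpace_fin, abs_of_pos (by positivity), Complex.real_smul] at h2
    rw [Real.rpow_neg hε.le, Real.rpow_natCast, osc, osc, ← h2]
    refine integral_congr_ae (Eventually.of_forall fun z => ?_)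
    simp only [scalePhase]
    congr 4
    field_simp
  rw [oscN, oscN, h1, ← mul_assoc, ← Complex.ofReal_mul, Real.mul_rpow (by positivity) hτ.le,
    ← Real.rpow_natCast ε 2, ← Real.rpow_mul hε.le, mul_comm (τ ^ _)]
  congr 5
  push_cast
  ring

end Rescaling

/-! ### Families depending smoothly on the scale, up to scale zero -/

section JointFamilies

open Set Filter

variable {n : ℕ}

local notation "𝔼" => EuclideanSpace ℝ (Fin n)

/-- Families of functions of `z`, supported in a fixed ball, that depend smoothly on a
parameter near zero. -/
structure JointTest (δ r : ℝ) (G : ℝ × EuclideanSpace ℝ (Fin n) → ℂ) : Prop where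
  smooth : ContDiffOn ℝ ∞ G (Ioo (-δ) δ ×ˢ Metric.ball 0 (r + 1))
  support : ∀ ε z, r < ‖z‖ → G (ε, z) = 0

/-- The partial derivative of a family. -/
def jpd (i : Fin n) (G : ℝ × EuclideanSpace ℝ (Fin n) → ℂ)
    (w : ℝ × EuclideanSpace ℝ (Fin n)) : ℂ := pd i (fun z => G (w.1, z)) w.2

variable {δ r : ℝ} {G G' : ℝ × EuclideanSpace ℝ (Fin n) → ℂ}

lemma isOpen_jointDomain (δ r : ℝ) :
    IsOpen (Ioo (-δ) δ ×ˢ Metric.ball (0 : 𝔼) (r + 1)) := isOpen_Ioo.prod Metric.isOpen_ball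

lemma JointTest.jpd (h : JointTest δ r G) (i : Fin n) : JointTest δ r (GeomOsc.jpd i G) := by
  refine ⟨?_, fun ε z hz => ?_⟩
  · have h1 := h.smooth.fderiv_of_isOpen (isOpen_jointDomain δ r) (m := ∞) (by simp)
    have h2 := h1.clm_apply (contDiffOn_const (c := ((0 : ℝ), (EuclideanSpace.single i (1 : ℝ) : 𝔼))))
    refine h2.congr fun w hw => ?_
    have hd := ((h.smooth.contDiffAt ((isOpen_jointDomain δ r).mem_nhds hw)).differentiableAt
      (by simp)).hasFDerivAt
    have h3 : HasFDerivAt (fun z : 𝔼 => (w.1, z)) (ContinuousLinearMap.inr ℝ ℝ 𝔼) w.2 :=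
      hasFDerivAt_prodMk_right w.1 w.2
    have h4 := (HasFDerivAt.comp w.2 (g := G) (f := fun z : 𝔼 => (w.1, z)) hd h3).fderiv
    rw [GeomOsc.jpd, pd]
    change fderiv ℝ (G ∘ fun z : 𝔼 => (w.1, z)) w.2 _ = _
    rw [h4]
    rfl
  · have h1 : (fun z => G (ε, z)) =ᶠ[𝓝 z] fun _ => 0 := by
      filter_upwards [continuous_norm.continuousAt.eventually (lt_mem_nhds hz)] with y hy
      exact h.support ε y hy
    rw [GeomOsc.jpd, pd, h1.fderiv_eq]
    simp

lemma JointTest.mul {A : ℝ × 𝔼 → ℝ}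
    (hA : ContDiffOn ℝ ∞ A (Ioo (-δ) δ ×ˢ Metric.ball 0 (r + 1))) (h : JointTest δ r G) :
    JointTest δ r fun w => (A w : ℂ) * G w :=
  ⟨(Complex.ofRealCLM.contDiff.comp_contDiffOn hA).mul h.smooth,
    fun ε z hz => by rw [h.support ε z hz, mul_zero]⟩

lemma JointTest.sub (h : JointTest δ r G) (h' : JointTest δ r G') :
    JointTest δ r fun w => G w - G' w :=
  ⟨h.smooth.sub h'.smooth, fun ε z hz => by rw [h.support ε z hz, h'.support ε z hz, sub_zero]⟩

lemma JointTest.sum {ι : Type*} {s : Finset ι} {G : ι → ℝ × 𝔼 → ℂ}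
    (h : ∀ i ∈ s, JointTest δ r (G i)) : JointTest δ r fun w => ∑ i ∈ s, G i w :=
  ⟨ContDiffOn.sum fun i hi => (h i hi).smooth,
    fun ε z hz => Finset.sum_eq_zero fun i hi => (h i hi).support ε z hz⟩

/-- Compactness of [0, δ/2] times a closed ball. The family is smooth across ε = 0, so the bound
does not deteriorate as ε → 0. -/
lemma JointTest.exists_integral_norm_le (h : JointTest δ r G) (hδ : 0 < δ) :
    ∃ B : ℝ, ∀ ε ∈ Icc 0 (δ / 2), ∫ z, ‖G (ε, z)‖ ≤ B := by
  have hsub : Icc 0 (δ / 2) ×ˢ Metric.closedBall (0 : 𝔼) r ⊆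
      Ioo (-δ) δ ×ˢ Metric.ball 0 (r + 1) := by
    rintro ⟨ε, z⟩ ⟨hε, hz⟩
    rw [mem_closedBall_zero_iff] at hz
    exact ⟨⟨by linarith [hε.1], by linarith [hε.2]⟩, mem_ball_zero_iff.2 (by linarith)⟩
  obtain ⟨C, hC⟩ := (isCompact_Icc.prod (isCompact_closedBall (0 : 𝔼) r)).exists_bound_of_continuousOn
    (h.smooth.continuousOn.mono hsub)
  refine ⟨C * volume.real (Metric.closedBall (0 : 𝔼) r), fun ε hε => ?_⟩
  rw [← setIntegral_eq_integral_of_forall_compl_eq_zero (s := Metric.closedBall (0 : 𝔼) r)]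
  · refine (Real.le_norm_self _).trans (norm_setIntegral_le_of_norm_le_const
      measure_closedBall_lt_top fun z hz => ?_)
    rw [norm_norm]
    exact hC (ε, z) ⟨hε, hz⟩
  · intro z hz
    rw [mem_closedBall_zero_iff, not_le] at hz
    rw [h.support ε z hz, norm_zero]

/-- The transposed rescaled operators, acting on families. -/
def jointT (a : Fin n → Fin n → EuclideanSpace ℝ (Fin n) → ℝ)
    (b : Fin n → EuclideanSpace ℝ (Fin n) → ℝ) (G : ℝ × EuclideanSpace ℝ (Fin n) → ℂ)
    (w : ℝ × EuclideanSpace ℝ (Fin n)) : ℂ :=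
  ∑ i, ∑ j, GeomOsc.jpd j (GeomOsc.jpd i fun w => (scaleCoeff₂ a w.1 i j w.2 : ℂ) * G w) w -
    ∑ k, GeomOsc.jpd k (fun w => (scaleCoeff₁ b w.1 k w.2 : ℂ) * G w) w

variable {U : Set (EuclideanSpace ℝ (Fin n))} {ϕ : EuclideanSpace ℝ (Fin n) → ℝ}
  {a : Fin n → Fin n → EuclideanSpace ℝ (Fin n) → ℝ} {b : Fin n → EuclideanSpace ℝ (Fin n) → ℝ}

lemma diffOpT_iterate_eq (ε : ℝ) (k : ℕ) :
    (diffOpT (scaleCoeff₂ a ε) (scaleCoeff₁ b ε))^[k] (fun z => G (ε, z)) =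
      fun z => (jointT a b)^[k] G (ε, z) := by
  induction k with
  | zero => rfl
  | succ k ih =>
    rw [Function.iterate_succ_apply', ih, Function.iterate_succ_apply']
    rfl

lemma JointTest.transpose (h : IsPhase U ϕ a b)
    (hδ : ∀ ε ∈ Ioo (-δ) δ, ∀ z ∈ Metric.ball (0 : 𝔼) (r + 1), ε • z ∈ U)
    (hG : JointTest δ r G) : JointTest δ r (jointT a b G) := by
  have hs : ∀ {f : 𝔼 → ℝ}, ContDiffOn ℝ ∞ f U → ContDiffOn ℝ ∞ (fun w : ℝ × 𝔼 => f (w.1 • w.2))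
      (Ioo (-δ) δ ×ˢ Metric.ball 0 (r + 1)) := fun hf =>
    hf.comp (contDiff_fst.smul contDiff_snd).contDiffOn fun w hw => hδ _ hw.1 _ hw.2
  exact (JointTest.sum fun i _ => JointTest.sum fun j _ =>
    ((hG.mul (hs (h.coeff₂ i j))).jpd i).jpd j).sub
    (JointTest.sum fun k _ => (hG.mul (contDiffOn_fst.mul (hs (h.coeff₁ k)))).jpd k)

/-- The rescaled coefficients a(εz) and ε b(εz) are jointly smooth through ε = 0, hence so are the
iterated transposes. Smoothness of ϕ(εz)/ε² at ε = 0 is not needed. -/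
lemma JointTest.exists_integral_transpose_le (h : IsPhase U ϕ a b) (hδ0 : 0 < δ)
    (hδ : ∀ ε ∈ Ioo (-δ) δ, ∀ z ∈ Metric.ball (0 : 𝔼) (r + 1), ε • z ∈ U)
    (hG : JointTest δ r G) (k : ℕ) :
    ∃ B : ℝ, ∀ ε ∈ Icc 0 (δ / 2),
      ∫ z, ‖(diffOpT (scaleCoeff₂ a ε) (scaleCoeff₁ b ε))^[k] (fun z => G (ε, z)) z‖ ≤ B := by
  have hk : JointTest δ r ((jointT a b)^[k] G) := by
    induction k with
    | zero => exact hG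
    | succ k ih => rw [Function.iterate_succ_apply']; exact ih.transpose h hδ
  simp only [diffOpT_iterate_eq]
  exact hk.exists_integral_norm_le hδ0

end JointFamilies

end GeomOsc
end

noncomputable section

set_option linter.unusedSectionVars false

namespace GeomOsc

universe u v

/-! ### The leading term of the stationary phase expansion -/

section StationaryLimit

open Set Filter

variable {n : ℕ}

local notation "𝔼" => EuclideanSpace ℝ (Fin n)

variable {U : Set (EuclideanSpace ℝ (Fin n))} {ϕ : EuclideanSpace ℝ (Fin n) → ℝ}
  {a : Fin n → Fin n → EuclideanSpace ℝ (Fin n) → ℝ} {b : Fin n → EuclideanSpace ℝ (Fin n) → ℝ}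
  {g ψ : EuclideanSpace ℝ (Fin n) → ℂ} {H : Matrix (Fin n) (Fin n) ℝ}

lemma fderiv_eq_sum_pd {F : Type*} [NormedAddCommGroup F] [NormedSpace ℝ F] (f : 𝔼 → F)
    (y z : 𝔼) : fderiv ℝ f y z = ∑ i, z i • pd i f y := by
  conv_lhs => rw [sum_single_smul z]
  rw [map_sum]
  simp only [map_smul, pd]

/-- The rescaled phase functions converge to the second order Taylor polynomial. -/
lemma tendsto_scalePhase (hU : U ∈ 𝓝 (0 : 𝔼)) (hUo : IsOpen U) (hϕ : ContDiffOn ℝ ∞ ϕ U)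
    (h0 : ϕ 0 = 0) (hd : ∀ i, pd i ϕ 0 = 0) (hH : ∀ i j, pd i (pd j ϕ) 0 = H i j) (z : 𝔼) :
    Tendsto (fun ε => scalePhase ϕ ε z) (𝓝[>] 0)
      (𝓝 (1 / 2 * ∑ i, ∑ j, H i j * z i * z j)) := by
  have hline : ∀ ε : ℝ, HasDerivAt (fun ε : ℝ => ε • z) z ε := fun ε => by
    simpa using (hasDerivAt_id ε).smul_const z
  have hev : ∀ᶠ ε in 𝓝 (0 : ℝ), ε • z ∈ U := by
    have : Tendsto (fun ε : ℝ => ε • z) (𝓝 0) (𝓝 ((0 : ℝ) • z)) :=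
      (hline 0).continuousAt
    rw [zero_smul] at this
    exact this hU
  have hder : ∀ {f : 𝔼 → ℝ}, ContDiffOn ℝ ∞ f U → ∀ ε : ℝ, ε • z ∈ U →
      HasDerivAt (fun ε : ℝ => f (ε • z)) (∑ j, z j • pd j f (ε • z)) ε := by
    intro f hf ε hε
    have h1 := ((hf.contDiffAt (hUo.mem_nhds hε)).differentiableAt (by simp)).hasFDerivAt
    rw [← fderiv_eq_sum_pd]
    exact h1.comp_hasDerivAt ε (hline ε)
  have h0U : (0 : ℝ) • z ∈ U := by rw [zero_smul]; exact mem_of_mem_nhds hU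
  have hc : Tendsto (fun ε : ℝ => ϕ (ε • z)) (𝓝[>] 0) (𝓝 0) := by
    have := (hder hϕ 0 h0U).continuousAt.tendsto
    rw [zero_smul, h0] at this
    exact this.mono_left nhdsWithin_le_nhds
  -- One application of l'Hôpital's rule; the resulting quotient is half a difference quotient of
  -- the radial derivative of ϕ at 0.
  refine HasDerivAt.lhopital_zero_nhdsGT (f' := fun ε => ∑ j, z j • pd j ϕ (ε • z))
    (g' := fun ε => 2 * ε) ?_ ?_ ?_ hc ?_ ?_
  · filter_upwards [nhdsWithin_le_nhds hev] with ε hε using hder hϕ ε hε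
  · exact Eventually.of_forall fun ε => by simpa using hasDerivAt_pow 2 ε
  · filter_upwards [self_mem_nhdsWithin] with ε hε
    have : (0 : ℝ) < ε := hε
    positivity
  · have : Tendsto (fun ε : ℝ => ε ^ 2) (𝓝 0) (𝓝 (0 ^ 2)) := (continuous_pow 2).tendsto 0
    rw [zero_pow two_ne_zero] at this
    exact this.mono_left nhdsWithin_le_nhds
  · have h1 : HasDerivAt (fun ε : ℝ => ∑ j, z j • pd j ϕ (ε • z))
        (∑ j, z j • ∑ i, z i • pd i (pd j ϕ) ((0 : ℝ) • z)) 0 :=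
      HasDerivAt.fun_sum fun j _ => (hder (contDiffOn_pd hUo j hϕ) 0 h0U).const_smul (z j)
    have h2 := hasDerivAt_iff_tendsto_slope.1 h1
    have h3 := (h2.mono_left (nhdsWithin_mono 0 fun x (hx : 0 < x) => hx.ne')).const_mul (1 / 2)
    have e : (1 / 2 : ℝ) * ∑ j, z j • ∑ i, z i • pd i (pd j ϕ) ((0 : ℝ) • z) =
        1 / 2 * ∑ i, ∑ j, H i j * z i * z j := by
      rw [zero_smul]
      congr 1
      simp only [hH, smul_eq_mul, Finset.mul_sum]
      rw [Finset.sum_comm]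
      exact Finset.sum_congr rfl fun i _ => Finset.sum_congr rfl fun j _ => by ring
    rw [e] at h3
    refine h3.congr fun ε => ?_
    simp only [slope, zero_smul, hd, vsub_eq_sub, sub_zero, smul_eq_mul, mul_zero,
      Finset.sum_const_zero]
    field_simp

/-- The quadratic form of `H`, divided by two. -/
def quadPhase (H : Matrix (Fin n) (Fin n) ℝ) (z : EuclideanSpace ℝ (Fin n)) : ℝ :=
  1 / 2 * ∑ i, ∑ j, H i j * z i * z j

lemma scalePhase_quadPhase {ε : ℝ} (hε : ε ≠ 0) :
    scalePhase (quadPhase H) ε = quadPhase H := by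
  funext z
  simp only [scalePhase, quadPhase, PiLp.smul_apply, smul_eq_mul]
  have : ∀ i j, H i j * (ε * z i) * (ε * z j) = ε ^ 2 * (H i j * z i * z j) := fun i j => by ring
  simp only [this, ← Finset.mul_sum]
  field_simp

/-- For fixed τ the exponentials have modulus one, so dominated convergence applies. -/
lemma tendsto_oscN_scalePhase (hU : U ∈ 𝓝 (0 : 𝔼)) (hUo : IsOpen U) (hϕ : ContDiffOn ℝ ∞ ϕ U)
    (h0 : ϕ 0 = 0) (hd : ∀ i, pd i ϕ 0 = 0) (hH : ∀ i j, pd i (pd j ϕ) 0 = H i j)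
    (hψ : Continuous ψ) (hψc : HasCompactSupport ψ) (hg : IsTest univ g) {δ : ℝ} (hδ : 0 < δ)
    (hgU : ∀ ε ∈ Ioo 0 δ, ∀ z ∈ tsupport g, ε • z ∈ U) (τ : ℝ) :
    Tendsto (fun ε => oscN (scalePhase ϕ ε) (fun z => ψ (ε • z) * g z) τ) (𝓝[>] 0)
      (𝓝 (oscN (quadPhase H) (fun z => ψ 0 * g z) τ)) := by
  refine Tendsto.const_mul _ ?_
  obtain ⟨C, hC⟩ := hψ.bounded_above_of_compact_support hψc
  refine tendsto_integral_filter_of_dominated_convergence (fun z => C * ‖g z‖) ?_ ?_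
    (hg.integrable.norm.const_mul C) (Eventually.of_forall fun z => ?_)
  · filter_upwards [Ioo_mem_nhdsGT hδ] with ε hε
    have h1 : IsTest ((fun z => ε • z) ⁻¹' U) g := ⟨hg.smooth, hg.compact, hgU ε hε⟩
    have hVo : IsOpen ((fun z : 𝔼 => ε • z) ⁻¹' U) := hUo.preimage (continuous_const_smul ε)
    have h2 := h1.osc_integrable hVo ((contDiffOn_comp_smul hϕ ε).div_const (ε ^ 2)) τ⁻¹
    refine ((h2.aestronglyMeasurable).mul
      (hψ.comp (continuous_const_smul ε)).aestronglyMeasurable).congr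
      (Eventually.of_forall fun z => ?_)
    simp only [Pi.mul_apply, Function.comp_apply, scalePhase]
    ring
  · refine Eventually.of_forall fun ε => Eventually.of_forall fun z => ?_
    rw [norm_mul, norm_exp_phase, one_mul, norm_mul]
    gcongr
    exact hC _
  · refine Tendsto.mul ?_ (Tendsto.mul_const _ ?_)
    · have h1 := ((tendsto_scalePhase hU hUo hϕ h0 hd hH z).const_mul τ⁻¹)
      have h2 : Continuous fun x : ℝ => Complex.exp (Complex.I * (x : ℂ)) := by fun_prop
      exact (h2.tendsto _).comp h1
    · have : Tendsto (fun ε : ℝ => ε • z) (𝓝[>] 0) (𝓝 ((0 : ℝ) • z)) :=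
        ((continuous_id.smul continuous_const).tendsto 0).mono_left nhdsWithin_le_nhds
      rw [zero_smul] at this
      exact (hψ.tendsto 0).comp this

/-- The quadratic phase is invariant under rescaling, so τ can be moved entirely into the cutoff. -/
lemma oscN_quadPhase {τ : ℝ} (hτ : 0 < τ) :
    oscN (quadPhase H) g τ =
      ∫ z : 𝔼, Complex.exp (Complex.I * (1 / 2 * ∑ i, ∑ j, H i j * z i * z j : ℝ)) *
        g (√τ • z) := by
  have h := oscN_scale (quadPhase H) g (Real.sqrt_pos.2 hτ) one_pos
  rw [scalePhase_quadPhase (Real.sqrt_pos.2 hτ).ne', Real.sq_sqrt hτ.le, mul_one] at h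
  rw [← h, oscN, osc]
  simp [quadPhase]

/-- Interpolation with k = n + 1 > n/2. The L¹ norms are replaced by given bounds in order to have
one constant for all scales. -/
lemma IsPhase.norm_oscN_transpose_le (h : IsPhase U ϕ a b) (hg : IsTest U g) {B₁ B₂ : ℝ}
    (h1 : ∫ y, ‖(diffOpT a b)^[1] g y‖ ≤ B₁) (h2 : ∫ y, ‖(diffOpT a b)^[n + 2] g y‖ ≤ B₂)
    {t : ℝ} (ht : 0 < t) :
    ‖oscN ϕ (diffOpT a b g) t‖ ≤
      ((1 / (1 - (n : ℝ) / 2 / ((n + 1 : ℕ) : ℝ))) ^ (n + 1) + 2 ^ (n + 1)) *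
      B₁ ^ (1 - (n : ℝ) / 2 / ((n + 1 : ℕ) : ℝ)) * B₂ ^ ((n : ℝ) / 2 / ((n + 1 : ℕ) : ℝ)) := by
  have hn : (n : ℝ) / 2 < ((n + 1 : ℕ) : ℝ) := by
    push_cast
    have : (0 : ℝ) ≤ n := Nat.cast_nonneg n
    linarith
  have hp : (0 : ℝ) < ((n + 1 : ℕ) : ℝ) := by positivity
  have hle : (n : ℝ) / 2 / ((n + 1 : ℕ) : ℝ) ≤ 1 := (div_le_one hp).2 hn.le
  have hnn : ∀ f : 𝔼 → ℂ, 0 ≤ ∫ y, ‖f y‖ := fun f => integral_nonneg fun y => norm_nonneg _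
  have key := h.norm_oscN_interpolate (hg.transpose h) hn ht
  have e1 : 0 ≤ 1 - (n : ℝ) / 2 / ((n + 1 : ℕ) : ℝ) := by linarith
  refine key.trans ?_
  have h2' : ∫ y, ‖(diffOpT a b)^[n + 1] (diffOpT a b g) y‖ ≤ B₂ := h2
  have h1' : ∫ y, ‖diffOpT a b g y‖ ≤ B₁ := h1
  have hb1 : 0 ≤ B₁ := (hnn _).trans h1
  have := hnn (diffOpT a b g)
  have := hnn ((diffOpT a b)^[n + 1] (diffOpT a b g))
  gcongr

/-- The principle of stationary phase, to leading order. -/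
theorem IsPhase.tendsto_oscN (h : IsPhase U ϕ a b) (hU : (0 : 𝔼) ∈ U) (h0 : ϕ 0 = 0)
    (hd : ∀ i, pd i ϕ 0 = 0) (hns : ∀ y ∈ U, y ≠ 0 → gradSq ϕ y ≠ 0)
    (hHH : H.IsHermitian) (hdet : H.det ≠ 0) (hH : ∀ i j, pd i (pd j ϕ) 0 = H i j)
    (hψ : IsTest U ψ) :
    Tendsto (oscN ϕ ψ) (𝓝[>] 0)
      (𝓝 (ψ 0 * ((((2 * Real.pi) ^ ((n : ℝ) / 2) : ℝ) : ℂ)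
          * Complex.exp (Complex.I * (Real.pi / 4 * signature H : ℝ))
          * ((Real.sqrt |H.det| : ℝ) : ℂ)⁻¹))) := by
  have hUn := h.isOpen.mem_nhds hU
  obtain ⟨g, hgs, hgc, hg1, hgF⟩ := exists_fresnel_cutoff hHH hdet
  have hg : IsTest univ g := ⟨hgs, hgc, subset_univ _⟩
  obtain ⟨r, hr⟩ := hgc.isBounded.subset_closedBall (0 : 𝔼)
  obtain ⟨R, hR, hRU⟩ := Metric.mem_nhds_iff.1 hUn
  set r' := max r 0 with hr'def
  have hr' : 0 ≤ r' := le_max_right _ _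
  have hgr : ∀ z ∈ tsupport g, ‖z‖ ≤ r' := fun z hz =>
    (mem_closedBall_zero_iff.1 (hr hz)).trans (le_max_left _ _)
  -- For |ε| < δ the rescaled domain contains the ball of radius r' + 1 and thus the support of g
  -- with some room.
  set δ := R / (r' + 1) with hδdef
  have hδ : 0 < δ := by positivity
  have hδU : ∀ ε ∈ Ioo (-δ) δ, ∀ z ∈ Metric.ball (0 : 𝔼) (r' + 1), ε • z ∈ U := by
    intro ε hε z hz
    refine hRU (mem_ball_zero_iff.2 ?_)
    rw [mem_ball_zero_iff] at hz
    have h1 : ‖ε‖ < δ := abs_lt.2 hε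
    rw [norm_smul]
    calc ‖ε‖ * ‖z‖ ≤ ‖ε‖ * (r' + 1) := by gcongr
      _ < δ * (r' + 1) := by gcongr
      _ = R := by rw [hδdef]; field_simp
  have hG : JointTest δ r' fun w : ℝ × 𝔼 => ψ (w.1 • w.2) * g w.2 := by
    refine ⟨((hψ.smooth.comp (contDiff_fst.smul contDiff_snd)).mul
      (hgs.comp contDiff_snd)).contDiffOn, fun ε z hz => ?_⟩
    have : g z = 0 := image_eq_zero_of_notMem_tsupport fun hz' => absurd (hgr z hz') (not_le.2 hz)
    simp [this]
  obtain ⟨B₁, hB₁⟩ := hG.exists_integral_transpose_le h hδ hδU 1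
  obtain ⟨B₂, hB₂⟩ := hG.exists_integral_transpose_le h hδ hδU (n + 2)
  obtain ⟨L, hL, -⟩ := h.exists_limit hψ fun t ht => h.norm_oscN_transpose_le hψ le_rfl le_rfl ht
  -- The rate of convergence as τ → 0 is uniform in the scale ε, and the limit L is the same for all
  -- ε.
  obtain ⟨K, hK⟩ : ∃ K : ℝ, ∀ ε ∈ Ioo 0 (δ / 2), ∀ τ > 0,
      ‖oscN (scalePhase ϕ ε) (fun z => ψ (ε • z) * g z) τ - L‖ ≤ K * τ := by
    refine ⟨((1 / (1 - (n : ℝ) / 2 / ((n + 1 : ℕ) : ℝ))) ^ (n + 1) + 2 ^ (n + 1)) *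
      B₁ ^ (1 - (n : ℝ) / 2 / ((n + 1 : ℕ) : ℝ)) * B₂ ^ ((n : ℝ) / 2 / ((n + 1 : ℕ) : ℝ)),
      fun ε hε => ?_⟩
    have hε0 : ε ≠ 0 := hε.1.ne'
    have hεI : ε ∈ Icc 0 (δ / 2) := ⟨hε.1.le, hε.2.le⟩
    have hgε : IsTest ((fun z => ε • z) ⁻¹' U) g := ⟨hgs, hgc, fun z hz =>
      hδU ε ⟨by linarith [hε.1], by linarith [hε.2]⟩ z
        (mem_ball_zero_iff.2 (by linarith [hgr z hz]))⟩
    have hGε : IsTest ((fun z => ε • z) ⁻¹' U) fun z => ψ (ε • z) * g z :=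
      hgε.mul (h.scale hε0).isOpen (hψ.smooth.comp (contDiff_const_smul ε)).contDiffOn
    obtain ⟨L', hL', hb⟩ := (h.scale hε0).exists_limit hGε fun t ht =>
      (h.scale hε0).norm_oscN_transpose_le hGε (hB₁ ε hεI) (hB₂ ε hεI) ht
    have hcut : ContDiff ℝ ∞ fun y : 𝔼 => g (ε⁻¹ • y) := hgs.comp (contDiff_const_smul ε⁻¹)
    have hgε' : IsTest U fun y => g (ε⁻¹ • y) * ψ y := hψ.mul h.isOpen hcut.contDiffOn
    -- Restricting ψ to a ball of size ε removes a part supported away from the only critical point;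
    -- by nonstationary phase this does not affect the limit.
    have hdiff : IsTest (U \ {0}) fun y => ψ y - g (ε⁻¹ • y) * ψ y := by
      have hs := hψ.sub hgε'
      refine ⟨hs.smooth, hs.compact, fun y hy => ⟨hs.subset hy, ?_⟩⟩
      rintro rfl
      refine absurd hy (notMem_tsupport_iff_eventuallyEq.2 ?_)
      have : Tendsto (fun y : 𝔼 => ε⁻¹ • y) (𝓝 0) (𝓝 (ε⁻¹ • 0)) :=
        (continuous_const_smul ε⁻¹).tendsto 0
      rw [smul_zero] at this
      filter_upwards [this hg1] with y hy
      have hy : g (ε⁻¹ • y) = 1 := hy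
      rw [hy, one_mul, sub_self, Pi.zero_apply]
    have hz := hdiff.tendsto_oscN_zero (h.isOpen.sdiff isClosed_singleton)
      (h.phase.mono sdiff_subset) fun y hy => hns y hy.1 hy.2
    have hL2 : Tendsto (oscN ϕ fun y => g (ε⁻¹ • y) * ψ y) (𝓝[>] 0) (𝓝 L) := by
      have h1 := hL.sub hz
      rw [sub_zero] at h1
      refine h1.congr fun t => ?_
      rw [oscN, oscN, oscN, hψ.osc_sub h.isOpen h.phase hgε']
      ring
    have hL3 : Tendsto (oscN (scalePhase ϕ ε) fun z => ψ (ε • z) * g z) (𝓝[>] 0) (𝓝 L) := by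
      have h1 : Tendsto (fun τ : ℝ => ε ^ 2 * τ) (𝓝[>] 0) (𝓝[>] 0) := by
        refine tendsto_nhdsWithin_iff.2 ⟨?_, ?_⟩
        · have : Tendsto (fun τ : ℝ => ε ^ 2 * τ) (𝓝 0) (𝓝 (ε ^ 2 * 0)) :=
            (continuous_const.mul continuous_id).tendsto 0
          rw [mul_zero] at this
          exact this.mono_left nhdsWithin_le_nhds
        · filter_upwards [self_mem_nhdsWithin] with τ hτ
          exact mul_pos (pow_pos hε.1 2) hτ
      refine (hL2.comp h1).congr' ?_
      filter_upwards [self_mem_nhdsWithin] with τ hτ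
      rw [Function.comp_apply, ← oscN_scale ϕ _ hε.1 hτ]
      congr 1
      funext z
      rw [inv_smul_smul₀ hε0, mul_comm]
    rw [tendsto_nhds_unique hL3 hL']
    exact hb
  -- Now ε → 0 at fixed τ; the uniform rate passes to the quadratic phase.
  have hJ : ∀ τ > 0, ‖oscN (quadPhase H) (fun z => ψ 0 * g z) τ - L‖ ≤ K * τ := by
    intro τ hτ
    have h1 := tendsto_oscN_scalePhase hUn h.isOpen h.phase h0 hd hH hψ.smooth.continuous
      hψ.compact hg hδ (fun ε hε z hz => hδU ε ⟨by linarith [hε.1], hε.2⟩ z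
        (mem_ball_zero_iff.2 (by linarith [hgr z hz]))) τ
    refine le_of_tendsto (h1.sub_const L).norm ?_
    filter_upwards [Ioo_mem_nhdsGT (half_pos hδ)] with ε hε using hK ε hε τ hτ
  have hJL : Tendsto (oscN (quadPhase H) fun z => ψ 0 * g z) (𝓝[>] 0) (𝓝 L) := by
    rw [tendsto_iff_norm_sub_tendsto_zero]
    have hK0 : Tendsto (fun τ : ℝ => K * τ) (𝓝[>] 0) (𝓝 0) := by
      have : Tendsto (fun τ : ℝ => K * τ) (𝓝 0) (𝓝 (K * 0)) :=
        (continuous_const.mul continuous_id).tendsto 0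
      rw [mul_zero] at this
      exact this.mono_left nhdsWithin_le_nhds
    refine squeeze_zero' (Eventually.of_forall fun _ => norm_nonneg _) ?_ hK0
    filter_upwards [self_mem_nhdsWithin] with τ hτ using hJ τ hτ
  have hsq : Tendsto (fun τ : ℝ => √τ) (𝓝[>] 0) (𝓝[>] 0) := by
    refine tendsto_nhdsWithin_iff.2 ⟨?_, ?_⟩
    · have : Tendsto (fun τ : ℝ => √τ) (𝓝 0) (𝓝 (√0)) := Real.continuous_sqrt.tendsto 0
      rw [Real.sqrt_zero] at this
      exact this.mono_left nhdsWithin_le_nhds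
    · filter_upwards [self_mem_nhdsWithin] with τ hτ using Real.sqrt_pos.2 hτ
  -- For the quadratic phase τ → 0 is the widening of the cutoff by 1/√τ in the Fresnel integral,
  -- whose limit is known.
  have hJF := (hgF.comp hsq).const_mul (ψ 0)
  have hJF' := hJF.congr' (f₂ := oscN (quadPhase H) fun z => ψ 0 * g z) ?_
  · rw [← tendsto_nhds_unique hJL hJF']
    exact hL
  · filter_upwards [self_mem_nhdsWithin] with τ hτ
    rw [Function.comp_apply, ← oscN_quadPhase hτ, oscN, oscN, osc_const_mul]
    ring

end StationaryLimit

end GeomOsc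
end

noncomputable section

set_option linter.unusedSectionVars false

namespace GeomOsc

universe u v

/-! ### The error of the expansion on ℝⁿ -/

section ErrorEstimate

open Set Filter

variable {n : ℕ}

local notation "𝔼" => EuclideanSpace ℝ (Fin n)

variable {U : Set (EuclideanSpace ℝ (Fin n))} {ϕ : EuclideanSpace ℝ (Fin n) → ℝ}
  {a : Fin n → Fin n → EuclideanSpace ℝ (Fin n) → ℝ} {b : Fin n → EuclideanSpace ℝ (Fin n) → ℝ}
  {ψ : EuclideanSpace ℝ (Fin n) → ℂ} {H : Matrix (Fin n) (Fin n) ℝ}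

/-- The error of the stationary phase expansion. -/
theorem IsPhase.norm_error_le (h : IsPhase U ϕ a b) (hU : (0 : 𝔼) ∈ U) (h0 : ϕ 0 = 0)
    (hd : ∀ i, pd i ϕ 0 = 0) (hns : ∀ y ∈ U, y ≠ 0 → gradSq ϕ y ≠ 0)
    (hHH : H.IsHermitian) (hdet : H.det ≠ 0) (hH : ∀ i j, pd i (pd j ϕ) 0 = H i j)
    (hψ : IsTest U ψ) (N : ℕ) {k : ℕ} (hk : (n : ℝ) / 2 < k) {t : ℝ} (ht : 0 < t) :
    ‖oscN ϕ ψ t - ∑ l ∈ Finset.range (N + 1), (Complex.I / 2) ^ l *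
        ((diffOpT a b)^[l] ψ 0 * ((((2 * Real.pi) ^ ((n : ℝ) / 2) : ℝ) : ℂ)
          * Complex.exp (Complex.I * (Real.pi / 4 * signature H : ℝ))
          * ((Real.sqrt |H.det| : ℝ) : ℂ)⁻¹)) * (t : ℂ) ^ l / (l.factorial : ℂ)‖ ≤
      ((1 / (1 - (n : ℝ) / 2 / k)) ^ k + 2 ^ k) *
      (∫ y, ‖(diffOpT a b)^[N + 1] ψ y‖) ^ (1 - (n : ℝ) / 2 / k) *
      (∫ y, ‖(diffOpT a b)^[N + k + 1] ψ y‖) ^ ((n : ℝ) / 2 / k) * t ^ (N + 1) := by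
  have hkp : (0 : ℝ) < k := lt_of_le_of_lt (by positivity) hk
  have hle : (n : ℝ) / 2 / k ≤ 1 := (div_le_one hkp).2 hk.le
  have hnn : ∀ f : 𝔼 → ℂ, 0 ≤ ∫ y, ‖f y‖ := fun f => integral_nonneg fun y => norm_nonneg _
  have e0 : (0 : ℝ) ≤ 1 / (1 - (n : ℝ) / 2 / k) := one_div_nonneg.2 (by linarith)
  have h1 := hnn ((diffOpT a b)^[N + 1] ψ)
  have h2 := hnn ((diffOpT a b)^[N + k + 1] ψ)
  refine (taylor_error_bound N (fun j t => (Complex.I / 2) ^ j * oscN ϕ ((diffOpT a b)^[j] ψ) t)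
    _ (fun j _ s hs => h.hasDerivAt_iterate hψ j hs) (fun j _ =>
      (h.tendsto_oscN hU h0 hd hns hHH hdet hH (hψ.transpose_iterate h j)).const_mul _)
    (((1 / (1 - (n : ℝ) / 2 / k)) ^ k + 2 ^ k) *
      (∫ y, ‖(diffOpT a b)^[N + 1] ψ y‖) ^ (1 - (n : ℝ) / 2 / k) *
      (∫ y, ‖(diffOpT a b)^[N + k + 1] ψ y‖) ^ ((n : ℝ) / 2 / k)) (by positivity)
    (fun s hs => ?_) t ht).trans' (le_of_eq ?_)
  · rw [norm_mul]
    refine (mul_le_of_le_one_left (norm_nonneg _) (norm_I_div_two_pow_le _)).trans ?_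
    -- The derivative of order N + 1 is a normalized integral of the (N+1)-st transpose of ψ;
    -- interpolating it involves k further transposes, N + k + 1 in all.
    have := h.norm_oscN_interpolate (hψ.transpose_iterate h (N + 1)) hk hs
    rwa [← Function.iterate_add_apply, show k + (N + 1) = N + k + 1 by ring] at this
  · simp

end ErrorEstimate

/-! ### Test functions on the manifold and in the chart -/

section TransferTest

open Set Filter Bundle

variable {n : ℕ} {M : Type u} [TopologicalSpace M] [ChartedSpace (EuclideanSpace ℝ (Fin n)) M]
  [IsManifold (𝓡 n) ∞ M]
variable {F : Type v} [NormedAddCommGroup F] [NormedSpace ℝ F]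

local notation "𝔼" => EuclideanSpace ℝ (Fin n)

variable {p : M} {Θ : M → EuclideanSpace ℝ (Fin n)} {U Ω : Set M}

lemma IsChart.contDiffOn_comp (h : IsChart Θ U) {f : M → F}
    (hf : ∀ q ∈ U, ContMDiffAt (𝓡 n) 𝓘(ℝ, F) ∞ f q) :
    ContDiffOn ℝ ∞ (fun y => f (chartInv Θ U p y)) (Θ '' U) := by
  rintro _ ⟨q, hq, rfl⟩
  exact (h.contDiffAt_comp hq (hf q hq)).contDiffWithinAt

lemma IsChart.frameDeriv_eq_pd (h : IsChart Θ U) {f : M → F} {q : M} (hq : q ∈ U)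
    (hf : ContMDiffAt (𝓡 n) 𝓘(ℝ, F) ∞ f q) (i : Fin n) :
    frameDeriv Θ i f q = pd i (fun y => f (chartInv Θ U p y)) (Θ q) :=
  h.frameDeriv_eq hq hf i

lemma IsChart.frameDeriv_frameDeriv_eq_pd (h : IsChart Θ U) {f : M → F}
    (hf : ∀ q ∈ U, ContMDiffAt (𝓡 n) 𝓘(ℝ, F) ∞ f q) {q : M} (hq : q ∈ U) (i j : Fin n) :
    frameDeriv Θ i (frameDeriv Θ j f) q =
      pd i (pd j fun y => f (chartInv Θ U p y)) (Θ q) := by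
  rw [h.frameDeriv_eq_pd (p := p) hq (contMDiffAt_frameDeriv h.toIsCoord hq (hf q hq) j), pd, pd]
  have : (fun y => frameDeriv Θ j f (chartInv Θ U p y)) =ᶠ[𝓝 (Θ q)]
      pd j fun y => f (chartInv Θ U p y) := by
    filter_upwards [h.eventually_image h.isOpen subset_rfl hq] with y hy
    rw [h.frameDeriv_eq_pd (p := p) (h.mem hy) (hf _ (h.mem hy)), h.right_inv hy]
  rw [this.fderiv_eq]

/-- A second order operator in a chart. -/
lemma IsChart.diffOp_eq (h : IsChart Θ U) (p : M) (a : Fin n → Fin n → M → ℝ) (b : Fin n → M → ℝ)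
    {f : M → ℂ} (hf : ∀ q ∈ U, ContMDiffAt (𝓡 n) 𝓘(ℝ, ℂ) ∞ f q) {q : M} (hq : q ∈ U) :
    ∑ i, ∑ j, a i j q • frameDeriv Θ i (frameDeriv Θ j f) q + ∑ k, b k q • frameDeriv Θ k f q =
      diffOp (fun i j y => a i j (chartInv Θ U p y)) (fun k y => b k (chartInv Θ U p y))
        (fun y => f (chartInv Θ U p y)) (Θ q) := by
  simp only [diffOp, h.frameDeriv_frameDeriv_eq_pd (p := p) hf hq,
    h.frameDeriv_eq_pd (p := p) hq (hf q hq), h.left_inv hq, Complex.real_smul]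

open Classical in
/-- The expression of a function on `Ω` in a chart, extended by zero. -/
def pushTest (Θ : M → EuclideanSpace ℝ (Fin n)) (U Ω : Set M) (p : M) (f : M → ℂ)
    (y : EuclideanSpace ℝ (Fin n)) : ℂ :=
  if y ∈ Θ '' Ω then f (chartInv Θ U p y) else 0

open Classical in
/-- The function on `Ω` with a given expression in a chart, extended by zero. -/
def pullTest (Θ : M → EuclideanSpace ℝ (Fin n)) (Ω : Set M) (g : EuclideanSpace ℝ (Fin n) → ℂ)
    (q : M) : ℂ :=
  if q ∈ Ω then g (Θ q) else 0

lemma IsChart.pushTest_apply (h : IsChart Θ U) (hΩU : Ω ⊆ U) {q : M} (hq : q ∈ Ω) (f : M → ℂ) :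
    pushTest Θ U Ω p f (Θ q) = f q := by
  rw [pushTest, if_pos ⟨q, hq, rfl⟩, h.left_inv (hΩU hq)]

lemma IsChart.isTest_pushTest (h : IsChart Θ U) (hΩ : IsOpen Ω) (hΩU : Ω ⊆ U) {f : M → ℂ}
    (hf : f ∈ testFunctions n Ω) : IsTest (Θ '' Ω) (pushTest Θ U Ω p f) := by
  obtain ⟨hfs, hfc, hfΩ⟩ := hf
  have hK : IsCompact (Θ '' tsupport f) := hfc.isCompact.image_of_continuousOn fun q hq =>
    (h.smooth q (hΩU (hfΩ hq))).continuousAt.continuousWithinAt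
  have h0 : ∀ y ∉ Θ '' tsupport f, pushTest Θ U Ω p f y = 0 := by
    intro y hy
    by_cases hyΩ : y ∈ Θ '' Ω
    · obtain ⟨q, hq, rfl⟩ := hyΩ
      rw [h.pushTest_apply hΩU hq]
      exact image_eq_zero_of_notMem_tsupport fun hq' => hy ⟨q, hq', rfl⟩
    · rw [pushTest, if_neg hyΩ]
  have hsub : tsupport (pushTest Θ U Ω p f) ⊆ Θ '' tsupport f :=
    closure_minimal (fun y hy => by_contra fun hy' => hy (h0 y hy')) hK.isClosed
  refine ⟨contDiff_iff_contDiffAt.2 fun y => ?_, hK.of_isClosed_subset (isClosed_tsupport _) hsub,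
    hsub.trans (image_mono hfΩ)⟩
  by_cases hy : y ∈ Θ '' Ω
  · obtain ⟨q, hq, rfl⟩ := hy
    refine (h.contDiffAt_comp (p := p) (hΩU hq) hfs.contMDiffAt).congr_of_eventuallyEq ?_
    filter_upwards [h.eventually_image hΩ hΩU hq] with y hy
    rw [pushTest, if_pos hy]
  · refine (contDiffAt_const (c := (0 : ℂ))).congr_of_eventuallyEq ?_
    filter_upwards [hK.isClosed.isOpen_compl.mem_nhds fun hy' => hy (image_mono hfΩ hy')]
      with z hz using h0 z hz

lemma IsChart.pullTest_mem [T2Space M] (h : IsChart Θ U) (hΩ : IsOpen Ω) (hΩU : Ω ⊆ U) (p : M)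
    {g : 𝔼 → ℂ} (hg : IsTest (Θ '' Ω) g) : pullTest Θ Ω g ∈ testFunctions n Ω := by
  have hK : IsCompact (chartInv Θ U p '' tsupport g) :=
    hg.compact.isCompact.image_of_continuousOn fun y hy =>
      (h.contMDiffAt_chartInv (image_mono hΩU (hg.subset hy))).continuousAt.continuousWithinAt
  have hKΩ : chartInv Θ U p '' tsupport g ⊆ Ω := by
    rintro _ ⟨y, hy, rfl⟩
    obtain ⟨q, hq, rfl⟩ := hg.subset hy
    rwa [h.left_inv (hΩU hq)]
  have h0 : ∀ q ∉ chartInv Θ U p '' tsupport g, pullTest Θ Ω g q = 0 := by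
    intro q hq
    by_cases hqΩ : q ∈ Ω
    · rw [pullTest, if_pos hqΩ]
      exact image_eq_zero_of_notMem_tsupport fun hq' => hq ⟨_, hq', h.left_inv (hΩU hqΩ)⟩
    · rw [pullTest, if_neg hqΩ]
  have hsub : tsupport (pullTest Θ Ω g) ⊆ chartInv Θ U p '' tsupport g :=
    closure_minimal (fun y hy => by_contra fun hy' => hy (h0 y hy')) hK.isClosed
  refine ⟨fun q => ?_, hK.of_isClosed_subset (isClosed_tsupport _) hsub, hsub.trans hKΩ⟩
  by_cases hq : q ∈ Ω
  · have h1 : ContMDiffAt (𝓡 n) 𝓘(ℝ, ℂ) ∞ (fun x => g (Θ x)) q :=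
      hg.smooth.contMDiff.contMDiffAt.comp q (h.smooth q (hΩU hq))
    refine h1.congr_of_eventuallyEq ?_
    filter_upwards [hΩ.mem_nhds hq] with y hy
    rw [pullTest, if_pos hy]
  · refine (contMDiffAt_const (c := (0 : ℂ))).congr_of_eventuallyEq ?_
    filter_upwards [hK.isClosed.isOpen_compl.mem_nhds fun hq' => hq (hKΩ hq')]
      with z hz using h0 z hz

lemma IsChart.push_pull (h : IsChart Θ U) (hΩU : Ω ⊆ U) {g : 𝔼 → ℂ} (hg : IsTest (Θ '' Ω) g) :
    pushTest Θ U Ω p (pullTest Θ Ω g) = g := by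
  funext y
  by_cases hy : y ∈ Θ '' Ω
  · obtain ⟨q, hq, rfl⟩ := hy
    rw [h.pushTest_apply hΩU hq, pullTest, if_pos hq]
  · rw [pushTest, if_neg hy, image_eq_zero_of_notMem_tsupport fun hy' => hy (hg.subset hy')]

end TransferTest

end GeomOsc
end

noncomputable section

set_option linter.unusedSectionVars false

namespace GeomOsc

universe u v

/-! ### Integrals and adjoints in the chart -/

section TransferIntegral

open Set Filter Bundle

variable {n : ℕ} {M : Type u} [TopologicalSpace M] [ChartedSpace (EuclideanSpace ℝ (Fin n)) M]
  [IsManifold (𝓡 n) ∞ M]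

local notation "𝔼" => EuclideanSpace ℝ (Fin n)

variable {p : M} {Θ : M → EuclideanSpace ℝ (Fin n)} {U Ω : Set M} {ρ : SmoothDensity n M}

/-- The expression of the density `f dμ` in a chart. -/
def pushDensity (ρ : SmoothDensity n M) (Θ : M → EuclideanSpace ℝ (Fin n)) (U Ω : Set M) (p : M)
    (f : M → ℂ) (y : EuclideanSpace ℝ (Fin n)) : ℂ :=
  (densityIn ρ Θ (chartInv Θ U p y) : ℂ) * pushTest Θ U Ω p f y

lemma IsChart.contDiffOn_density (h : IsChart Θ U) (p : M) (ρ : SmoothDensity n M) :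
    ContDiffOn ℝ ∞ (fun y => densityIn ρ Θ (chartInv Θ U p y)) (Θ '' U) :=
  h.contDiffOn_comp fun _ hq => h.toIsCoord.contMDiffAt_densityIn ρ hq

lemma IsChart.density_ne_zero (h : IsChart Θ U) (p : M) (ρ : SmoothDensity n M) {y : 𝔼}
    (hy : y ∈ Θ '' U) : densityIn ρ Θ (chartInv Θ U p y) ≠ 0 :=
  (h.toIsCoord.densityIn_pos ρ (h.mem hy)).ne'

lemma IsChart.isTest_pushDensity (h : IsChart Θ U) (hΩ : IsOpen Ω) (hΩU : Ω ⊆ U) {f : M → ℂ}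
    (hf : f ∈ testFunctions n Ω) : IsTest (Θ '' Ω) (pushDensity ρ Θ U Ω p f) :=
  (h.isTest_pushTest hΩ hΩU hf).real_mul (h.isOpen_image hΩ hΩU)
    ((h.contDiffOn_density p ρ).mono (image_mono hΩU))

/-- The density is positive, so a test function in the chart may be divided by it before it is
pulled back. -/
lemma IsChart.exists_pushDensity_eq [T2Space M] (h : IsChart Θ U) (hΩ : IsOpen Ω) (hΩU : Ω ⊆ U)
    (p : M) (ρ : SmoothDensity n M) {g : 𝔼 → ℂ} (hg : IsTest (Θ '' Ω) g) :
    ∃ f ∈ testFunctions n Ω, pushDensity ρ Θ U Ω p f = g := by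
  have hr : ∀ y ∈ Θ '' Ω, densityIn ρ Θ (chartInv Θ U p y) ≠ 0 := fun y hy =>
    h.density_ne_zero p ρ (image_mono hΩU hy)
  have h1 : IsTest (Θ '' Ω) fun y => (((densityIn ρ Θ (chartInv Θ U p y))⁻¹ : ℝ) : ℂ) * g y :=
    hg.real_mul (h.isOpen_image hΩ hΩU) (((h.contDiffOn_density p ρ).mono (image_mono hΩU)).inv hr)
  refine ⟨_, h.pullTest_mem hΩ hΩU p h1, funext fun y => ?_⟩
  rw [pushDensity, h.push_pull hΩU h1]
  by_cases hy : y ∈ Θ '' Ω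
  · have : (densityIn ρ Θ (chartInv Θ U p y) : ℂ) ≠ 0 := by exact_mod_cast hr y hy
    push_cast
    field_simp
  · have : g y = 0 := image_eq_zero_of_notMem_tsupport fun hy' => hy (hg.subset hy')
    simp [this]

lemma IsTest.eq_zero_of_integral {V : Set 𝔼} {D : 𝔼 → ℂ} (hD : IsTest V D)
    (h0 : ∫ y, (starRingEnd ℂ) (D y) * D y = 0) (y : 𝔼) : D y = 0 := by
  have e : ∀ y, (starRingEnd ℂ) (D y) * D y = ((‖D y‖ ^ 2 : ℝ) : ℂ) := fun y => by
    rw [Complex.conj_mul']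
    push_cast
    rfl
  simp only [e] at h0
  rw [integral_complex_ofReal, Complex.ofReal_eq_zero] at h0
  by_contra hy
  have hc : Continuous fun y => ‖D y‖ ^ 2 := hD.smooth.continuous.norm.pow 2
  have hs : HasCompactSupport fun y => ‖D y‖ ^ 2 :=
    hD.compact.comp_left (g := fun z : ℂ => ‖z‖ ^ 2) (by simp)
  have := hc.integral_pos_of_hasCompactSupport_nonneg_nonzero (μ := volume) hs
    (fun y => by positivity) (x := y) (pow_ne_zero 2 (norm_ne_zero_iff.2 hy))
  exact this.ne' h0

lemma IsTest.conj {V : Set 𝔼} {D : 𝔼 → ℂ} (hD : IsTest V D) :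
    IsTest V fun y => (starRingEnd ℂ) (D y) :=
  ⟨Complex.conjCLE.contDiff.comp hD.smooth, hD.compact.comp_left (map_zero _),
    (tsupport_comp_subset (g := starRingEnd ℂ) (map_zero _) D).trans hD.subset⟩

variable [SecondCountableTopology M] [MeasurableSpace M] [BorelSpace M] {μ : Measure M}

lemma IsChart.setIntegral_mul_eq (h : IsChart Θ U) (p : M) (hρ : ρ.Generates μ) (hΩ : IsOpen Ω)
    (hΩU : Ω ⊆ U) {f g : M → ℂ} (hf : ContinuousOn f Ω) (hg : g ∈ testFunctions n Ω) :
    ∫ x in Ω, f x * g x ∂μ = ∫ y, f (chartInv Θ U p y) * pushDensity ρ Θ U Ω p g y := by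
  rw [h.setIntegral_eq p hρ hΩ hΩU (f := fun x => f x * g x)
    ((hf.mul hg.1.continuous.continuousOn).aestronglyMeasurable hΩ.measurableSet),
    ← setIntegral_eq_integral_of_forall_compl_eq_zero (s := Θ '' Ω)
      (f := fun y => f (chartInv Θ U p y) * pushDensity ρ Θ U Ω p g y)]
  · refine setIntegral_congr_fun (h.isOpen_image hΩ hΩU).measurableSet fun y hy => ?_
    simp only [pushDensity, pushTest, if_pos hy, Complex.real_smul]
    ring
  · intro y hy
    rw [pushDensity, pushTest, if_neg hy, mul_zero, mul_zero]

lemma IsChart.setIntegral_norm_eq (h : IsChart Θ U) (p : M) (hρ : ρ.Generates μ) (hΩ : IsOpen Ω)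
    (hΩU : Ω ⊆ U) {g : M → ℂ} (hg : g ∈ testFunctions n Ω) :
    ∫ x in Ω, ‖g x‖ ∂μ = ∫ y, ‖pushDensity ρ Θ U Ω p g y‖ := by
  rw [h.setIntegral_eq p hρ hΩ hΩU (f := fun x => ‖g x‖)
    (hg.1.continuous.norm.continuousOn.aestronglyMeasurable hΩ.measurableSet),
    ← setIntegral_eq_integral_of_forall_compl_eq_zero (s := Θ '' Ω)
      (f := fun y => ‖pushDensity ρ Θ U Ω p g y‖)]
  · refine setIntegral_congr_fun (h.isOpen_image hΩ hΩU).measurableSet fun y hy => ?_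
    have hpos := (h.toIsCoord.densityIn_pos ρ (h.mem (p := p) (image_mono hΩU hy))).le
    simp only [pushDensity, pushTest, if_pos hy, norm_mul, Complex.norm_real,
      Real.norm_of_nonneg hpos, smul_eq_mul]
  · intro y hy
    rw [pushDensity, pushTest, if_neg hy, mul_zero, norm_zero]

variable {ϕ : EuclideanSpace ℝ (Fin n) → ℝ}
  {a : Fin n → Fin n → EuclideanSpace ℝ (Fin n) → ℝ} {b : Fin n → EuclideanSpace ℝ (Fin n) → ℝ}
  {L : (M → ℂ) → M → ℂ}

lemma contDiffOn_diffOp {W : Set 𝔼} (hP : IsPhase W ϕ a b) {f : 𝔼 → ℂ}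
    (hf : ContDiffOn ℝ ∞ f W) : ContDiffOn ℝ ∞ (diffOp a b f) W := by
  refine (ContDiffOn.sum fun i _ => ContDiffOn.sum fun j _ => ?_).add
    (ContDiffOn.sum fun k _ => ?_)
  · exact (ContDiffOn.ofReal' (hP.coeff₂ i j)).mul
      (contDiffOn_pd hP.isOpen i (contDiffOn_pd hP.isOpen j hf))
  · exact (ContDiffOn.ofReal' (hP.coeff₁ k)).mul (contDiffOn_pd hP.isOpen k hf)

/-- The adjoint of a second order operator, in a chart. -/
theorem IsChart.adjoint_eq [T2Space M] (h : IsChart Θ U) (p : M) (hρ : ρ.Generates μ)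
    (hΩ : IsOpen Ω) (hΩU : Ω ⊆ U) (hP : IsPhase (Θ '' U) ϕ a b)
    (hL : ∀ f : M → ℂ, (∀ q ∈ U, ContMDiffAt (𝓡 n) 𝓘(ℝ, ℂ) ∞ f q) → ∀ q ∈ U,
      L f q = diffOp a b (fun y => f (chartInv Θ U p y)) (Θ q)) {g : M → ℂ}
    (hg : g ∈ testFunctions n Ω) :
    adjoint n μ Ω L g ∈ testFunctions n Ω ∧
      pushDensity ρ Θ U Ω p (adjoint n μ Ω L g) = diffOpT a b (pushDensity ρ Θ U Ω p g) := by
  have hVU : Θ '' Ω ⊆ Θ '' U := image_mono hΩU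
  have hV := h.isOpen_image hΩ hΩU
  have hPΩ : IsPhase (Θ '' Ω) ϕ a b := ⟨hV, hP.phase.mono hVU, fun i j => (hP.coeff₂ i j).mono hVU,
    fun k => (hP.coeff₁ k).mono hVU, fun c y hy => hP.op_exp c y (hVU hy)⟩
  have hEg : IsTest (Θ '' Ω) (pushDensity ρ Θ U Ω p g) := h.isTest_pushDensity hΩ hΩU hg
  have key : ∀ f ∈ testFunctions n Ω, ∫ x in Ω, L f x * g x ∂μ =
      ∫ y, f (chartInv Θ U p y) * diffOpT a b (pushDensity ρ Θ U Ω p g) y := by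
    intro f hf
    have hfs : ∀ q ∈ U, ContMDiffAt (𝓡 n) 𝓘(ℝ, ℂ) ∞ f q := fun q _ => hf.1.contMDiffAt
    have hf' := h.contDiffOn_comp (p := p) hfs
    have hLc : ContinuousOn (L f) Ω := by
      have h1 : ContinuousOn (fun q => diffOp a b (fun y => f (chartInv Θ U p y)) (Θ q)) Ω :=
        (contDiffOn_diffOp hP hf').continuousOn.comp
          (fun q hq => (h.smooth q (hΩU hq)).continuousAt.continuousWithinAt)
          fun q hq => ⟨q, hΩU hq, rfl⟩
      exact h1.congr fun q hq => hL f hfs q (hΩU hq)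
    rw [h.setIntegral_mul_eq p hρ hΩ hΩU hLc hg,
      ← (hEg.mono hVU).integral_diffOp_mul hP hf']
    refine integral_congr_ae (Eventually.of_forall fun y => ?_)
    by_cases hy : y ∈ Θ '' Ω
    · simp only [hL f hfs _ (h.mem (hVU hy)), h.right_inv (hVU hy)]
    · have : pushDensity ρ Θ U Ω p g y = 0 :=
        image_eq_zero_of_notMem_tsupport fun hy' => hy (hEg.subset hy')
      simp [this]
  -- The transpose in the chart, read back on M, shows that an adjoint exists, so the default value
  -- in `adjoint` is not taken.
  obtain ⟨A, hA, hAE⟩ := h.exists_pushDensity_eq hΩ hΩU p ρ (hEg.transpose hPΩ)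
  have hex : ∃ A ∈ testFunctions n Ω, ∀ f ∈ testFunctions n Ω,
      ∫ x in Ω, L f x * g x ∂μ = ∫ x in Ω, f x * A x ∂μ := by
    refine ⟨A, hA, fun f hf => ?_⟩
    rw [key f hf, h.setIntegral_mul_eq p hρ hΩ hΩU hf.1.continuous.continuousOn hA, hAE]
  rw [adjoint, dif_pos hex]
  obtain ⟨hB, hBi⟩ := hex.choose_spec
  set B := hex.choose
  refine ⟨hB, ?_⟩
  have hEB : IsTest (Θ '' Ω) (pushDensity ρ Θ U Ω p B) := h.isTest_pushDensity hΩ hΩU hB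
  -- The chosen adjoint B may differ from A a priori. Testing with the conjugate of the difference D
  -- of the two expressions gives ∫ |D|² = 0.
  have hD := hEB.sub (hEg.transpose hPΩ)
  have hf := h.pullTest_mem hΩ hΩU p hD.conj
  have h1 := hBi _ hf
  rw [key _ hf, h.setIntegral_mul_eq p hρ hΩ hΩU hf.1.continuous.continuousOn hB] at h1
  have hfΨ : ∀ y ∈ Θ '' Ω, pullTest Θ Ω (fun y => (starRingEnd ℂ) (pushDensity ρ Θ U Ω p B y -
      diffOpT a b (pushDensity ρ Θ U Ω p g) y)) (chartInv Θ U p y) =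
      (starRingEnd ℂ) (pushDensity ρ Θ U Ω p B y -
        diffOpT a b (pushDensity ρ Θ U Ω p g) y) := by
    rintro _ ⟨q, hq, rfl⟩
    rw [h.left_inv (hΩU hq), pullTest, if_pos hq]
  have e : ∀ {G : 𝔼 → ℂ}, IsTest (Θ '' Ω) G → ∀ y,
      pullTest Θ Ω (fun y => (starRingEnd ℂ) (pushDensity ρ Θ U Ω p B y -
        diffOpT a b (pushDensity ρ Θ U Ω p g) y)) (chartInv Θ U p y) * G y =
      (starRingEnd ℂ) (pushDensity ρ Θ U Ω p B y -
        diffOpT a b (pushDensity ρ Θ U Ω p g) y) * G y := by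
    intro G hG y
    by_cases hy : y ∈ Θ '' Ω
    · rw [hfΨ y hy]
    · rw [image_eq_zero_of_notMem_tsupport fun hy' => hy (hG.subset hy'), mul_zero, mul_zero]
  simp only [e hEB, e (hEg.transpose hPΩ)] at h1
  have h2 := hD.eq_zero_of_integral (by
    simp only [mul_sub]
    rw [integral_sub, ← h1, sub_self]
    · exact (hEB.mul hV hD.conj.smooth.contDiffOn).integrable
    · exact ((hEg.transpose hPΩ).mul hV hD.conj.smooth.contDiffOn).integrable)
  exact funext fun y => sub_eq_zero.1 (h2 y)

lemma IsChart.adjoint_iterate_eq [T2Space M] (h : IsChart Θ U) (p : M) (hρ : ρ.Generates μ)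
    (hΩ : IsOpen Ω) (hΩU : Ω ⊆ U) (hP : IsPhase (Θ '' U) ϕ a b)
    (hL : ∀ f : M → ℂ, (∀ q ∈ U, ContMDiffAt (𝓡 n) 𝓘(ℝ, ℂ) ∞ f q) → ∀ q ∈ U,
      L f q = diffOp a b (fun y => f (chartInv Θ U p y)) (Θ q)) {g : M → ℂ}
    (hg : g ∈ testFunctions n Ω) (k : ℕ) :
    (adjoint n μ Ω L)^[k] g ∈ testFunctions n Ω ∧
      pushDensity ρ Θ U Ω p ((adjoint n μ Ω L)^[k] g) =
        (diffOpT a b)^[k] (pushDensity ρ Θ U Ω p g) := by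
  induction k with
  | zero => exact ⟨hg, rfl⟩
  | succ k ih =>
    have h1 := h.adjoint_eq p hρ hΩ hΩU hP hL ih.1
    rw [Function.iterate_succ_apply', Function.iterate_succ_apply']
    exact ⟨h1.1, by rw [h1.2, ih.2]⟩

end TransferIntegral

end GeomOsc
end

noncomputable section

set_option linter.unusedSectionVars false

namespace GeomOsc

universe u v

/-! ### The phase in normal coordinates and the final estimate -/

section NormalPhase

open Set Filter Bundle

variable {n : ℕ} {M : Type u} [TopologicalSpace M] [ChartedSpace (EuclideanSpace ℝ (Fin n)) M]
  [IsManifold (𝓡 n) ∞ M] [T2Space M]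

local notation "𝔼" => EuclideanSpace ℝ (Fin n)

variable {cov : Connection n M} {p : M} {Ω₀ Ω : Set M} {γ : M → ℝ → M} {Φ : M → ℝ}

/-- The phase function in normal coordinates, normalized to vanish at the origin. -/
def normalPhase (n : ℕ) {M : Type u} [TopologicalSpace M]
    [ChartedSpace (EuclideanSpace ℝ (Fin n)) M] (p : M) (Ω₀ : Set M) (γ : M → ℝ → M) (Φ : M → ℝ)
    (y : EuclideanSpace ℝ (Fin n)) : ℝ :=
  Φ (chartInv (normalCoord n p γ) Ω₀ p y) - Φ p

/-- In normal coordinates, `□` is an operator adapted to the phase. -/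
lemma IsNormalNhd.exists_isPhase (h : IsNormalNhd cov p Ω₀ γ)
    (hcov : cov.ContMDiffCovariantDerivative ∞) (htor : cov.torsion = 0)
    (hΦ : ∀ q ∈ Ω₀, ContMDiffAt (𝓡 n) 𝓘(ℝ, ℝ) ∞ Φ q) (hcrit : mvfderiv (𝓡 n) Φ p = 0)
    (hd : ∀ q ∈ Ω₀, (weightedHessMatrix cov 1 Φ (γ q)).det ≠ 0) :
    ∃ a b, IsPhase (normalCoord n p γ '' Ω₀) (normalPhase n p Ω₀ γ Φ) a b ∧
      ∀ f : M → ℂ, (∀ q ∈ Ω₀, ContMDiffAt (𝓡 n) 𝓘(ℝ, ℂ) ∞ f q) → ∀ q ∈ Ω₀,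
        box cov Φ γ f q = diffOp a b (fun y => f (chartInv (normalCoord n p γ) Ω₀ p y))
          (normalCoord n p γ q) := by
  have hΘ := h.isChart hcov
  obtain ⟨a, b, ha, hb, hbox⟩ := h.box_eq hcov hΦ hd
  have hL : ∀ f : M → ℂ, (∀ q ∈ Ω₀, ContMDiffAt (𝓡 n) 𝓘(ℝ, ℂ) ∞ f q) → ∀ q ∈ Ω₀,
      box cov Φ γ f q = diffOp (fun i j y => a i j (chartInv (normalCoord n p γ) Ω₀ p y))
        (fun k y => b k (chartInv (normalCoord n p γ) Ω₀ p y))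
        (fun y => f (chartInv (normalCoord n p γ) Ω₀ p y)) (normalCoord n p γ q) :=
    fun f hf q hq => (hbox f q hq (hf q hq)).trans (hΘ.diffOp_eq p a b hf hq)
  refine ⟨_, _, ⟨hΘ.isOpen_image h.isOpen subset_rfl,
    (hΘ.contDiffOn_comp hΦ).sub contDiffOn_const, fun i j => hΘ.contDiffOn_comp (ha i j),
    fun k => hΘ.contDiffOn_comp (hb k), ?_⟩, hL⟩
  rintro c _ ⟨q, hq, rfl⟩
  -- The exponential of the normalized phase as a function of Φ; its derivatives are ic g and (ic)²
  -- g, which turns `box_comp` into the identity required of a phase.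
  set g : ℝ → ℂ := fun s => Complex.exp (Complex.I * (c * (s - Φ p) : ℝ)) with hg
  have hgs : ContDiff ℝ ∞ g := by
    refine (contDiff_const.mul ?_).cexp
    exact Complex.ofRealCLM.contDiff.comp (contDiff_const.mul (contDiff_id.sub contDiff_const))
  have hg' : ∀ s, HasDerivAt g (Complex.I * c * g s) s := by
    intro s
    have h2 : HasDerivAt (fun x : ℝ => Complex.I * ((c * (x - Φ p) : ℝ) : ℂ)) (Complex.I * c) s := by
      have := (((hasDerivAt_id s).sub_const (Φ p)).const_mul c).ofReal_comp.const_mul Complex.I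
      simpa using this
    refine h2.cexp.congr_deriv ?_
    rw [hg, mul_comm]
  have h1 := h.box_comp hcov htor hΦ hcrit hd hgs hg' (fun s => (hg' s).const_mul _) hq
  have h2 := hL (fun y => g (Φ y)) (fun x hx => hgs.contMDiff.contMDiffAt.comp x (hΦ x hx)) q hq
  have h3 : normalPhase n p Ω₀ γ Φ (normalCoord n p γ q) = Φ q - Φ p := by
    rw [normalPhase, hΘ.left_inv hq]
  rw [h3]
  refine (h2.symm.trans h1).trans ?_
  simp only [Complex.real_smul, hg]
  push_cast
  linear_combination (2 * (Φ q - Φ p : ℂ) * c ^ 2 *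
    Complex.exp (Complex.I * (c * (Φ q - Φ p)))) * Complex.I_sq

lemma IsNormalNhd.chartInv_zero (h : IsNormalNhd cov p Ω₀ γ)
    (hcov : cov.ContMDiffCovariantDerivative ∞) :
    chartInv (normalCoord n p γ) Ω₀ p 0 = p := by
  rw [← h.normalCoord_center, (h.isChart hcov).left_inv h.mem]

lemma IsNormalNhd.pd_normalPhase (h : IsNormalNhd cov p Ω₀ γ)
    (hcov : cov.ContMDiffCovariantDerivative ∞)
    (hΦ : ∀ q ∈ Ω₀, ContMDiffAt (𝓡 n) 𝓘(ℝ, ℝ) ∞ Φ q) {q : M} (hq : q ∈ Ω₀) (i : Fin n) :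
    pd i (normalPhase n p Ω₀ γ Φ) (normalCoord n p γ q) = frameDeriv (normalCoord n p γ) i Φ q := by
  rw [(h.isChart hcov).frameDeriv_eq_pd (p := p) hq (hΦ q hq), pd, pd]
  unfold normalPhase
  rw [fderiv_sub_const]

lemma IsNormalNhd.frame_center (h : IsNormalNhd cov p Ω₀ γ)
    (hcov : cov.ContMDiffCovariantDerivative ∞) (i : Fin n) :
    frame (normalCoord n p γ) (EuclideanSpace.single i 1) p = stdFrame p i := by
  have h1 := (h.isCoord_normalCoord hcov).frame_apply h.mem (stdFrame p i)
  rw [(h.normalCoord_near_center hcov).2] at h1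
  exact h1

/-- The second derivatives of the phase at the critical point. -/
lemma IsNormalNhd.pd_pd_normalPhase (h : IsNormalNhd cov p Ω₀ γ)
    (hcov : cov.ContMDiffCovariantDerivative ∞)
    (hΦ : ∀ q ∈ Ω₀, ContMDiffAt (𝓡 n) 𝓘(ℝ, ℝ) ∞ Φ q) (hcrit : mvfderiv (𝓡 n) Φ p = 0)
    (i j : Fin n) :
    pd i (pd j (normalPhase n p Ω₀ γ Φ)) 0 = hessMatrix cov Φ p j i := by
  have hΘ := h.isChart hcov
  have h1 : pd j (normalPhase n p Ω₀ γ Φ) =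
      pd j fun y => Φ (chartInv (normalCoord n p γ) Ω₀ p y) := by
    funext y
    rw [pd, pd]
    unfold normalPhase
    rw [fderiv_sub_const]
  have h2 := hΘ.frameDeriv_frameDeriv_eq_pd (p := p) hΦ h.mem i j
  rw [h.normalCoord_center] at h2
  have h3 := hessComp_eq (cov := cov) hΘ.toIsCoord h.mem (hΦ p h.mem) j i
  have h4 : ∀ k, frameDeriv (normalCoord n p γ) k Φ p = 0 := fun k => by
    rw [frameDeriv, hcrit]
    rfl
  -- At a critical point the Christoffel term of the Hessian disappears, so the second derivatives
  -- in normal coordinates are the entries of ∇²Φ(p).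
  simp only [h4, smul_zero, Finset.sum_const_zero, sub_zero] at h3
  rw [h1, ← h2, ← h3, hessComp, h.frame_center hcov, h.frame_center hcov]
  rfl

lemma hessMatrix_isHermitian (htor : cov.torsion = 0)
    (hΦ : ContMDiffAt (𝓡 n) 𝓘(ℝ, ℝ) ∞ Φ p) : (hessMatrix cov Φ p).IsHermitian := by
  refine Matrix.IsHermitian.ext fun i j => ?_
  rw [star_trivial]
  exact hess_symm htor hΦ _ _

/-- The center is the only critical point of the phase. -/
lemma IsNormalNhd.gradSq_ne_zero (h : IsNormalNhd cov p Ω₀ γ)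
    (hcov : cov.ContMDiffCovariantDerivative ∞)
    (hΦ : ∀ q ∈ Ω₀, ContMDiffAt (𝓡 n) 𝓘(ℝ, ℝ) ∞ Φ q) (hcrit : mvfderiv (𝓡 n) Φ p = 0)
    (hd : ∀ q ∈ Ω₀, (weightedHessMatrix cov 1 Φ (γ q)).det ≠ 0) {y : 𝔼}
    (hy : y ∈ normalCoord n p γ '' Ω₀) (hy0 : y ≠ 0) :
    gradSq (normalPhase n p Ω₀ γ Φ) y ≠ 0 := by
  obtain ⟨q, hq, rfl⟩ := hy
  intro h0
  rw [gradSq, Finset.sum_eq_zero_iff_of_nonneg fun i _ => sq_nonneg _] at h0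
  have h1 : Matrix.mulVec (firstMatrix cov p γ Φ q) (fun j => normalCoord n p γ q j) = 0 := by
    funext i
    have h2 := pow_eq_zero_iff two_ne_zero |>.1 (h0 i (Finset.mem_univ i))
    rw [h.pd_normalPhase hcov hΦ hq, h.frameDeriv_eq hcov hΦ hcrit hq] at h2
    exact h2
  -- The gradient is the first weighted Hessian applied to the radial vector; as that form is
  -- nondegenerate, only the center can be critical.
  have h2 := Matrix.eq_zero_of_mulVec_eq_zero (h.firstMatrix_det hcov hΦ hq (hd q hq)) h1
  refine hy0 ?_
  ext j
  exact congrFun h2 j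

variable [SecondCountableTopology M] [MeasurableSpace M] [BorelSpace M] {μ : Measure M}
  {ρ : SmoothDensity n M}

lemma IsNormalNhd.pushDensity_zero (h : IsNormalNhd cov p Ω₀ γ)
    (hcov : cov.ContMDiffCovariantDerivative ∞) (hpΩ : p ∈ Ω) (hΩ : Ω ⊆ Ω₀) (f : M → ℂ) :
    pushDensity ρ (normalCoord n p γ) Ω₀ Ω p f 0 = (ρ.toFun p (stdFrame p) : ℂ) * f p := by
  have h1 := (h.isChart hcov).pushTest_apply (p := p) hΩ hpΩ f
  rw [h.normalCoord_center] at h1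
  rw [pushDensity, h1, h.chartInv_zero hcov, densityIn]
  simp only [h.frame_center hcov]

/-- The phase in the chart is normalized to vanish at the center, which separates the factor
e^{iΦ(p)/t}. -/
lemma IsNormalNhd.oscIntegral_eq (h : IsNormalNhd cov p Ω₀ γ)
    (hcov : cov.ContMDiffCovariantDerivative ∞)
    (hΦ : ∀ q ∈ Ω₀, ContMDiffAt (𝓡 n) 𝓘(ℝ, ℝ) ∞ Φ q) (hρ : ρ.Generates μ) (hΩo : IsOpen Ω)
    (hΩ : Ω ⊆ Ω₀) {ψ : M → ℂ} (hψ : ψ ∈ testFunctions n Ω) (t : ℝ) :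
    oscIntegral n μ Ω Φ ψ t = Complex.exp (Complex.I * (t⁻¹ * Φ p : ℝ)) *
      oscN (normalPhase n p Ω₀ γ Φ) (pushDensity ρ (normalCoord n p γ) Ω₀ Ω p ψ) t := by
  have hc : ContinuousOn (fun x => ((t ^ (-(n : ℝ) / 2) : ℝ) : ℂ) *
      Complex.exp (Complex.I * (t⁻¹ * Φ x : ℝ))) Ω := by
    have h1 : ContinuousOn Φ Ω := fun q hq => (hΦ q (hΩ hq)).continuousAt.continuousWithinAt
    fun_prop
  rw [oscIntegral, (h.isChart hcov).setIntegral_mul_eq p hρ hΩo hΩ hc hψ, oscN, osc, ← mul_assoc,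
    ← integral_const_mul, neg_div]
  refine integral_congr_ae (Eventually.of_forall fun y => ?_)
  have e : Complex.exp (Complex.I * (t⁻¹ * Φ (chartInv (normalCoord n p γ) Ω₀ p y) : ℝ)) =
      Complex.exp (Complex.I * (t⁻¹ * Φ p : ℝ)) *
        Complex.exp (Complex.I * (t⁻¹ * normalPhase n p Ω₀ γ Φ y : ℝ)) := by
    rw [← Complex.exp_add, normalPhase]
    congr 1
    push_cast
    ring
  simp only [e]
  ring

/-- The quantitative error estimate. -/
theorem IsNormalNhd.norm_expansionError_le (h : IsNormalNhd cov p Ω₀ γ)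
    (hcov : cov.ContMDiffCovariantDerivative ∞) (htor : cov.torsion = 0)
    (hΦ : ∀ q ∈ Ω₀, ContMDiffAt (𝓡 n) 𝓘(ℝ, ℝ) ∞ Φ q) (hcrit : mvfderiv (𝓡 n) Φ p = 0)
    (hdet : (hessMatrix cov Φ p).det ≠ 0)
    (hd : ∀ q ∈ Ω₀, (weightedHessMatrix cov 1 Φ (γ q)).det ≠ 0) (hΩo : IsOpen Ω) (hpΩ : p ∈ Ω)
    (hΩ : Ω ⊆ Ω₀) (hρ : ρ.Generates μ) {ψ : M → ℂ} (hψ : ψ ∈ testFunctions n Ω) (N : ℕ) {k : ℕ}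
    (hk : (n : ℝ) / 2 < k) {t : ℝ} (ht : 0 < t) :
    ‖expansionError cov Φ γ ρ μ Ω p ψ N t‖ ≤
      ((1 / (1 - (n : ℝ) / (2 * k))) ^ k + 2 ^ k) * t ^ (N + 1) *
      (∫ x in Ω, ‖(adjoint n μ Ω (box cov Φ γ))^[N + 1] ψ x‖ ∂μ) ^ (1 - (n : ℝ) / (2 * k)) *
      (∫ x in Ω, ‖(adjoint n μ Ω (box cov Φ γ))^[N + k + 1] ψ x‖ ∂μ) ^ ((n : ℝ) / (2 * k)) := by
  have hΘ := h.isChart hcov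
  obtain ⟨a, b, hP, hL⟩ := h.exists_isPhase hcov htor hΦ hcrit hd
  have hit := fun j => hΘ.adjoint_iterate_eq (μ := μ) p hρ hΩo hΩ hP hL hψ j
  have hE : IsTest (normalCoord n p γ '' Ω₀) (pushDensity ρ (normalCoord n p γ) Ω₀ Ω p ψ) :=
    (hΘ.isTest_pushDensity hΩo hΩ hψ).mono (image_mono hΩ)
  have h0 : (0 : 𝔼) ∈ normalCoord n p γ '' Ω₀ := ⟨p, h.mem, h.normalCoord_center⟩
  have hϕ0 : normalPhase n p Ω₀ γ Φ 0 = 0 := by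
    rw [normalPhase, h.chartInv_zero hcov, sub_self]
  have hpd : ∀ i, pd i (normalPhase n p Ω₀ γ Φ) 0 = 0 := fun i => by
    rw [← h.normalCoord_center, h.pd_normalPhase hcov hΦ h.mem, frameDeriv, hcrit]
    rfl
  have hHH := hessMatrix_isHermitian htor (hΦ p h.mem)
  have hH : ∀ i j, pd i (pd j (normalPhase n p Ω₀ γ Φ)) 0 = hessMatrix cov Φ p i j := by
    intro i j
    rw [h.pd_pd_normalPhase hcov hΦ hcrit, ← hHH.apply, star_trivial]
  have key := hP.norm_error_le h0 hϕ0 hpd (fun y hy hy0 => h.gradSq_ne_zero hcov hΦ hcrit hd hy hy0)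
    hHH hdet hH hE N hk ht
  simp only [← (hit _).2, h.pushDensity_zero hcov hpΩ hΩ] at key
  rw [← hΘ.setIntegral_norm_eq p hρ hΩo hΩ (hit _).1,
    ← hΘ.setIntegral_norm_eq p hρ hΩo hΩ (hit _).1, div_div] at key
  refine (le_of_eq ?_).trans (key.trans (le_of_eq (by ring)))
  rw [expansionError, h.oscIntegral_eq hcov hΦ hρ hΩo hΩ hψ]
  -- The factor e^{iΦ(p)/t} has modulus one, so it may be restored inside the norm.
  conv_rhs => rw [← one_mul ‖_‖, ← norm_exp_phase (t⁻¹ * Φ p), ← norm_mul, mul_sub]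
  congr 2
  simp only [Finset.mul_sum]
  refine Finset.sum_congr rfl fun l _ => ?_
  have hs : ((Real.sqrt |(hessMatrix cov Φ p).det| : ℝ) : ℂ) ≠ 0 := by
    exact_mod_cast (Real.sqrt_pos.2 (abs_pos.2 hdet)).ne'
  push_cast
  rw [inv_div, div_pow, div_eq_mul_inv (ρ.toFun p (stdFrame p) : ℂ)]
  field_simp

end NormalPhase

end GeomOsc
end

theorem lemma4 (n N k : ℕ) (hk : (n : ℝ) / 2 < k) :
    ∃ C : ℝ, ∀ (M : Type*) [TopologicalSpace M] [ChartedSpace (EuclideanSpace ℝ (Fin n)) M]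
      [IsManifold (𝓡 n) ∞ M] [T2Space M] [SecondCountableTopology M]
      [MeasurableSpace M] [BorelSpace M]
      (cov : GeomOsc.Connection n M) (_ : cov.ContMDiffCovariantDerivative ∞)
      (_ : cov.torsion = 0)
      (Φ : M → ℝ) (p : M) (Ω₀ Ω : Set M) (γ : M → ℝ → M)
      -- `Ω₀` is a normal neighborhood of the nondegenerate critical point `p` of `Φ`,
      -- on which the weighted Hessian of weight one is nondegenerate
      (_ : GeomOsc.IsNormalNhd cov p Ω₀ γ)
      (_ : ContMDiffOn (𝓡 n) 𝓘(ℝ, ℝ) ∞ Φ Ω₀)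
      (_ : mvfderiv (𝓡 n) Φ p = 0)
      (_ : (GeomOsc.hessMatrix cov Φ p).det ≠ 0)
      (_ : ∀ q ∈ Ω₀, (GeomOsc.weightedHessMatrix cov 1 Φ (γ q)).det ≠ 0)
      (_ : IsOpen Ω) (_ : p ∈ Ω) (_ : Ω ⊆ Ω₀)
      (ρ : GeomOsc.SmoothDensity n M) (μ : Measure M) (_ : ρ.Generates μ)
      (ψ : M → ℂ) (_ : ψ ∈ GeomOsc.testFunctions n Ω),
      ((fun t : ℝ => GeomOsc.expansionError cov Φ γ ρ μ Ω p ψ N t)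
        =O[𝓝[>] (0 : ℝ)] fun t : ℝ => t ^ (N + 1)) ∧
      ∀ t : ℝ, 0 < t →
        ‖GeomOsc.expansionError cov Φ γ ρ μ Ω p ψ N t‖ ≤
          C * t ^ (N + 1)
            * (∫ x in Ω, ‖(GeomOsc.adjoint n μ Ω (GeomOsc.box cov Φ γ))^[N + 1] ψ x‖ ∂μ)
                ^ (1 - (n : ℝ) / (2 * k))
            * (∫ x in Ω, ‖(GeomOsc.adjoint n μ Ω (GeomOsc.box cov Φ γ))^[N + k + 1] ψ x‖ ∂μ)
                ^ ((n : ℝ) / (2 * k)) := by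
  -- The constant of the interpolation inequality; it depends only on n and k.
  refine ⟨(1 / (1 - (n : ℝ) / (2 * k))) ^ k + 2 ^ k, ?_⟩
  intro M _ _ _ _ _ _ _ cov hcov htor Φ p Ω₀ Ω γ h hΦ hcrit hdet hd hΩo hpΩ hΩ ρ μ hρ ψ hψ
  have hΦ' : ∀ q ∈ Ω₀, ContMDiffAt (𝓡 n) 𝓘(ℝ, ℝ) ∞ Φ q := fun q hq =>
    hΦ.contMDiffAt (h.isOpen.mem_nhds hq)
  have key := fun (t : ℝ) (ht : 0 < t) =>
    h.norm_expansionError_le hcov htor hΦ' hcrit hdet hd hΩo hpΩ hΩ hρ hψ N hk ht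
  -- For fixed ψ the two integrals are constants, so the O(t^{N+1}) statement follows from the
  -- quantitative bound with the given k.
  refine ⟨Asymptotics.IsBigO.of_bound (((1 / (1 - (n : ℝ) / (2 * k))) ^ k + 2 ^ k)
    * (∫ x in Ω, ‖(GeomOsc.adjoint n μ Ω (GeomOsc.box cov Φ γ))^[N + 1] ψ x‖ ∂μ)
        ^ (1 - (n : ℝ) / (2 * k))
    * (∫ x in Ω, ‖(GeomOsc.adjoint n μ Ω (GeomOsc.box cov Φ γ))^[N + k + 1] ψ x‖ ∂μ)
        ^ ((n : ℝ) / (2 * k))) ?_, key⟩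
  filter_upwards [self_mem_nhdsWithin] with t ht
  have ht : 0 < t := ht
  refine (key t ht).trans (le_of_eq ?_)
  rw [Real.norm_of_nonneg (pow_nonneg ht.le _)]
  ring
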